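/- Let $n\ge 0$ and $\varkappa\in\mathbb R$, and let $\mathcal H_{zz}(t),W_{zz}(t),W_{zw}(t),W_{ww}(t)$ be real $2n\times 2n$ matrices and $\mathcal H_z(t)\in\mathbb R^{2n}$, all smooth in $t\in\mathbb R$, with $\mathcal H_{zz},W_{zz},W_{ww}$ symmetric. For $\hbar>0$ put $\hat z=(-i\hbar\partial_{x},x)$, $\hat w=(-i\hbar\partial_y,y)$, $J=\begin{pmatrix}0&-\mathbb I\\ \mathbb I&0\end{pmatrix}$, $$\mathcal H(\hat z,t)=\tfrac12\langle\hat z,\mathcal H_{zz}\hat z\rangle+\langle\mathcal H_z,\hat z\rangle,\qquad V(\hat z,\hat w,t)=\tfrac12\langle\hat z,W_{zz}\hat z\rangle+\langle\hat z,W_{zw}\hat w\rangle+\tfrac12\langle\hat w,W_{ww}\hat w\rangle,$$ and consider the nonlocal Gross--Pitaevskii equation (GPE) $$\{-i\hbar\partial_t+\mathcal H(\hat z,t)+\varkappa\hat V(t,\Psi(t))\}\Psi=0,\qquad \hat V(t,\Psi)=\int_{\mathbb R^n}dy\,\Psi^*(y,t)V(\hat z,\hat w,t)\Psi(y,t).$$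 For $\tilde\varkappa\in\mathbb R$ let $\mathfrak H_{zz}=\mathcal H_{zz}+\tilde\varkappa W_{zz}$, with upper left (momentum) $n\times n$ block $\mathfrak H_{pp}$. The Hamilton--Ehrenfest system for $\mathfrak g=(z,\Delta)$, $z=(P,X)$, is $$\dot z=J\{\mathcal H_z+[\mathcal H_{zz}+\tilde\varkappa(W_{zz}+W_{zw})]z\},\qquad \dot\Delta=J\mathfrak H_{zz}\Delta-\Delta\mathfrak H_{zz}J .$$ The matriciant is given by $\partial_t\mathcal A(t,s)=J\mathfrak H_{zz}(t)\mathcal A(t,s)$, $\mathcal A(s,s)=\mathbb I$, and is written $\mathcal A=\begin{pmatrix}\lambda_4^\intercal&-\lambda_2^\intercal\\-\lambda_3^\intercal&\lambda_1^\intercal\end{pmatrix}$. Put $S(t)=\int_0^t(\langle P,\dot X\rangle-\mathfrak H)\,d\tau$ with $$\mathfrak H=\tfrac12\langle z,[\mathcal H_{zz}+\tilde\varkappa(W_{zz}+2W_{zw}+W_{ww})]z\rangle+\langle\mathcal H_z,z\rangle+\tfrac12\tilde\varkappa\,\mathrm{Sp}(W_{ww}\Delta).$$ For a nonzero Schwartz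 function $\psi$ on $\mathbb R^n$ let $\tilde\varkappa=\varkappa\|\psi\|^2$, let $\mathfrak g_0(\psi)$ consist of the means of $\hat z$ and the symmetrized centered second moments of $\hat z$ in the normalized state $\psi/\|\psi\|$, and let $\mathfrak g(t)=(P(t),X(t),\Delta(t))$ be the solution of the Hamilton--Ehrenfest system with $\mathfrak g(s)=\mathfrak g_0(\psi)$. With $\Delta x=x-X(t)$, $\Delta y=y-X(s)$ define, for $\det\lambda_3(t,s)\ne0$, $t\neq s$, $$\hat U_\varkappa(t,s,\psi)(x)=\int_{\mathbb R^n}G(x,y,t,s)\psi(y)\,dy,$$ $$G=\frac{1}{\sqrt{\det(-2\pi i\hbar\lambda_3)}}\exp\Big\{\frac i\hbar\Big[S(t)-S(s)+\langle P(t),\Delta x\rangle-\langle P(s),\Delta y\rangle-\tfrac12\langle\Delta y,\lambda_1\lambda_3^{-1}\Delta y\rangle+\langle\Delta x,\lambda_3^{-1}\Delta y\rangle-\tfrac12\langle\Delta x,\lambda_3^{-1}\lambda_4\Delta x\rangle\Big]\Big\},$$ and $\hat U_\varkappa(s,s,\psi)=\psi$. Theorem. The matriciant and the solutions of the Hamilton--Ehrenfest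 system exist for all times, and a branch of the square root, depending only on $\hbar,\tilde\varkappa,s,t$ and continuous in $t$ where $\det\lambda_3(t,s)\ne0$, can be chosen so that the following holds whenever $\det\mathfrak H_{pp}(s)\neq0$, where $\tilde\varkappa=\varkappa\|\psi\|^2$. 1. $\det\lambda_3(t,s)\ne0$ for all $t\ne s$ close to $s$. 2. For all $\hbar>0$ and every nonzero Schwartz function $\psi$ there is a solution $\Psi$ of the GPE for all $t\in\mathbb R$, depending smoothly on $t$ in the topology of the Schwartz space, with $\Psi|_{t=s}=\psi$ and $\Psi(\cdot,t)=\hat U_\varkappa(t,s,\psi)$ for $t=s$ and for all $t$ with $\det\lambda_3(t,s)\neq0$. Every solution of the GPE on an open time interval containing $s$ that is smooth in $t$ with values in the Schwartz space and equals $\psi$ at $t=s$ coincides with $\Psi$ on that interval. 3. $\hat U_\varkappa$ acts on trajectory concentrated functions. For $\hbar_0>0$ call a family $\Phi(x,t,\hbar)$, $0<\hbar<\hbar_0$, $t\in\mathbb R$, trajectory concentrated if $$\Phi=\varphi\Big(\tfrac{x-X(t,\hbar)}{\sqrt\hbar},t,\hbar\Big)\exp\big\{\tfrac i\hbar\big(S(t,\hbar)+\langle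 P(t,\hbar),x-X(t,\hbar)\rangle\big)\big\},$$ where $S$ is real, $(P,X)$ is the mean of $\hat z$ in the state $\Phi$, $\varphi$ is a Schwartz function of its first argument, and $\varphi$ (in the Schwartz topology), $S,P,X$ are smooth functions of $t$ and $\sqrt\hbar$, extending smoothly to $-\sqrt{\hbar_0}<\sqrt\hbar<\sqrt{\hbar_0}$; initial data at time $s$ are defined in the same way without $t$. If $\psi(x,\hbar)$ is such an initial datum, and $\psi(\cdot,\hbar)\ne0$ and $\det\mathfrak H_{pp}(s)\neq0$ for all $0<\hbar<\hbar_0$, then there is a trajectory concentrated family $\Psi$ which for each $\hbar\in(0,\hbar_0)$ solves the GPE for all $t\in\mathbb R$, equals $\psi(\cdot,\hbar)$ at $t=s$, and equals $\hat U_\varkappa(t,s,\psi(\cdot,\hbar))$ for $t=s$ and for all $t$ with $\det\lambda_3(t,s)\ne0$. -/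

import Mathlib

open scoped ContDiff SchwartzMap Matrix Topology

noncomputable section

namespace NonlocalGPE

/-- Configuration space `ℝⁿ`. -/
abbrev E (n : ℕ) : Type := EuclideanSpace ℝ (Fin n)

/-- Indices of phase-space coordinates `z = (p, x)`: `inl j` is `p_j`, `inr j` is `x_j`. -/
abbrev Idx (n : ℕ) : Type := Fin n ⊕ Fin n

/-- The coefficients of the quadratic operators
`H(ẑ,t) = ½⟨ẑ, Hzz(t) ẑ⟩ + ⟨Hz(t), ẑ⟩` and
`V(ẑ,ŵ,t) = ½⟨ẑ, Wzz(t) ẑ⟩ + ⟨ẑ, Wzw(t) ŵ⟩ + ½⟨ŵ, Www(t) ŵ⟩`.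
They are real and smooth in time; the matrices of the pure quadratic forms are symmetric, so that
the expressions are Weyl ordered. -/
structure QuadraticModel (n : ℕ) where
  Hzz : ℝ → Matrix (Idx n) (Idx n) ℝ
  Hz : ℝ → Idx n → ℝ
  Wzz : ℝ → Matrix (Idx n) (Idx n) ℝ
  Wzw : ℝ → Matrix (Idx n) (Idx n) ℝ
  Www : ℝ → Matrix (Idx n) (Idx n) ℝ
  smooth_Hzz : ∀ a b, ContDiff ℝ ∞ (fun t => Hzz t a b)
  smooth_Hz : ∀ a, ContDiff ℝ ∞ (fun t => Hz t a)
  smooth_Wzz : ∀ a b, ContDiff ℝ ∞ (fun t => Wzz t a b)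
  smooth_Wzw : ∀ a b, ContDiff ℝ ∞ (fun t => Wzw t a b)
  smooth_Www : ∀ a b, ContDiff ℝ ∞ (fun t => Www t a b)
  symm_Hzz : ∀ t, (Hzz t).IsSymm
  symm_Wzz : ∀ t, (Wzz t).IsSymm
  symm_Www : ∀ t, (Www t).IsSymm

/-! ### Operators, norm and moments -/

/-- The operators `ẑ = (-iħ∂/∂x, x)`. -/
def zOp {n : ℕ} (ħ : ℝ) : Idx n → (E n → ℂ) → E n → ℂ
  | Sum.inl j, u => fun x =>
      -Complex.I * (ħ : ℂ) * fderiv ℝ u x (EuclideanSpace.single j (1 : ℝ))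
  | Sum.inr j, u => fun x => ((x j : ℝ) : ℂ) * u x

/-- `ẑ_a` acting on the first variable of a two-particle function. -/
def zOpFst {n : ℕ} (ħ : ℝ) (a : Idx n) (f : E n → E n → ℂ) : E n → E n → ℂ :=
  fun x y => zOp ħ a (fun x' => f x' y) x

/-- `ŵ_a`, that is, `ẑ_a` acting on the second variable of a two-particle function. -/
def wOpSnd {n : ℕ} (ħ : ℝ) (a : Idx n) (f : E n → E n → ℂ) : E n → E n → ℂ :=
  fun x y => zOp ħ a (f x) y

/-- `‖u‖² = ∫ |u|²`. -/
def normSq {n : ℕ} (u : E n → ℂ) : ℝ := ∫ x, ‖u x‖ ^ 2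

/-- `⟨u|v⟩ = ∫ u* v`. -/
def braket {n : ℕ} (u v : E n → ℂ) : ℂ := ∫ x, (starRingEnd ℂ) (u x) * v x

/-- First moments `z_u = ⟨u|ẑ|u⟩ / ‖u‖²`. -/
def meanZ {n : ℕ} (ħ : ℝ) (u : E n → ℂ) (a : Idx n) : ℝ :=
  (braket u (zOp ħ a u)).re / normSq u

/-- The centered operators `Δẑ_a = ẑ_a - c_a`. -/
def dzOp {n : ℕ} (ħ : ℝ) (c : Idx n → ℝ) (a : Idx n) (u : E n → ℂ) : E n → ℂ :=
  fun x => zOp ħ a u x - (c a : ℂ) * u x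

/-- Centered second moments `⟨u|Δẑ_a Δẑ_b + Δẑ_b Δẑ_a|u⟩ / (2‖u‖²)`. -/
def covZ {n : ℕ} (ħ : ℝ) (u : E n → ℂ) : Matrix (Idx n) (Idx n) ℝ :=
  Matrix.of fun a b =>
    (braket u (fun x => dzOp ħ (meanZ ħ u) a (dzOp ħ (meanZ ħ u) b u) x
      + dzOp ħ (meanZ ħ u) b (dzOp ħ (meanZ ħ u) a u) x)).re / (2 * normSq u)

/-- Points `𝔤 = (z, Δ)` of the phase space of the Hamilton–Ehrenfest system. -/
@[ext] structure PhasePoint (n : ℕ) where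
  z : Idx n → ℝ
  cov : Matrix (Idx n) (Idx n) ℝ

/-- `𝔤₀(u) = ⟨u|𝔤̂|u⟩ / ‖u‖²`: the first and the centered second moments of `u`. -/
def moments {n : ℕ} (ħ : ℝ) (u : E n → ℂ) : PhasePoint n := ⟨meanZ ħ u, covZ ħ u⟩

/-! ### The Gross–Pitaevskii equation -/

/-- `H(ẑ,t)` applied to `u`. -/
def QuadraticModel.hamiltonian {n : ℕ} (Q : QuadraticModel n) (ħ t : ℝ) (u : E n → ℂ) (x : E n) :
    ℂ :=
  (1 / 2 : ℂ) * ∑ a, ∑ b, (Q.Hzz t a b : ℂ) * zOp ħ a (zOp ħ b u) x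
    + ∑ a, (Q.Hz t a : ℂ) * zOp ħ a u x

/-- `V(ẑ,ŵ,t)` applied to a two-particle function. -/
def QuadraticModel.pairOp {n : ℕ} (Q : QuadraticModel n) (ħ t : ℝ) (f : E n → E n → ℂ)
    (x y : E n) : ℂ :=
  (1 / 2 : ℂ) * ∑ a, ∑ b, (Q.Wzz t a b : ℂ) * zOpFst ħ a (zOpFst ħ b f) x y
    + ∑ a, ∑ b, (Q.Wzw t a b : ℂ) * zOpFst ħ a (wOpSnd ħ b f) x y
    + (1 / 2 : ℂ) * ∑ a, ∑ b, (Q.Www t a b : ℂ) * wOpSnd ħ a (wOpSnd ħ b f) x y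

/-- `V̂(t,Ψ) u (x) = ∫ dy Ψ*(y) V(ẑ,ŵ,t) Ψ(y) u(x)`. -/
def QuadraticModel.meanField {n : ℕ} (Q : QuadraticModel n) (ħ t : ℝ) (Ψ u : E n → ℂ) (x : E n) :
    ℂ :=
  ∫ y, (starRingEnd ℂ) (Ψ y) * Q.pairOp ħ t (fun x' y' => u x' * Ψ y') x y

/-- `Ψ` satisfies `{-iħ∂_t + H(ẑ,t) + ϰ V̂(t,Ψ(t))} Ψ = 0` at all times in `T`. -/
def QuadraticModel.SolvesGPE {n : ℕ} (Q : QuadraticModel n) (ϰ ħ : ℝ) (T : Set ℝ)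
    (Ψ : ℝ → E n → ℂ) : Prop :=
  ∀ t ∈ T, ∀ x, DifferentiableAt ℝ (fun τ => Ψ τ x) t ∧
    -Complex.I * (ħ : ℂ) * deriv (fun τ => Ψ τ x) t
      + Q.hamiltonian ħ t (Ψ t) x + (ϰ : ℂ) * Q.meanField ħ t (Ψ t) (Ψ t) x = 0

/-! ### Hamilton–Ehrenfest system, matriciant, action (`κ` stands for `ϰ‖Ψ‖²`) -/

/-- `𝔥_zz(t) = Hzz(t) + κ Wzz(t)`. -/
def QuadraticModel.hess {n : ℕ} (Q : QuadraticModel n) (κ t : ℝ) : Matrix (Idx n) (Idx n) ℝ :=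
  Q.Hzz t + κ • Q.Wzz t

/-- The momentum block `𝔥_pp(t)` of `𝔥_zz(t)`. -/
def QuadraticModel.hpp {n : ℕ} (Q : QuadraticModel n) (κ t : ℝ) : Matrix (Fin n) (Fin n) ℝ :=
  (Q.hess κ t).toBlocks₁₁

/-- `g` is a solution, on the whole time axis, of the Hamilton–Ehrenfest system. Here
`Matrix.J` is the block matrix `(0, -1; 1, 0)`. -/
def QuadraticModel.IsHESSolution {n : ℕ} (Q : QuadraticModel n) (κ : ℝ) (g : ℝ → PhasePoint n) :
    Prop :=
  ∀ t,
    (∀ a, HasDerivAt (fun τ => (g τ).z a)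
      ((Matrix.J (Fin n) ℝ *ᵥ
        (Q.Hz t + (Q.Hzz t + κ • (Q.Wzz t + Q.Wzw t)) *ᵥ (g t).z)) a) t) ∧
    (∀ a b, HasDerivAt (fun τ => (g τ).cov a b)
      ((Matrix.J (Fin n) ℝ * Q.hess κ t * (g t).cov
        - (g t).cov * Q.hess κ t * Matrix.J (Fin n) ℝ) a b) t)

/-- `A = 𝒜(·,s)` is the matriciant: `Ȧ = J 𝔥_zz A`, `A(s) = 1`. -/
def QuadraticModel.IsMatriciant {n : ℕ} (Q : QuadraticModel n) (κ s : ℝ)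
    (A : ℝ → Matrix (Idx n) (Idx n) ℝ) : Prop :=
  A s = 1 ∧ ∀ t a b, HasDerivAt (fun τ => A τ a b) ((Matrix.J (Fin n) ℝ * Q.hess κ t * A t) a b) t

/-! The blocks `λ_k` of the matriciant: `𝒜 = (λ₄ᵀ, -λ₂ᵀ; -λ₃ᵀ, λ₁ᵀ)`. -/

def lam1 {n : ℕ} (A : Matrix (Idx n) (Idx n) ℝ) : Matrix (Fin n) (Fin n) ℝ := (A.toBlocks₂₂)ᵀ
def lam3 {n : ℕ} (A : Matrix (Idx n) (Idx n) ℝ) : Matrix (Fin n) (Fin n) ℝ := -(A.toBlocks₂₁)ᵀ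
def lam4 {n : ℕ} (A : Matrix (Idx n) (Idx n) ℝ) : Matrix (Fin n) (Fin n) ℝ := (A.toBlocks₁₁)ᵀ

/-- The scalar `𝔥 = ½⟨z,[Hzz + κ(Wzz + 2Wzw + Www)]z⟩ + ⟨Hz,z⟩ + ½ κ Sp(Www Δ)`. -/
def QuadraticModel.energy {n : ℕ} (Q : QuadraticModel n) (κ t : ℝ) (g : PhasePoint n) : ℝ :=
  1 / 2 * (g.z ⬝ᵥ ((Q.Hzz t + κ • (Q.Wzz t + (2 : ℝ) • Q.Wzw t + Q.Www t)) *ᵥ g.z))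
    + Q.Hz t ⬝ᵥ g.z + 1 / 2 * κ * (Q.Www t * g.cov).trace

/-- The action `S(t) = ∫₀ᵗ (⟨P, Ẋ⟩ - 𝔥) dτ` along the curve `g = (P, X, Δ)`. -/
def QuadraticModel.action {n : ℕ} (Q : QuadraticModel n) (κ : ℝ) (g : ℝ → PhasePoint n) (t : ℝ) :
    ℝ :=
  ∫ τ in (0 : ℝ)..t,
    (∑ j, (g τ).z (Sum.inl j) * deriv (fun σ => (g σ).z (Sum.inr j)) τ - Q.energy κ τ (g τ))

/-! ### Green function and nonlinear evolution operator -/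

/-- `r` is a branch of `√det(-2πiħ λ₃(·,s))`: a square root at every time, continuous wherever
`det λ₃(·,s) ≠ 0`. -/
def IsRootBranch {n : ℕ} (ħ : ℝ) (A : ℝ → Matrix (Idx n) (Idx n) ℝ) (r : ℝ → ℂ) : Prop :=
  (∀ t, r t ^ 2 =
    ((-Complex.I * 2 * (Real.pi : ℂ) * (ħ : ℂ)) • (lam3 (A t)).map (Complex.ofReal)).det) ∧
  ContinuousOn r {t | (lam3 (A t)).det ≠ 0}

/-- The Gaussian Green function. `A` is the matriciant `𝒜(t,s)`, `ρ` the value of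
`√det(-2πiħ λ₃(t,s))`, `dS = S(t) - S(s)`, and `zt`, `zs` are `(P,X)` at the times `t` and `s`. -/
def green {n : ℕ} (ħ : ℝ) (A : Matrix (Idx n) (Idx n) ℝ) (ρ : ℂ) (dS : ℝ) (zt zs : Idx n → ℝ)
    (x y : E n) : ℂ :=
  let dx : Fin n → ℝ := fun j => x j - zt (Sum.inr j)
  let dy : Fin n → ℝ := fun j => y j - zs (Sum.inr j)
  let phase : ℝ :=
    dS + (fun j => zt (Sum.inl j)) ⬝ᵥ dx - (fun j => zs (Sum.inl j)) ⬝ᵥ dy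
      - 1 / 2 * (dy ⬝ᵥ ((lam1 A * (lam3 A)⁻¹) *ᵥ dy))
      + dx ⬝ᵥ ((lam3 A)⁻¹ *ᵥ dy)
      - 1 / 2 * (dx ⬝ᵥ (((lam3 A)⁻¹ * lam4 A) *ᵥ dx))
  1 / ρ * Complex.exp (Complex.I / (ħ : ℂ) * (phase : ℂ))

/-- The nonlinear evolution operator `Û(t,s,ψ)`. `A κ s t` is the matriciant `𝒜(t,s)`,
`flow κ s c` the solution of the Hamilton–Ehrenfest system equal to `c` at time `s`, and
`root ħ κ s` a branch of the square root; `κ = ϰ‖ψ‖²` and `c = 𝔤₀(ψ)`. At `t = s`, where the Green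
function is the delta function, the operator is the identity. -/
def QuadraticModel.evolution {n : ℕ} (Q : QuadraticModel n)
    (A : ℝ → ℝ → ℝ → Matrix (Idx n) (Idx n) ℝ)
    (flow : ℝ → ℝ → PhasePoint n → ℝ → PhasePoint n)
    (root : ℝ → ℝ → ℝ → ℝ → ℂ) (ϰ ħ t s : ℝ) (ψ : E n → ℂ) (x : E n) : ℂ :=
  let κ : ℝ := ϰ * normSq ψ
  let g : ℝ → PhasePoint n := flow κ s (moments ħ ψ)
  open scoped Classical in
  if t = s then ψ x
  else ∫ y, green ħ (A κ s t) (root ħ κ s t) (Q.action κ g t - Q.action κ g s) (g t).z (g s).z x y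
    * ψ y

/-! ### Trajectory concentrated functions -/

/-- `φ` is a family of Schwartz functions depending smoothly, in the topology of the Schwartz
space, on a parameter in the open set `D`. -/
def SchwartzSmoothOn {n : ℕ} {F : Type*} [NormedAddCommGroup F] [NormedSpace ℝ F] (D : Set F)
    (φ : F → E n → ℂ) : Prop :=
  IsOpen D ∧ ContDiffOn ℝ ∞ (fun q : F × E n => φ q.1 q.2) (D ×ˢ Set.univ) ∧
    ∀ K ⊆ D, IsCompact K → ∀ k m : ℕ, ∃ C : ℝ, ∀ τ ∈ K, ∀ ξ : E n,
      ‖ξ‖ ^ k * ‖iteratedFDeriv ℝ m (fun q : F × E n => φ q.1 q.2) (τ, ξ)‖ ≤ C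

/-- `exp[(i/ħ)(S + ⟨P, x - X⟩)] φ((x - X)/√ħ)`. -/
def tcWave {n : ℕ} (ħ S : ℝ) (P X : E n) (φ : E n → ℂ) (x : E n) : ℂ :=
  φ ((Real.sqrt ħ)⁻¹ • (x - X)) *
    Complex.exp (Complex.I / (ħ : ℂ) * ((S + inner ℝ P (x - X) : ℝ) : ℂ))

/-- The class `𝒫_ħᵗ` of trajectory concentrated functions `Φ ħ t x`, for `0 < ħ < ħ₀` and all
times. The profile `φ` is Schwartz in `ξ`; it and `S, P, X` depend smoothly on `t` and on
`√ħ`, up to a neighbourhood of `√ħ = 0`; `(P, X)` is the mean phase-space point of `Φ`. -/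
def IsTCFamily {n : ℕ} (ħ₀ : ℝ) (Φ : ℝ → ℝ → E n → ℂ) : Prop :=
  ∃ (φ : ℝ × ℝ → E n → ℂ) (S : ℝ × ℝ → ℝ) (P X : ℝ × ℝ → E n),
    let D : Set (ℝ × ℝ) := Set.univ ×ˢ Set.Ioo (-Real.sqrt ħ₀) (Real.sqrt ħ₀)
    SchwartzSmoothOn D φ ∧ ContDiffOn ℝ ∞ S D ∧ ContDiffOn ℝ ∞ P D ∧ ContDiffOn ℝ ∞ X D ∧
    ∀ ħ ∈ Set.Ioo 0 ħ₀, ∀ t,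
      Φ ħ t = tcWave ħ (S (t, Real.sqrt ħ)) (P (t, Real.sqrt ħ)) (X (t, Real.sqrt ħ))
        (φ (t, Real.sqrt ħ)) ∧
      ∀ j, meanZ ħ (Φ ħ t) (Sum.inl j) = P (t, Real.sqrt ħ) j ∧
        meanZ ħ (Φ ħ t) (Sum.inr j) = X (t, Real.sqrt ħ) j

/-- The class of initial data `ψ ħ x`: trajectory concentrated functions at one fixed time. -/
def IsTCData {n : ℕ} (ħ₀ : ℝ) (ψ : ℝ → E n → ℂ) : Prop :=
  ∃ (φ : ℝ → E n → ℂ) (S : ℝ → ℝ) (P X : ℝ → E n),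
    let D : Set ℝ := Set.Ioo (-Real.sqrt ħ₀) (Real.sqrt ħ₀)
    SchwartzSmoothOn D φ ∧ ContDiffOn ℝ ∞ S D ∧ ContDiffOn ℝ ∞ P D ∧ ContDiffOn ℝ ∞ X D ∧
    ∀ ħ ∈ Set.Ioo 0 ħ₀,
      ψ ħ = tcWave ħ (S (Real.sqrt ħ)) (P (Real.sqrt ħ)) (X (Real.sqrt ħ)) (φ (Real.sqrt ħ)) ∧
      ∀ j, meanZ ħ (ψ ħ) (Sum.inl j) = P (Real.sqrt ħ) j ∧
        meanZ ħ (ψ ħ) (Sum.inr j) = X (Real.sqrt ħ) j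

end NonlocalGPE

end

open NonlocalGPE

/-! Because `V` is quadratic, the mean field of a state depends on that state only through its
squared norm and its first and second moments. The nonlinear operator applied to `φ` is therefore a
real quadratic Hamiltonian with coefficients read off from these numbers
(`QuadraticModel.gpe_operator_eq`). For such Hamiltonians the norm is conserved and Ehrenfest's
equations for the moments close. Hence the moments can be found before the wave function: they
follow the Hamilton–Ehrenfest system with `κ = ϰ‖ψ‖²`. Inserting its solution into the coefficients
gives a linear Schrödinger equation. The moments of a solution of that equation and the inserted
ones satisfy the same linear differential equations, so they coincide and the solution solves the
nonlinear equation (`QuadraticModel.moments_of_effective`, `QuadraticModel.solvesGPE_of_effective`).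
Uniqueness has the same source: two solutions with equal data have equal moments, hence solve one
linear equation with a symmetric Hamiltonian, and the norm of their difference stays zero
(`QuadraticModel.gpe_unique`).

In the frame that moves along `(P, X)`, dilated by `√ħ` and multiplied by the phase `exp(i(S + ⟨P, x
- X⟩)/ħ)`, Hamilton's equations account for the linear terms and the action for the scalar ones.
What is left is the homogeneous quadratic equation with `ħ = 1` for the profile
(`SchwartzCurve.tcL_solves`).

The homogeneous equation is solved by superposing coherent states, so that times with `det λ₃ = 0`
play no special role. The centre of a coherent state moves by the matriciant. Its Gaussian matrix is
`Γ = C D⁻¹`, where `(C; D)` is the image of the positive Lagrangian frame `(i; 1)`. Positivity is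
preserved by symplectic maps, so `D` is always invertible and `Im Γ` positive. The prefactor `(det
D)^(-1/2)` is the exponential of an integral and needs no choice of branch. A windowed Fourier
transform expands a profile in coherent states (`QuadraticModel.profile_self`), and the
superposition is a smooth family of Schwartz functions of the time and the parameters.

The phase of the Green function is a generating function of the linear flow. Applied to a coherent
state, the kernel thus reduces to one centred Gaussian integral and returns the propagated state
times a scalar (`QuadraticModel.integral_greenPhase_coherent`). That scalar, with its factor
`ħ^(n/2)`, is taken as the branch of the square root. By Fubini, kernel and propagator agree on
every profile (`QuadraticModel.integral_green_tcWave`).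

For trajectory concentrated data the construction is carried out with the parameter `ε = √ħ`, on
which flow, action and profile depend smoothly across `ε = 0`
(`QuadraticModel.exists_concentrated_solution`). This rests on a calculus of smooth families that
decay rapidly, or grow polynomially, in one variable and locally uniformly in the parameters. -/

open scoped ContDiff SchwartzMap Matrix Topology

set_option linter.unusedSectionVars false

noncomputable section

namespace NonlocalGPE

open MeasureTheory Set Filter

/-! ### Families of Schwartz functions and of slowly growing functions -/

section Bounds

variable {F F' V V' : Type} [NormedAddCommGroup F] [NormedAddCommGroup F'] [NormedAddCommGroup V]
  [NormedAddCommGroup V']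

/-- `a` grows at most polynomially in the second variable, locally uniformly in the first. -/
def PolyBound (D : Set F) (a : F × V → ℝ) : Prop :=
  ∀ K ⊆ D, IsCompact K → ∃ N : ℕ, ∃ C : ℝ, 0 ≤ C ∧ ∀ τ ∈ K, ∀ ξ, a (τ, ξ) ≤ C * (1 + ‖ξ‖) ^ N

/-- `a` decays rapidly in the second variable, locally uniformly in the first. -/
def RapidBound (D : Set F) (a : F × V → ℝ) : Prop :=
  ∀ K ⊆ D, IsCompact K → ∀ k : ℕ, ∃ C : ℝ, 0 ≤ C ∧ ∀ τ ∈ K, ∀ ξ, (1 + ‖ξ‖) ^ k * a (τ, ξ) ≤ C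

theorem PolyBound.mono {D : Set F} {a b : F × V → ℝ} (hb : PolyBound D b)
    (h : ∀ τ ∈ D, ∀ ξ, a (τ, ξ) ≤ b (τ, ξ)) : PolyBound D a := by
  intro K hK hKc
  obtain ⟨N, C, hC, hN⟩ := hb K hK hKc
  exact ⟨N, C, hC, fun τ hτ ξ => (h τ (hK hτ) ξ).trans (hN τ hτ ξ)⟩

theorem RapidBound.mono {D : Set F} {a b : F × V → ℝ} (hb : RapidBound D b)
    (h : ∀ τ ∈ D, ∀ ξ, a (τ, ξ) ≤ b (τ, ξ)) : RapidBound D a := by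
  intro K hK hKc k
  obtain ⟨C, hC, hN⟩ := hb K hK hKc k
  refine ⟨C, hC, fun τ hτ ξ => le_trans ?_ (hN τ hτ ξ)⟩
  exact mul_le_mul_of_nonneg_left (h τ (hK hτ) ξ) (by positivity)

theorem PolyBound.add {D : Set F} {a b : F × V → ℝ} (ha : PolyBound D a) (hb : PolyBound D b) :
    PolyBound D (fun q => a q + b q) := by
  intro K hK hKc
  obtain ⟨N, C, hC, hN⟩ := ha K hK hKc
  obtain ⟨N', C', hC', hN'⟩ := hb K hK hKc
  refine ⟨N + N', C + C', by positivity, fun τ hτ ξ => ?_⟩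
  have h1 : (1 : ℝ) ≤ 1 + ‖ξ‖ := by linarith [norm_nonneg ξ]
  have h2 : (1 + ‖ξ‖) ^ N ≤ (1 + ‖ξ‖) ^ (N + N') := pow_le_pow_right₀ h1 (by omega)
  have h3 : (1 + ‖ξ‖) ^ N' ≤ (1 + ‖ξ‖) ^ (N + N') := pow_le_pow_right₀ h1 (by omega)
  calc a (τ, ξ) + b (τ, ξ) ≤ C * (1 + ‖ξ‖) ^ N + C' * (1 + ‖ξ‖) ^ N' :=
        add_le_add (hN τ hτ ξ) (hN' τ hτ ξ)
    _ ≤ C * (1 + ‖ξ‖) ^ (N + N') + C' * (1 + ‖ξ‖) ^ (N + N') := by gcongr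
    _ = _ := by ring

theorem PolyBound.mul {D : Set F} {a b : F × V → ℝ} (ha : PolyBound D a) (hb : PolyBound D b)
    (hb0 : ∀ q, 0 ≤ b q) : PolyBound D (fun q => a q * b q) := by
  intro K hK hKc
  obtain ⟨N, C, hC, hN⟩ := ha K hK hKc
  obtain ⟨N', C', hC', hN'⟩ := hb K hK hKc
  refine ⟨N + N', C * C', by positivity, fun τ hτ ξ => ?_⟩
  calc a (τ, ξ) * b (τ, ξ) ≤ (C * (1 + ‖ξ‖) ^ N) * (C' * (1 + ‖ξ‖) ^ N') :=
        mul_le_mul (hN τ hτ ξ) (hN' τ hτ ξ) (hb0 _) (by positivity)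
    _ = _ := by ring

theorem PolyBound.const {D : Set F} (c : ℝ) : PolyBound D (fun _ : F × V => c) := by
  intro K hK hKc
  refine ⟨0, |c|, abs_nonneg c, fun τ hτ ξ => ?_⟩
  simpa using le_abs_self c

theorem PolyBound.sum {D : Set F} {ι : Type*} {a : ι → F × V → ℝ} (s : Finset ι)
    (ha : ∀ i ∈ s, PolyBound D (a i)) : PolyBound D (fun q => ∑ i ∈ s, a i q) := by
  classical
  induction s using Finset.induction_on with
  | empty => simpa using PolyBound.const 0
  | insert i s hi ih =>
    simp only [Finset.sum_insert hi]
    exact (ha i (Finset.mem_insert_self i s)).add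
      (ih fun j hj => ha j (Finset.mem_insert_of_mem hj))

theorem PolyBound.pow {D : Set F} {a : F × V → ℝ} (ha : PolyBound D a) (h0 : ∀ q, 0 ≤ a q)
    (n : ℕ) : PolyBound D (fun q => a q ^ n) := by
  induction n with
  | zero => simpa using PolyBound.const 1
  | succ n ih => simpa only [pow_succ] using ih.mul ha h0

theorem RapidBound.add {D : Set F} {a b : F × V → ℝ} (ha : RapidBound D a) (hb : RapidBound D b) :
    RapidBound D (fun q => a q + b q) := by
  intro K hK hKc k
  obtain ⟨C, hC, hN⟩ := ha K hK hKc k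
  obtain ⟨C', hC', hN'⟩ := hb K hK hKc k
  refine ⟨C + C', by positivity, fun τ hτ ξ => ?_⟩
  rw [mul_add]
  exact add_le_add (hN τ hτ ξ) (hN' τ hτ ξ)

theorem PolyBound.mul_rapid {D : Set F} {a b : F × V → ℝ} (ha : PolyBound D a)
    (hb : RapidBound D b) (hb0 : ∀ q, 0 ≤ b q) : RapidBound D (fun q => a q * b q) := by
  intro K hK hKc k
  obtain ⟨N, C, hC, hN⟩ := ha K hK hKc
  obtain ⟨C', hC', hN'⟩ := hb K hK hKc (k + N)
  refine ⟨C * C', by positivity, fun τ hτ ξ => ?_⟩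
  calc (1 + ‖ξ‖) ^ k * (a (τ, ξ) * b (τ, ξ))
      ≤ (1 + ‖ξ‖) ^ k * ((C * (1 + ‖ξ‖) ^ N) * b (τ, ξ)) := by
        have := hN τ hτ ξ
        have := hb0 (τ, ξ)
        gcongr
    _ = C * ((1 + ‖ξ‖) ^ (k + N) * b (τ, ξ)) := by ring
    _ ≤ C * C' := mul_le_mul_of_nonneg_left (hN' τ hτ ξ) hC

theorem RapidBound.zero {D : Set F} : RapidBound D (fun _ : F × V => 0) := by
  intro K hK hKc k
  exact ⟨0, le_rfl, fun τ hτ ξ => by simp⟩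

theorem RapidBound.sum {D : Set F} {ι : Type*} {a : ι → F × V → ℝ} (s : Finset ι)
    (ha : ∀ i ∈ s, RapidBound D (a i)) : RapidBound D (fun q => ∑ i ∈ s, a i q) := by
  classical
  induction s using Finset.induction_on with
  | empty => simpa using RapidBound.zero
  | insert i s hi ih =>
    simp only [Finset.sum_insert hi]
    exact (ha i (Finset.mem_insert_self i s)).add
      (ih fun j hj => ha j (Finset.mem_insert_of_mem hj))

theorem RapidBound.polyBound {D : Set F} {a : F × V → ℝ} (ha : RapidBound D a) :
    PolyBound D a := by
  intro K hK hKc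
  obtain ⟨C, hC, h⟩ := ha K hK hKc 0
  exact ⟨0, C, hC, fun τ hτ ξ => by simpa using h τ hτ ξ⟩

/-- The hypothesis `hθ` is a quantitative form of properness: it trades decay in `θ` for decay in
`ξ`, a weight of order `k` in `ξ` costing a weight of order `N * k` in `θ`. Compact sets of
parameters go to compact sets under `σ`. -/
theorem RapidBound.comp {D : Set F} {D' : Set F'} {a : F × V → ℝ} (ha : RapidBound D a)
    (h0 : ∀ q, 0 ≤ a q)
    {σ : F' → F} {θ : F' × V' → V} (hσ : ContinuousOn σ D') (hσD : MapsTo σ D' D)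
    (hθ : ∀ K ⊆ D', IsCompact K → ∃ N : ℕ, ∃ C : ℝ, ∀ τ ∈ K, ∀ ξ,
      1 + ‖ξ‖ ≤ C * (1 + ‖θ (τ, ξ)‖) ^ N) :
    RapidBound D' (fun q => a (σ q.1, θ q)) := by
  intro K hK hKc k
  obtain ⟨N, C, hN⟩ := hθ K hK hKc
  obtain ⟨C', hC', hN'⟩ := ha (σ '' K) (by
    rintro _ ⟨τ, hτ, rfl⟩; exact hσD (hK hτ)) (hKc.image_of_continuousOn (hσ.mono hK)) (N * k)
  refine ⟨|C| ^ k * C', by positivity, fun τ hτ ξ => ?_⟩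
  have h1 : 1 + ‖ξ‖ ≤ |C| * (1 + ‖θ (τ, ξ)‖) ^ N :=
    (hN τ hτ ξ).trans (mul_le_mul_of_nonneg_right (le_abs_self C) (by positivity))
  calc (1 + ‖ξ‖) ^ k * a (σ τ, θ (τ, ξ))
      ≤ (|C| * (1 + ‖θ (τ, ξ)‖) ^ N) ^ k * a (σ τ, θ (τ, ξ)) := by
        have := h0 (σ τ, θ (τ, ξ)); gcongr
    _ = |C| ^ k * ((1 + ‖θ (τ, ξ)‖) ^ (N * k) * a (σ τ, θ (τ, ξ))) := by
        rw [mul_pow, ← pow_mul]; ring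
    _ ≤ |C| ^ k * C' := by
        have := hN' (σ τ) ⟨τ, hτ, rfl⟩ (θ (τ, ξ)); gcongr

end Bounds

theorem isOpen_prod_univ {X Y : Type*} [TopologicalSpace X] [TopologicalSpace Y] {D : Set X}
    (h : IsOpen D) : IsOpen (D ×ˢ (univ : Set Y)) :=
  h.prod isOpen_univ

/-! ### Calculus of rapidly decaying and slowly growing smooth families -/

section Calculus

variable {F F' V V' W G G₁ G₂ : Type}
  [NormedAddCommGroup F] [NormedSpace ℝ F] [NormedAddCommGroup F'] [NormedSpace ℝ F']
  [NormedAddCommGroup V] [NormedSpace ℝ V] [NormedAddCommGroup V'] [NormedSpace ℝ V']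
  [NormedAddCommGroup W] [NormedSpace ℝ W]
  [NormedAddCommGroup G] [NormedSpace ℝ G]
  [NormedAddCommGroup G₁] [NormedSpace ℝ G₁] [NormedAddCommGroup G₂] [NormedSpace ℝ G₂]

/-- Smooth functions all of whose derivatives decay rapidly in the second variable, locally
uniformly in the first. -/
structure RapidOn (D : Set F) (f : F × V → G) : Prop where
  isOpen : IsOpen D
  smooth : ContDiffOn ℝ ∞ f (D ×ˢ univ)
  bound : ∀ m : ℕ, RapidBound D (fun q => ‖iteratedFDeriv ℝ m f q‖)

/-- Smooth functions all of whose derivatives grow at most polynomially in the second variable,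
locally uniformly in the first. -/
structure SlowOn (D : Set F) (f : F × V → G) : Prop where
  isOpen : IsOpen D
  smooth : ContDiffOn ℝ ∞ f (D ×ˢ univ)
  bound : ∀ m : ℕ, PolyBound D (fun q => ‖iteratedFDeriv ℝ m f q‖)

/-- The weights `‖ξ‖ ^ k` and `(1 + ‖ξ‖) ^ k` are interchangeable because `(1 + r) ^ k ≤ 2 ^ (k - 1)
* (1 + r ^ k)`. The second kind is multiplicative and submultiplicative under products of spaces,
which the calculus below exploits. -/
theorem schwartzSmoothOn_iff {n : ℕ} {D : Set F} {φ : F → E n → ℂ} :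
    SchwartzSmoothOn D φ ↔ RapidOn D (fun q : F × E n => φ q.1 q.2) := by
  constructor
  · rintro ⟨h1, h2, h3⟩
    refine ⟨h1, h2, fun m K hK hKc k => ?_⟩
    obtain ⟨C, hC⟩ := h3 K hK hKc k m
    obtain ⟨C', hC'⟩ := h3 K hK hKc 0 m
    refine ⟨|2 ^ (k - 1) * (C' + C)|, abs_nonneg _, fun τ hτ ξ => ?_⟩
    refine le_trans ?_ (le_abs_self _)
    have := add_pow_le zero_le_one (norm_nonneg ξ) k
    refine (mul_le_mul_of_nonneg_right this (norm_nonneg _)).trans ?_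
    rw [mul_assoc, add_mul]
    have a1 := hC τ hτ ξ
    have a2 := hC' τ hτ ξ
    simp only [pow_zero, one_mul] at a2
    gcongr
    simpa using a2
  · rintro ⟨h1, h2, h3⟩
    refine ⟨h1, h2, fun K hK hKc k m => ?_⟩
    obtain ⟨C, hC0, hC⟩ := h3 m K hK hKc k
    refine ⟨C, fun τ hτ ξ => le_trans ?_ (hC τ hτ ξ)⟩
    gcongr
    linarith [norm_nonneg ξ]

theorem RapidOn.slow {D : Set F} {f : F × V → G} (hf : RapidOn D f) : SlowOn D f :=
  ⟨hf.isOpen, hf.smooth, fun m => (hf.bound m).polyBound⟩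

theorem RapidOn.mono {D D' : Set F} {f : F × V → G} (hf : RapidOn D f) (hD : IsOpen D')
    (h : D' ⊆ D) : RapidOn D' f :=
  ⟨hD, hf.smooth.mono (prod_mono h subset_rfl), fun m K hK => hf.bound m K (hK.trans h)⟩

theorem iteratedFDeriv_congr_of_eqOn {X : Type} [NormedAddCommGroup X] [NormedSpace ℝ X]
    {s : Set X} (hs : IsOpen s) {f g : X → G} (h : EqOn f g s) {x : X} (hx : x ∈ s) (m : ℕ) :
    iteratedFDeriv ℝ m f x = iteratedFDeriv ℝ m g x := by
  have : f =ᶠ[𝓝 x] g := by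
    filter_upwards [hs.mem_nhds hx] with y hy using h hy
  exact (this.iteratedFDeriv ℝ m).eq_of_nhds

theorem RapidOn.congr {D : Set F} {f g : F × V → G} (hf : RapidOn D f)
    (h : ∀ τ ∈ D, ∀ ξ, g (τ, ξ) = f (τ, ξ)) : RapidOn D g := by
  have h' : EqOn g f (D ×ˢ univ) := fun q hq => h q.1 hq.1 q.2
  refine ⟨hf.isOpen, hf.smooth.congr h', fun m => (hf.bound m).mono fun τ hτ ξ => ?_⟩
  rw [iteratedFDeriv_congr_of_eqOn (isOpen_prod_univ hf.isOpen) h' ⟨hτ, mem_univ ξ⟩]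

theorem SlowOn.congr {D : Set F} {f g : F × V → G} (hf : SlowOn D f)
    (h : ∀ τ ∈ D, ∀ ξ, g (τ, ξ) = f (τ, ξ)) : SlowOn D g := by
  have h' : EqOn g f (D ×ˢ univ) := fun q hq => h q.1 hq.1 q.2
  refine ⟨hf.isOpen, hf.smooth.congr h', fun m => (hf.bound m).mono fun τ hτ ξ => ?_⟩
  rw [iteratedFDeriv_congr_of_eqOn (isOpen_prod_univ hf.isOpen) h' ⟨hτ, mem_univ ξ⟩]

section pointwise

variable {X : Type} [NormedAddCommGroup X] [NormedSpace ℝ X]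

theorem norm_iteratedFDeriv_bilin_le {s : Set X} (hs : IsOpen s) (B : G₁ →L[ℝ] G₂ →L[ℝ] G)
    {f : X → G₁} {g : X → G₂} (hf : ContDiffOn ℝ ∞ f s) (hg : ContDiffOn ℝ ∞ g s) {x : X}
    (hx : x ∈ s) (m : ℕ) :
    ‖iteratedFDeriv ℝ m (fun y => B (f y) (g y)) x‖ ≤ ‖B‖ * ∑ i ∈ Finset.range (m + 1),
      (m.choose i : ℝ) * ‖iteratedFDeriv ℝ i f x‖ * ‖iteratedFDeriv ℝ (m - i) g x‖ := by
  have := B.norm_iteratedFDerivWithin_le_of_bilinear hf hg hs.uniqueDiffOn hx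
    (n := m) (by exact_mod_cast le_top)
  simpa only [iteratedFDerivWithin_of_isOpen _ hs hx] using this

/-- A crude Faà di Bruno bound. Sums over all orders up to `m` serve as the constants for the outer
and the inner map, and the summand `1` keeps the base at least one, so that each of its powers still
dominates the single derivative of the inner map. -/
theorem norm_iteratedFDeriv_comp_on_le {Y : Type} [NormedAddCommGroup Y] [NormedSpace ℝ Y]
    {s : Set X} (hs : IsOpen s) {t : Set Y} (ht : IsOpen t)
    {f : Y → G} {θ : X → Y} (hf : ContDiffOn ℝ ∞ f t) (hθ : ContDiffOn ℝ ∞ θ s)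
    (hst : MapsTo θ s t) {x : X} (hx : x ∈ s) (m : ℕ) :
    ‖iteratedFDeriv ℝ m (f ∘ θ) x‖ ≤ m.factorial *
      (∑ i ∈ Finset.range (m + 1), ‖iteratedFDeriv ℝ i f (θ x)‖) *
      (1 + ∑ i ∈ Finset.range (m + 1), ‖iteratedFDeriv ℝ i θ x‖) ^ m := by
  rw [← iteratedFDerivWithin_of_isOpen _ hs hx]
  refine norm_iteratedFDerivWithin_comp_le hf hθ (by exact_mod_cast le_top) ht.uniqueDiffOn
    hs.uniqueDiffOn hst hx ?_ ?_
  · intro i hi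
    rw [iteratedFDerivWithin_of_isOpen _ ht (hst hx)]
    exact Finset.single_le_sum (f := fun i => ‖iteratedFDeriv ℝ i f (θ x)‖)
      (fun _ _ => norm_nonneg _) (Finset.mem_range.2 (by omega))
  · intro i h1 hi
    rw [iteratedFDerivWithin_of_isOpen _ hs hx]
    have h2 : ‖iteratedFDeriv ℝ i θ x‖ ≤ ∑ i ∈ Finset.range (m + 1), ‖iteratedFDeriv ℝ i θ x‖ :=
      Finset.single_le_sum (f := fun i => ‖iteratedFDeriv ℝ i θ x‖)
      (fun _ _ => norm_nonneg _) (Finset.mem_range.2 (by omega))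
    have h3 : (0 : ℝ) ≤ ∑ i ∈ Finset.range (m + 1), ‖iteratedFDeriv ℝ i θ x‖ :=
      Finset.sum_nonneg fun _ _ => norm_nonneg _
    calc _ ≤ 1 + ∑ i ∈ Finset.range (m + 1), ‖iteratedFDeriv ℝ i θ x‖ := by linarith
      _ ≤ _ := le_self_pow₀ (by linarith) (by omega)

theorem norm_iteratedFDeriv_clm_le {s : Set X} (hs : IsOpen s) (L : G₁ →L[ℝ] G)
    {f : X → G₁} (hf : ContDiffOn ℝ ∞ f s) {x : X} (hx : x ∈ s) (m : ℕ) :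
    ‖iteratedFDeriv ℝ m (fun y => L (f y)) x‖ ≤ ‖L‖ * ‖iteratedFDeriv ℝ m f x‖ :=
  L.norm_iteratedFDeriv_comp_left (hf.contDiffAt (hs.mem_nhds hx)) (by exact_mod_cast le_top)

end pointwise

theorem SlowOn.bilin {D : Set F} {f : F × V → G₁} {g : F × V → G₂} (hf : SlowOn D f)
    (hg : SlowOn D g) (B : G₁ →L[ℝ] G₂ →L[ℝ] G) : SlowOn D (fun q => B (f q) (g q)) := by
  refine ⟨hf.isOpen, (B.contDiff.comp_contDiffOn hf.smooth).clm_apply hg.smooth, fun m => ?_⟩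
  refine PolyBound.mono (b := fun q => ‖B‖ * ∑ i ∈ Finset.range (m + 1),
    (m.choose i : ℝ) * ‖iteratedFDeriv ℝ i f q‖ * ‖iteratedFDeriv ℝ (m - i) g q‖) ?_
    fun τ hτ ξ => norm_iteratedFDeriv_bilin_le
    (isOpen_prod_univ hf.isOpen) B hf.smooth hg.smooth ⟨hτ, mem_univ ξ⟩ m
  refine (PolyBound.const _).mul (PolyBound.sum _ fun i _ => ?_)
    fun q => Finset.sum_nonneg fun _ _ => by positivity
  exact ((PolyBound.const _).mul (hf.bound i) fun _ => norm_nonneg _).mul (hg.bound _)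
    fun _ => norm_nonneg _

theorem SlowOn.bilin_rapid {D : Set F} {f : F × V → G₁} {g : F × V → G₂} (hf : SlowOn D f)
    (hg : RapidOn D g) (B : G₁ →L[ℝ] G₂ →L[ℝ] G) : RapidOn D (fun q => B (f q) (g q)) := by
  refine ⟨hf.isOpen, (B.contDiff.comp_contDiffOn hf.smooth).clm_apply hg.smooth, fun m => ?_⟩
  refine RapidBound.mono (b := fun q => ‖B‖ * ∑ i ∈ Finset.range (m + 1),
    (m.choose i : ℝ) * ‖iteratedFDeriv ℝ i f q‖ * ‖iteratedFDeriv ℝ (m - i) g q‖) ?_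
    fun τ hτ ξ => norm_iteratedFDeriv_bilin_le
    (isOpen_prod_univ hf.isOpen) B hf.smooth hg.smooth ⟨hτ, mem_univ ξ⟩ m
  refine (PolyBound.const _).mul_rapid (RapidBound.sum _ fun i _ => ?_)
    fun q => Finset.sum_nonneg fun _ _ => by positivity
  exact ((PolyBound.const _).mul (hf.bound i) fun _ => norm_nonneg _).mul_rapid (hg.bound _)
    fun _ => norm_nonneg _

theorem RapidOn.clm {D : Set F} {f : F × V → G₁} (hf : RapidOn D f) (L : G₁ →L[ℝ] G) :
    RapidOn D (fun q => L (f q)) := by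
  refine ⟨hf.isOpen, L.contDiff.comp_contDiffOn hf.smooth, fun m => ?_⟩
  refine RapidBound.mono ((PolyBound.const ‖L‖).mul_rapid (hf.bound m) fun _ => norm_nonneg _)
    fun τ hτ ξ => norm_iteratedFDeriv_clm_le (isOpen_prod_univ hf.isOpen) L hf.smooth
      ⟨hτ, mem_univ ξ⟩ m

theorem SlowOn.clm {D : Set F} {f : F × V → G₁} (hf : SlowOn D f) (L : G₁ →L[ℝ] G) :
    SlowOn D (fun q => L (f q)) := by
  refine ⟨hf.isOpen, L.contDiff.comp_contDiffOn hf.smooth, fun m => ?_⟩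
  refine PolyBound.mono ((PolyBound.const ‖L‖).mul (hf.bound m) fun _ => norm_nonneg _)
    fun τ hτ ξ => norm_iteratedFDeriv_clm_le (isOpen_prod_univ hf.isOpen) L hf.smooth
      ⟨hτ, mem_univ ξ⟩ m

theorem norm_iteratedFDeriv_add_le {X : Type} [NormedAddCommGroup X] [NormedSpace ℝ X] {s : Set X}
    (hs : IsOpen s) {f g : X → G} (hf : ContDiffOn ℝ ∞ f s) (hg : ContDiffOn ℝ ∞ g s) {x : X}
    (hx : x ∈ s) (m : ℕ) :
    ‖iteratedFDeriv ℝ m (fun y => f y + g y) x‖ ≤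
      ‖iteratedFDeriv ℝ m f x‖ + ‖iteratedFDeriv ℝ m g x‖ := by
  have h1 : ContDiffAt ℝ m f x := (hf.contDiffAt (hs.mem_nhds hx)).of_le (by exact_mod_cast le_top)
  have h2 : ContDiffAt ℝ m g x := (hg.contDiffAt (hs.mem_nhds hx)).of_le (by exact_mod_cast le_top)
  rw [fun_iteratedFDeriv_add_apply h1 h2]
  exact norm_add_le _ _

theorem RapidOn.add {D : Set F} {f g : F × V → G} (hf : RapidOn D f) (hg : RapidOn D g) :
    RapidOn D (fun q => f q + g q) :=
  ⟨hf.isOpen, hf.smooth.add hg.smooth, fun m => ((hf.bound m).add (hg.bound m)).mono fun _ hτ _ =>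
    norm_iteratedFDeriv_add_le (isOpen_prod_univ hf.isOpen) hf.smooth hg.smooth ⟨hτ, mem_univ _⟩ m⟩

theorem SlowOn.add {D : Set F} {f g : F × V → G} (hf : SlowOn D f) (hg : SlowOn D g) :
    SlowOn D (fun q => f q + g q) :=
  ⟨hf.isOpen, hf.smooth.add hg.smooth, fun m => ((hf.bound m).add (hg.bound m)).mono fun _ hτ _ =>
    norm_iteratedFDeriv_add_le (isOpen_prod_univ hf.isOpen) hf.smooth hg.smooth ⟨hτ, mem_univ _⟩ m⟩

/-- The derivatives of a function of the parameter alone factor through the first projection, which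
has norm at most one; continuity on compact sets then bounds them independently of `ξ`. -/
theorem SlowOn.param {D : Set F} (hD : IsOpen D) {f : F → G} (hf : ContDiffOn ℝ ∞ f D) :
    SlowOn D (fun q : F × V => f q.1) := by
  have hs : ContDiffOn ℝ ∞ (fun q : F × V => f q.1) (D ×ˢ univ) :=
    hf.comp contDiff_fst.contDiffOn fun q hq => hq.1
  refine ⟨hD, hs, fun m K hK hKc => ?_⟩
  have h1 : ContinuousOn (fun τ => ‖iteratedFDeriv ℝ m f τ‖) K := by
    have h2 := (hf.continuousOn_iteratedFDerivWithin (m := m) (by exact_mod_cast le_top)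
      hD.uniqueDiffOn)
    exact ((h2.congr fun τ hτ => (iteratedFDerivWithin_of_isOpen m hD hτ).symm).mono hK).norm
  obtain ⟨C, hC⟩ := (hKc.bddAbove_image h1)
  refine ⟨0, |C|, abs_nonneg C, fun τ hτ ξ => ?_⟩
  have hC' : ‖iteratedFDeriv ℝ m f τ‖ ≤ C := hC ⟨τ, hτ, rfl⟩
  have h3 : iteratedFDeriv ℝ m (fun q : F × V => f q.1) (τ, ξ)
      = (iteratedFDeriv ℝ m f τ).compContinuousLinearMap
        (fun _ => ContinuousLinearMap.fst ℝ F V) := by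
    have h4 : (ContinuousLinearMap.fst ℝ F V) ⁻¹' D = D ×ˢ univ := by ext; simp
    have := (ContinuousLinearMap.fst ℝ F V).iteratedFDerivWithin_comp_right hf hD.uniqueDiffOn
      (by rw [h4]; exact (isOpen_prod_univ hD).uniqueDiffOn) (x := (τ, ξ)) (hK hτ) (i := m)
      (by exact_mod_cast le_top)
    have hx : (τ, ξ) ∈ D ×ˢ (univ : Set V) := ⟨hK hτ, mem_univ ξ⟩
    rw [h4, iteratedFDerivWithin_of_isOpen _ (isOpen_prod_univ hD) hx] at this
    refine Eq.trans this ?_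
    simp only [ContinuousLinearMap.coe_fst', iteratedFDerivWithin_of_isOpen _ hD (hK hτ)]
  simp only [pow_zero, mul_one, h3]
  refine ((iteratedFDeriv ℝ m f τ).norm_compContinuousLinearMap_le _).trans ?_
  calc _ ≤ ‖iteratedFDeriv ℝ m f τ‖ * 1 := by
        gcongr
        exact Finset.prod_le_one (fun _ _ => norm_nonneg _)
          fun _ _ => ContinuousLinearMap.norm_fst_le ℝ F V
    _ ≤ |C| := by rw [mul_one]; exact hC'.trans (le_abs_self C)

theorem SlowOn.const {D : Set F} (hD : IsOpen D) (c : G) : SlowOn D (fun _ : F × V => c) :=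
  SlowOn.param hD contDiffOn_const

theorem SlowOn.clm_snd {D : Set F} (hD : IsOpen D) (L : V →L[ℝ] G) :
    SlowOn D (fun q : F × V => L q.2) := by
  have hs : ContDiff ℝ ∞ (fun q : F × V => L q.2) := L.contDiff.comp contDiff_snd
  refine ⟨hD, hs.contDiffOn, fun m => ?_⟩
  have e : (fun q : F × V => L q.2) = (L.comp (ContinuousLinearMap.snd ℝ F V)) := rfl
  -- A continuous linear map grows linearly, its first derivative is constant, and all higher ones
  -- vanish.
  rcases m with _ | _ | m
  · intro K hK hKc
    refine ⟨1, ‖L‖, norm_nonneg _, fun τ hτ ξ => ?_⟩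
    simp only [norm_iteratedFDeriv_zero]
    calc _ ≤ ‖L‖ * ‖ξ‖ := L.le_opNorm ξ
      _ ≤ _ := by gcongr; rw [pow_one]; linarith
  · refine (PolyBound.const ‖(L.comp (ContinuousLinearMap.snd ℝ F V))‖).mono fun τ hτ ξ => ?_
    rw [zero_add, ← norm_iteratedFDeriv_fderiv, norm_iteratedFDeriv_zero, e,
      ContinuousLinearMap.fderiv]
  · refine (PolyBound.const 0).mono fun τ hτ ξ => ?_
    rw [← norm_iteratedFDeriv_fderiv, e]
    have : fderiv ℝ (L.comp (ContinuousLinearMap.snd ℝ F V))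
      = fun _ => L.comp (ContinuousLinearMap.snd ℝ F V) := by
      ext1 x; exact ContinuousLinearMap.fderiv _
    rw [this, iteratedFDeriv_succ_const]
    simp

theorem SlowOn.sum {D : Set F} (hD : IsOpen D) {ι : Type*} {f : ι → F × V → G} (s : Finset ι)
    (hf : ∀ i ∈ s, SlowOn D (f i)) : SlowOn D (fun q => ∑ i ∈ s, f i q) := by
  classical
  induction s using Finset.induction_on with
  | empty => simpa using SlowOn.const hD 0
  | insert i s hi ih =>
    simp only [Finset.sum_insert hi]
    exact (hf i (Finset.mem_insert_self i s)).add
      (ih fun j hj => hf j (Finset.mem_insert_of_mem hj))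

section algebra

variable {A : Type} [NormedRing A] [NormedAlgebra ℝ A]

theorem SlowOn.mul {D : Set F} {f g : F × V → A} (hf : SlowOn D f) (hg : SlowOn D g) :
    SlowOn D (fun q => f q * g q) := hf.bilin hg (ContinuousLinearMap.mul ℝ A)

theorem SlowOn.mul_rapid {D : Set F} {f g : F × V → A} (hf : SlowOn D f) (hg : RapidOn D g) :
    RapidOn D (fun q => f q * g q) := hf.bilin_rapid hg (ContinuousLinearMap.mul ℝ A)

theorem RapidOn.mul_slow {D : Set F} {f g : F × V → A} (hf : RapidOn D f) (hg : SlowOn D g) :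
    RapidOn D (fun q => f q * g q) := hg.bilin_rapid hf (ContinuousLinearMap.mul ℝ A).flip

end algebra

theorem SlowOn.smul {D : Set F} {f : F × V → ℝ} {g : F × V → G} (hf : SlowOn D f)
    (hg : SlowOn D g) : SlowOn D (fun q => f q • g q) :=
  hf.bilin hg (ContinuousLinearMap.lsmul ℝ ℝ)

theorem SlowOn.ofReal {D : Set F} {f : F × V → ℝ} (hf : SlowOn D f) :
    SlowOn D (fun q => (f q : ℂ)) := hf.clm Complex.ofRealCLM

theorem SlowOn.of_coord {n : ℕ} {D : Set F} (hD : IsOpen D) {f : F × V → E n}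
    (hf : ∀ j, SlowOn D (fun q => f q j)) : SlowOn D f := by
  have h := SlowOn.sum hD Finset.univ fun (j : Fin n) _ =>
    (hf j).smul (SlowOn.const (V := V) hD (EuclideanSpace.single j (1 : ℝ)))
  refine h.congr fun τ hτ ξ => ?_
  ext i
  simp [Finset.sum_apply, Pi.single_apply]

theorem SlowOn.prodMk {D : Set F} {f : F × V → G₁} {g : F × V → G₂} (hf : SlowOn D f)
    (hg : SlowOn D g) : SlowOn D (fun q => (f q, g q)) := by
  have := (hf.clm (ContinuousLinearMap.inl ℝ G₁ G₂)).add (hg.clm (ContinuousLinearMap.inr ℝ G₁ G₂))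
  simpa using this

theorem RapidOn.fderiv {D : Set F} {f : F × V → G} (hf : RapidOn D f) :
    RapidOn D (fun q => fderiv ℝ f q) := by
  refine ⟨hf.isOpen, hf.smooth.fderiv_of_isOpen (isOpen_prod_univ hf.isOpen)
    (by norm_cast), fun m => (hf.bound (m + 1)).mono fun τ hτ ξ => ?_⟩
  exact norm_iteratedFDeriv_fderiv.le

theorem RapidOn.fderiv_apply {D : Set F} {f : F × V → G} (hf : RapidOn D f) (v : F × V) :
    RapidOn D (fun q => _root_.fderiv ℝ f q v) :=
  hf.fderiv.clm (ContinuousLinearMap.apply ℝ G v)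

/-- Composition with a smooth, slowly growing and proper family of maps. -/
theorem RapidOn.comp {D : Set F} {D' : Set F'} {f : F × V → G} (hf : RapidOn D f)
    (hD' : IsOpen D') {σ : F' → F} {θ : F' × V' → V} (hσ : ContDiffOn ℝ ∞ σ D')
    (hσD : MapsTo σ D' D) (hθ : SlowOn D' θ)
    (hp : ∀ K ⊆ D', IsCompact K → ∃ N : ℕ, ∃ C : ℝ, ∀ τ ∈ K, ∀ ξ,
      1 + ‖ξ‖ ≤ C * (1 + ‖θ (τ, ξ)‖) ^ N) :
    RapidOn D' (fun q => f (σ q.1, θ q)) := by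
  have hΘ : SlowOn D' (fun q : F' × V' => (σ q.1, θ q)) := (SlowOn.param hD' hσ).prodMk hθ
  have hm : MapsTo (fun q : F' × V' => (σ q.1, θ q)) (D' ×ˢ univ) (D ×ˢ univ) :=
    fun q hq => ⟨hσD hq.1, mem_univ _⟩
  refine ⟨hD', hf.smooth.comp hΘ.smooth hm, fun m => ?_⟩
  refine RapidBound.mono (b := fun q : F' × V' => m.factorial *
      (∑ i ∈ Finset.range (m + 1), ‖iteratedFDeriv ℝ i f (σ q.1, θ q)‖) *
      (1 + ∑ i ∈ Finset.range (m + 1), ‖iteratedFDeriv ℝ i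
        (fun q : F' × V' => (σ q.1, θ q)) q‖) ^ m) ?_
    fun τ hτ ξ => norm_iteratedFDeriv_comp_on_le
    (isOpen_prod_univ hD') (isOpen_prod_univ hf.isOpen) hf.smooth hΘ.smooth hm ⟨hτ, mem_univ ξ⟩ m
  have h1 : RapidBound D' (fun q : F' × V' => ∑ i ∈ Finset.range (m + 1),
      ‖iteratedFDeriv ℝ i f (σ q.1, θ q)‖) :=
    RapidBound.comp (RapidBound.sum _ fun i _ => hf.bound i)
      (fun q => Finset.sum_nonneg fun _ _ => norm_nonneg _) hσ.continuousOn hσD hp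
  have h2 := (((PolyBound.const (V := V') (D := D') 1).add
    (PolyBound.sum (Finset.range (m + 1)) fun i _ => hΘ.bound i)).pow
    (fun q => by positivity) m)
  have h3 := (h2.mul (PolyBound.const (m.factorial : ℝ)) fun _ => by positivity).mul_rapid h1
    (fun q => Finset.sum_nonneg fun _ _ => norm_nonneg _)
  refine h3.mono fun τ hτ ξ => le_of_eq (by ring)

theorem contDiff_cexp_real : ContDiff ℝ ∞ Complex.exp :=
  (Complex.contDiff_exp (𝕜 := ℂ)).restrict_scalars ℝ

/-- Every derivative of the exponential is the exponential, so the chain rule yields one common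
factor `‖exp (c x)‖` times a polynomial in the derivatives of `c`. Real derivatives are restrictions
of the complex ones, with the same norm. -/
theorem norm_iteratedFDeriv_cexp_le {X : Type} [NormedAddCommGroup X] [NormedSpace ℝ X]
    {s : Set X} (hs : IsOpen s) {c : X → ℂ} (hc : ContDiffOn ℝ ∞ c s) {x : X} (hx : x ∈ s)
    (m : ℕ) :
    ‖iteratedFDeriv ℝ m (fun y => Complex.exp (c y)) x‖ ≤ m.factorial *
      ((m + 1) * ‖Complex.exp (c x)‖) *
      (1 + ∑ i ∈ Finset.range (m + 1), ‖iteratedFDeriv ℝ i c x‖) ^ m := by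
  have h := norm_iteratedFDeriv_comp_on_le hs isOpen_univ (f := Complex.exp)
    (contDiff_cexp_real).contDiffOn hc (mapsTo_univ _ _) hx m
  refine h.trans ?_
  have h2 : ∀ i, ‖iteratedFDeriv ℝ i Complex.exp (c x)‖ ≤ ‖Complex.exp (c x)‖ := by
    intro i
    have h3 := (Complex.contDiff_exp (𝕜 := ℂ) (n := i)).contDiffAt (x := c x)
    rw [← h3.restrictScalars_iteratedFDeriv (𝕜 := ℝ)]
    simp only [Function.comp_apply, ContinuousMultilinearMap.norm_restrictScalars,
      norm_iteratedFDeriv_eq_norm_iteratedDeriv, iteratedDeriv_eq_iterate, Complex.iter_deriv_exp]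
    exact le_rfl
  gcongr
  calc _ ≤ ∑ i ∈ Finset.range (m + 1), ‖Complex.exp (c x)‖ := Finset.sum_le_sum fun i _ => h2 i
    _ = _ := by simp

theorem SlowOn.cexp {D : Set F} {c : F × V → ℂ} (hc : SlowOn D c)
    (h : ∀ τ ∈ D, ∀ ξ, (c (τ, ξ)).re ≤ 0) : SlowOn D (fun q => Complex.exp (c q)) := by
  refine ⟨hc.isOpen, (contDiff_cexp_real).comp_contDiffOn hc.smooth,
    fun m => ?_⟩
  refine PolyBound.mono (b := fun q : F × V => (m.factorial * ((m + 1) * 1) : ℝ) *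
      (1 + ∑ i ∈ Finset.range (m + 1), ‖iteratedFDeriv ℝ i c q‖) ^ m) ?_
    fun τ hτ ξ => (norm_iteratedFDeriv_cexp_le
    (isOpen_prod_univ hc.isOpen) hc.smooth ⟨hτ, mem_univ ξ⟩ m).trans
    (mul_le_mul_of_nonneg_right ?_ (by positivity))
  · exact (PolyBound.const _).mul (((PolyBound.const 1).add
      (PolyBound.sum (Finset.range (m + 1)) fun i _ => hc.bound i)).pow
      (fun q => by positivity) m) fun q => by positivity
  · gcongr
    rw [Complex.norm_exp]
    exact Real.exp_le_one_iff.2 (h τ hτ ξ)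

/-- Decay of the exponential itself suffices: the derivatives of the exponent contribute only
polynomial factors, which rapid decay absorbs. -/
theorem SlowOn.cexp_rapid {D : Set F} {c : F × V → ℂ} (hc : SlowOn D c)
    (h : RapidBound D (fun q => ‖Complex.exp (c q)‖)) : RapidOn D (fun q => Complex.exp (c q)) := by
  refine ⟨hc.isOpen, (contDiff_cexp_real).comp_contDiffOn hc.smooth,
    fun m => ?_⟩
  refine RapidBound.mono (b := fun q : F × V => m.factorial *
      ((m + 1) * ‖Complex.exp (c q)‖) *
      (1 + ∑ i ∈ Finset.range (m + 1), ‖iteratedFDeriv ℝ i c q‖) ^ m) ?_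
    fun τ hτ ξ => (norm_iteratedFDeriv_cexp_le
    (isOpen_prod_univ hc.isOpen) hc.smooth ⟨hτ, mem_univ ξ⟩ m)
  have h2 := (((PolyBound.const (V := V) (D := D) 1).add
    (PolyBound.sum (Finset.range (m + 1)) fun i _ => hc.bound i)).pow
    (fun q => by positivity) m)
  have h3 := (h2.mul (PolyBound.const (m.factorial * (m + 1) : ℝ)) fun _ => by positivity).mul_rapid
    h (fun q => norm_nonneg _)
  refine h3.mono fun τ hτ ξ => le_of_eq (by ring)

theorem SlowOn.cexp_I {D : Set F} {c : F × V → ℝ} (hc : SlowOn D c) :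
    SlowOn D (fun q => Complex.exp (Complex.I * (c q : ℂ))) :=
  ((SlowOn.const hc.isOpen Complex.I).mul hc.ofReal).cexp fun τ _ ξ => by simp

/-- Tensor products. -/
theorem RapidOn.tensor {D : Set F} {f : F × V → ℂ} {g : F × W → ℂ} (hf : RapidOn D f)
    (hg : RapidOn D g) : RapidOn D (fun q : F × (V × W) => f (q.1, q.2.1) * g (q.1, q.2.2)) := by
  -- A factor pulled back to the product does not decay in the other variable, so it is no rapid
  -- family there. Only the pointwise domination of its derivatives is recorded; the weight is split
  -- at the end by `1 + ‖(v, w)‖ ≤ (1 + ‖v‖) * (1 + ‖w‖)`.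
  have pullback : ∀ {U U' : Type} [NormedAddCommGroup U] [NormedSpace ℝ U] [NormedAddCommGroup U']
      [NormedSpace ℝ U'] (f : F × U → ℂ) (hf : RapidOn D f) (L : U' →L[ℝ] U),
      ContDiffOn ℝ ∞ (fun q : F × U' => f (q.1, L q.2)) (D ×ˢ univ) ∧
      ∀ m, ∃ C : ℝ, 0 ≤ C ∧ ∀ τ ∈ D, ∀ ξ : U', ‖iteratedFDeriv ℝ m (fun q : F × U' => f (q.1, L q.2))
        (τ, ξ)‖ ≤ C * ‖iteratedFDeriv ℝ m f (τ, L ξ)‖ := by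
    intro U U' _ _ _ _ f hf L
    set M : F × U' →L[ℝ] F × U := (ContinuousLinearMap.fst ℝ F U').prod
      (L.comp (ContinuousLinearMap.snd ℝ F U')) with hM
    have hpre : M ⁻¹' (D ×ˢ univ) = D ×ˢ univ := by ext; simp [hM]
    refine ⟨hf.smooth.comp M.contDiff.contDiffOn (by rintro q hq; simpa [hM] using hq.1), ?_⟩
    intro m
    refine ⟨‖M‖ ^ m, by positivity, fun τ hτ ξ => ?_⟩
    have hx : (τ, ξ) ∈ D ×ˢ (univ : Set U') := ⟨hτ, mem_univ _⟩
    have := M.iteratedFDerivWithin_comp_right hf.smooth (isOpen_prod_univ hf.isOpen).uniqueDiffOn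
      (by rw [hpre]; exact (isOpen_prod_univ hf.isOpen).uniqueDiffOn) (x := (τ, ξ))
      (by simpa [hM] using hτ) (i := m) (by exact_mod_cast le_top)
    rw [hpre, iteratedFDerivWithin_of_isOpen _ (isOpen_prod_univ hf.isOpen) hx,
      iteratedFDerivWithin_of_isOpen _ (isOpen_prod_univ hf.isOpen) (by simpa [hM] using hτ)] at this
    have e : (fun q : F × U' => f (q.1, L q.2)) = f ∘ M := rfl
    rw [e, this]
    refine (ContinuousMultilinearMap.norm_compContinuousLinearMap_le _ _).trans (le_of_eq ?_)
    rw [Finset.prod_const, Finset.card_univ, Fintype.card_fin, mul_comm]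
    rfl
  obtain ⟨sf, bf⟩ := pullback f hf (ContinuousLinearMap.fst ℝ V W)
  obtain ⟨sg, bg⟩ := pullback g hg (ContinuousLinearMap.snd ℝ V W)
  refine ⟨hf.isOpen, sf.mul sg, fun m => ?_⟩
  refine RapidBound.mono (b := fun q => ‖ContinuousLinearMap.mul ℝ ℂ‖ *
    ∑ i ∈ Finset.range (m + 1), (m.choose i : ℝ) *
      ‖iteratedFDeriv ℝ i (fun q : F × (V × W) => f (q.1, q.2.1)) q‖ *
      ‖iteratedFDeriv ℝ (m - i) (fun q : F × (V × W) => g (q.1, q.2.2)) q‖) ?_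
    fun τ hτ ξ => norm_iteratedFDeriv_bilin_le
    (isOpen_prod_univ hf.isOpen) (ContinuousLinearMap.mul ℝ ℂ) sf sg ⟨hτ, mem_univ ξ⟩ m
  refine (PolyBound.const _).mul_rapid (RapidBound.sum _ fun i _ => ?_)
    fun q => Finset.sum_nonneg fun _ _ => by positivity
  obtain ⟨C₁, hC₁, h₁⟩ := bf i
  obtain ⟨C₂, hC₂, h₂⟩ := bg (m - i)
  intro K hK hKc k
  obtain ⟨c₁, hc₁, b₁⟩ := hf.bound i K hK hKc k
  obtain ⟨c₂, hc₂, b₂⟩ := hg.bound (m - i) K hK hKc k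
  refine ⟨m.choose i * (C₁ * c₁) * (C₂ * c₂), by positivity, ?_⟩
  rintro τ hτ ⟨v, w⟩
  have a₁ := h₁ τ (hK hτ) (v, w)
  have a₂ := h₂ τ (hK hτ) (v, w)
  have d₁ := b₁ τ hτ v
  have d₂ := b₂ τ hτ w
  have hvw : 1 + ‖(v, w)‖ ≤ (1 + ‖v‖) * (1 + ‖w‖) := by
    have : ‖(v, w)‖ ≤ ‖v‖ + ‖w‖ := by
      rw [Prod.norm_def]; exact max_le (by simp) (by simp)
    nlinarith [norm_nonneg v, norm_nonneg w, mul_nonneg (norm_nonneg v) (norm_nonneg w)]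
  simp only [ContinuousLinearMap.coe_fst', ContinuousLinearMap.coe_snd'] at a₁ a₂
  beta_reduce
  calc (1 + ‖(v, w)‖) ^ k * (m.choose i * ‖iteratedFDeriv ℝ i (fun q => f (q.1, q.2.1)) (τ, v, w)‖ *
        ‖iteratedFDeriv ℝ (m - i) (fun q => g (q.1, q.2.2)) (τ, v, w)‖)
      ≤ ((1 + ‖v‖) * (1 + ‖w‖)) ^ k * (m.choose i * (C₁ * ‖iteratedFDeriv ℝ i f (τ, v)‖) *
        (C₂ * ‖iteratedFDeriv ℝ (m - i) g (τ, w)‖)) := by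
        gcongr
    _ = m.choose i * (C₁ * ((1 + ‖v‖) ^ k * ‖iteratedFDeriv ℝ i f (τ, v)‖)) *
        (C₂ * ((1 + ‖w‖) ^ k * ‖iteratedFDeriv ℝ (m - i) g (τ, w)‖)) := by
        rw [mul_pow]; ring
    _ ≤ _ := by gcongr

end Calculus

theorem norm_compContinuousLinearMap_le_of_le_one {X Y G : Type} [NormedAddCommGroup X]
    [NormedSpace ℝ X] [NormedAddCommGroup Y] [NormedSpace ℝ Y] [NormedAddCommGroup G]
    [NormedSpace ℝ G] {m : ℕ} (M : ContinuousMultilinearMap ℝ (fun _ : Fin m => Y) G)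
    (L : X →L[ℝ] Y) (hL : ‖L‖ ≤ 1) :
    ‖M.compContinuousLinearMap fun _ => L‖ ≤ ‖M‖ :=
  (M.norm_compContinuousLinearMap_le _).trans (mul_le_of_le_one_right (norm_nonneg _)
    (Finset.prod_le_one (fun _ _ => norm_nonneg _) fun _ _ => hL))

/-! ### Differentiation under the integral sign -/

section ParametricIntegral

variable {Q W : Type} [NormedAddCommGroup Q] [NormedSpace ℝ Q]
  [NormedAddCommGroup W] [NormedSpace ℝ W] [SecondCountableTopology W] [MeasurableSpace W]
  [BorelSpace W]

/-- Smooth families, all of whose derivatives are locally dominated by integrable functions. -/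
structure DominatedOn {G : Type} [NormedAddCommGroup G] [NormedSpace ℝ G] (μ : Measure W)
    (D : Set Q) (f : Q × W → G) : Prop where
  isOpen : IsOpen D
  smooth : ContDiffOn ℝ ∞ f (D ×ˢ univ)
  dom : ∀ m : ℕ, ∀ q₀ ∈ D, ∃ U ∈ 𝓝 q₀, ∃ b : W → ℝ, Integrable b μ ∧
    ∀ᵐ w ∂μ, ∀ q ∈ U, ‖iteratedFDeriv ℝ m f (q, w)‖ ≤ b w

variable {G : Type} [NormedAddCommGroup G] [NormedSpace ℝ G] {μ : Measure W} {D : Set Q}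
  {f : Q × W → G}

theorem DominatedOn.clm {G' : Type} [NormedAddCommGroup G'] [NormedSpace ℝ G']
    (hf : DominatedOn μ D f) (L : G →L[ℝ] G') : DominatedOn μ D (fun q => L (f q)) := by
  refine ⟨hf.isOpen, L.contDiff.comp_contDiffOn hf.smooth, fun m q₀ hq₀ => ?_⟩
  obtain ⟨U, hU, b, hb, h⟩ := hf.dom m q₀ hq₀
  refine ⟨U ∩ D, inter_mem hU (hf.isOpen.mem_nhds hq₀), fun w => ‖L‖ * b w, hb.const_mul _, ?_⟩
  filter_upwards [h] with w hw q hq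
  exact (norm_iteratedFDeriv_clm_le (isOpen_prod_univ hf.isOpen) L hf.smooth
    ⟨hq.2, mem_univ w⟩ m).trans (mul_le_mul_of_nonneg_left (hw q hq.1) (norm_nonneg _))

theorem DominatedOn.fderiv (hf : DominatedOn μ D f) :
    DominatedOn μ D (fun q => fderiv ℝ f q) := by
  refine ⟨hf.isOpen, hf.smooth.fderiv_of_isOpen (isOpen_prod_univ hf.isOpen)
    (by norm_cast), fun m q₀ hq₀ => ?_⟩
  simpa only [norm_iteratedFDeriv_fderiv] using hf.dom (m + 1) q₀ hq₀

theorem DominatedOn.continuous_slice (hf : DominatedOn μ D f) {q : Q} (hq : q ∈ D) :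
    Continuous fun w => f (q, w) :=
  hf.smooth.continuousOn.comp_continuous (by fun_prop) fun w => ⟨hq, mem_univ w⟩

theorem DominatedOn.integrable (hf : DominatedOn μ D f) {q : Q} (hq : q ∈ D) (m : ℕ) :
    Integrable (fun w => iteratedFDeriv ℝ m f (q, w)) μ := by
  obtain ⟨U, hU, b, hb, h⟩ := hf.dom m q hq
  refine hb.mono' (Continuous.aestronglyMeasurable ?_) ?_
  · have h2 := (hf.smooth.continuousOn_iteratedFDerivWithin (m := m) (by exact_mod_cast le_top)
      (isOpen_prod_univ hf.isOpen).uniqueDiffOn)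
    exact ((h2.congr fun τ hτ => (iteratedFDerivWithin_of_isOpen m (isOpen_prod_univ hf.isOpen)
      hτ).symm)).comp_continuous (by fun_prop) fun w => ⟨hq, mem_univ w⟩
  · filter_upwards [h] with w hw using hw q (mem_of_mem_nhds hU)

theorem DominatedOn.integrable_slice (hf : DominatedOn μ D f) {q : Q} (hq : q ∈ D) :
    Integrable (fun w => f (q, w)) μ := by
  refine (hf.integrable hq 0).norm.mono' (hf.continuous_slice hq).aestronglyMeasurable
    (Eventually.of_forall fun w => ?_)
  simp

theorem DominatedOn.hasFDerivAt (hf : DominatedOn μ D f) {q : Q} (hq : q ∈ D) :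
    HasFDerivAt (fun q => ∫ w, f (q, w) ∂μ)
      (∫ w, (_root_.fderiv ℝ f (q, w)).comp (ContinuousLinearMap.inl ℝ Q W) ∂μ) q := by
  have hf' : DominatedOn μ D (fun p =>
      (_root_.fderiv ℝ f p).comp (ContinuousLinearMap.inl ℝ Q W)) :=
    hf.fderiv.clm ((ContinuousLinearMap.compL ℝ Q (Q × W) G).flip (ContinuousLinearMap.inl ℝ Q W))
  obtain ⟨U, hU, b, hb, h⟩ := hf'.dom 0 q hq
  refine hasFDerivAt_integral_of_dominated_of_fderiv_le
    (F := fun q w => f (q, w))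
    (F' := fun q w => (_root_.fderiv ℝ f (q, w)).comp (ContinuousLinearMap.inl ℝ Q W))
    (s := U ∩ D) (bound := b) (inter_mem hU (hf.isOpen.mem_nhds hq)) ?_
    (hf.integrable_slice hq) (hf'.continuous_slice hq).aestronglyMeasurable ?_ hb ?_
  · filter_upwards [hf.isOpen.mem_nhds hq] with x hx
    exact (hf.continuous_slice hx).aestronglyMeasurable
  · filter_upwards [h] with w hw x hx
    simpa using hw x hx.1
  · refine Eventually.of_forall fun w x hx => ?_
    have h1 : HasFDerivAt f (_root_.fderiv ℝ f (x, w)) (x, w) :=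
      ((hf.smooth.contDiffAt ((isOpen_prod_univ hf.isOpen).mem_nhds ⟨hx.2, mem_univ w⟩)
        ).differentiableAt (by simp)).hasFDerivAt
    exact h1.comp x (hasFDerivAt_prodMk_left x w)

/-- The derivative of the integral is the integral of the partial derivative, which is again a
dominated family but takes values in a space of linear maps; hence the induction runs over all
target spaces. The norm bound travels along because restriction to the directions of `Q` has norm at
most one. -/
theorem DominatedOn.contDiffOn_aux (m : ℕ) : ∀ {G : Type} [NormedAddCommGroup G] [NormedSpace ℝ G]
    {f : Q × W → G}, DominatedOn μ D f → ContDiffOn ℝ m (fun q => ∫ w, f (q, w) ∂μ) D ∧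
      ∀ q ∈ D, ‖iteratedFDeriv ℝ m (fun q => ∫ w, f (q, w) ∂μ) q‖ ≤
        ∫ w, ‖iteratedFDeriv ℝ m f (q, w)‖ ∂μ := by
  induction m with
  | zero =>
    intro G _ _ f hf
    refine ⟨contDiffOn_zero.2 fun q hq => (hf.hasFDerivAt hq).continuousAt.continuousWithinAt,
      fun q hq => ?_⟩
    simpa using norm_integral_le_integral_norm _
  | succ m ih =>
    intro G _ _ f hf
    have hf' : DominatedOn μ D (fun p =>
        (_root_.fderiv ℝ f p).comp (ContinuousLinearMap.inl ℝ Q W)) :=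
      hf.fderiv.clm ((ContinuousLinearMap.compL ℝ Q (Q × W) G).flip
        (ContinuousLinearMap.inl ℝ Q W))
    obtain ⟨h1, h2⟩ := ih hf'
    have e : EqOn (_root_.fderiv ℝ (fun q => ∫ w, f (q, w) ∂μ))
      (fun q => ∫ w, (_root_.fderiv ℝ f (q, w)).comp (ContinuousLinearMap.inl ℝ Q W) ∂μ) D :=
      fun q hq => (hf.hasFDerivAt hq).fderiv
    constructor
    · have := (contDiffOn_succ_iff_fderiv_of_isOpen (𝕜 := ℝ) (n := m)
        (f := fun q => ∫ w, f (q, w) ∂μ) hf.isOpen).2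
        ⟨fun q hq => (hf.hasFDerivAt hq).differentiableAt.differentiableWithinAt,
          fun h => absurd h (by simp), h1.congr e⟩
      exact_mod_cast this
    · intro q hq
      rw [← norm_iteratedFDeriv_fderiv, iteratedFDeriv_congr_of_eqOn hf.isOpen e hq]
      refine (h2 q hq).trans (integral_mono (hf'.integrable hq m).norm
        (hf.integrable hq (m + 1)).norm fun w => ?_)
      have h3 := norm_iteratedFDeriv_clm_le (isOpen_prod_univ hf.isOpen)
        ((ContinuousLinearMap.compL ℝ Q (Q × W) G).flip (ContinuousLinearMap.inl ℝ Q W))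
        hf.fderiv.smooth (x := (q, w)) ⟨hq, mem_univ w⟩ m
      refine h3.trans ?_
      rw [norm_iteratedFDeriv_fderiv]
      refine mul_le_of_le_one_left (norm_nonneg _) ?_
      refine ContinuousLinearMap.opNorm_le_bound _ zero_le_one fun L => ?_
      simp only [ContinuousLinearMap.flip_apply, ContinuousLinearMap.compL_apply, one_mul]
      exact (L.opNorm_comp_le _).trans (mul_le_of_le_one_right (norm_nonneg _)
        (ContinuousLinearMap.norm_inl_le_one ℝ Q W))

theorem DominatedOn.contDiffOn (hf : DominatedOn μ D f) :
    ContDiffOn ℝ ∞ (fun q => ∫ w, f (q, w) ∂μ) D :=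
  contDiffOn_infty.2 fun m => (DominatedOn.contDiffOn_aux m hf).1

theorem DominatedOn.norm_iteratedFDeriv_le (hf : DominatedOn μ D f) (m : ℕ) {q : Q} (hq : q ∈ D) :
    ‖iteratedFDeriv ℝ m (fun q => ∫ w, f (q, w) ∂μ) q‖ ≤
        ∫ w, ‖iteratedFDeriv ℝ m f (q, w)‖ ∂μ :=
  (DominatedOn.contDiffOn_aux m hf).2 q hq

/-- On a bounded interval, compactness supplies constants as dominating functions, so no decay is
required. -/
theorem contDiffOn_integral_Icc {f : Q × ℝ → G} {D : Set Q} (hD : IsOpen D)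
    [FiniteDimensional ℝ Q]
    (hf : ContDiffOn ℝ ∞ f (D ×ˢ univ)) :
    ContDiffOn ℝ ∞ (fun q => ∫ r in (0 : ℝ)..1, f (q, r)) D := by
  have : DominatedOn (volume.restrict (Ioc (0 : ℝ) 1)) D f := by
    refine ⟨hD, hf, fun m q₀ hq₀ => ?_⟩
    obtain ⟨K, hK, hqK, hKD⟩ := exists_compact_subset hD hq₀
    have h2 := (hf.continuousOn_iteratedFDerivWithin (m := m) (by exact_mod_cast le_top)
      (isOpen_prod_univ hD).uniqueDiffOn)
    have h3 : ContinuousOn (fun x => ‖iteratedFDeriv ℝ m f x‖) (K ×ˢ Icc 0 1) :=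
      ((h2.congr fun τ hτ => (iteratedFDerivWithin_of_isOpen m (isOpen_prod_univ hD)
        hτ).symm).mono (prod_mono hKD (subset_univ _))).norm
    obtain ⟨C, hC⟩ := (hK.prod isCompact_Icc).bddAbove_image h3
    refine ⟨K, mem_interior_iff_mem_nhds.1 hqK, fun _ => C, integrable_const _, ?_⟩
    refine (ae_restrict_iff' measurableSet_Ioc).2 (Eventually.of_forall fun w hw q hq => ?_)
    exact hC ⟨(q, w), ⟨hq, Ioc_subset_Icc_self hw⟩, rfl⟩
  simpa only [intervalIntegral.integral_of_le zero_le_one] using this.contDiffOn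

/-- Smooth dependence of an integral on its upper limit and on parameters. -/
theorem contDiffOn_intervalIntegral {f : Q × ℝ → G} {D : Set Q} (hD : IsOpen D) (s : ℝ)
    [FiniteDimensional ℝ Q]
    (hf : ContDiffOn ℝ ∞ f (D ×ˢ univ)) :
    ContDiffOn ℝ ∞ (fun q : Q × ℝ => ∫ r in s..q.2, f (q.1, r)) (D ×ˢ univ) := by
  -- The substitution `r ↦ s + r (t - s)` fixes the limits at `0` and `1` and turns the endpoint
  -- into one more parameter of the integrand.
  have h1 : ContDiffOn ℝ ∞ (fun p : (Q × ℝ) × ℝ => f (p.1.1, s + p.2 * (p.1.2 - s)))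
      ((D ×ˢ univ) ×ˢ univ) :=
    hf.comp (ContDiff.contDiffOn (by fun_prop)) fun p hp => ⟨hp.1.1, mem_univ _⟩
  have h2 := contDiffOn_integral_Icc (isOpen_prod_univ hD) h1
  have h3 : ContDiffOn ℝ ∞ (fun q : Q × ℝ => (q.2 - s) • ∫ r in (0 : ℝ)..1,
      f (q.1, s + r * (q.2 - s))) (D ×ˢ univ) :=
    ContDiffOn.smul (ContDiff.contDiffOn (by fun_prop)) h2
  refine h3.congr fun q _ => ?_
  have := intervalIntegral.smul_integral_comp_add_mul (a := 0) (b := 1) (fun r => f (q.1, r))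
    (q.2 - s) s
  simp only [mul_zero, add_zero, mul_one, add_sub_cancel] at this
  simp only [mul_comm _ (q.2 - s), this]

end ParametricIntegral

/-! ### Slices and partial integrals of families of Schwartz functions -/

section Rapid

variable {F F' V W G : Type}
  [NormedAddCommGroup F] [NormedSpace ℝ F] [NormedAddCommGroup F'] [NormedSpace ℝ F']
  [NormedAddCommGroup V] [NormedSpace ℝ V]
  [NormedAddCommGroup G] [NormedSpace ℝ G]

/-- Change of parameters. -/
theorem RapidOn.comp_param {D : Set F} {D' : Set F'} {f : F × V → G} (hf : RapidOn D f)
    (hD' : IsOpen D') {σ : F' → F} (hσ : ContDiffOn ℝ ∞ σ D')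
    (hσD : MapsTo σ D' D) : RapidOn D' (fun q : F' × V => f (σ q.1, q.2)) :=
  hf.comp hD' hσ hσD (SlowOn.clm_snd hD' (ContinuousLinearMap.id ℝ V))
    fun K _ _ => ⟨1, 1, fun τ _ ξ => by simp⟩

theorem RapidOn.exists_schwartzMap {D : Set F} {f : F × V → G} (hf : RapidOn D f) {τ : F}
    (hτ : τ ∈ D) : ∃ φ : 𝓢(V, G), ∀ ξ, φ ξ = f (τ, ξ) := by
  have h1 : RapidOn univ (fun q : ℝ × V => f (τ, q.2)) :=
    hf.comp_param isOpen_univ contDiffOn_const fun _ _ => hτ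
  have h2 : ContDiff ℝ ∞ (fun q : ℝ × V => f (τ, q.2)) :=
    contDiffOn_univ.1 (by simpa using h1.smooth)
  have h3 : (fun ξ => f (τ, ξ)) = (fun q : ℝ × V => f (τ, q.2)) ∘ ContinuousLinearMap.inr ℝ ℝ V :=
    by ext; simp
  refine ⟨⟨fun ξ => f (τ, ξ), ?_, ?_⟩, fun ξ => rfl⟩
  · rw [h3]; exact h2.comp (ContinuousLinearMap.contDiff _)
  · intro k m
    obtain ⟨C, hC0, hC⟩ := h1.bound m {0} (subset_univ _) isCompact_singleton k
    refine ⟨C, fun ξ => ?_⟩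
    have h4 := hC 0 rfl ξ
    rw [h3, ContinuousLinearMap.iteratedFDeriv_comp_right _ h2 _ (by exact_mod_cast le_top)]
    refine le_trans ?_ h4
    exact mul_le_mul (pow_le_pow_left₀ (norm_nonneg _) (by linarith [norm_nonneg ξ]) k)
      (norm_compContinuousLinearMap_le_of_le_one _ _ (ContinuousLinearMap.norm_inr_le_one ℝ ℝ V))
      (norm_nonneg _) (by positivity)

theorem rapidOn_schwartzMap (φ : 𝓢(V, G)) {D : Set F} (hD : IsOpen D) :
    RapidOn D (fun q : F × V => φ q.2) := by
  have h2 : ContDiff ℝ ∞ φ := φ.smooth _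
  refine ⟨hD, (h2.comp contDiff_snd).contDiffOn, fun m K hK hKc k => ?_⟩
  obtain ⟨C, -, hC⟩ := φ.decay k m
  obtain ⟨C', -, hC'⟩ := φ.decay 0 m
  refine ⟨|2 ^ (k - 1) * (C' + C)|, abs_nonneg _, fun τ hτ ξ => le_trans ?_ (le_abs_self _)⟩
  have e : (fun q : F × V => φ q.2) = φ ∘ ContinuousLinearMap.snd ℝ F V := rfl
  have h5 : ‖iteratedFDeriv ℝ m (fun q : F × V => φ q.2) (τ, ξ)‖ ≤ ‖iteratedFDeriv ℝ m φ ξ‖ := by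
    rw [e, ContinuousLinearMap.iteratedFDeriv_comp_right _ h2 _ (by exact_mod_cast le_top)]
    exact norm_compContinuousLinearMap_le_of_le_one _ _ (ContinuousLinearMap.norm_snd_le ℝ F V)
  have a1 := hC ξ
  have a2 := hC' ξ
  simp only [pow_zero, one_mul] at a2
  calc (1 + ‖ξ‖) ^ k * ‖iteratedFDeriv ℝ m (fun q : F × V => φ q.2) (τ, ξ)‖
      ≤ (2 ^ (k - 1) * (1 ^ k + ‖ξ‖ ^ k)) * ‖iteratedFDeriv ℝ m φ ξ‖ := by
        have := add_pow_le zero_le_one (norm_nonneg ξ) k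
        gcongr
    _ = 2 ^ (k - 1) * (‖iteratedFDeriv ℝ m φ ξ‖ + ‖ξ‖ ^ k * ‖iteratedFDeriv ℝ m φ ξ‖) := by
        rw [one_pow]; ring
    _ ≤ _ := by gcongr

theorem RapidOn.integrable [FiniteDimensional ℝ V] [MeasurableSpace V] [BorelSpace V]
    {μ : Measure V} [μ.IsAddHaarMeasure]
    {D : Set F} {f : F × V → G} (hf : RapidOn D f) {τ : F}
    (hτ : τ ∈ D) : Integrable (fun ξ => f (τ, ξ)) μ := by
  obtain ⟨φ, hφ⟩ := hf.exists_schwartzMap hτ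
  have := φ.integrable (μ := μ)
  exact this.congr (Eventually.of_forall hφ)

variable [NormedAddCommGroup W] [NormedSpace ℝ W] [FiniteDimensional ℝ W] [MeasurableSpace W]
  [BorelSpace W] {μ : Measure W} [μ.IsAddHaarMeasure]

/-- The exponent `finrank + 1` is the integer margin of decay that is spent on integrability in all
estimates of partial integrals. -/
theorem integrable_one_add_norm_pow (μ : Measure W) [μ.IsAddHaarMeasure] :
    Integrable (fun w : W => ((1 + ‖w‖) ^ (Module.finrank ℝ W + 1))⁻¹) μ := by
  have := integrable_one_add_norm (E := W) (μ := μ) (r := ((Module.finrank ℝ W + 1 : ℕ) : ℝ))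
    (by exact_mod_cast Nat.lt_succ_self _)
  refine this.congr (Eventually.of_forall fun w => ?_)
  simp only
  rw [Real.rpow_neg (by positivity), Real.rpow_natCast]

theorem RapidOn.norm_iteratedFDeriv_assoc {D : Set F} {f : F × (V × W) → G} (hf : RapidOn D f)
    {τ : F} (hτ : τ ∈ D) (v : V) (w : W) (m : ℕ) :
    ‖iteratedFDeriv ℝ m (fun p : (F × V) × W => f (p.1.1, (p.1.2, p.2))) ((τ, v), w)‖ ≤
      ‖iteratedFDeriv ℝ m f (τ, (v, w))‖ := by
  set M : (F × V) × W →L[ℝ] F × (V × W) :=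
    (ContinuousLinearEquiv.prodAssoc ℝ F V W : (F × V) × W →L[ℝ] F × (V × W)) with hM
  have hpre : M ⁻¹' (D ×ˢ univ) = (D ×ˢ univ) ×ˢ univ := by
    ext ⟨⟨a, b⟩, c⟩; simp [hM]
  have ho := isOpen_prod_univ (Y := V × W) hf.isOpen
  have ho' := isOpen_prod_univ (Y := W) (isOpen_prod_univ (Y := V) hf.isOpen)
  have h1 : ((τ, v), w) ∈ (D ×ˢ univ) ×ˢ univ := ⟨⟨hτ, mem_univ _⟩, mem_univ _⟩
  have h2 : M ((τ, v), w) ∈ D ×ˢ univ := ⟨hτ, mem_univ _⟩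
  have := M.iteratedFDerivWithin_comp_right hf.smooth ho.uniqueDiffOn
      (by rw [hpre]; exact ho'.uniqueDiffOn) (x := ((τ, v), w)) h2 (i := m)
      (by exact_mod_cast le_top)
  rw [hpre, iteratedFDerivWithin_of_isOpen _ ho' h1, iteratedFDerivWithin_of_isOpen _ ho h2] at this
  have e : (fun p : (F × V) × W => f (p.1.1, (p.1.2, p.2))) = f ∘ M := rfl
  rw [e, this]
  refine norm_compContinuousLinearMap_le_of_le_one _ _ ?_
  refine M.opNorm_le_bound zero_le_one ?_
  rintro ⟨⟨a, b⟩, c⟩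
  simp [hM, Prod.norm_def, max_assoc]

theorem RapidOn.dominatedOn [FiniteDimensional ℝ F] {D : Set F} {f : F × (V × W) → G}
    (hf : RapidOn D f) :
    DominatedOn μ (D ×ˢ univ) (fun p : (F × V) × W => f (p.1.1, (p.1.2, p.2))) := by
  refine ⟨isOpen_prod_univ hf.isOpen, hf.smooth.comp (ContDiff.contDiffOn (by fun_prop))
    fun p hp => ⟨hp.1.1, mem_univ _⟩, fun m q₀ hq₀ => ?_⟩
  obtain ⟨K, hK, hqK, hKD⟩ := exists_compact_subset hf.isOpen hq₀.1
  obtain ⟨C, hC0, hC⟩ := hf.bound m K hKD hK (Module.finrank ℝ W + 1)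
  refine ⟨K ×ˢ univ, prod_mem_nhds (mem_interior_iff_mem_nhds.1 hqK) univ_mem,
    fun w => C * ((1 + ‖w‖) ^ (Module.finrank ℝ W + 1))⁻¹,
    (integrable_one_add_norm_pow μ).const_mul C, Eventually.of_forall ?_⟩
  rintro w ⟨τ, v⟩ ⟨hτ, -⟩
  refine (hf.norm_iteratedFDeriv_assoc (hKD hτ) v w m).trans ?_
  beta_reduce
  rw [← div_eq_mul_inv, le_div_iff₀ (by positivity), mul_comm]
  refine le_trans ?_ (hC τ hτ (v, w))
  gcongr
  rw [Prod.norm_def]; exact le_max_right _ _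

/-- Partial integration of a family of Schwartz functions. -/
theorem RapidOn.integral [FiniteDimensional ℝ F] {D : Set F} {f : F × (V × W) → G}
    (hf : RapidOn D f) :
    RapidOn D (fun q : F × V => ∫ w, f (q.1, (q.2, w)) ∂μ) := by
  have hd := hf.dominatedOn (μ := μ)
  refine ⟨hf.isOpen, hd.contDiffOn, fun m K hK hKc k => ?_⟩
  -- The first `k` powers pay for the weight in `v`, the remaining `finrank + 1` for integrability
  -- in `w`; both `‖v‖` and `‖w‖` are at most `‖(v, w)‖`.
  obtain ⟨C, hC0, hC⟩ := hf.bound m K hK hKc (k + (Module.finrank ℝ W + 1))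
  refine ⟨∫ w, C * ((1 + ‖w‖) ^ (Module.finrank ℝ W + 1))⁻¹ ∂μ,
    integral_nonneg fun w => by positivity, fun τ hτ v => ?_⟩
  have hq : (τ, v) ∈ D ×ˢ (univ : Set V) := ⟨hK hτ, mem_univ _⟩
  calc (1 + ‖v‖) ^ k * ‖iteratedFDeriv ℝ m (fun q : F × V => ∫ w, f (q.1, (q.2, w)) ∂μ) (τ, v)‖
      ≤ (1 + ‖v‖) ^ k * ∫ w, ‖iteratedFDeriv ℝ m
        (fun p : (F × V) × W => f (p.1.1, (p.1.2, p.2))) ((τ, v), w)‖ ∂μ := by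
        gcongr; exact hd.norm_iteratedFDeriv_le m hq
    _ = ∫ w, (1 + ‖v‖) ^ k * ‖iteratedFDeriv ℝ m
        (fun p : (F × V) × W => f (p.1.1, (p.1.2, p.2))) ((τ, v), w)‖ ∂μ :=
        (integral_const_mul _ _).symm
    _ ≤ _ := by
        refine integral_mono ((hd.integrable hq m).norm.const_mul _)
          ((integrable_one_add_norm_pow μ).const_mul C) fun w => ?_
        simp only
        rw [← div_eq_mul_inv, le_div_iff₀ (by positivity)]
        refine le_trans ?_ (hC τ hτ (v, w))
        have h1 := hf.norm_iteratedFDeriv_assoc (hK hτ) v w m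
        have h2 : ‖v‖ ≤ ‖(v, w)‖ := by rw [Prod.norm_def]; exact le_max_left _ _
        have h3 : ‖w‖ ≤ ‖(v, w)‖ := by rw [Prod.norm_def]; exact le_max_right _ _
        calc _ = ((1 + ‖v‖) ^ k * (1 + ‖w‖) ^ (Module.finrank ℝ W + 1)) * ‖iteratedFDeriv ℝ m
              (fun p : (F × V) × W => f (p.1.1, p.1.2, p.2)) ((τ, v), w)‖ := by ring
          _ ≤ ((1 + ‖(v, w)‖) ^ k * (1 + ‖(v, w)‖) ^ (Module.finrank ℝ W + 1)) *
              ‖iteratedFDeriv ℝ m f (τ, v, w)‖ := by gcongr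
          _ = _ := by rw [← pow_add]

theorem RapidOn.fderiv_integral [FiniteDimensional ℝ F] {D : Set F} {f : F × (V × W) → G}
    [CompleteSpace G]
    (hf : RapidOn D f) {τ : F} (hτ : τ ∈ D) (v : V) (σ : F) (η : V) :
    _root_.fderiv ℝ (fun q : F × V => ∫ w, f (q.1, (q.2, w)) ∂μ) (τ, v) (σ, η) =
      ∫ w, _root_.fderiv ℝ f (τ, (v, w)) (σ, (η, 0)) ∂μ := by
  have hd := hf.dominatedOn (μ := μ)
  have hq : (τ, v) ∈ D ×ˢ (univ : Set V) := ⟨hτ, mem_univ _⟩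
  have hi : Integrable (fun w => (_root_.fderiv ℝ
      (fun p : (F × V) × W => f (p.1.1, (p.1.2, p.2))) ((τ, v), w)).comp
      (ContinuousLinearMap.inl ℝ (F × V) W)) μ :=
    (hd.fderiv.clm ((ContinuousLinearMap.compL ℝ (F × V) ((F × V) × W) G).flip
        (ContinuousLinearMap.inl ℝ (F × V) W))).integrable_slice hq
  rw [(hd.hasFDerivAt hq).fderiv, ContinuousLinearMap.integral_apply hi]
  refine integral_congr_ae (Eventually.of_forall fun w => ?_)
  have h1 : HasFDerivAt f (_root_.fderiv ℝ f (τ, (v, w))) (τ, (v, w)) :=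
      ((hf.smooth.contDiffAt ((isOpen_prod_univ hf.isOpen).mem_nhds ⟨hτ, mem_univ (v, w)⟩)
        ).differentiableAt (by simp)).hasFDerivAt
  have h2 : HasFDerivAt (fun p : (F × V) × W => f (p.1.1, (p.1.2, p.2)))
    ((_root_.fderiv ℝ f (τ, (v, w))).comp
      (ContinuousLinearEquiv.prodAssoc ℝ F V W : (F × V) × W →L[ℝ] F × (V × W))) ((τ, v), w) :=
    HasFDerivAt.comp (g := f) ((τ, v), w) h1
      (ContinuousLinearEquiv.prodAssoc ℝ F V W).hasFDerivAt
  simp only [h2.fderiv]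
  rfl

end Rapid
open scoped FourierTransform RealInnerProductSpace

/-! ### Partial Fourier transform of families of Schwartz functions -/

section PartialFourier

variable {F V W : Type}
  [NormedAddCommGroup F] [NormedSpace ℝ F] [FiniteDimensional ℝ F]
  [NormedAddCommGroup V] [NormedSpace ℝ V]
  [NormedAddCommGroup W] [InnerProductSpace ℝ W] [FiniteDimensional ℝ W] [MeasurableSpace W]
  [BorelSpace W]

/-- The Fourier transform in the last variable. -/
def partialFourier {G : Type} [NormedAddCommGroup G] [NormedSpace ℂ G] (h : F × (V × W) → G) :
    F × (V × W) → G :=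
  fun q => 𝓕 (fun y => h (q.1, (q.2.1, y))) q.2.2

variable {G : Type} [NormedAddCommGroup G] [NormedSpace ℂ G] {D : Set F} {h : F × (V × W) → G}

/-- The integrand of the partial Fourier transform; the frequency is a parameter. -/
theorem RapidOn.fourier_integrand (hh : RapidOn D h) :
    RapidOn (D ×ˢ (univ : Set W)) (fun q : (F × W) × (V × W) =>
      Complex.exp (Complex.I * ((-2 * Real.pi * ⟪q.2.2, q.1.2⟫ : ℝ) : ℂ)) • h (q.1.1, q.2)) := by
  have ho : IsOpen (D ×ˢ (univ : Set W)) := isOpen_prod_univ hh.isOpen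
  have h1 : RapidOn (D ×ˢ (univ : Set W)) (fun q : (F × W) × (V × W) => h (q.1.1, q.2)) :=
    hh.comp_param ho (σ := Prod.fst) contDiff_fst.contDiffOn fun q hq => hq.1
  have h2 : SlowOn (D ×ˢ (univ : Set W)) (fun q : (F × W) × (V × W) => ⟪q.2.2, q.1.2⟫) :=
    (SlowOn.clm_snd ho (ContinuousLinearMap.snd ℝ V W)).bilin
      (SlowOn.param ho (f := Prod.snd) contDiff_snd.contDiffOn) (innerSL ℝ)
  have h3 := ((SlowOn.const (V := V × W) ho (-2 * Real.pi)).mul h2).cexp_I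
  exact h3.bilin_rapid h1 (ContinuousLinearMap.lsmul ℝ ℂ)

theorem partialFourier_eq (q : F × (V × W)) :
    partialFourier h q = ∫ y, Complex.exp (Complex.I * ((-2 * Real.pi * ⟪y, q.2.2⟫ : ℝ) : ℂ)) •
      h (q.1, (q.2.1, y)) := by
  rw [partialFourier, Real.fourier_eq']
  simp only [mul_comm Complex.I]

theorem RapidOn.norm_partialFourier_le (hh : RapidOn D h) {K : Set F} (hK : K ⊆ D)
    (hKc : IsCompact K) (l : ℕ) :
    ∃ C : ℝ, 0 ≤ C ∧ ∀ τ ∈ K, ∀ v p, (1 + ‖v‖) ^ l * ‖partialFourier h (τ, (v, p))‖ ≤ C := by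
  obtain ⟨C, hC0, hC⟩ := hh.bound 0 K hK hKc (l + (Module.finrank ℝ W + 1))
  refine ⟨∫ w : W, C * ((1 + ‖w‖) ^ (Module.finrank ℝ W + 1))⁻¹,
    integral_nonneg fun w => by positivity, fun τ hτ v p => ?_⟩
  have e : (1 + ‖v‖) ^ l * ‖partialFourier h (τ, (v, p))‖ =
      ‖∫ y, ((1 + ‖v‖) ^ l : ℝ) • (Complex.exp (Complex.I *
        ((-2 * Real.pi * ⟪y, p⟫ : ℝ) : ℂ)) • h (τ, (v, y)))‖ := by
    rw [integral_smul, norm_smul, partialFourier_eq]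
    simp only [norm_pow, Real.norm_eq_abs]
    rw [abs_of_nonneg (by positivity : (0 : ℝ) ≤ 1 + ‖v‖)]
  rw [e]
  refine norm_integral_le_of_norm_le ((integrable_one_add_norm_pow volume).const_mul C)
    (Eventually.of_forall fun w => ?_)
  rw [norm_smul, norm_smul, mul_comm Complex.I, Complex.norm_exp_ofReal_mul_I, one_mul, norm_pow,
    Real.norm_eq_abs, abs_of_nonneg (by positivity : (0 : ℝ) ≤ 1 + ‖v‖)]
  rw [← div_eq_mul_inv, le_div_iff₀ (by positivity)]
  refine le_trans ?_ (hC τ hτ (v, w))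
  have h2 : ‖v‖ ≤ ‖(v, w)‖ := by rw [Prod.norm_def]; exact le_max_left _ _
  have h3 : ‖w‖ ≤ ‖(v, w)‖ := by rw [Prod.norm_def]; exact le_max_right _ _
  calc _ = ((1 + ‖v‖) ^ l * (1 + ‖w‖) ^ (Module.finrank ℝ W + 1)) * ‖h (τ, (v, w))‖ := by ring
    _ ≤ ((1 + ‖(v, w)‖) ^ l * (1 + ‖(v, w)‖) ^ (Module.finrank ℝ W + 1)) * ‖h (τ, (v, w))‖ := by
        gcongr
    _ = _ := by rw [← pow_add]; simp

theorem RapidOn.differentiableAt (hh : RapidOn D h) {τ : F} (hτ : τ ∈ D) (x : V × W) :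
    DifferentiableAt ℝ h (τ, x) :=
  (hh.smooth.contDiffAt ((isOpen_prod_univ hh.isOpen).mem_nhds ⟨hτ, mem_univ x⟩)
        ).differentiableAt (by simp)

theorem RapidOn.slice_integrable (hh : RapidOn D h) {τ : F} (hτ : τ ∈ D) (v : V) :
    Integrable (fun y : W => h (τ, (v, y))) :=
  (hh.dominatedOn (μ := volume)).integrable_slice (q := (τ, v)) ⟨hτ, mem_univ _⟩

/-- The Fourier transform turns a derivative in `y` into multiplication by the frequency, so the
bound for the derivative of `h` gains one power of `‖p‖` for `h`. The derivative has values in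
linear maps, hence the quantification over `G`; the factor `2π ≥ 1` is simply dropped. -/
theorem RapidOn.pow_norm_partialFourier_le (k : ℕ) : ∀ {G : Type} [NormedAddCommGroup G]
    [NormedSpace ℂ G] {h : F × (V × W) → G}, RapidOn D h → ∀ K ⊆ D, IsCompact K → ∀ l : ℕ,
    ∃ C : ℝ, 0 ≤ C ∧ ∀ τ ∈ K, ∀ v p,
      ‖p‖ ^ k * ((1 + ‖v‖) ^ l * ‖partialFourier h (τ, (v, p))‖) ≤ C := by
  induction k with
  | zero =>
    intro G _ _ h hh K hK hKc l
    simpa using hh.norm_partialFourier_le hK hKc l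
  | succ k ih =>
    intro G _ _ h hh K hK hKc l
    set J : W →L[ℝ] F × (V × W) :=
      (ContinuousLinearMap.inr ℝ F (V × W)).comp (ContinuousLinearMap.inr ℝ V W) with hJ
    have h1 : RapidOn D (fun q => (_root_.fderiv ℝ h q).comp J) :=
      hh.fderiv.clm ((ContinuousLinearMap.compL ℝ W (F × (V × W)) G).flip J)
    obtain ⟨C, hC0, hC⟩ := ih h1 K hK hKc l
    refine ⟨C, hC0, fun τ hτ v p => le_trans ?_ (hC τ hτ v p)⟩
    have hd : ∀ y, HasFDerivAt (fun y => h (τ, (v, y)))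
        ((_root_.fderiv ℝ h (τ, (v, y))).comp J) y := fun y =>
      (hh.differentiableAt (hK hτ) (v, y)).hasFDerivAt.comp y
        ((hasFDerivAt_prodMk_right τ (v, y)).comp y (hasFDerivAt_prodMk_right v y))
    have he : _root_.fderiv ℝ (fun y => h (τ, (v, y))) =
        fun y => (_root_.fderiv ℝ h (τ, (v, y))).comp J := funext fun y => (hd y).fderiv
    have h2 := Real.fourier_fderiv (hh.slice_integrable (hK hτ) v)
      (fun y => (hd y).differentiableAt) (by rw [he]; exact h1.slice_integrable (hK hτ) v)
    rw [he] at h2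
    have h3 : ‖partialFourier (fun q => (_root_.fderiv ℝ h q).comp J) (τ, (v, p))‖ =
        2 * Real.pi * ‖p‖ * ‖partialFourier h (τ, (v, p))‖ := by
      simp only [partialFourier]
      rw [h2, VectorFourier.norm_fourierSMulRight]
      rw [neg_apply, norm_neg, innerSL_apply_norm]
    rw [h3, pow_succ]
    have h4 : 1 ≤ 2 * Real.pi := by linarith [Real.pi_gt_three]
    have h5 : 0 ≤ ‖p‖ ^ k * ((1 + ‖v‖) ^ l * (‖p‖ * ‖partialFourier h (τ, (v, p))‖)) := by
      positivity
    nlinarith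

theorem RapidOn.rapidBound_partialFourier (hh : RapidOn D h) :
    RapidBound D (fun q => ‖partialFourier h q‖) := by
  intro K hK hKc k
  obtain ⟨C, hC0, hC⟩ := hh.norm_partialFourier_le hK hKc k
  obtain ⟨C', hC'0, hC'⟩ := RapidOn.pow_norm_partialFourier_le k hh K hK hKc k
  refine ⟨2 ^ (k - 1) * (C + C'), by positivity, ?_⟩
  rintro τ hτ ⟨v, p⟩
  have hvw : 1 + ‖(v, p)‖ ≤ (1 + ‖v‖) * (1 + ‖p‖) := by
    have : ‖(v, p)‖ ≤ ‖v‖ + ‖p‖ := by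
      rw [Prod.norm_def]; exact max_le (by simp) (by simp)
    nlinarith [norm_nonneg v, norm_nonneg p, mul_nonneg (norm_nonneg v) (norm_nonneg p)]
  have h1 := add_pow_le zero_le_one (norm_nonneg p) k
  rw [one_pow] at h1
  have h2 := hC τ hτ v p
  have h3 := hC' τ hτ v p
  beta_reduce
  calc (1 + ‖(v, p)‖) ^ k * ‖partialFourier h (τ, (v, p))‖
      ≤ ((1 + ‖v‖) * (1 + ‖p‖)) ^ k * ‖partialFourier h (τ, (v, p))‖ := by gcongr
    _ = (1 + ‖p‖) ^ k * ((1 + ‖v‖) ^ k * ‖partialFourier h (τ, (v, p))‖) := by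
        rw [mul_pow]; ring
    _ ≤ (2 ^ (k - 1) * (1 + ‖p‖ ^ k)) * ((1 + ‖v‖) ^ k * ‖partialFourier h (τ, (v, p))‖) := by
        gcongr
    _ = 2 ^ (k - 1) * ((1 + ‖v‖) ^ k * ‖partialFourier h (τ, (v, p))‖ +
        ‖p‖ ^ k * ((1 + ‖v‖) ^ k * ‖partialFourier h (τ, (v, p))‖)) := by ring
    _ ≤ _ := by gcongr

/-- With the frequency moved to the parameters, the transform is a partial integral of a rapid
family, hence smooth. This gives smoothness only; uniform decay in the frequency comes from the
bounds obtained by integrating by parts. -/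
theorem RapidOn.contDiffOn_partialFourier (hh : RapidOn D h) :
    ContDiffOn ℝ ∞ (partialFourier h) (D ×ˢ univ) := by
  have h1 := (hh.fourier_integrand.integral (μ := volume)).smooth
  have h2 : ContDiffOn ℝ ∞ (fun q : F × (V × W) => ((q.1, q.2.2), q.2.1)) (D ×ˢ univ) :=
    ContDiff.contDiffOn (by fun_prop)
  refine (h1.comp h2 fun q hq => ⟨⟨hq.1, mem_univ _⟩, mem_univ _⟩).congr fun q _ => ?_
  rw [partialFourier_eq]
  rfl

/-- The family whose partial Fourier transform is the derivative of that of `h`. -/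
def fourierDerivData (h : F × (V × W) → G) (q : F × (V × W)) : F × (V × W) →L[ℝ] G :=
  (fderiv ℝ h q).comp ((ContinuousLinearMap.fst ℝ F (V × W)).prod
    ((ContinuousLinearMap.inl ℝ V W).comp ((ContinuousLinearMap.fst ℝ V W).comp
      (ContinuousLinearMap.snd ℝ F (V × W))))) +
  ContinuousLinearMap.smulRightL ℝ (F × (V × W)) G ((innerSL ℝ q.2.2).comp
    ((ContinuousLinearMap.snd ℝ V W).comp (ContinuousLinearMap.snd ℝ F (V × W))))
    ((-2 * Real.pi * Complex.I : ℂ) • h q)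

theorem fourierDerivData_apply (q : F × (V × W)) (σ : F) (η : V) (π : W) :
    fourierDerivData h q (σ, (η, π)) = fderiv ℝ h q (σ, (η, 0)) +
      ⟪q.2.2, π⟫ • ((-2 * Real.pi * Complex.I : ℂ) • h q) := rfl

theorem RapidOn.fourierDerivData (hh : RapidOn D h) : RapidOn D (fourierDerivData h) := by
  refine RapidOn.add (hh.fderiv.clm ((ContinuousLinearMap.compL ℝ (F × (V × W)) (F × (V × W)) G
    ).flip _)) ?_
  have h1 : SlowOn D (fun q : F × (V × W) => (innerSL ℝ q.2.2).comp
      ((ContinuousLinearMap.snd ℝ V W).comp (ContinuousLinearMap.snd ℝ F (V × W)))) :=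
    SlowOn.clm_snd hh.isOpen (((ContinuousLinearMap.compL ℝ (F × (V × W)) W ℝ).flip
      ((ContinuousLinearMap.snd ℝ V W).comp (ContinuousLinearMap.snd ℝ F (V × W)))).comp
      ((innerSL ℝ).comp (ContinuousLinearMap.snd ℝ V W)))
  exact h1.bilin_rapid (hh.clm (ContinuousLinearMap.lsmul ℝ ℂ (-2 * Real.pi * Complex.I : ℂ)))
    (ContinuousLinearMap.smulRightL ℝ (F × (V × W)) G)

/-- Derivatives in `τ` and `v` pass under the integral, and a derivative in the frequency brings
down `-2πi⟨y, π⟩`. Since the result is again a partial Fourier transform of a rapid family,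
derivatives of all orders can be estimated by the order-zero bound. -/
theorem RapidOn.fderiv_partialFourier [CompleteSpace G] (hh : RapidOn D h) {τ : F} (hτ : τ ∈ D)
    (x : V × W) :
    _root_.fderiv ℝ (partialFourier h) (τ, x) =
      partialFourier (NonlocalGPE.fourierDerivData h) (τ, x) := by
  obtain ⟨v, p⟩ := x
  have hf := hh.fourier_integrand
  set f := (fun q : (F × W) × (V × W) =>
      Complex.exp (Complex.I * ((-2 * Real.pi * ⟪q.2.2, q.1.2⟫ : ℝ) : ℂ)) • h (q.1.1, q.2)) with hfd
  have hint := hf.integral (μ := volume)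
  have hmem : (τ, p) ∈ D ×ˢ (univ : Set W) := ⟨hτ, mem_univ _⟩
  set M : F × (V × W) →L[ℝ] (F × W) × V :=
    ((ContinuousLinearMap.fst ℝ F (V × W)).prod ((ContinuousLinearMap.snd ℝ V W).comp
      (ContinuousLinearMap.snd ℝ F (V × W)))).prod ((ContinuousLinearMap.fst ℝ V W).comp
      (ContinuousLinearMap.snd ℝ F (V × W))) with hM
  have e : partialFourier h = (fun q : (F × W) × V => ∫ w, f (q.1, (q.2, w))) ∘ M := by
    ext1 q
    rw [partialFourier_eq]
    rfl
  have hd : DifferentiableAt ℝ (fun q : (F × W) × V => ∫ w, f (q.1, (q.2, w))) (M (τ, (v, p))) :=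
    ((hint.smooth.contDiffAt ((isOpen_prod_univ hint.isOpen).mem_nhds ⟨hmem, mem_univ v⟩)
        ).differentiableAt (by simp))
  rw [e, fderiv_comp _ hd M.differentiableAt, ContinuousLinearMap.fderiv]
  refine ContinuousLinearMap.ext ?_
  rintro ⟨σ, η, π⟩
  rw [ContinuousLinearMap.comp_apply]
  have e2 : M (σ, (η, π)) = ((σ, π), η) := rfl
  have e3 : M (τ, (v, p)) = ((τ, p), v) := rfl
  rw [e2, e3, hf.fderiv_integral hmem, partialFourier_eq]
  have hint2 := (RapidOn.fourier_integrand (G := F × (V × W) →L[ℝ] G)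
    hh.fourierDerivData).slice_integrable hmem v
  rw [ContinuousLinearMap.integral_apply hint2]
  refine integral_congr_ae (Eventually.of_forall fun y => ?_)
  have h1 : HasFDerivAt (fun q : (F × W) × (V × W) => ⟪q.2.2, q.1.2⟫) _ ((τ, p), (v, y)) :=
    HasFDerivAt.inner ℝ (f := fun q : (F × W) × (V × W) => q.2.2) (g := fun q => q.1.2)
      (hasFDerivAt_snd.comp (g := Prod.snd) ((τ, p), (v, y)) hasFDerivAt_snd)
      (hasFDerivAt_snd.comp (g := Prod.snd) ((τ, p), (v, y)) hasFDerivAt_fst)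
  have h2 := ((Complex.ofRealCLM.hasFDerivAt.comp _ (h1.const_mul (-2 * Real.pi))).const_mul
    Complex.I).cexp
  have h3 : HasFDerivAt (fun q : (F × W) × (V × W) => h (q.1.1, q.2))
      ((_root_.fderiv ℝ h (τ, (v, y))).comp (((ContinuousLinearMap.fst ℝ F W).comp
        (ContinuousLinearMap.fst ℝ (F × W) (V × W))).prod
        (ContinuousLinearMap.snd ℝ (F × W) (V × W)))) ((τ, p), (v, y)) :=
    (hh.differentiableAt hτ (v, y)).hasFDerivAt.comp (g := h) ((τ, p), (v, y))
      (((ContinuousLinearMap.fst ℝ F W).comp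
        (ContinuousLinearMap.fst ℝ (F × W) (V × W))).prod
        (ContinuousLinearMap.snd ℝ (F × W) (V × W))).hasFDerivAt
  have h4 : HasFDerivAt f _ ((τ, p), (v, y)) := h2.smul h3
  beta_reduce
  rw [h4.fderiv]
  rw [smul_apply, fourierDerivData_apply, smul_add, add_apply, smul_apply,
    ContinuousLinearMap.smulRight_apply]
  congr 1
  simp only [smul_apply, ContinuousLinearMap.comp_apply, ContinuousLinearMap.prod_apply,
    ContinuousLinearMap.coe_fst', ContinuousLinearMap.coe_snd', fderivInnerCLM_apply,
    Complex.ofRealCLM_apply, Function.comp_apply, inner_zero_left, add_zero]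
  rw [← Complex.coe_smul, smul_smul, smul_smul, smul_smul]
  congr 1
  simp only [smul_eq_mul]
  push_cast
  ring

/-- Decay of order zero for every target space, iterated along `fderiv_partialFourier`, is decay of
every order. -/
theorem RapidOn.partialFourier_aux (m : ℕ) : ∀ {G : Type} [NormedAddCommGroup G]
    [NormedSpace ℂ G] [CompleteSpace G] {h : F × (V × W) → G}, RapidOn D h →
    RapidBound D (fun q => ‖iteratedFDeriv ℝ m (NonlocalGPE.partialFourier h) q‖) := by
  induction m with
  | zero =>
    intro G _ _ _ h hh
    simpa using hh.rapidBound_partialFourier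
  | succ m ih =>
    intro G _ _ _ h hh
    refine (ih (G := F × (V × W) →L[ℝ] G) hh.fourierDerivData).mono fun τ hτ ξ => ?_
    rw [← norm_iteratedFDeriv_fderiv]
    refine le_of_eq (congrArg norm ?_)
    have hx : (τ, ξ) ∈ D ×ˢ (univ : Set (V × W)) := ⟨hτ, mem_univ _⟩
    exact iteratedFDeriv_congr_of_eqOn (isOpen_prod_univ hh.isOpen)
      (fun q hq => hh.fderiv_partialFourier hq.1 q.2) hx m

/-- The partial Fourier transform of a family of Schwartz functions. -/
theorem RapidOn.partialFourier [CompleteSpace G] (hh : RapidOn D h) :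
    RapidOn D (NonlocalGPE.partialFourier h) :=
  ⟨hh.isOpen, hh.contDiffOn_partialFourier, fun m => RapidOn.partialFourier_aux m hh⟩

end PartialFourier

/-! ### Linear differential equations with parameters -/

section LinearODE

/-- The terms of the Picard series of `x' = M(p,t) x`, `x(s) = x₀`. -/
def picardTerm {V : Type} [NormedAddCommGroup V] [NormedSpace ℝ V] (M : ℝ × ℝ → V →L[ℝ] V) (s : ℝ)
    (x₀ : V) : ℕ → ℝ × ℝ → V
  | 0, _ => x₀
  | k + 1, q => ∫ r in s..q.2, M (q.1, r) (picardTerm M s x₀ k (q.1, r))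

/-- The generator of the system solved by a solution together with its parameter derivative. -/
def variationGenerator {V : Type} [NormedAddCommGroup V] [NormedSpace ℝ V]
    (M : ℝ × ℝ → V →L[ℝ] V) (q : ℝ × ℝ) : V × V →L[ℝ] V × V :=
  ((M q).comp (ContinuousLinearMap.fst ℝ V V)).prod
    ((fderiv ℝ M q (1, 0)).comp (ContinuousLinearMap.fst ℝ V V) +
      (M q).comp (ContinuousLinearMap.snd ℝ V V))

variable {V : Type} [NormedAddCommGroup V] [NormedSpace ℝ V] {M : ℝ × ℝ → V →L[ℝ] V}

theorem contDiff_intervalIntegral {f : ℝ × ℝ → V} (s : ℝ) (hf : ContDiff ℝ ∞ f) :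
    ContDiff ℝ ∞ (fun q : ℝ × ℝ => ∫ r in s..q.2, f (q.1, r)) := by
  have := contDiffOn_intervalIntegral (D := univ) isOpen_univ s hf.contDiffOn
  rwa [univ_prod_univ, contDiffOn_univ] at this

theorem contDiff_picardTerm (hM : ContDiff ℝ ∞ M) (s : ℝ) (x₀ : V) (k : ℕ) :
    ContDiff ℝ ∞ (picardTerm M s x₀ k) := by
  induction k with
  | zero => exact contDiff_const
  | succ k ih =>
    have : picardTerm M s x₀ (k + 1) =
        fun q => ∫ r in s..q.2, M (q.1, r) (picardTerm M s x₀ k (q.1, r)) := rfl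
    rw [this]
    exact contDiff_intervalIntegral s (hM.clm_apply ih)

theorem contDiff_variationGenerator (hM : ContDiff ℝ ∞ M) :
    ContDiff ℝ ∞ (variationGenerator M) := by
  have h1 : ContDiff ℝ ∞ (fun q => fderiv ℝ M q (1, 0)) :=
    (hM.fderiv_right (m := ∞) (by norm_cast)).clm_apply contDiff_const
  have h2 : ContDiff ℝ ∞ (fun q => (M q).comp (ContinuousLinearMap.fst ℝ V V)) :=
    hM.clm_comp contDiff_const
  have h3 : ContDiff ℝ ∞ (fun q => (fderiv ℝ M q (1, 0)).comp (ContinuousLinearMap.fst ℝ V V) +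
      (M q).comp (ContinuousLinearMap.snd ℝ V V)) :=
    (h1.clm_comp contDiff_const).add (hM.clm_comp contDiff_const)
  have h4 := (contDiff_const (c := ContinuousLinearMap.inl ℝ V V)).clm_comp h2 |>.add
    ((contDiff_const (c := ContinuousLinearMap.inr ℝ V V)).clm_comp h3)
  convert h4 using 1
  funext q
  ext x <;> simp [variationGenerator]

/-- After rescaling to the unit interval the integrand carries the factor `r ^ k`, whose integral `1
/ (k + 1)` builds up the factorial. -/
theorem norm_picardTerm_le (s : ℝ) (x₀ : V) {T C : ℝ} {p : ℝ}
    (hC0 : 0 ≤ C)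
    (hC : ∀ t, |t - s| ≤ T → ‖M (p, t)‖ ≤ C) (k : ℕ) :
    ∀ t, |t - s| ≤ T → ‖picardTerm M s x₀ k (p, t)‖ ≤
      ‖x₀‖ * ((C * |t - s|) ^ k / k.factorial) := by
  induction k with
  | zero => intro t _; simp [picardTerm]
  | succ k ih =>
    intro t ht
    have e : picardTerm M s x₀ (k + 1) (p, t) = (t - s) • ∫ r in (0 : ℝ)..1,
        M (p, s + (t - s) * r) (picardTerm M s x₀ k (p, s + (t - s) * r)) := by
      have := intervalIntegral.smul_integral_comp_add_mul (a := 0) (b := 1)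
        (fun r => M (p, r) (picardTerm M s x₀ k (p, r))) (t - s) s
      simp only [mul_zero, add_zero, mul_one, add_sub_cancel] at this
      exact this.symm
    rw [e, norm_smul, Real.norm_eq_abs]
    have hb : ∀ r ∈ Ioc (0 : ℝ) 1,
        ‖M (p, s + (t - s) * r) (picardTerm M s x₀ k (p, s + (t - s) * r))‖ ≤
        (C * (‖x₀‖ * ((C * |t - s|) ^ k / k.factorial))) * r ^ k := by
      intro r hr
      have h1 : |s + (t - s) * r - s| = |t - s| * r := by
        rw [add_sub_cancel_left, abs_mul, abs_of_pos hr.1]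
      have h2 : |s + (t - s) * r - s| ≤ T := by
        rw [h1]
        exact (mul_le_of_le_one_right (abs_nonneg _) hr.2).trans ht
      calc _ ≤ C * (‖x₀‖ * ((C * |s + (t - s) * r - s|) ^ k / k.factorial)) :=
            ((M _).le_opNorm _).trans (mul_le_mul (hC _ h2) (ih _ h2) (norm_nonneg _) hC0)
        _ = _ := by rw [h1, ← mul_assoc C |t - s| r, mul_pow _ r]; ring
    have h3 := intervalIntegral.norm_integral_le_of_norm_le (μ := volume) (zero_le_one' ℝ)
      (Eventually.of_forall hb) ((continuous_const.mul (continuous_pow k)).intervalIntegrable _ _)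
    rw [intervalIntegral.integral_const_mul, integral_pow] at h3
    calc |t - s| * _ ≤ |t - s| * _ := mul_le_mul_of_nonneg_left h3 (abs_nonneg _)
      _ = _ := by
        rw [Nat.factorial_succ]
        push_cast
        have : (k.factorial : ℝ) ≠ 0 := by positivity
        have : (k : ℝ) + 1 ≠ 0 := by positivity
        simp only [one_pow, ne_eq, Nat.succ_ne_zero, not_false_eq_true, zero_pow, sub_zero]
        field_simp
        ring

theorem hasDerivAt_picardTerm_time (hM : ContDiff ℝ ∞ M) [CompleteSpace V] (s : ℝ) (x₀ : V) (k : ℕ)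
    (p t : ℝ) : HasDerivAt (fun t => picardTerm M s x₀ (k + 1) (p, t))
      (M (p, t) (picardTerm M s x₀ k (p, t))) t := by
  have hc : Continuous fun r => M (p, r) (picardTerm M s x₀ k (p, r)) :=
    ((hM.continuous.comp (by fun_prop : Continuous fun r : ℝ => (p, r)))).clm_apply
      ((contDiff_picardTerm hM s x₀ k).continuous.comp (by fun_prop))
  exact intervalIntegral.integral_hasDerivAt_right (hc.intervalIntegrable _ _)
    hc.stronglyMeasurable.stronglyMeasurableAtFilter hc.continuousAt

theorem hasDerivAt_param_intervalIntegral [CompleteSpace V] {f : ℝ × ℝ → V} (hf : ContDiff ℝ ∞ f)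
    (s t p : ℝ) :
    HasDerivAt (fun p => ∫ r in s..t, f (p, r)) (∫ r in s..t, fderiv ℝ f (p, r) (1, 0)) p := by
  have hc : Continuous fun q => fderiv ℝ f q (1, 0) :=
    (hf.continuous_fderiv (by simp)).clm_apply continuous_const
  obtain ⟨C, hC⟩ := ((isCompact_Icc (a := p - 1) (b := p + 1)).prod
    (isCompact_uIcc (a := s) (b := t))).bddAbove_image hc.norm.continuousOn
  refine (intervalIntegral.hasDerivAt_integral_of_dominated_loc_of_deriv_le
    (F := fun p r => f (p, r)) (F' := fun p r => fderiv ℝ f (p, r) (1, 0)) (bound := fun _ => C)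
    (s := Icc (p - 1) (p + 1)) (Icc_mem_nhds (by linarith) (by linarith))
    (Eventually.of_forall fun x => (hf.continuous.comp (by fun_prop)).aestronglyMeasurable)
    ((hf.continuous.comp (by fun_prop)).intervalIntegrable _ _)
    (hc.comp (by fun_prop)).aestronglyMeasurable
    (Eventually.of_forall fun r hr x hx => hC ⟨(x, r), ⟨hx, uIoc_subset_uIcc hr⟩, rfl⟩)
    intervalIntegrable_const (Eventually.of_forall fun r hr x hx => ?_)).2
  exact ((hf.differentiable (by simp)).differentiableAt (x := (x, r))).hasFDerivAt.comp_hasDerivAt x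
    ((hasDerivAt_id x).prodMk (hasDerivAt_const x r))

/-- A Picard term together with its parameter derivative is a Picard term of the equation of
variations. Thus the parameter derivative of a Picard series is a component of another Picard
series, and higher regularity needs no new estimates. -/
theorem picardTerm_variation (hM : ContDiff ℝ ∞ M) [CompleteSpace V] (s : ℝ) (x₀ : V) (k : ℕ)
    (q : ℝ × ℝ) :
    picardTerm (variationGenerator M) s (x₀, 0) k q =
      (picardTerm M s x₀ k q, fderiv ℝ (picardTerm M s x₀ k) q (1, 0)) := by
  induction k generalizing q with
  | zero =>
    have : picardTerm M s x₀ 0 = fun _ => x₀ := rfl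
    rw [this]
    simp [picardTerm]
  | succ k ih =>
    set f : ℝ × ℝ → V := fun q => M q (picardTerm M s x₀ k q) with hf
    have hfs : ContDiff ℝ ∞ f := hM.clm_apply (contDiff_picardTerm hM s x₀ k)
    have hfd : ∀ q, fderiv ℝ f q (1, 0) = fderiv ℝ M q (1, 0) (picardTerm M s x₀ k q) +
        M q (fderiv ℝ (picardTerm M s x₀ k) q (1, 0)) := by
      intro q
      have h1 := ((hM.differentiable (by simp)).differentiableAt (x := q)).hasFDerivAt.clm_apply
        (((contDiff_picardTerm hM s x₀ k).differentiable (by simp)).differentiableAt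
          (x := q)).hasFDerivAt
      rw [h1.fderiv]
      simp [add_comm]
    have h2 : fderiv ℝ (picardTerm M s x₀ (k + 1)) q (1, 0) =
        ∫ r in s..q.2, fderiv ℝ f (q.1, r) (1, 0) := by
      have h3 := hasDerivAt_param_intervalIntegral hfs s q.2 q.1
      have h4 : HasDerivAt (fun p => picardTerm M s x₀ (k + 1) (p, q.2))
          (fderiv ℝ (picardTerm M s x₀ (k + 1)) q (1, 0)) q.1 :=
        HasFDerivAt.comp_hasDerivAt (f := fun p => (p, q.2)) q.1
          (((contDiff_picardTerm hM s x₀ (k + 1)).differentiable (by simp)).differentiableAt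
            (x := q)).hasFDerivAt
          ((hasDerivAt_id q.1).prodMk (hasDerivAt_const q.1 q.2))
      exact h4.unique h3
    rw [h2]
    have h5 : ∀ r, variationGenerator M (q.1, r) (picardTerm (variationGenerator M) s (x₀, 0) k
        (q.1, r)) = (f (q.1, r), fderiv ℝ f (q.1, r) (1, 0)) := by
      intro r
      rw [ih, hfd]
      simp [variationGenerator, hf]
    have h6 : Continuous fun r => f (q.1, r) := hfs.continuous.comp (by fun_prop)
    have h7 : Continuous fun r => fderiv ℝ f (q.1, r) (1, 0) :=
      ((hfs.continuous_fderiv (by simp)).clm_apply continuous_const).comp (by fun_prop)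
    simp only [picardTerm, h5]
    rw [intervalIntegral.intervalIntegral_eq_integral_uIoc,
      intervalIntegral.intervalIntegral_eq_integral_uIoc,
      intervalIntegral.intervalIntegral_eq_integral_uIoc,
      integral_pair (h6.intervalIntegrable _ _).def' (h7.intervalIntegrable _ _).def']
    rfl

/-- The solution of `x' = M(p,t) x`, `x(s) = x₀`. -/
def picardSum (M : ℝ × ℝ → V →L[ℝ] V) (s : ℝ) (x₀ : V) (q : ℝ × ℝ) : V :=
  ∑' k, picardTerm M s x₀ k q

/-- One constant has to serve the generator and all Picard terms near `q`. On the unit ball `|t -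
s|` is at most `T = |q.2 - s| + 1`, and since `T ≥ 1` the product of `T` with a bound for `M` does
both. -/
theorem exists_norm_picardTerm_le (hM : ContDiff ℝ ∞ M) (s : ℝ) (x₀ : V) (q : ℝ × ℝ) :
    ∃ C : ℝ, 0 ≤ C ∧ ∀ q' ∈ Metric.ball q 1, ‖M q'‖ ≤ C ∧ ∀ k,
      ‖picardTerm M s x₀ k q'‖ ≤ ‖x₀‖ * (C ^ k / k.factorial) := by
  set T := |q.2 - s| + 1 with hT
  obtain ⟨C, hC⟩ := ((isCompact_Icc (a := q.1 - 1) (b := q.1 + 1)).prod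
    (isCompact_Icc (a := s - T) (b := s + T))).bddAbove_image hM.continuous.norm.continuousOn
  have hT0 : 1 ≤ T := by rw [hT]; linarith [abs_nonneg (q.2 - s)]
  have hC' : ∀ p, |p - q.1| ≤ 1 → ∀ t, |t - s| ≤ T → ‖M (p, t)‖ ≤ |C| := by
    intro p hp t ht
    rw [abs_le] at hp ht
    exact (hC ⟨(p, t), ⟨⟨by linarith, by linarith⟩, ⟨by linarith, by linarith⟩⟩, rfl⟩).trans
      (le_abs_self C)
  refine ⟨|C| * T, by positivity, fun q' hq' => ?_⟩
  rw [Metric.mem_ball, Prod.dist_eq, max_lt_iff, Real.dist_eq, Real.dist_eq] at hq'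
  have ht : |q'.2 - s| ≤ T := by
    have := abs_sub_le q'.2 q.2 s
    rw [hT]; linarith
  refine ⟨(hC' q'.1 hq'.1.le q'.2 ht).trans (le_mul_of_one_le_right (abs_nonneg _) hT0),
    fun k => (norm_picardTerm_le s x₀ (abs_nonneg C) (hC' q'.1 hq'.1.le) k q'.2 ht).trans ?_⟩
  gcongr

/-- The series is differentiated term by term. In the parameter direction the derivatives form the
second component of the series for the variational system; in the time direction they form the
series itself, shifted by one and multiplied by `M`. Both are dominated by exponential series on the
unit ball. -/
theorem hasFDerivAt_picardSum (hM : ContDiff ℝ ∞ M) [CompleteSpace V] (s : ℝ) (x₀ : V)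
    (q : ℝ × ℝ) :
    HasFDerivAt (picardSum M s x₀)
      ((ContinuousLinearMap.fst ℝ ℝ ℝ).smulRight (picardSum (variationGenerator M) s (x₀, 0) q).2 +
        (ContinuousLinearMap.snd ℝ ℝ ℝ).smulRight (M q (picardSum M s x₀ q))) q := by
  obtain ⟨C, hC0, hC⟩ := exists_norm_picardTerm_le hM s x₀ q
  obtain ⟨C', hC'0, hC'⟩ := exists_norm_picardTerm_le (contDiff_variationGenerator hM) s (x₀, 0) q
  have hd : ∀ k q', HasFDerivAt (picardTerm M s x₀ k) (fderiv ℝ (picardTerm M s x₀ k) q') q' :=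
    fun k q' => (((contDiff_picardTerm hM s x₀ k).differentiable (by simp)).differentiableAt
          ).hasFDerivAt
  have h0 : ∀ k q', fderiv ℝ (picardTerm M s x₀ k) q' (0, 1) =
      match k with
      | 0 => 0
      | k + 1 => M q' (picardTerm M s x₀ k q') := by
    intro k q'
    rcases k with _ | k
    · have : picardTerm M s x₀ 0 = fun _ => x₀ := rfl
      rw [this]; simp
    · have h4 : HasDerivAt (fun t => picardTerm M s x₀ (k + 1) (q'.1, t))
          (fderiv ℝ (picardTerm M s x₀ (k + 1)) q' (0, 1)) q'.2 :=
        HasFDerivAt.comp_hasDerivAt (f := fun t => (q'.1, t)) q'.2 (hd (k + 1) q')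
          ((hasDerivAt_const q'.2 q'.1).prodMk (hasDerivAt_id q'.2))
      exact h4.unique (hasDerivAt_picardTerm_time hM s x₀ k q'.1 q'.2)
  have hsplit : ∀ k q', fderiv ℝ (picardTerm M s x₀ k) q' =
      (ContinuousLinearMap.fst ℝ ℝ ℝ).smulRight
        (picardTerm (variationGenerator M) s (x₀, 0) k q').2 +
      (ContinuousLinearMap.snd ℝ ℝ ℝ).smulRight (fderiv ℝ (picardTerm M s x₀ k) q' (0, 1)) := by
    intro k q'
    rw [picardTerm_variation hM]
    refine ContinuousLinearMap.ext fun v => ?_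
    have : v = v.1 • ((1 : ℝ), (0 : ℝ)) + v.2 • ((0 : ℝ), (1 : ℝ)) := by ext <;> simp
    conv_lhs => rw [this, map_add, map_smul, map_smul]
    rfl
  set u : ℕ → ℝ := fun k => ‖((x₀, 0) : V × V)‖ * (C' ^ k / k.factorial) +
    (match k with
      | 0 => 0
      | k + 1 => C * (‖x₀‖ * (C ^ k / k.factorial))) with hu
  have hu1 : Summable fun k : ℕ => ‖((x₀, 0) : V × V)‖ * (C' ^ k / k.factorial) :=
    (Real.summable_pow_div_factorial C').mul_left _
  have hu2 : Summable fun k : ℕ => C * (‖x₀‖ * (C ^ k / k.factorial)) :=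
    ((Real.summable_pow_div_factorial C).mul_left _).mul_left _
  have hus : Summable u := by
    refine hu1.add ?_
    exact (summable_nat_add_iff 1).1 hu2
  have hsum : Summable fun k => picardTerm M s x₀ k q :=
    Summable.of_norm_bounded ((Real.summable_pow_div_factorial C).mul_left ‖x₀‖)
      fun k => (hC q (Metric.mem_ball_self one_pos)).2 k
  have hsum' : Summable fun k => picardTerm (variationGenerator M) s (x₀, 0) k q :=
    Summable.of_norm_bounded ((Real.summable_pow_div_factorial C').mul_left _)
      fun k => (hC' q (Metric.mem_ball_self one_pos)).2 k
  have hmain := hasFDerivAt_tsum_of_isPreconnected (u := u) (f := fun k => picardTerm M s x₀ k)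
    (f' := fun k q' => fderiv ℝ (picardTerm M s x₀ k) q') (s := Metric.ball q 1) (x₀ := q) (x := q)
    hus Metric.isOpen_ball (convex_ball q 1).isPreconnected (fun k q' _ => hd k q') ?_
    (Metric.mem_ball_self one_pos) hsum (Metric.mem_ball_self one_pos)
  · refine hmain.congr_fderiv ?_
    have e1 : HasSum (fun k => (picardTerm (variationGenerator M) s (x₀, 0) k q).2)
        (picardSum (variationGenerator M) s (x₀, 0) q).2 :=
      hsum'.hasSum.map (ContinuousLinearMap.snd ℝ V V) (ContinuousLinearMap.snd ℝ V V).continuous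
    have e2 : HasSum (fun k => fderiv ℝ (picardTerm M s x₀ k) q (0, 1))
        (M q (picardSum M s x₀ q)) := by
      rw [← hasSum_nat_add_iff' 1]
      simp only [Finset.range_one, Finset.sum_singleton]
      rw [h0 0 q, sub_zero]
      refine HasSum.congr_fun ?_ fun k => h0 (k + 1) q
      exact hsum.hasSum.map (M q) (M q).continuous
    have e3 : HasSum (fun k => fderiv ℝ (picardTerm M s x₀ k) q)
      ((ContinuousLinearMap.fst ℝ ℝ ℝ).smulRight (picardSum (variationGenerator M) s (x₀, 0) q).2 +
        (ContinuousLinearMap.snd ℝ ℝ ℝ).smulRight (M q (picardSum M s x₀ q))) := by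
      have e4 := (e1.mapL (ContinuousLinearMap.smulRightL ℝ (ℝ × ℝ) V
        (ContinuousLinearMap.fst ℝ ℝ ℝ))).add (e2.mapL (ContinuousLinearMap.smulRightL ℝ (ℝ × ℝ) V
        (ContinuousLinearMap.snd ℝ ℝ ℝ)))
      have e5 : (fun k => fderiv ℝ (picardTerm M s x₀ k) q) = _ := funext fun k => hsplit k q
      rw [e5]
      exact e4
    exact e3.tsum_eq
  · intro k q' hq'
    rw [hsplit, h0]
    refine (norm_add_le _ _).trans (add_le_add ?_ ?_)
    · refine ContinuousLinearMap.opNorm_le_bound _ (by positivity) fun v => ?_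
      rw [ContinuousLinearMap.smulRight_apply, norm_smul, mul_comm]
      exact mul_le_mul ((norm_snd_le _).trans ((hC' q' hq').2 k)) (norm_fst_le v) (norm_nonneg _)
        (by positivity)
    · rcases k with _ | k
      · simp
      · refine ContinuousLinearMap.opNorm_le_bound _ (by positivity) fun v => ?_
        rw [ContinuousLinearMap.smulRight_apply, norm_smul, mul_comm]
        refine mul_le_mul (((M q').le_opNorm _).trans (mul_le_mul (hC q' hq').1
          ((hC q' hq').2 k) (norm_nonneg _) hC0)) (norm_snd_le v) (norm_nonneg _) (by positivity)

/-- The derivative is expressed through Picard sums on `V` and on `V × V`, so the order of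
smoothness is raised for all spaces and generators simultaneously. -/
theorem contDiff_picardSum_aux (m : ℕ) : ∀ {V : Type} [NormedAddCommGroup V] [NormedSpace ℝ V]
    [CompleteSpace V] {M : ℝ × ℝ → V →L[ℝ] V} (_ : ContDiff ℝ ∞ M) (s : ℝ) (x₀ : V),
    ContDiff ℝ m (picardSum M s x₀) := by
  induction m with
  | zero =>
    intro V _ _ _ M hM s x₀
    exact contDiff_zero.2 (continuous_iff_continuousAt.2 fun q =>
      (hasFDerivAt_picardSum hM s x₀ q).continuousAt)
  | succ m ih =>
    intro V _ _ _ M hM s x₀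
    rw [Nat.cast_succ]
    refine contDiff_succ_iff_hasFDerivAt.2 ⟨_, ?_, fun q => hasFDerivAt_picardSum hM s x₀ q⟩
    have h1 := ih hM s x₀
    have h2 := ih (contDiff_variationGenerator hM) s (x₀, 0)
    refine ContDiff.add ?_ ?_
    · exact contDiff_const.smulRight (contDiff_snd.comp h2)
    · exact contDiff_const.smulRight ((hM.of_le (by exact_mod_cast le_top)).clm_apply h1)

theorem contDiff_picardSum [CompleteSpace V] (hM : ContDiff ℝ ∞ M) (s : ℝ) (x₀ : V) :
    ContDiff ℝ ∞ (picardSum M s x₀) :=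
  contDiff_infty.2 fun m => contDiff_picardSum_aux m hM s x₀

theorem hasDerivAt_picardSum [CompleteSpace V] (hM : ContDiff ℝ ∞ M) (s : ℝ) (x₀ : V) (p t : ℝ) :
    HasDerivAt (fun t => picardSum M s x₀ (p, t)) (M (p, t) (picardSum M s x₀ (p, t))) t := by
  have := HasFDerivAt.comp_hasDerivAt (f := fun t => (p, t)) t (hasFDerivAt_picardSum hM s x₀ (p, t))
    ((hasDerivAt_const t p).prodMk (hasDerivAt_id t))
  simpa [Function.comp_def] using this

theorem picardSum_self (s : ℝ) (x₀ : V) (p : ℝ) : picardSum M s x₀ (p, s) = x₀ := by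
  rw [picardSum, tsum_eq_single 0]
  · rfl
  · intro k hk
    obtain ⟨k, rfl⟩ := Nat.exists_eq_succ_of_ne_zero hk
    simp [picardTerm]

end LinearODE

/-! ### Matrix-valued functions -/

section MatrixFunctions

variable {ι ι' ι'' : Type} [Fintype ι] [Fintype ι'] [Fintype ι'']

theorem contDiff_matrix_mul {F 𝕜 : Type} [NormedAddCommGroup F] [NormedSpace ℝ F] [RCLike 𝕜]
    {M : F → Matrix ι ι' 𝕜} {N : F → Matrix ι' ι'' 𝕜}
    (hM : ∀ a b, ContDiff ℝ ∞ fun q => M q a b) (hN : ∀ a b, ContDiff ℝ ∞ fun q => N q a b)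
    (a : ι) (b : ι'') : ContDiff ℝ ∞ fun q => (M q * N q) a b := by
  simp only [Matrix.mul_apply]
  exact ContDiff.sum fun c _ => (hM a c).mul (hN c b)

theorem contDiff_matrix_mulVec {F 𝕜 : Type} [NormedAddCommGroup F] [NormedSpace ℝ F] [RCLike 𝕜]
    {M : F → Matrix ι ι' 𝕜} {v : F → ι' → 𝕜}
    (hM : ∀ a b, ContDiff ℝ ∞ fun q => M q a b) (hv : ∀ a, ContDiff ℝ ∞ fun q => v q a)
    (a : ι) : ContDiff ℝ ∞ fun q => (M q *ᵥ v q) a := by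
  simp only [Matrix.mulVec, dotProduct]
  exact ContDiff.sum fun c _ => (hM a c).mul (hv c)

theorem contDiff_matrix_det [DecidableEq ι] {F 𝕜 : Type} [NormedAddCommGroup F] [NormedSpace ℝ F]
    [RCLike 𝕜] {M : F → Matrix ι ι 𝕜} (hM : ∀ a b, ContDiff ℝ ∞ fun q => M q a b) :
    ContDiff ℝ ∞ fun q => (M q).det := by
  simp only [Matrix.det_apply']
  exact ContDiff.sum fun σ _ => contDiff_const.mul (contDiff_prod fun i _ => hM _ _)

theorem contDiff_matrix_inv [DecidableEq ι] {F 𝕜 : Type} [NormedAddCommGroup F] [NormedSpace ℝ F]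
    [RCLike 𝕜] {M : F → Matrix ι ι 𝕜} (hM : ∀ a b, ContDiff ℝ ∞ fun q => M q a b)
    (h0 : ∀ q, (M q).det ≠ 0) (a b : ι) : ContDiff ℝ ∞ fun q => (M q)⁻¹ a b := by
  simp only [Matrix.inv_def, Ring.inverse_eq_inv', Matrix.smul_apply, Matrix.adjugate_apply]
  refine ((contDiff_matrix_det hM).inv h0).smul (contDiff_matrix_det fun c d => ?_)
  by_cases h : c = b
  · subst h
    simp only [Matrix.updateRow_self]
    exact contDiff_const
  · simp only [Matrix.updateRow_ne h]
    exact hM c d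

theorem hasDerivAt_matrix_mul {𝕜 : Type} [RCLike 𝕜]
    {M : ℝ → Matrix ι ι' 𝕜} {N : ℝ → Matrix ι' ι'' 𝕜} {M' : Matrix ι ι' 𝕜} {N' : Matrix ι' ι'' 𝕜}
    {t : ℝ} (hM : ∀ a b, HasDerivAt (fun t => M t a b) (M' a b) t)
    (hN : ∀ a b, HasDerivAt (fun t => N t a b) (N' a b) t) (a : ι) (b : ι'') :
    HasDerivAt (fun t => (M t * N t) a b) ((M' * N t + M t * N') a b) t := by
  simp only [Matrix.mul_apply, Matrix.add_apply]
  rw [← Finset.sum_add_distrib]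
  exact HasDerivAt.fun_sum fun c _ => (hM a c).mul (hN c b)

theorem hasDerivAt_matrix_mulVec {𝕜 : Type} [RCLike 𝕜]
    {M : ℝ → Matrix ι ι' 𝕜} {v : ℝ → ι' → 𝕜} {M' : Matrix ι ι' 𝕜} {v' : ι' → 𝕜}
    {t : ℝ} (hM : ∀ a b, HasDerivAt (fun t => M t a b) (M' a b) t)
    (hv : ∀ a, HasDerivAt (fun t => v t a) (v' a) t) (a : ι) :
    HasDerivAt (fun t => (M t *ᵥ v t) a) ((M' *ᵥ v t + M t *ᵥ v') a) t := by
  simp only [Matrix.mulVec, dotProduct, Pi.add_apply]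
  rw [← Finset.sum_add_distrib]
  exact HasDerivAt.fun_sum fun c _ => (hM a c).mul (hv c)

/-- Jacobi's formula, for a solution of a linear differential equation. -/
theorem hasDerivAt_matrix_det [DecidableEq ι] {𝕜 : Type} [RCLike 𝕜] {M : ℝ → Matrix ι ι 𝕜}
    {X : Matrix ι ι 𝕜} {t : ℝ} (hM : ∀ a b, HasDerivAt (fun t => M t a b) ((X * M t) a b) t) :
    HasDerivAt (fun t => (M t).det) (X.trace * (M t).det) t := by
  have h1 : HasDerivAt (fun t => (M t).det) (∑ σ : Equiv.Perm ι, (Equiv.Perm.sign σ : 𝕜) *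
      ∑ i, (∏ j ∈ Finset.univ.erase i, M t (σ j) j) • (X * M t) (σ i) i) t := by
    simp only [Matrix.det_apply']
    refine HasDerivAt.fun_sum fun σ _ => ?_
    have := HasDerivAt.fun_finsetProd (u := Finset.univ) (f := fun i t => M t (σ i) i)
      (f' := fun i => (X * M t) (σ i) i) (x := t) (fun i _ => hM (σ i) i)
    exact this.const_mul _
  refine h1.congr_deriv ?_
  -- Grouped by the differentiated column `i`, the derivative is a sum of determinants with column
  -- `i` replaced. Cramer's rule turns this sum into the trace of `adjugate M * (X * M)`, and
  -- cyclicity of the trace finishes.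
  have h2 : ∀ i, ((M t).updateCol i (fun a => (X * M t) a i)).det =
      ∑ σ : Equiv.Perm ι, (Equiv.Perm.sign σ : 𝕜) *
        ((∏ j ∈ Finset.univ.erase i, M t (σ j) j) • (X * M t) (σ i) i) := by
    intro i
    rw [Matrix.det_apply']
    refine Finset.sum_congr rfl fun σ _ => ?_
    rw [← Finset.prod_erase_mul _ _ (Finset.mem_univ i), Matrix.updateCol_self, smul_eq_mul]
    congr 2
    refine Finset.prod_congr rfl fun j hj => ?_
    rw [Matrix.updateCol_ne (Finset.ne_of_mem_erase hj)]
  simp only [Finset.mul_sum]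
  rw [Finset.sum_comm]
  simp only [← h2, ← Matrix.cramer_apply, Matrix.cramer_eq_adjugate_mulVec]
  have h3 : ∑ i, ((M t).adjugate *ᵥ fun a => (X * M t) a i) i =
      ((M t).adjugate * (X * M t)).trace := by
    simp [Matrix.trace, Matrix.mul_apply, Matrix.mulVec, dotProduct]
  rw [h3, Matrix.trace_mul_comm, Matrix.mul_assoc, Matrix.mul_adjugate, Matrix.mul_smul,
    Matrix.mul_one, Matrix.trace_smul, smul_eq_mul, mul_comm]

end MatrixFunctions

/-! ### Fundamental solutions -/

section FundamentalSolution

variable {ι : Type} [Fintype ι] [DecidableEq ι]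

/-- The operator with matrix `M`. -/
def entriesCLM (M : Matrix ι ι ℝ) : (ι → ℝ) →L[ℝ] (ι → ℝ) :=
  ∑ a, ∑ b, M a b • (ContinuousLinearMap.proj (R := ℝ) (φ := fun _ : ι => ℝ) b).smulRight
    (Pi.single a (1 : ℝ) : ι → ℝ)

theorem entriesCLM_apply (M : Matrix ι ι ℝ) (v : ι → ℝ) : entriesCLM M v = M *ᵥ v := by
  funext c
  simp [entriesCLM, Matrix.mulVec, dotProduct, Pi.single_apply]

theorem contDiff_entriesCLM {F : Type} [NormedAddCommGroup F] [NormedSpace ℝ F]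
    {M : F → Matrix ι ι ℝ} (hM : ∀ a b, ContDiff ℝ ∞ fun q => M q a b) :
    ContDiff ℝ ∞ fun q => entriesCLM (M q) := by
  unfold entriesCLM
  exact ContDiff.sum fun a _ => ContDiff.sum fun b _ => (hM a b).smul contDiff_const

/-- The fundamental matrix, equal to `1` at time `s`, of `x' = M(p,t) x`. -/
def fundamentalMatrix (M : ℝ × ℝ → Matrix ι ι ℝ) (s : ℝ) (q : ℝ × ℝ) : Matrix ι ι ℝ :=
  Matrix.of fun a b => picardSum (fun q => entriesCLM (M q)) s (Pi.single b 1) q a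

variable {M : ℝ × ℝ → Matrix ι ι ℝ}

theorem contDiff_fundamentalMatrix (hM : ∀ a b, ContDiff ℝ ∞ fun q => M q a b) (s : ℝ) (a b : ι) :
    ContDiff ℝ ∞ fun q => fundamentalMatrix M s q a b :=
  contDiff_pi.1 (contDiff_picardSum (contDiff_entriesCLM hM) s (Pi.single b (1 : ℝ))) a

theorem fundamentalMatrix_self (s p : ℝ) : fundamentalMatrix M s (p, s) = 1 := by
  ext a b
  simp [fundamentalMatrix, picardSum_self, Matrix.one_apply, Pi.single_apply]

theorem hasDerivAt_fundamentalMatrix (hM : ∀ a b, ContDiff ℝ ∞ fun q => M q a b) (s p t : ℝ)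
    (a b : ι) : HasDerivAt (fun t => fundamentalMatrix M s (p, t) a b)
      ((M (p, t) * fundamentalMatrix M s (p, t)) a b) t := by
  have h := hasDerivAt_pi.1 (hasDerivAt_picardSum (contDiff_entriesCLM hM) s
    (Pi.single b (1 : ℝ)) p t) a
  rw [entriesCLM_apply] at h
  exact h

/-- The difference solves the homogeneous equation, and on a compact interval the generator is
bounded, hence the field Lipschitz. The interval spanned by `s` and `t` is enlarged a little inside
the open set `T`, so that `s` becomes an interior point. -/
theorem linear_ode_unique {V : Type} [NormedAddCommGroup V] [NormedSpace ℝ V] {L : ℝ → V →L[ℝ] V}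
    (hL : Continuous L) {T : Set ℝ} (hT : T.OrdConnected) (hT' : IsOpen T) {s : ℝ} (hs : s ∈ T)
    {x y : ℝ → V} (f : ℝ → V) (hx : ∀ t ∈ T, HasDerivAt x (L t (x t) + f t) t)
    (hy : ∀ t ∈ T, HasDerivAt y (L t (y t) + f t) t) (h0 : x s = y s) : ∀ t ∈ T, x t = y t := by
  intro t ht
  obtain ⟨δ, hδ, hsub⟩ := Metric.isOpen_iff.1 hT' (min s t) (by
    rcases min_choice s t with h | h <;> rw [h] <;> assumption)
  obtain ⟨δ', hδ', hsub'⟩ := Metric.isOpen_iff.1 hT' (max s t) (by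
    rcases max_choice s t with h | h <;> rw [h] <;> assumption)
  rw [Real.ball_eq_Ioo] at hsub hsub'
  have ha : min s t - δ / 2 ∈ T := hsub ⟨by linarith, by linarith⟩
  have hb : max s t + δ' / 2 ∈ T := hsub' ⟨by linarith, by linarith⟩
  have hsubT := hT.out ha hb
  obtain ⟨C, hC⟩ := (isCompact_Icc (a := min s t - δ / 2) (b := max s t + δ' / 2)).bddAbove_image
    hL.norm.continuousOn
  have hd : ∀ r ∈ T, HasDerivAt (fun r => x r - y r) (L r (x r - y r)) r := by
    intro r hr
    refine ((hx r hr).sub (hy r hr)).congr_deriv ?_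
    rw [map_sub]; abel
  have hz := ODE_solution_unique_of_mem_Icc (v := fun r v => L r v) (s := fun _ => univ)
    (K := (max C 0).toNNReal) (t₀ := s) (a := min s t - δ / 2) (b := max s t + δ' / 2)
    (f := fun r => x r - y r) (g := fun _ => 0)
    (fun r hr => (LipschitzWith.of_dist_le_mul fun v w => by
      rw [dist_eq_norm, dist_eq_norm, ← map_sub]
      refine ((L r).le_opNorm _).trans (mul_le_mul_of_nonneg_right ?_ (norm_nonneg _))
      rw [Real.coe_toNNReal _ (le_max_right _ _)]
      exact (hC ⟨r, Ioo_subset_Icc_self hr, rfl⟩).trans (le_max_left _ _)).lipschitzOnWith)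
    ⟨by linarith [min_le_left s t], by linarith [le_max_left s t]⟩
    (HasDerivAt.continuousOn fun r hr => hd r (hsubT hr))
    (fun r hr => hd r (hsubT (Ioo_subset_Icc_self hr))) (fun _ _ => trivial) continuousOn_const
    (fun r hr => by simpa using hasDerivAt_const r (0 : V)) (fun _ _ => trivial) (by simp [h0])
  exact sub_eq_zero.1 (hz (x := t) ⟨by linarith [min_le_right s t], by linarith [le_max_right s t]⟩)

end FundamentalSolution

/-! ### The matriciant and the flow of the Hamilton–Ehrenfest system -/

section Matriciant

variable {n : ℕ}

/-- The matriciant `𝒜(t,s)`. -/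
def QuadraticModel.matriciant (Q : QuadraticModel n) (κ s t : ℝ) : Matrix (Idx n) (Idx n) ℝ :=
  fundamentalMatrix (fun q => Matrix.J (Fin n) ℝ * Q.hess q.1 q.2) s (κ, t)

variable (Q : QuadraticModel n)

theorem QuadraticModel.contDiff_hess (a b : Idx n) :
    ContDiff ℝ ∞ fun q : ℝ × ℝ => Q.hess q.1 q.2 a b := by
  have h1 : ContDiff ℝ ∞ fun q : ℝ × ℝ => Q.Hzz q.2 a b := (Q.smooth_Hzz a b).comp contDiff_snd
  have h2 : ContDiff ℝ ∞ fun q : ℝ × ℝ => Q.Wzz q.2 a b := (Q.smooth_Wzz a b).comp contDiff_snd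
  simp only [QuadraticModel.hess, Matrix.add_apply, Matrix.smul_apply, smul_eq_mul]
  exact h1.add (contDiff_fst.mul h2)

theorem QuadraticModel.hess_isSymm (κ t : ℝ) : (Q.hess κ t).IsSymm :=
  (Q.symm_Hzz t).add ((Q.symm_Wzz t).smul κ)

theorem QuadraticModel.contDiff_J_hess (a b : Idx n) :
    ContDiff ℝ ∞ fun q : ℝ × ℝ => (Matrix.J (Fin n) ℝ * Q.hess q.1 q.2) a b :=
  contDiff_matrix_mul (M := fun _ => Matrix.J (Fin n) ℝ) (fun _ _ => contDiff_const)
    Q.contDiff_hess a b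

theorem QuadraticModel.contDiff_matriciant (s : ℝ) (a b : Idx n) :
    ContDiff ℝ ∞ fun q : ℝ × ℝ => Q.matriciant q.1 s q.2 a b :=
  contDiff_fundamentalMatrix Q.contDiff_J_hess s a b

theorem QuadraticModel.matriciant_self (κ s : ℝ) : Q.matriciant κ s s = 1 :=
  fundamentalMatrix_self s κ

theorem QuadraticModel.hasDerivAt_matriciant (κ s t : ℝ) (a b : Idx n) :
    HasDerivAt (fun t => Q.matriciant κ s t a b)
      ((Matrix.J (Fin n) ℝ * Q.hess κ t * Q.matriciant κ s t) a b) t :=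
  hasDerivAt_fundamentalMatrix Q.contDiff_J_hess s κ t a b

theorem QuadraticModel.isMatriciant (κ s : ℝ) : Q.IsMatriciant κ s (Q.matriciant κ s) :=
  ⟨Q.matriciant_self κ s, fun t a b => Q.hasDerivAt_matriciant κ s t a b⟩

/-- The derivative of `Aᵀ J A` vanishes since `𝔥` is symmetric, `Jᵀ = -J` and `J² = -1`; at `t = s`
its value is `J`. -/
theorem QuadraticModel.matriciant_symplectic (κ s t : ℝ) :
    (Q.matriciant κ s t)ᵀ * Matrix.J (Fin n) ℝ * Q.matriciant κ s t = Matrix.J (Fin n) ℝ := by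
  ext a b
  have hd : ∀ t, HasDerivAt (fun t => ((Q.matriciant κ s t)ᵀ * Matrix.J (Fin n) ℝ *
      Q.matriciant κ s t) a b) 0 t := by
    intro t
    have h1 := Q.hasDerivAt_matriciant κ s t
    have h2 : ∀ a b, HasDerivAt (fun t => (Q.matriciant κ s t)ᵀ a b)
        ((Matrix.J (Fin n) ℝ * Q.hess κ t * Q.matriciant κ s t)ᵀ a b) t := fun a b => h1 b a
    have h3 := hasDerivAt_matrix_mul (N := fun _ => Matrix.J (Fin n) ℝ) (N' := 0) h2
      (fun _ _ => hasDerivAt_const _ _)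
    refine (hasDerivAt_matrix_mul h3 h1 a b).congr_deriv ?_
    rw [Matrix.mul_zero, add_zero, Matrix.transpose_mul, Matrix.transpose_mul,
      (Q.hess_isSymm κ t).eq, Matrix.J_transpose]
    have h4 : (Q.matriciant κ s t)ᵀ * (Q.hess κ t * -Matrix.J (Fin n) ℝ) * Matrix.J (Fin n) ℝ *
        Q.matriciant κ s t + (Q.matriciant κ s t)ᵀ * Matrix.J (Fin n) ℝ *
        (Matrix.J (Fin n) ℝ * Q.hess κ t * Q.matriciant κ s t) =
        (Q.matriciant κ s t)ᵀ * (-(Q.hess κ t * (Matrix.J (Fin n) ℝ * Matrix.J (Fin n) ℝ)) +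
          (Matrix.J (Fin n) ℝ * Matrix.J (Fin n) ℝ) * Q.hess κ t) * Q.matriciant κ s t := by
      noncomm_ring
    rw [h4, Matrix.J_squared]
    simp
  have := is_const_of_deriv_eq_zero (fun t => (hd t).differentiableAt) (fun t => (hd t).deriv) t s
  simpa [Q.matriciant_self] using this

/-- The generator of the affine system for the first moments, as a linear system with one more
unknown. -/
def QuadraticModel.meanGenerator (q : ℝ × ℝ) : Matrix (Option (Idx n)) (Option (Idx n)) ℝ :=
  Matrix.of fun
    | some a, some b => (Matrix.J (Fin n) ℝ * (Q.Hzz q.2 + q.1 • (Q.Wzz q.2 + Q.Wzw q.2))) a b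
    | some a, none => (Matrix.J (Fin n) ℝ *ᵥ Q.Hz q.2) a
    | none, _ => 0

theorem QuadraticModel.contDiff_meanGenerator (a b : Option (Idx n)) :
    ContDiff ℝ ∞ fun q => Q.meanGenerator q a b := by
  rcases a with _ | a
  · exact contDiff_const
  rcases b with _ | b
  · exact contDiff_matrix_mulVec (M := fun _ : ℝ × ℝ => Matrix.J (Fin n) ℝ)
      (fun _ _ => contDiff_const) (fun a => (Q.smooth_Hz a).comp contDiff_snd) a
  · refine contDiff_matrix_mul (M := fun _ : ℝ × ℝ => Matrix.J (Fin n) ℝ)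
      (fun _ _ => contDiff_const) (fun a b => ?_) a b
    have h1 : ContDiff ℝ ∞ fun q : ℝ × ℝ => Q.Hzz q.2 a b := (Q.smooth_Hzz a b).comp contDiff_snd
    have h2 : ContDiff ℝ ∞ fun q : ℝ × ℝ => Q.Wzz q.2 a b := (Q.smooth_Wzz a b).comp contDiff_snd
    have h3 : ContDiff ℝ ∞ fun q : ℝ × ℝ => Q.Wzw q.2 a b := (Q.smooth_Wzw a b).comp contDiff_snd
    exact h1.add (contDiff_fst.mul (h2.add h3))

/-- The first moments at time `t`, given those at time `s`. -/
def QuadraticModel.meanFlow (κ s : ℝ) (z₀ : Idx n → ℝ) (t : ℝ) (a : Idx n) : ℝ :=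
  (fundamentalMatrix Q.meanGenerator s (κ, t) *ᵥ fun o => o.elim 1 z₀) (some a)

theorem QuadraticModel.meanFlow_self (κ s : ℝ) (z₀ : Idx n → ℝ) : Q.meanFlow κ s z₀ s = z₀ := by
  funext a
  simp [QuadraticModel.meanFlow, fundamentalMatrix_self]

theorem QuadraticModel.contDiffOn_meanFlow {F : Type} [NormedAddCommGroup F] [NormedSpace ℝ F]
    {D : Set F} {κ τ : F → ℝ} {z₀ : F → Idx n → ℝ} (hκ : ContDiffOn ℝ ∞ κ D)
    (hτ : ContDiffOn ℝ ∞ τ D) (hz : ∀ a, ContDiffOn ℝ ∞ (fun q => z₀ q a) D) (s : ℝ) (a : Idx n) :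
    ContDiffOn ℝ ∞ (fun q => Q.meanFlow (κ q) s (z₀ q) (τ q) a) D := by
  simp only [QuadraticModel.meanFlow, Matrix.mulVec, dotProduct]
  refine ContDiffOn.sum fun b _ => ContDiffOn.mul ?_ ?_
  · exact (contDiff_fundamentalMatrix Q.contDiff_meanGenerator s (some a) b).comp_contDiffOn
      (hκ.prodMk hτ)
  · rcases b with _ | b
    · exact contDiffOn_const
    · exact hz b

theorem QuadraticModel.hasDerivAt_meanFlow (κ s : ℝ) (z₀ : Idx n → ℝ) (t : ℝ) (a : Idx n) :
    HasDerivAt (fun t => Q.meanFlow κ s z₀ t a) ((Matrix.J (Fin n) ℝ *ᵥ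
        (Q.Hz t + (Q.Hzz t + κ • (Q.Wzz t + Q.Wzw t)) *ᵥ Q.meanFlow κ s z₀ t)) a) t := by
  set y : ℝ → Option (Idx n) → ℝ := fun t =>
    fundamentalMatrix Q.meanGenerator s (κ, t) *ᵥ fun o => o.elim 1 z₀ with hy
  have hd : ∀ t o, HasDerivAt (fun t => y t o) ((Q.meanGenerator (κ, t) *ᵥ y t) o) t := by
    intro t o
    have := hasDerivAt_matrix_mulVec (v := fun _ => fun o : Option (Idx n) => o.elim 1 z₀) (v' := 0)
      (hasDerivAt_fundamentalMatrix Q.contDiff_meanGenerator s κ t)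
      (fun _ => hasDerivAt_const _ _) o
    refine this.congr_deriv ?_
    rw [Matrix.mulVec_zero, add_zero, hy, Matrix.mulVec_mulVec]
  -- The additional unknown has zero derivative and starts at `1`, so the column `none` of the
  -- generator reproduces the inhomogeneous term.
  have h0 : ∀ t, y t none = 1 := by
    intro t
    have hd0 : ∀ t, HasDerivAt (fun t => y t none) 0 t := fun t => (hd t none).congr_deriv (by
      simp [QuadraticModel.meanGenerator, Matrix.mulVec, dotProduct])
    have := is_const_of_deriv_eq_zero (fun t => (hd0 t).differentiableAt) (fun t => (hd0 t).deriv)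
      t s
    simpa [hy, fundamentalMatrix_self] using this
  refine (hd t (some a)).congr_deriv ?_
  have h1 : Q.meanFlow κ s z₀ t = fun a => y t (some a) := rfl
  have h2 : (Q.meanGenerator (κ, t) *ᵥ y t) (some a) = Q.meanGenerator (κ, t) (some a) none *
      y t none + ∑ b, Q.meanGenerator (κ, t) (some a) (some b) * y t (some b) := by
    simp only [Matrix.mulVec, dotProduct, Fintype.sum_option]
  rw [h2, h0, mul_one, Matrix.mulVec_add, Matrix.mulVec_mulVec, h1]
  rfl

/-- The flow of the Hamilton–Ehrenfest system. -/
def QuadraticModel.heFlow (κ s : ℝ) (c : PhasePoint n) (t : ℝ) : PhasePoint n :=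
  ⟨Q.meanFlow κ s c.z t, Q.matriciant κ s t * c.cov * (Q.matriciant κ s t)ᵀ⟩

theorem QuadraticModel.heFlow_self (κ s : ℝ) (c : PhasePoint n) : Q.heFlow κ s c s = c := by
  ext <;> simp [QuadraticModel.heFlow, Q.meanFlow_self, Q.matriciant_self]

/-- Covariances are transported by conjugation `A Δ₀ Aᵀ`. Since `(J𝔥)ᵀ = -𝔥J`, differentiating the
transposed factor gives the second term with its minus sign. -/
theorem QuadraticModel.hasDerivAt_heFlow_cov (κ s : ℝ) (c : PhasePoint n) (t : ℝ) (a b : Idx n) :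
    HasDerivAt (fun t => (Q.heFlow κ s c t).cov a b)
      ((Matrix.J (Fin n) ℝ * Q.hess κ t * (Q.heFlow κ s c t).cov
        - (Q.heFlow κ s c t).cov * Q.hess κ t * Matrix.J (Fin n) ℝ) a b) t := by
  have h1 := Q.hasDerivAt_matriciant κ s t
  have h2 : ∀ a b, HasDerivAt (fun t => (Q.matriciant κ s t)ᵀ a b)
      ((Matrix.J (Fin n) ℝ * Q.hess κ t * Q.matriciant κ s t)ᵀ a b) t := fun a b => h1 b a
  have h3 := hasDerivAt_matrix_mul (N := fun _ => c.cov) (N' := 0) h1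
    (fun _ _ => hasDerivAt_const _ _)
  refine (hasDerivAt_matrix_mul h3 h2 a b).congr_deriv ?_
  simp only [QuadraticModel.heFlow]
  rw [Matrix.mul_zero, add_zero, Matrix.transpose_mul, Matrix.transpose_mul,
    (Q.hess_isSymm κ t).eq, Matrix.J_transpose]
  noncomm_ring

theorem QuadraticModel.isHESSolution_heFlow (κ s : ℝ) (c : PhasePoint n) :
    Q.IsHESSolution κ (Q.heFlow κ s c) := fun t =>
  ⟨fun a => Q.hasDerivAt_meanFlow κ s c.z t a, fun a b => Q.hasDerivAt_heFlow_cov κ s c t a b⟩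

end Matriciant

/-! ### The complex frame of a Gaussian wave packet -/

section Frame

variable {n : ℕ}

/-- The frame `(i; 1)`. -/
def standardFrame (n : ℕ) : Matrix (Idx n) (Fin n) ℂ :=
  Matrix.fromRows (Complex.I • (1 : Matrix (Fin n) (Fin n) ℂ)) 1

/-- The image under `A` of the frame `(i; 1)`. -/
def waveFrame (A : Matrix (Idx n) (Idx n) ℝ) : Matrix (Idx n) (Fin n) ℂ :=
  A.map Complex.ofReal * standardFrame n

/-- The position block of the frame. -/
def waveD (A : Matrix (Idx n) (Idx n) ℝ) : Matrix (Fin n) (Fin n) ℂ := (waveFrame A).toRows₂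

/-- The complex symmetric matrix of the Gaussian. -/
def waveΓ (A : Matrix (Idx n) (Idx n) ℝ) : Matrix (Fin n) (Fin n) ℂ :=
  (waveFrame A).toRows₁ * (waveD A)⁻¹

/-- The normalized frame `(Γ; 1)`. -/
def waveL (A : Matrix (Idx n) (Idx n) ℝ) : Matrix (Idx n) (Fin n) ℂ :=
  Matrix.fromRows (waveΓ A) 1

variable {A : Matrix (Idx n) (Idx n) ℝ}

theorem J_mul_fromRows {𝕜 : Type} [CommRing 𝕜] (X Y : Matrix (Fin n) (Fin n) 𝕜) :
    Matrix.J (Fin n) 𝕜 * Matrix.fromRows X Y = Matrix.fromRows (-Y) X := by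
  simp [Matrix.J, Matrix.fromBlocks_mul_fromRows]

theorem symplectic_map (hA : Aᵀ * Matrix.J (Fin n) ℝ * A = Matrix.J (Fin n) ℝ) :
    (A.map Complex.ofReal)ᵀ * Matrix.J (Fin n) ℂ * A.map Complex.ofReal = Matrix.J (Fin n) ℂ := by
  have := congrArg (fun M : Matrix (Idx n) (Idx n) ℝ => M.map Complex.ofRealHom) hA
  simp only [Matrix.map_mul, Matrix.map_J] at this
  exact this

/-- The frame `(i; 1)` spans a Lagrangian subspace of the complexified phase space on which the
Hermitian form `-i v* J v` is positive. A real symplectic matrix preserves both features: isotropy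
here, positivity in `waveFrame_conjTranspose_J`. -/
theorem waveFrame_transpose_J (hA : Aᵀ * Matrix.J (Fin n) ℝ * A = Matrix.J (Fin n) ℝ) :
    (waveFrame A)ᵀ * Matrix.J (Fin n) ℂ * waveFrame A = 0 := by
  have h := symplectic_map hA
  rw [waveFrame, Matrix.transpose_mul]
  rw [show ∀ (X : Matrix (Fin n) (Idx n) ℂ) (Y J Y' : Matrix (Idx n) (Idx n) ℂ)
    (Z : Matrix (Idx n) (Fin n) ℂ), X * Y * J * (Y' * Z) = X * (Y * J * Y' * Z) from
    fun X Y J Y' Z => by simp only [Matrix.mul_assoc], h, standardFrame, J_mul_fromRows, Matrix.transpose_fromRows,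
    Matrix.fromCols_mul_fromRows]
  simp

theorem waveFrame_conjTranspose_J (hA : Aᵀ * Matrix.J (Fin n) ℝ * A = Matrix.J (Fin n) ℝ) :
    (waveFrame A)ᴴ * Matrix.J (Fin n) ℂ * waveFrame A = (2 * Complex.I) • 1 := by
  have h := symplectic_map hA
  have h' : (A.map Complex.ofReal)ᴴ = (A.map Complex.ofReal)ᵀ := by
    ext a b; simp
  rw [waveFrame, Matrix.conjTranspose_mul, h']
  rw [show ∀ (X : Matrix (Fin n) (Idx n) ℂ) (Y J Y' : Matrix (Idx n) (Idx n) ℂ)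
    (Z : Matrix (Idx n) (Fin n) ℂ), X * Y * J * (Y' * Z) = X * (Y * J * Y' * Z) from
    fun X Y J Y' Z => by simp only [Matrix.mul_assoc], h, standardFrame, J_mul_fromRows,
    Matrix.conjTranspose_fromRows_eq_fromCols_conjTranspose, Matrix.fromCols_mul_fromRows]
  simp [two_mul, add_smul]

-- On a vector `v` annihilated by the position block the Hermitian form of the frame would vanish,
-- while it equals `2i` times the squared length of `v`. Hence the Gaussian never degenerates,
-- whatever the rank of `λ₃`.
open scoped ComplexOrder in
theorem waveD_det_ne_zero (hA : Aᵀ * Matrix.J (Fin n) ℝ * A = Matrix.J (Fin n) ℝ) :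
    (waveD A).det ≠ 0 := by
  intro h0
  obtain ⟨v, hv, hDv⟩ := Matrix.exists_mulVec_eq_zero_iff.2 h0
  have h1 := waveFrame_conjTranspose_J hA
  rw [← Matrix.fromRows_toRows (waveFrame A), Matrix.mul_assoc, J_mul_fromRows,
    Matrix.conjTranspose_fromRows_eq_fromCols_conjTranspose, Matrix.fromCols_mul_fromRows] at h1
  have h2 := congrArg (fun M : Matrix (Fin n) (Fin n) ℂ => star v ⬝ᵥ (M *ᵥ v)) h1
  change _ = 0 at hDv
  simp only [Matrix.add_mulVec, Matrix.smul_mulVec, Matrix.one_mulVec, dotProduct_add,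
    ← Matrix.mulVec_mulVec, Matrix.neg_mulVec] at h2
  change star v ⬝ᵥ ((waveFrame A).toRows₁ᴴ *ᵥ -(waveD A *ᵥ v)) +
    star v ⬝ᵥ ((waveD A)ᴴ *ᵥ ((waveFrame A).toRows₁ *ᵥ v)) = _ at h2
  rw [hDv, neg_zero, Matrix.mulVec_zero, dotProduct_zero, zero_add, Matrix.dotProduct_mulVec,
    ← Matrix.star_mulVec, hDv, star_zero, zero_dotProduct, dotProduct_smul, smul_eq_mul] at h2
  have h3 : star v ⬝ᵥ v = 0 := by
    have : (2 * Complex.I : ℂ) ≠ 0 := by simp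
    exact (mul_eq_zero.1 h2.symm).resolve_left this
  exact hv (dotProduct_star_self_eq_zero.1 h3)

theorem waveL_mul_waveD (hA : Aᵀ * Matrix.J (Fin n) ℝ * A = Matrix.J (Fin n) ℝ) :
    waveL A * waveD A = waveFrame A := by
  rw [waveL, Matrix.fromRows_mul, waveΓ, Matrix.mul_assoc,
    Matrix.nonsing_inv_mul _ (waveD_det_ne_zero hA).isUnit, Matrix.mul_one, Matrix.one_mul, waveD,
    Matrix.fromRows_toRows]

theorem waveL_eq (hA : Aᵀ * Matrix.J (Fin n) ℝ * A = Matrix.J (Fin n) ℝ) :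
    waveL A = waveFrame A * (waveD A)⁻¹ := by
  rw [← waveL_mul_waveD hA, Matrix.mul_assoc,
    Matrix.mul_nonsing_inv _ (waveD_det_ne_zero hA).isUnit, Matrix.mul_one]

/-- Normalizing the frame to `(Γ; 1)` preserves isotropy, and isotropy of this frame is the symmetry
of `Γ`. -/
theorem waveΓ_isSymm (hA : Aᵀ * Matrix.J (Fin n) ℝ * A = Matrix.J (Fin n) ℝ) :
    (waveΓ A).IsSymm := by
  have h1 : (waveL A)ᵀ * Matrix.J (Fin n) ℂ * waveL A = 0 := by
    rw [waveL_eq hA, Matrix.transpose_mul]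
    rw [show ∀ (X Z : Matrix (Fin n) (Fin n) ℂ) (Y : Matrix (Fin n) (Idx n) ℂ)
      (J : Matrix (Idx n) (Idx n) ℂ) (W : Matrix (Idx n) (Fin n) ℂ),
      X * Y * J * (W * Z) = X * (Y * J * W * Z) from
      fun X Y J Y' Z => by simp only [Matrix.mul_assoc], waveFrame_transpose_J hA]
    simp
  rw [Matrix.mul_assoc, waveL, J_mul_fromRows, Matrix.transpose_fromRows,
    Matrix.fromCols_mul_fromRows] at h1
  simp only [Matrix.mul_neg, Matrix.mul_one, Matrix.transpose_one, Matrix.one_mul] at h1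
  exact (neg_add_eq_zero.1 h1)

/-- The Hermitian form of the frame, transported by `D⁻¹`, is the imaginary part of `Γ`; it is
therefore positive definite. -/
theorem waveΓ_sub_conjTranspose (hA : Aᵀ * Matrix.J (Fin n) ℝ * A = Matrix.J (Fin n) ℝ) :
    waveΓ A - (waveΓ A)ᴴ = (2 * Complex.I) • ((waveD A)⁻¹ᴴ * (waveD A)⁻¹) := by
  have h1 : (waveL A)ᴴ * Matrix.J (Fin n) ℂ * waveL A =
      (2 * Complex.I) • ((waveD A)⁻¹ᴴ * (waveD A)⁻¹) := by
    rw [waveL_eq hA, Matrix.conjTranspose_mul]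
    rw [show ∀ (X Z : Matrix (Fin n) (Fin n) ℂ) (Y : Matrix (Fin n) (Idx n) ℂ)
      (J : Matrix (Idx n) (Idx n) ℂ) (W : Matrix (Idx n) (Fin n) ℂ),
      X * Y * J * (W * Z) = X * (Y * J * W * Z) from
      fun X Y J Y' Z => by simp only [Matrix.mul_assoc], waveFrame_conjTranspose_J hA]
    simp
  rw [← h1, Matrix.mul_assoc, waveL, J_mul_fromRows,
    Matrix.conjTranspose_fromRows_eq_fromCols_conjTranspose, Matrix.fromCols_mul_fromRows]
  simp [sub_eq_neg_add]

/-- With `v = D⁻¹ x` the imaginary part of the quadratic form is `|v|²`, and `x = D v` is estimated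
by Cauchy–Schwarz. The explicit constant, the sum of squares of the entries of `D`, makes the decay
of the Gaussian uniform on compact sets of parameters. -/
theorem norm_sq_le_im_waveΓ (hA : Aᵀ * Matrix.J (Fin n) ℝ * A = Matrix.J (Fin n) ℝ) (x : E n) :
    ‖x‖ ^ 2 ≤ (∑ j, ∑ k, ‖waveD A j k‖ ^ 2) *
      (∑ j, ∑ k, (x j : ℂ) * waveΓ A j k * (x k : ℂ)).im := by
  set ξ : Fin n → ℂ := fun j => (x j : ℂ) with hξ
  set v : Fin n → ℂ := (waveD A)⁻¹ *ᵥ ξ with hv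
  have hDv : waveD A *ᵥ v = ξ := by
    rw [hv, Matrix.mulVec_mulVec, Matrix.mul_nonsing_inv _ (waveD_det_ne_zero hA).isUnit,
      Matrix.one_mulVec]
  have hstar : star ξ = ξ := by funext j; simp [hξ]
  have h1 : (∑ j, ∑ k, (x j : ℂ) * waveΓ A j k * (x k : ℂ)) = ξ ⬝ᵥ (waveΓ A *ᵥ ξ) := by
    simp [dotProduct, Matrix.mulVec, Finset.mul_sum, mul_assoc, hξ]
  have h2 : ξ ⬝ᵥ (waveΓ A *ᵥ ξ) - star (ξ ⬝ᵥ (waveΓ A *ᵥ ξ)) =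
      (2 * Complex.I) * (star v ⬝ᵥ v) := by
    have h3 : star (ξ ⬝ᵥ (waveΓ A *ᵥ ξ)) = ξ ⬝ᵥ ((waveΓ A)ᴴ *ᵥ ξ) := by
      rw [← Matrix.star_dotProduct_star, Matrix.star_mulVec, hstar, Matrix.dotProduct_mulVec]
    rw [h3, ← dotProduct_sub, ← Matrix.sub_mulVec, waveΓ_sub_conjTranspose hA, Matrix.smul_mulVec,
      dotProduct_smul, smul_eq_mul, ← Matrix.mulVec_mulVec, ← hv, Matrix.dotProduct_mulVec]
    congr 2
    rw [hv, Matrix.star_mulVec, hstar]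
  have h4 : (ξ ⬝ᵥ (waveΓ A *ᵥ ξ)).im = ∑ j, ‖v j‖ ^ 2 := by
    have h5 := congrArg Complex.im h2
    have h6 : star v ⬝ᵥ v = ((∑ j, ‖v j‖ ^ 2 : ℝ) : ℂ) := by
      simp [dotProduct, Complex.conj_mul']
    rw [h6] at h5
    simp only [Complex.sub_im, Complex.star_def, Complex.conj_im, Complex.mul_im, Complex.mul_re,
      Complex.ofReal_re, Complex.ofReal_im, Complex.I_re, Complex.I_im, Complex.re_ofNat,
      Complex.im_ofNat] at h5
    linarith
  rw [h1, h4, EuclideanSpace.norm_sq_eq, Finset.sum_mul]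
  refine Finset.sum_le_sum fun j _ => ?_
  have h7 : ‖x j‖ = ‖∑ k, waveD A j k * v k‖ := by
    have := congrFun hDv j
    simp only [Matrix.mulVec, dotProduct] at this
    rw [this, hξ]; simp
  rw [h7]
  have h8 : ‖∑ k, waveD A j k * v k‖ ≤ ∑ k, ‖waveD A j k‖ * ‖v k‖ :=
    (norm_sum_le _ _).trans (by simp)
  exact (pow_le_pow_left₀ (norm_nonneg _) h8 2).trans (Finset.sum_mul_sq_le_sq_mul_sq _ _ _)

end Frame

/-! ### Gaussian wave packets -/

section WavePacket

variable {n : ℕ} (Q : QuadraticModel n)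

theorem QuadraticModel.contDiff_waveFrame (s : ℝ) (a : Idx n) (j : Fin n) :
    ContDiff ℝ ∞ fun q : ℝ × ℝ => waveFrame (Q.matriciant q.1 s q.2) a j :=
  contDiff_matrix_mul (N := fun _ => standardFrame n)
    (fun a b => Complex.ofRealCLM.contDiff.comp (Q.contDiff_matriciant s a b))
    (fun _ _ => contDiff_const) a j

theorem QuadraticModel.contDiff_waveΓ (s : ℝ) (j k : Fin n) :
    ContDiff ℝ ∞ fun q : ℝ × ℝ => waveΓ (Q.matriciant q.1 s q.2) j k :=
  contDiff_matrix_mul (M := fun q : ℝ × ℝ => (waveFrame (Q.matriciant q.1 s q.2)).toRows₁)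
    (fun a b => Q.contDiff_waveFrame s (Sum.inl a) b)
    (contDiff_matrix_inv (M := fun q : ℝ × ℝ => waveD (Q.matriciant q.1 s q.2))
      (fun a b => Q.contDiff_waveFrame s (Sum.inr a) b)
      fun q => waveD_det_ne_zero (Q.matriciant_symplectic q.1 s q.2)) j k

theorem QuadraticModel.contDiff_waveL (s : ℝ) (a : Idx n) (j : Fin n) :
    ContDiff ℝ ∞ fun q : ℝ × ℝ => waveL (Q.matriciant q.1 s q.2) a j := by
  rcases a with a | a
  · exact Q.contDiff_waveΓ s a j
  · exact contDiff_const

theorem hasDerivAt_intervalIntegral_right {G : Type} [NormedAddCommGroup G] [NormedSpace ℝ G]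
    [CompleteSpace G] {f : ℝ × ℝ → G} (s : ℝ) (hf : ContDiff ℝ ∞ f) (p t : ℝ) :
    HasDerivAt (fun t => ∫ r in s..t, f (p, r)) (f (p, t)) t := by
  have hc : Continuous fun r => f (p, r) := hf.continuous.comp (by fun_prop)
  exact intervalIntegral.integral_hasDerivAt_right (hc.intervalIntegrable _ _)
    hc.stronglyMeasurable.stronglyMeasurableAtFilter hc.continuousAt

/-- `𝔥_zz(t)` as a complex matrix. -/
def QuadraticModel.hessC (κ t : ℝ) : Matrix (Idx n) (Idx n) ℂ := (Q.hess κ t).map Complex.ofReal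

theorem QuadraticModel.contDiff_hessC (a b : Idx n) :
    ContDiff ℝ ∞ fun q : ℝ × ℝ => Q.hessC q.1 q.2 a b :=
  Complex.ofRealCLM.contDiff.comp (Q.contDiff_hess a b)

/-- The logarithm of the prefactor of the Gaussian wave packet. -/
def QuadraticModel.waveLog (s : ℝ) (q : ℝ × ℝ) : ℂ :=
  ∫ r in s..q.2, -(1 / 2 : ℂ) *
    ((Q.hessC q.1 r * waveL (Q.matriciant q.1 s r)).toRows₁).trace

theorem QuadraticModel.contDiff_waveLog_integrand (s : ℝ) :
    ContDiff ℝ ∞ fun q : ℝ × ℝ => -(1 / 2 : ℂ) *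
      ((Q.hessC q.1 q.2 * waveL (Q.matriciant q.1 s q.2)).toRows₁).trace :=
  contDiff_const.mul (ContDiff.sum fun j _ =>
    contDiff_matrix_mul Q.contDiff_hessC (Q.contDiff_waveL s) (Sum.inl j) j)

theorem QuadraticModel.contDiff_waveLog (s : ℝ) : ContDiff ℝ ∞ (Q.waveLog s) :=
  contDiff_intervalIntegral s (Q.contDiff_waveLog_integrand s)

theorem QuadraticModel.waveLog_self (κ s : ℝ) : Q.waveLog s (κ, s) = 0 := by
  simp [QuadraticModel.waveLog]

theorem QuadraticModel.hasDerivAt_waveLog (κ s t : ℝ) :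
    HasDerivAt (fun t => Q.waveLog s (κ, t)) (-(1 / 2 : ℂ) *
      ((Q.hessC κ t * waveL (Q.matriciant κ s t)).toRows₁).trace) t := by
  exact hasDerivAt_intervalIntegral_right s (Q.contDiff_waveLog_integrand s) κ t

theorem QuadraticModel.hasDerivAt_waveFrame (κ s t : ℝ) (a : Idx n) (j : Fin n) :
    HasDerivAt (fun t => waveFrame (Q.matriciant κ s t) a j)
      ((Matrix.J (Fin n) ℂ * Q.hessC κ t * waveFrame (Q.matriciant κ s t)) a j) t := by
  have h1 : ∀ a b, HasDerivAt (fun t => (Q.matriciant κ s t).map Complex.ofReal a b)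
      (((Matrix.J (Fin n) ℝ * Q.hess κ t * Q.matriciant κ s t).map Complex.ofReal) a b) t :=
    fun a b => (Q.hasDerivAt_matriciant κ s t a b).ofReal_comp
  refine (hasDerivAt_matrix_mul (N := fun _ => standardFrame n) (N' := 0) h1
    (fun _ _ => hasDerivAt_const _ _) a j).congr_deriv ?_
  have h2 : (Matrix.J (Fin n) ℝ * Q.hess κ t * Q.matriciant κ s t).map Complex.ofReal =
      Matrix.J (Fin n) ℂ * Q.hessC κ t * (Q.matriciant κ s t).map Complex.ofReal := by
    have h3 := Matrix.map_mul (L := Matrix.J (Fin n) ℝ * Q.hess κ t) (M := Q.matriciant κ s t)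
      (f := Complex.ofRealHom)
    have h4 := Matrix.map_mul (L := Matrix.J (Fin n) ℝ) (M := Q.hess κ t) (f := Complex.ofRealHom)
    rw [Matrix.map_J] at h4
    rw [h4] at h3
    exact h3
  rw [h2, Matrix.mul_zero, add_zero, waveFrame, Matrix.mul_assoc]

theorem QuadraticModel.waveD_generator (κ s t : ℝ) :
    (Matrix.J (Fin n) ℂ * Q.hessC κ t * waveFrame (Q.matriciant κ s t)).toRows₂ =
      (Q.hessC κ t * waveL (Q.matriciant κ s t)).toRows₁ * waveD (Q.matriciant κ s t) := by
  rw [← waveL_mul_waveD (Q.matriciant_symplectic κ s t), Matrix.mul_assoc, ← Matrix.mul_assoc _ _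
    (waveD _), ← Matrix.fromRows_toRows (Q.hessC κ t * waveL (Q.matriciant κ s t)),
    Matrix.fromRows_mul, J_mul_fromRows]
  simp

/-- Liouville's formula: the logarithmic derivative of `det D` is the trace whose negative half is
integrated in `waveLog`. So `exp waveLog` is a smooth choice of `(det D)^(-1/2)` along the flow,
equal to one at time `s`. -/
theorem QuadraticModel.exp_waveLog_mul_det (κ s t : ℝ) :
    Complex.exp (2 * Q.waveLog s (κ, t)) * (waveD (Q.matriciant κ s t)).det = 1 := by
  have hd : ∀ t, HasDerivAt (fun t => Complex.exp (2 * Q.waveLog s (κ, t)) *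
      (waveD (Q.matriciant κ s t)).det) 0 t := by
    intro t
    have h1 := hasDerivAt_matrix_det (M := fun t => waveD (Q.matriciant κ s t)) (t := t)
      (X := (Q.hessC κ t * waveL (Q.matriciant κ s t)).toRows₁) (fun a b => by
        rw [← Q.waveD_generator]
        exact Q.hasDerivAt_waveFrame κ s t (Sum.inr a) b)
    refine (((Q.hasDerivAt_waveLog κ s t).const_mul 2).cexp.mul h1).congr_deriv ?_
    ring
  have := is_const_of_deriv_eq_zero (fun t => (hd t).differentiableAt) (fun t => (hd t).deriv) t s
  rw [this, Q.waveLog_self, Q.matriciant_self]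
  simp [waveD, waveFrame, standardFrame]

/-- A matrix Riccati equation. It follows by differentiating `Γ D = C`, where both blocks of the
frame obey the linear flow, and cancelling the invertible `D`; that `Γ` is differentiable is known
from its formula. -/
theorem QuadraticModel.hasDerivAt_waveΓ (κ s t : ℝ) (j k : Fin n) :
    HasDerivAt (fun t => waveΓ (Q.matriciant κ s t) j k)
      (-((waveL (Q.matriciant κ s t))ᵀ * Q.hessC κ t * waveL (Q.matriciant κ s t)) j k) t := by
  set A := fun t => Q.matriciant κ s t with hA
  have hsymp := fun t => Q.matriciant_symplectic κ s t
  have hdiff : ∀ j k, DifferentiableAt ℝ (fun t => waveΓ (A t) j k) t := fun j k =>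
    ((Q.contDiff_waveΓ s j k).comp (by fun_prop : ContDiff ℝ ∞ fun t : ℝ => (κ, t))).differentiable
      (by simp) t
  set Γ' : Matrix (Fin n) (Fin n) ℂ := Matrix.of fun j k => deriv (fun t => waveΓ (A t) j k) t
  have h1 : ∀ j k, HasDerivAt (fun t => waveΓ (A t) j k) (Γ' j k) t := fun j k =>
    (hdiff j k).hasDerivAt
  have h2 : ∀ j k, HasDerivAt (fun t => waveD (A t) j k)
      (((Q.hessC κ t * waveL (A t)).toRows₁ * waveD (A t)) j k) t := fun j k => by
    rw [← Q.waveD_generator]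
    exact Q.hasDerivAt_waveFrame κ s t (Sum.inr j) k
  have h3 : ∀ t, waveΓ (A t) * waveD (A t) = (waveFrame (A t)).toRows₁ := fun t => by
    rw [← waveL_mul_waveD (hsymp t), waveL, Matrix.fromRows_mul, Matrix.toRows₁_fromRows]
  have h4 : Γ' * waveD (A t) + waveΓ (A t) * ((Q.hessC κ t * waveL (A t)).toRows₁ * waveD (A t)) =
      -((Q.hessC κ t * waveL (A t)).toRows₂ * waveD (A t)) := by
    ext j k
    have h5 := hasDerivAt_matrix_mul h1 h2 j k
    simp only [h3] at h5
    rw [h5.unique (Q.hasDerivAt_waveFrame κ s t (Sum.inl j) k)]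
    rw [← waveL_mul_waveD (hsymp t), Matrix.mul_assoc, ← Matrix.mul_assoc _ _
      (waveD _), ← Matrix.fromRows_toRows (Q.hessC κ t * waveL (Q.matriciant κ s t)),
      Matrix.fromRows_mul, J_mul_fromRows]
    rfl
  have h6 : Γ' = -((waveL (A t))ᵀ * Q.hessC κ t * waveL (A t)) := by
    have h7 : Γ' * waveD (A t) =
        -((waveL (A t))ᵀ * Q.hessC κ t * waveL (A t)) * waveD (A t) := by
      rw [eq_sub_of_add_eq h4, waveL, Matrix.transpose_fromRows, (waveΓ_isSymm (hsymp t)).eq,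
        Matrix.transpose_one, ← waveL, Matrix.mul_assoc _ (Q.hessC κ t)]
      conv_rhs => rw [← Matrix.fromRows_toRows (Q.hessC κ t * waveL (A t))]
      rw [Matrix.fromCols_mul_fromRows, Matrix.one_mul]
      noncomm_ring
    have := congrArg (fun M => M * (waveD (A t))⁻¹) h7
    have h8 : waveD (A t) * (waveD (A t))⁻¹ = 1 :=
      Matrix.mul_nonsing_inv _ (waveD_det_ne_zero (hsymp t)).isUnit
    simpa only [Matrix.mul_assoc _ (waveD (A t)), h8, Matrix.mul_one] using this
  have := h1 j k
  rw [h6] at this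
  exact this

/-- The Gaussian wave packet with the initial value `exp(-|ξ|²/2)` at time `s`; the parameters are
`κ` and the time. -/
def QuadraticModel.wavePacket (s : ℝ) (q : (ℝ × ℝ) × E n) : ℂ :=
  Complex.exp (Q.waveLog s q.1 + Complex.I / 2 *
    ∑ j, ∑ k, (q.2 j : ℂ) * waveΓ (Q.matriciant q.1.1 s q.1.2) j k * (q.2 k : ℂ))

theorem slowOn_coord {F : Type} [NormedAddCommGroup F] [NormedSpace ℝ F] {D : Set F}
    (hD : IsOpen D) (j : Fin n) : SlowOn D (fun q : F × E n => ((q.2 j : ℝ) : ℂ)) :=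
  (SlowOn.clm_snd hD (EuclideanSpace.proj j : E n →L[ℝ] ℝ)).ofReal

theorem exists_pow_mul_exp_neg_sq_le {b : ℝ} (hb : 0 < b) (k : ℕ) :
    ∃ C : ℝ, ∀ r : ℝ, 0 ≤ r → (1 + r) ^ k * Real.exp (-b * r ^ 2) ≤ C := by
  -- The constant comes from `(1 + r) ^ k ≤ k! exp (1 + r)` and from completing the square, `1 + r -
  -- b r² ≤ 1 + 1 / (4b)`.
  refine ⟨k.factorial * Real.exp (1 + 1 / (4 * b)), fun r hr => ?_⟩
  have h1 := Real.pow_div_factorial_le_exp (1 + r) (by linarith) k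
  rw [div_le_iff₀ (by positivity)] at h1
  calc (1 + r) ^ k * Real.exp (-b * r ^ 2)
      ≤ (Real.exp (1 + r) * k.factorial) * Real.exp (-b * r ^ 2) := by gcongr
    _ = k.factorial * Real.exp (1 + r + -b * r ^ 2) := by
      rw [Real.exp_add (1 + r)]; ring
    _ ≤ _ := by
      gcongr 2
      have h2 : (1 + 1 / (4 * b)) - (1 + r + -b * r ^ 2) = b * (r - 1 / (2 * b)) ^ 2 := by
        field_simp; ring
      nlinarith [mul_nonneg hb.le (sq_nonneg (r - 1 / (2 * b)))]

theorem QuadraticModel.rapidOn_wavePacket (s : ℝ) : RapidOn univ (Q.wavePacket s) := by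
  have hexp : SlowOn univ (fun q : (ℝ × ℝ) × E n => Q.waveLog s q.1 + Complex.I / 2 *
      ∑ j, ∑ k, (q.2 j : ℂ) * waveΓ (Q.matriciant q.1.1 s q.1.2) j k * (q.2 k : ℂ)) := by
    refine (SlowOn.param isOpen_univ (Q.contDiff_waveLog s).contDiffOn).add
      ((SlowOn.const isOpen_univ _).mul (SlowOn.sum isOpen_univ _ fun j _ =>
        SlowOn.sum isOpen_univ _ fun k _ => ((slowOn_coord isOpen_univ j).mul
          (SlowOn.param isOpen_univ (Q.contDiff_waveΓ s j k).contDiffOn)).mul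
          (slowOn_coord isOpen_univ k)))
  refine hexp.cexp_rapid fun K _ hKc k => ?_
  have hcont : Continuous fun q : ℝ × ℝ => ∑ j, ∑ k, ‖waveD (Q.matriciant q.1 s q.2) j k‖ ^ 2 :=
    continuous_finsetSum _ fun j _ => continuous_finsetSum _ fun k _ =>
      (Q.contDiff_waveFrame s (Sum.inr j) k).continuous.norm.pow 2
  obtain ⟨B, hB⟩ := hKc.bddAbove_image hcont.continuousOn
  obtain ⟨C₁, hC₁⟩ := hKc.bddAbove_image (Complex.continuous_re.comp
    (Q.contDiff_waveLog s).continuous).continuousOn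
  -- On `K` the squares of the entries of `D` sum to at most `|B| + 1`, so half of the imaginary
  -- quadratic form is at least this multiple of `‖ξ‖²`.
  have hb : 0 < 1 / (2 * (|B| + 1)) := by positivity
  obtain ⟨C, hC⟩ := exists_pow_mul_exp_neg_sq_le hb k
  have hC0 : 0 ≤ C := le_trans (by positivity) (hC 0 le_rfl)
  refine ⟨Real.exp C₁ * C, by positivity, fun τ hτ ξ => ?_⟩
  have h1 := norm_sq_le_im_waveΓ (Q.matriciant_symplectic τ.1 s τ.2) ξ
  set I₀ := (∑ j, ∑ k, (ξ j : ℂ) * waveΓ (Q.matriciant τ.1 s τ.2) j k * (ξ k : ℂ)).im with hI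
  have h2 : ∑ j, ∑ k, ‖waveD (Q.matriciant τ.1 s τ.2) j k‖ ^ 2 ≤ |B| + 1 :=
    (hB ⟨τ, hτ, rfl⟩).trans (by linarith [le_abs_self B])
  have hs0 : 0 ≤ ∑ j, ∑ k, ‖waveD (Q.matriciant τ.1 s τ.2) j k‖ ^ 2 := by positivity
  -- The constant may be enlarged only for nonnegative `I₀`. A negative value would force `ξ = 0`
  -- and thereby `I₀ = 0`.
  have h3 : ‖ξ‖ ^ 2 ≤ (|B| + 1) * I₀ := by
    rcases le_or_gt 0 I₀ with h | h
    · exact h1.trans (mul_le_mul_of_nonneg_right h2 h)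
    · have h4 : ‖ξ‖ ^ 2 ≤ 0 := h1.trans (mul_nonpos_of_nonneg_of_nonpos hs0 h.le)
      have h5 : ξ = 0 := by
        have : ‖ξ‖ = 0 := by nlinarith [norm_nonneg ξ]
        simpa using this
      rw [hI, h5] at h
      simp at h
  have h6 : 1 / (2 * (|B| + 1)) * ‖ξ‖ ^ 2 ≤ I₀ / 2 := by
    have : 1 / (2 * (|B| + 1)) * ‖ξ‖ ^ 2 ≤ 1 / (2 * (|B| + 1)) * ((|B| + 1) * I₀) := by gcongr
    refine this.trans (le_of_eq ?_)
    field_simp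
  simp only [Complex.norm_exp]
  have h7 : (Q.waveLog s τ + Complex.I / 2 * ∑ j, ∑ k, (ξ j : ℂ) *
      waveΓ (Q.matriciant τ.1 s τ.2) j k * (ξ k : ℂ)).re = (Q.waveLog s τ).re - I₀ / 2 := by
    rw [Complex.add_re, hI, show ∀ z : ℂ, (Complex.I / 2 * z).re = -(z.im / 2) from fun z => by
      rw [div_mul_eq_mul_div, Complex.div_ofNat_re]; simp [neg_div]]
    ring
  rw [h7]
  have h8 : Real.exp ((Q.waveLog s τ).re - I₀ / 2) ≤
      Real.exp C₁ * Real.exp (-(1 / (2 * (|B| + 1))) * ‖ξ‖ ^ 2) := by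
    rw [← Real.exp_add]
    refine Real.exp_le_exp.2 ?_
    have : (Q.waveLog s τ).re ≤ C₁ := hC₁ ⟨τ, hτ, rfl⟩
    linarith
  calc _ ≤ (1 + ‖ξ‖) ^ k * (Real.exp C₁ * Real.exp (-(1 / (2 * (|B| + 1))) * ‖ξ‖ ^ 2)) := by
        gcongr
    _ = Real.exp C₁ * ((1 + ‖ξ‖) ^ k * Real.exp (-(1 / (2 * (|B| + 1))) * ‖ξ‖ ^ 2)) := by ring
    _ ≤ _ := by
      gcongr
      exact hC _ (norm_nonneg ξ)

theorem QuadraticModel.wavePacket_self (κ s : ℝ) (ξ : E n) :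
    Q.wavePacket s ((κ, s), ξ) = Complex.exp (-(1 / 2 : ℂ) * ((‖ξ‖ ^ 2 : ℝ) : ℂ)) := by
  have h : waveΓ (Q.matriciant κ s s) = Complex.I • 1 := by
    rw [Q.matriciant_self]
    simp [waveΓ, waveD, waveFrame, standardFrame]
  rw [QuadraticModel.wavePacket]
  simp only [h, Q.waveLog_self, EuclideanSpace.norm_sq_eq]
  congr 1
  simp only [Matrix.smul_apply, Matrix.one_apply, smul_eq_mul, mul_ite, mul_one, mul_zero, ite_mul,
    zero_mul, Finset.sum_ite_eq, Finset.mem_univ, if_true, zero_add]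
  push_cast
  rw [Finset.mul_sum, Finset.mul_sum]
  refine Finset.sum_congr rfl fun j _ => ?_
  rw [Real.norm_eq_abs, ← Complex.ofReal_pow, sq_abs, Complex.ofReal_pow]
  linear_combination (1 / 2 : ℂ) * (ξ j : ℂ) ^ 2 * Complex.I_mul_I

theorem exists_hasFDerivAt_coord (x : E n) (j : Fin n) : ∃ L : Fin n → E n →L[ℝ] ℂ,
    (∀ k, HasFDerivAt (fun x : E n => (x k : ℂ)) (L k) x) ∧
      ∀ k, L k (EuclideanSpace.single j 1) = if k = j then 1 else 0 := by
  refine ⟨fun k => Complex.ofRealCLM.comp (EuclideanSpace.proj k : E n →L[ℝ] ℝ),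
    fun k => (Complex.ofRealCLM.comp (EuclideanSpace.proj k : E n →L[ℝ] ℝ)).hasFDerivAt,
    fun k => ?_⟩
  by_cases h : k = j <;> simp [h]

/-- Leibniz rule for the multiplication by a linear function. -/
theorem zOp_linear_mul (ħ : ℝ) (a : Idx n) (c : Fin n → ℂ) {u : E n → ℂ} {x : E n}
    (hu : DifferentiableAt ℝ u x) :
    zOp ħ a (fun x => (∑ k, c k * (x k : ℂ)) * u x) x =
      (∑ k, c k * (x k : ℂ)) * zOp ħ a u x +
        a.elim (fun j => -Complex.I * (ħ : ℂ) * c j) (fun _ => 0) * u x := by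
  rcases a with j | j
  · obtain ⟨L, hL, hLj⟩ := exists_hasFDerivAt_coord x j
    have h1 : HasFDerivAt (fun x : E n => ∑ k, c k * (x k : ℂ)) (∑ k, c k • L k) x :=
      HasFDerivAt.fun_sum fun k _ => (hL k).const_mul (c k)
    have h2 : (∑ k, c k • L k) (EuclideanSpace.single j 1) = c j := by
      simp [hLj]
    simp only [zOp, Sum.elim_inl]
    rw [(h1.fun_mul hu.hasFDerivAt).fderiv]
    change _ * ((∑ k, c k * (x k : ℂ)) • _ + u x • (∑ k, c k • L k) (EuclideanSpace.single j 1)) = _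
    rw [h2, smul_eq_mul, smul_eq_mul]
    change _ * (_ * fderiv ℝ u x (EuclideanSpace.single j 1) + _) = _
    ring
  · simp only [zOp, Sum.elim_inr]
    ring

theorem zOp_exp_quadratic (ħ : ℝ) (ℓ : ℂ) {Γ : Matrix (Fin n) (Fin n) ℂ} (hΓ : Γ.IsSymm)
    (x : E n) (j : Fin n) :
    zOp ħ (Sum.inl j) (fun x : E n => Complex.exp (ℓ + Complex.I / 2 *
      ∑ j, ∑ k, (x j : ℂ) * Γ j k * (x k : ℂ))) x = (ħ : ℂ) * (∑ k, Γ j k * (x k : ℂ)) *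
      Complex.exp (ℓ + Complex.I / 2 * ∑ j, ∑ k, (x j : ℂ) * Γ j k * (x k : ℂ)) := by
  obtain ⟨L, hL, hLj⟩ := exists_hasFDerivAt_coord x j
  have h1 : HasFDerivAt (fun x : E n => ∑ j, ∑ k, (x j : ℂ) * Γ j k * (x k : ℂ)) _ x :=
    HasFDerivAt.fun_sum fun j _ => HasFDerivAt.fun_sum fun k _ =>
      ((hL j).mul_const (Γ j k)).fun_mul (hL k)
  have h2 := ((h1.const_mul (Complex.I / 2)).const_add ℓ).cexp
  simp only [zOp]
  rw [h2.fderiv]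
  have h4 : ∑ i, ∑ k, ((x i : ℂ) * Γ i k * (if k = j then 1 else 0) +
      (x k : ℂ) * (Γ i k * if i = j then 1 else 0)) =
      2 * ∑ k, Γ j k * (x k : ℂ) := by
    simp only [Finset.sum_add_distrib]
    rw [Finset.sum_comm (f := fun i k => (x k : ℂ) * (Γ i k * if i = j then 1 else 0))]
    simp only [mul_ite, mul_one, mul_zero, Finset.sum_ite_eq', Finset.mem_univ, if_true]
    rw [two_mul]
    refine congrArg₂ _ (Finset.sum_congr rfl fun k _ => ?_) (Finset.sum_congr rfl fun k _ => ?_)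
    · rw [mul_comm, hΓ.apply]
    · rw [mul_comm]
  have h5 : (∑ i, ∑ k, (((x i : ℂ) * Γ i k) • L k + (x k : ℂ) • Γ i k • L i))
      (EuclideanSpace.single j (1 : ℝ)) = 2 * ∑ k, Γ j k * (x k : ℂ) := by
    rw [← h4]
    simp [hLj]
  simp only [smul_apply, smul_eq_mul]
  rw [h5]
  linear_combination -(ħ : ℂ) * (∑ k, Γ j k * (x k : ℂ)) * Complex.exp (ℓ + Complex.I / 2 *
    ∑ j, ∑ k, (x j : ℂ) * Γ j k * (x k : ℂ)) * Complex.I_mul_I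

theorem RapidOn.differentiableAt_slice {F V G : Type} [NormedAddCommGroup F] [NormedSpace ℝ F]
    [NormedAddCommGroup V] [NormedSpace ℝ V] [NormedAddCommGroup G] [NormedSpace ℝ G] {D : Set F}
    {f : F × V → G} (hf : RapidOn D f) {τ : F} (hτ : τ ∈ D) (x : V) :
    DifferentiableAt ℝ (fun x => f (τ, x)) x :=
  DifferentiableAt.comp (f := fun x => (τ, x)) x
    ((hf.smooth.contDiffAt ((isOpen_prod_univ hf.isOpen).mem_nhds
      ⟨hτ, mem_univ x⟩)).differentiableAt (by simp)) (by fun_prop)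

theorem QuadraticModel.zOp_wavePacket (s : ℝ) (q : ℝ × ℝ) (a : Idx n) :
    zOp 1 a (fun x => Q.wavePacket s (q, x)) = fun x =>
      (∑ k, waveL (Q.matriciant q.1 s q.2) a k * (x k : ℂ)) * Q.wavePacket s (q, x) := by
  funext x
  rcases a with j | j
  · have := zOp_exp_quadratic 1 (Q.waveLog s q)
      (waveΓ_isSymm (Q.matriciant_symplectic q.1 s q.2)) x j
    rw [Complex.ofReal_one, one_mul] at this
    exact this
  · simp [zOp, waveL, Matrix.one_apply]

/-- The wave packet solves the Schrödinger equation with the quadratic Hamiltonian. -/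
theorem QuadraticModel.hasDerivAt_wavePacket (κ s t : ℝ) (x : E n) :
    HasDerivAt (fun t => Q.wavePacket s ((κ, t), x)) (-Complex.I * ((1 / 2 : ℂ) *
      ∑ a, ∑ b, (Q.hess κ t a b : ℂ) *
        zOp 1 a (zOp 1 b (fun y => Q.wavePacket s ((κ, t), y))) x)) t := by
  set L := waveL (Q.matriciant κ s t) with hL
  set ξ : Fin n → ℂ := fun k => (x k : ℂ) with hξ
  set u := Q.wavePacket s ((κ, t), x) with hu
  have hdiff := fun x => (Q.rapidOn_wavePacket s).differentiableAt_slice (mem_univ (κ, t)) x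
  -- Each `ẑ` multiplies the Gaussian by a linear function; the second one also differentiates the
  -- first factor. The quadratic part is matched by the Riccati equation for `Γ`, and the constants
  -- `-i L b j`, summed against `𝔥`, give the trace that the derivative of `waveLog` supplies.
  have h1 : ∀ a b, zOp 1 a (zOp 1 b (fun y => Q.wavePacket s ((κ, t), y))) x =
      ((L *ᵥ ξ) a * (L *ᵥ ξ) b + a.elim (fun j => -Complex.I * L b j) (fun _ => 0)) * u := by
    intro a b
    rw [Q.zOp_wavePacket, zOp_linear_mul 1 a _ (hdiff x), Q.zOp_wavePacket]
    simp only [Complex.ofReal_one, mul_one]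
    change (L *ᵥ ξ) b * ((L *ᵥ ξ) a * u) + _ * u = _
    ring
  have h2 : ∑ a, ∑ b, (Q.hess κ t a b : ℂ) *
        zOp 1 a (zOp 1 b (fun y => Q.wavePacket s ((κ, t), y))) x =
      ((L *ᵥ ξ) ⬝ᵥ (Q.hessC κ t *ᵥ (L *ᵥ ξ)) - Complex.I * (Q.hessC κ t * L).toRows₁.trace) * u := by
    simp only [h1]
    have h3 : (L *ᵥ ξ) ⬝ᵥ (Q.hessC κ t *ᵥ (L *ᵥ ξ)) =
        ∑ a, ∑ b, (Q.hess κ t a b : ℂ) * ((L *ᵥ ξ) a * (L *ᵥ ξ) b) := by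
      generalize L *ᵥ ξ = y
      simp only [dotProduct, Matrix.mulVec, Finset.mul_sum]
      refine Finset.sum_congr rfl fun a _ => Finset.sum_congr rfl fun b _ => ?_
      simp only [QuadraticModel.hessC, Matrix.map_apply]
      ring
    have h4 : Complex.I * (Q.hessC κ t * L).toRows₁.trace =
        -∑ a, ∑ b, (Q.hess κ t a b : ℂ) *
          a.elim (fun j => -Complex.I * L b j) (fun _ => 0) := by
      rw [Fintype.sum_sum_type]
      simp only [Sum.elim_inl, Sum.elim_inr, mul_zero, Finset.sum_const_zero, add_zero,
        Matrix.trace, Matrix.diag, Finset.mul_sum, ← Finset.sum_neg_distrib]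
      refine Finset.sum_congr rfl fun j _ => ?_
      change Complex.I * (Q.hessC κ t * L) (Sum.inl j) j = _
      rw [Matrix.mul_apply, Finset.mul_sum]
      refine Finset.sum_congr rfl fun b _ => ?_
      simp only [QuadraticModel.hessC, Matrix.map_apply]
      ring
    rw [h3, h4, sub_neg_eq_add, ← Finset.sum_add_distrib, Finset.sum_mul]
    refine Finset.sum_congr rfl fun a _ => ?_
    rw [← Finset.sum_add_distrib, Finset.sum_mul]
    refine Finset.sum_congr rfl fun b _ => ?_
    ring
  rw [h2]
  have h5 : HasDerivAt (fun t => ∑ j, ∑ k, (x j : ℂ) * waveΓ (Q.matriciant κ s t) j k * (x k : ℂ))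
      (∑ j, ∑ k, (x j : ℂ) * (-(Lᵀ * Q.hessC κ t * L) j k) * (x k : ℂ)) t :=
    HasDerivAt.fun_sum fun j _ => HasDerivAt.fun_sum fun k _ =>
      ((Q.hasDerivAt_waveΓ κ s t j k).const_mul _).mul_const _
  have h6 := ((Q.hasDerivAt_waveLog κ s t).add (h5.const_mul (Complex.I / 2))).cexp
  refine h6.congr_deriv ?_
  have h7 : ∑ j, ∑ k, (x j : ℂ) * (-(Lᵀ * Q.hessC κ t * L) j k) * (x k : ℂ) =
      -((L *ᵥ ξ) ⬝ᵥ (Q.hessC κ t *ᵥ (L *ᵥ ξ))) := by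
    have h8 : (L *ᵥ ξ) ⬝ᵥ (Q.hessC κ t *ᵥ (L *ᵥ ξ)) = ξ ⬝ᵥ ((Lᵀ * Q.hessC κ t * L) *ᵥ ξ) := by
      rw [← Matrix.mulVec_mulVec, ← Matrix.mulVec_mulVec, Matrix.dotProduct_mulVec ξ Lᵀ,
        Matrix.vecMul_transpose]
    rw [h8, dotProduct, ← Finset.sum_neg_distrib]
    refine Finset.sum_congr rfl fun j _ => ?_
    rw [Matrix.mulVec, dotProduct, Finset.mul_sum, ← Finset.sum_neg_distrib]
    refine Finset.sum_congr rfl fun k _ => ?_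
    ring
  rw [h7]
  change u * _ = _
  linear_combination (-(1 / 2 : ℂ) * (Q.hessC κ t * L).toRows₁.trace * u) * Complex.I_mul_I

end WavePacket

/-! ### The operators `ẑ` on Schwartz space -/

section SchwartzOperators

variable {n : ℕ}

open LineDeriv in
/-- `ẑ_a` on Schwartz functions. -/
def zS (ħ : ℝ) : Idx n → 𝓢(E n, ℂ) →ₗ[ℂ] 𝓢(E n, ℂ)
  | Sum.inl j => (-Complex.I * (ħ : ℂ)) •
      ((lineDerivOpCLM ℂ 𝓢(E n, ℂ) (EuclideanSpace.single j (1 : ℝ)) :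
        𝓢(E n, ℂ) →L[ℂ] 𝓢(E n, ℂ)) : 𝓢(E n, ℂ) →ₗ[ℂ] 𝓢(E n, ℂ))
  | Sum.inr j => (SchwartzMap.smulLeftCLM ℂ (fun x : E n => ((x j : ℝ) : ℂ)) :
      𝓢(E n, ℂ) →ₗ[ℂ] 𝓢(E n, ℂ))

theorem hasTemperateGrowth_coord (j : Fin n) :
    (fun x : E n => ((x j : ℝ) : ℂ)).HasTemperateGrowth :=
  (Complex.ofRealCLM.comp (EuclideanSpace.proj j : E n →L[ℝ] ℝ)).hasTemperateGrowth

theorem coe_zS (ħ : ℝ) (a : Idx n) (φ : 𝓢(E n, ℂ)) : ⇑(zS ħ a φ) = zOp ħ a φ := by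
  funext x
  rcases a with j | j
  · rfl
  · exact SchwartzMap.smulLeftCLM_apply_apply (hasTemperateGrowth_coord j) φ x

theorem zS_inl_apply (ħ : ℝ) (j : Fin n) (φ : 𝓢(E n, ℂ)) (x : E n) :
    zS ħ (Sum.inl j) φ x = -Complex.I * (ħ : ℂ) * fderiv ℝ φ x (EuclideanSpace.single j (1 : ℝ)) := by
  rw [coe_zS]; rfl

theorem zS_inr_apply (ħ : ℝ) (j : Fin n) (φ : 𝓢(E n, ℂ)) (x : E n) :
    zS ħ (Sum.inr j) φ x = ((x j : ℝ) : ℂ) * φ x := by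
  rw [coe_zS]; rfl

theorem fderiv_fderiv_apply_comm {X G : Type} [NormedAddCommGroup X] [NormedSpace ℝ X]
    [NormedAddCommGroup G] [NormedSpace ℝ G] {f : X → G} {x : X} (hf : ContDiffAt ℝ ∞ f x)
    (v w : X) :
    fderiv ℝ (fun y => fderiv ℝ f y v) x w = fderiv ℝ (fun y => fderiv ℝ f y w) x v := by
  have h1 : DifferentiableAt ℝ (fderiv ℝ f) x :=
    (hf.fderiv_right (m := 1) (by norm_cast)).differentiableAt one_ne_zero
  have h2 : ∀ v w, fderiv ℝ (fun y => fderiv ℝ f y v) x w = fderiv ℝ (fderiv ℝ f) x w v := by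
    intro v w
    rw [fderiv_clm_apply h1 (by fun_prop)]
    simp
  rw [h2, h2]
  exact (hf.isSymmSndFDerivAt (by simpa using ENat.LEInfty.out)) w v

theorem zS_inl_inr_comm (ħ : ℝ) (j k : Fin n) (φ : 𝓢(E n, ℂ)) :
    zS ħ (Sum.inl j) (zS ħ (Sum.inr k) φ) - zS ħ (Sum.inr k) (zS ħ (Sum.inl j) φ) =
      (-Complex.I * (ħ : ℂ) * if j = k then 1 else 0) • φ := by
  ext x
  have h1 := zOp_linear_mul ħ (Sum.inl j) (Pi.single k (1 : ℂ)) (φ.differentiableAt (x := x))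
  have h2 : ∀ x : E n, ∑ i, (Pi.single k (1 : ℂ) : Fin n → ℂ) i * (x i : ℂ) = (x k : ℂ) := by
    intro x; simp [Pi.single_apply]
  simp only [h2, Sum.elim_inl] at h1
  rw [sub_apply, smul_apply, zS_inr_apply, coe_zS ħ (Sum.inl j),
    coe_zS ħ (Sum.inl j), coe_zS]
  change zOp ħ (Sum.inl j) (fun x => (x k : ℂ) * φ x) x - _ = _
  rw [h1]
  simp [Pi.single_apply]

/-- The canonical commutation relations. -/
theorem zS_comm (ħ : ℝ) (a b : Idx n) (φ : 𝓢(E n, ℂ)) :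
    zS ħ a (zS ħ b φ) - zS ħ b (zS ħ a φ) =
      (Complex.I * (ħ : ℂ) * (Matrix.J (Fin n) ℝ a b : ℂ)) • φ := by
  rcases a with j | j <;> rcases b with k | k
  · ext x
    have h : ∀ j k : Fin n, zS ħ (Sum.inl j) (zS ħ (Sum.inl k) φ) x =
        (-Complex.I * (ħ : ℂ)) * ((-Complex.I * (ħ : ℂ)) * fderiv ℝ (fun y => fderiv ℝ φ y
          (EuclideanSpace.single k (1 : ℝ))) x (EuclideanSpace.single j (1 : ℝ))) := by
      intro j k
      rw [zS_inl_apply]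
      congr 1
      have : ⇑(zS ħ (Sum.inl k) φ) = fun y => (-Complex.I * (ħ : ℂ)) * fderiv ℝ φ y
          (EuclideanSpace.single k (1 : ℝ)) := by
        funext y; exact zS_inl_apply ħ k φ y
      rw [this, fderiv_const_mul]
      · rfl
      · exact ((((φ.smooth ⊤).fderiv_right (m := 1) (by norm_cast)).differentiable
          one_ne_zero) x).clm_apply (by fun_prop)
    rw [sub_apply, h, h, fderiv_fderiv_apply_comm (φ.smooth ⊤).contDiffAt]
    simp [Matrix.J]
  · rw [zS_inl_inr_comm]
    by_cases hjk : j = k <;> simp [Matrix.J, hjk]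
  · rw [← neg_sub, zS_inl_inr_comm, ← neg_smul]
    by_cases hjk : j = k
    · simp [Matrix.J, hjk]
    · simp [Matrix.J, hjk, Ne.symm hjk]
  · ext x
    simp only [sub_apply, zS_inr_apply]
    simp [Matrix.J]
    ring

/-! ### The scalar product -/

theorem integrable_braket (φ ψ : 𝓢(E n, ℂ)) :
    Integrable (fun x => (starRingEnd ℂ) (φ x) * ψ x) := by
  have h1 := (rapidOn_schwartzMap φ (F := ℝ) isOpen_univ).clm
    (Complex.conjCLE : ℂ →L[ℝ] ℂ)
  have h2 := rapidOn_schwartzMap ψ (F := ℝ) isOpen_univ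
  exact (h1.slow.mul_rapid h2).integrable (mem_univ 0)

/-- `⟨φ|·⟩` as a linear functional. -/
def braketL (φ : 𝓢(E n, ℂ)) : 𝓢(E n, ℂ) →ₗ[ℂ] ℂ where
  toFun ψ := braket φ ψ
  map_add' ψ χ := by
    simp only [braket, add_apply, mul_add]
    exact integral_add (integrable_braket φ ψ) (integrable_braket φ χ)
  map_smul' c ψ := by
    simp only [braket, smul_apply, smul_eq_mul, RingHom.id_apply]
    rw [← integral_const_mul]
    congr 1; funext x; ring

theorem braketL_apply (φ ψ : 𝓢(E n, ℂ)) : braketL φ ψ = braket φ ψ := rfl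

theorem braketL_conj (φ ψ : 𝓢(E n, ℂ)) : (starRingEnd ℂ) (braketL φ ψ) = braketL ψ φ := by
  simp only [braketL_apply, braket]
  rw [← integral_conj]
  congr 1; funext x; simp [mul_comm]

theorem braketL_smul_left (c : ℂ) (φ ψ : 𝓢(E n, ℂ)) :
    braketL (c • φ) ψ = (starRingEnd ℂ) c * braketL φ ψ := by
  rw [← braketL_conj, map_smul, smul_eq_mul, map_mul, braketL_conj]

theorem braketL_add_left (φ φ' ψ : 𝓢(E n, ℂ)) :
    braketL (φ + φ') ψ = braketL φ ψ + braketL φ' ψ := by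
  rw [← braketL_conj, map_add, map_add, braketL_conj, braketL_conj]

theorem braketL_sum_left {ι : Type} (s : Finset ι) (φ : ι → 𝓢(E n, ℂ)) (ψ : 𝓢(E n, ℂ)) :
    braketL (∑ i ∈ s, φ i) ψ = ∑ i ∈ s, braketL (φ i) ψ := by
  rw [← braketL_conj, map_sum, map_sum]
  exact Finset.sum_congr rfl fun i _ => braketL_conj _ _

theorem braketL_self (φ : 𝓢(E n, ℂ)) : braketL φ φ = (normSq φ : ℂ) := by
  simp only [braketL_apply, braket, normSq]
  rw [← integral_complex_ofReal]
  congr 1; funext x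
  rw [Complex.conj_mul']; push_cast; rfl

/-- The operators `ẑ_a` are symmetric. -/
theorem braketL_zS (ħ : ℝ) (a : Idx n) (φ ψ : 𝓢(E n, ℂ)) :
    braketL (zS ħ a φ) ψ = braketL φ (zS ħ a ψ) := by
  rcases a with j | j
  · have h := SchwartzMap.integral_bilinear_lineDerivOp_right_eq_neg_left (μ := volume) φ ψ
      ((ContinuousLinearMap.mul ℝ ℂ).comp (Complex.conjCLE : ℂ →L[ℝ] ℂ))
      (EuclideanSpace.single j (1 : ℝ))
    have h' : ∫ x, (starRingEnd ℂ) (φ x) * fderiv ℝ ψ x (EuclideanSpace.single j (1 : ℝ)) =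
      -∫ x, (starRingEnd ℂ) (fderiv ℝ φ x (EuclideanSpace.single j (1 : ℝ))) * ψ x := h
    simp only [braketL_apply, braket, zS_inl_apply]
    have e1 : ∀ x, (starRingEnd ℂ) (-Complex.I * (ħ : ℂ) * fderiv ℝ φ x
        (EuclideanSpace.single j (1 : ℝ))) * ψ x = (Complex.I * ħ) * ((starRingEnd ℂ)
          (fderiv ℝ φ x (EuclideanSpace.single j (1 : ℝ))) * ψ x) := fun x => by
      simp only [map_mul, map_neg, Complex.conj_I, Complex.conj_ofReal]; ring
    have e2 : ∀ x, (starRingEnd ℂ) (φ x) * (-Complex.I * (ħ : ℂ) * fderiv ℝ ψ x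
        (EuclideanSpace.single j (1 : ℝ))) = (-(Complex.I * ħ)) * ((starRingEnd ℂ) (φ x) *
          fderiv ℝ ψ x (EuclideanSpace.single j (1 : ℝ))) := fun x => by ring
    simp only [e1, e2]
    rw [integral_const_mul, integral_const_mul, h']
    ring
  · simp only [braketL_apply, braket, zS_inr_apply, map_mul, Complex.conj_ofReal]
    congr 1; funext x; ring

/-! ### Quadratic Hamiltonians -/

/-- `½⟨ẑ, hẑ⟩ + ⟨b, ẑ⟩ + c`. -/
def affineS (ħ : ℝ) (h : Matrix (Idx n) (Idx n) ℝ) (b : Idx n → ℝ) (c : ℝ) :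
    𝓢(E n, ℂ) →ₗ[ℂ] 𝓢(E n, ℂ) :=
  (1 / 2 : ℂ) • ∑ a, ∑ a', (h a a' : ℂ) • (zS ħ a ∘ₗ zS ħ a') + ∑ a, (b a : ℂ) • zS ħ a +
    (c : ℂ) • LinearMap.id

variable {ħ : ℝ} {h : Matrix (Idx n) (Idx n) ℝ} {b : Idx n → ℝ} {c : ℝ}

theorem affineS_apply (φ : 𝓢(E n, ℂ)) : affineS ħ h b c φ =
    (1 / 2 : ℂ) • ∑ a, ∑ a', (h a a' : ℂ) • zS ħ a (zS ħ a' φ) + ∑ a, (b a : ℂ) • zS ħ a φ +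
      (c : ℂ) • φ := by
  simp [affineS, LinearMap.sum_apply]

theorem braketL_affineS (hh : h.IsSymm) (φ ψ : 𝓢(E n, ℂ)) :
    braketL (affineS ħ h b c φ) ψ = braketL φ (affineS ħ h b c ψ) := by
  simp only [affineS_apply, braketL_add_left, braketL_smul_left, braketL_sum_left, braketL_zS,
    map_add, map_smul, map_sum, smul_eq_mul, Complex.conj_ofReal]
  congr 3
  · simp [Complex.conj_ofNat]
  · rw [Finset.sum_comm]
    refine Finset.sum_congr rfl fun a _ => Finset.sum_congr rfl fun a' _ => ?_
    rw [hh.apply]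

/-- The commutator of the Hamiltonian with `ẑ_e`. -/
theorem affineS_zS_comm (hh : h.IsSymm) (e : Idx n) (φ : 𝓢(E n, ℂ)) :
    affineS ħ h b c (zS ħ e φ) - zS ħ e (affineS ħ h b c φ) =
      -(Complex.I * (ħ : ℂ)) • ∑ a, (Matrix.J (Fin n) ℝ e a : ℂ) •
        (∑ a', (h a a' : ℂ) • zS ħ a' φ + (b a : ℂ) • φ) := by
  have h1 : ∀ a φ, zS ħ e (zS ħ a φ) = zS ħ a (zS ħ e φ) +
      (Complex.I * (ħ : ℂ) * (Matrix.J (Fin n) ℝ e a : ℂ)) • φ := fun a φ =>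
    (sub_eq_iff_eq_add'.1 (zS_comm ħ e a φ))
  simp only [affineS_apply, map_add, map_smul, map_sum]
  simp only [h1, map_add, map_smul, smul_add, Finset.sum_add_distrib, Finset.smul_sum, smul_smul]
  -- The commutator hits either of the two factors `ẑ`; by symmetry of `h` both contributions agree
  -- and cancel the factor one half.
  have h2 : ∑ x, ∑ i, ((1 / 2 : ℂ) * ((h x i : ℂ) * (Complex.I * (ħ : ℂ) *
      (Matrix.J (Fin n) ℝ e i : ℂ)))) • zS ħ x φ =
      ∑ x, ∑ i, ((1 / 2 : ℂ) * ((h x i : ℂ) * (Complex.I * (ħ : ℂ) *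
      (Matrix.J (Fin n) ℝ e x : ℂ)))) • zS ħ i φ := by
    rw [Finset.sum_comm]
    refine Finset.sum_congr rfl fun a _ => Finset.sum_congr rfl fun a' _ => ?_
    rw [hh.apply]
  have h3 : ∑ x, ∑ i, (-(Complex.I * (ħ : ℂ)) * ((Matrix.J (Fin n) ℝ e x : ℂ) * (h x i : ℂ))) •
      zS ħ i φ = -((∑ x, ∑ i, ((1 / 2 : ℂ) * ((h x i : ℂ) * (Complex.I * (ħ : ℂ) *
      (Matrix.J (Fin n) ℝ e i : ℂ)))) • zS ħ x φ) +
      ∑ x, ∑ i, ((1 / 2 : ℂ) * ((h x i : ℂ) * (Complex.I * (ħ : ℂ) *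
      (Matrix.J (Fin n) ℝ e x : ℂ)))) • zS ħ i φ) := by
    rw [h2, ← two_smul ℂ, Finset.smul_sum, ← Finset.sum_neg_distrib]
    refine Finset.sum_congr rfl fun a _ => ?_
    rw [Finset.smul_sum, ← Finset.sum_neg_distrib]
    refine Finset.sum_congr rfl fun a' _ => ?_
    rw [smul_smul, ← neg_smul]
    congr 1; ring
  have h4 : ∑ x, (-(Complex.I * (ħ : ℂ)) * ((Matrix.J (Fin n) ℝ e x : ℂ) * (b x : ℂ))) • φ =
      -∑ x, ((b x : ℂ) * (Complex.I * (ħ : ℂ) * (Matrix.J (Fin n) ℝ e x : ℂ))) • φ := by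
    rw [← Finset.sum_neg_distrib]
    refine Finset.sum_congr rfl fun a' _ => ?_
    rw [← neg_smul]
    congr 1; ring
  rw [h3, h4]
  abel

end SchwartzOperators

/-! ### Differentiable curves in Schwartz space -/

section SchwartzCurves

theorem RapidOn.dominatedOn_snd {F W G : Type} [NormedAddCommGroup F] [NormedSpace ℝ F]
    [FiniteDimensional ℝ F] [NormedAddCommGroup W] [NormedSpace ℝ W] [FiniteDimensional ℝ W]
    [MeasurableSpace W] [BorelSpace W] [NormedAddCommGroup G] [NormedSpace ℝ G] {μ : Measure W}
    [μ.IsAddHaarMeasure] {D : Set F} {f : F × W → G} (hf : RapidOn D f) : DominatedOn μ D f := by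
  refine ⟨hf.isOpen, hf.smooth, fun m q₀ hq₀ => ?_⟩
  obtain ⟨K, hK, hqK, hKD⟩ := exists_compact_subset hf.isOpen hq₀
  obtain ⟨C, hC0, hC⟩ := hf.bound m K hKD hK (Module.finrank ℝ W + 1)
  refine ⟨K, mem_interior_iff_mem_nhds.1 hqK,
    fun w => C * ((1 + ‖w‖) ^ (Module.finrank ℝ W + 1))⁻¹,
    (integrable_one_add_norm_pow μ).const_mul C, Eventually.of_forall fun w τ hτ => ?_⟩
  beta_reduce
  rw [← div_eq_mul_inv, le_div_iff₀ (by positivity), mul_comm]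
  exact hC τ hτ w

theorem RapidOn.differentiableAt_prod {F V G : Type} [NormedAddCommGroup F] [NormedSpace ℝ F]
    [NormedAddCommGroup V] [NormedSpace ℝ V] [NormedAddCommGroup G] [NormedSpace ℝ G] {D : Set F}
    {f : F × V → G} (hf : RapidOn D f) {τ : F} (hτ : τ ∈ D) (x : V) :
    DifferentiableAt ℝ f (τ, x) :=
  (hf.smooth.contDiffAt ((isOpen_prod_univ hf.isOpen).mem_nhds
    ⟨hτ, mem_univ x⟩)).differentiableAt (by simp)

theorem RapidOn.contDiffOn_integral {F W G : Type} [NormedAddCommGroup F] [NormedSpace ℝ F]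
    [FiniteDimensional ℝ F] [NormedAddCommGroup W] [NormedSpace ℝ W] [FiniteDimensional ℝ W]
    [MeasurableSpace W] [BorelSpace W] [NormedAddCommGroup G] [NormedSpace ℝ G] {μ : Measure W}
    [μ.IsAddHaarMeasure] {D : Set F} {f : F × W → G} (hf : RapidOn D f) :
    ContDiffOn ℝ ∞ (fun q => ∫ w, f (q, w) ∂μ) D :=
  (hf.dominatedOn_snd (μ := μ)).contDiffOn

variable {n : ℕ}

/-- `U` is a smooth curve in Schwartz space with the derivative `U'`. -/
structure SchwartzCurve (T : Set ℝ) (U U' : ℝ → 𝓢(E n, ℂ)) : Prop where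
  rapid : RapidOn T (fun q : ℝ × E n => U q.1 q.2)
  hasDerivAt : ∀ t ∈ T, ∀ x, HasDerivAt (fun t => U t x) (U' t x) t

variable {T : Set ℝ} {U U' V V' : ℝ → 𝓢(E n, ℂ)}

theorem SchwartzCurve.fderiv_eq (hU : SchwartzCurve T U U') {t : ℝ} (ht : t ∈ T) (x : E n) :
    fderiv ℝ (fun q : ℝ × E n => U q.1 q.2) (t, x) (1, 0) = U' t x := by
  have h1 := HasFDerivAt.comp_hasDerivAt (f := fun t => (t, x)) t
    (hU.rapid.differentiableAt_prod ht x).hasFDerivAt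
    ((hasDerivAt_id t).prodMk (hasDerivAt_const t x))
  exact h1.unique (hU.hasDerivAt t ht x)

theorem SchwartzCurve.rapid_deriv (hU : SchwartzCurve T U U') :
    RapidOn T (fun q : ℝ × E n => U' q.1 q.2) :=
  (hU.rapid.fderiv_apply (1, 0)).congr fun _ ht x => (hU.fderiv_eq ht x).symm

theorem exists_schwartzCurve {u : ℝ × E n → ℂ} (hu : RapidOn T u) :
    ∃ U U' : ℝ → 𝓢(E n, ℂ), SchwartzCurve T U U' ∧ ∀ t ∈ T, ∀ x, U t x = u (t, x) := by
  classical
  have h1 := hu.fderiv_apply ((1, 0) : ℝ × E n)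
  choose! U hU using fun t (ht : t ∈ T) => hu.exists_schwartzMap ht
  choose! U' hU' using fun t (ht : t ∈ T) => h1.exists_schwartzMap ht
  refine ⟨U, U', ⟨hu.congr fun t ht x => hU t ht x, fun t ht x => ?_⟩, hU⟩
  have h2 := HasFDerivAt.comp_hasDerivAt (f := fun t => (t, x)) t
    (hu.differentiableAt_prod ht x).hasFDerivAt
    ((hasDerivAt_id t).prodMk (hasDerivAt_const t x))
  rw [hU' t ht x]
  refine h2.congr_of_eventuallyEq ?_
  filter_upwards [hu.isOpen.mem_nhds ht] with r hr
  exact hU r hr x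

theorem SchwartzCurve.zS (hU : SchwartzCurve T U U') (ħ : ℝ) (a : Idx n) :
    SchwartzCurve T (fun t => zS ħ a (U t)) (fun t => zS ħ a (U' t)) := by
  have ho := hU.rapid.isOpen
  rcases a with j | j
  · have hsl : ∀ {V : ℝ → 𝓢(E n, ℂ)}, RapidOn T (fun q : ℝ × E n => V q.1 q.2) →
        ∀ t ∈ T, ∀ x, NonlocalGPE.zS ħ (Sum.inl j) (V t) x = -Complex.I * (ħ : ℂ) *
        fderiv ℝ (fun q : ℝ × E n => V q.1 q.2) (t, x) (0, EuclideanSpace.single j (1 : ℝ)) := by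
      intro V hV t ht x
      rw [zS_inl_apply]
      congr 1
      have := HasFDerivAt.comp (f := fun x => (t, x)) x
        (hV.differentiableAt_prod ht x).hasFDerivAt (hasFDerivAt_prodMk_right t x)
      have h2 : fderiv ℝ (fun x => V t x) x = _ := this.fderiv
      rw [h2]
      rfl
    refine ⟨((SlowOn.const ho (-Complex.I * (ħ : ℂ))).mul_rapid (hU.rapid.fderiv_apply
      (0, EuclideanSpace.single j (1 : ℝ)))).congr (hsl hU.rapid), fun t ht x => ?_⟩
    rw [hsl hU.rapid_deriv t ht x]
    have h3 : HasDerivAt (fun t => -Complex.I * (ħ : ℂ) * fderiv ℝ (fun q : ℝ × E n => U q.1 q.2)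
        (t, x) (0, EuclideanSpace.single j (1 : ℝ))) (-Complex.I * (ħ : ℂ) *
        fderiv ℝ (fun q : ℝ × E n => U' q.1 q.2) (t, x)
          (0, EuclideanSpace.single j (1 : ℝ))) t := by
      refine HasDerivAt.const_mul _ ?_
      have hd := (hU.rapid.fderiv_apply (0, EuclideanSpace.single j (1 : ℝ))
        ).differentiableAt_prod ht x
      have h4 := HasFDerivAt.comp_hasDerivAt (f := fun t => (t, x)) t hd.hasFDerivAt
        ((hasDerivAt_id t).prodMk (hasDerivAt_const t x))
      refine h4.congr_deriv ?_
      -- Time and space derivatives commute on the jointly smooth function, so `ẑ` may be applied to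
      -- the time derivative.
      rw [fderiv_fderiv_apply_comm (hU.rapid.smooth.contDiffAt
        ((isOpen_prod_univ ho).mem_nhds ⟨ht, mem_univ x⟩))]
      refine congrArg (fun L : ℝ × E n →L[ℝ] ℂ => L (0, EuclideanSpace.single j (1 : ℝ)))
        (Filter.EventuallyEq.fderiv_eq ?_)
      filter_upwards [(isOpen_prod_univ ho).mem_nhds (⟨ht, mem_univ x⟩ :
        (t, x) ∈ T ×ˢ (univ : Set (E n)))] with q hq
      exact hU.fderiv_eq hq.1 q.2
    refine h3.congr_of_eventuallyEq ?_
    filter_upwards [ho.mem_nhds ht] with r hr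
    exact hsl hU.rapid r hr x
  · refine ⟨((slowOn_coord ho j).mul_rapid hU.rapid).congr fun t _ x => zS_inr_apply ħ j (U t) x,
      fun t ht x => ?_⟩
    simp only [zS_inr_apply]
    exact (hU.hasDerivAt t ht x).const_mul _

theorem SchwartzCurve.hasDerivAt_braketL (hU : SchwartzCurve T U U') (hV : SchwartzCurve T V V')
    {t : ℝ} (ht : t ∈ T) :
    HasDerivAt (fun t => braketL (U t) (V t)) (braketL (U' t) (V t) + braketL (U t) (V' t)) t := by
  have h1 : RapidOn T (fun q : ℝ × E n => (starRingEnd ℂ) (U q.1 q.2) * V q.1 q.2) :=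
    (hU.rapid.clm (Complex.conjCLE : ℂ →L[ℝ] ℂ)).slow.mul_rapid hV.rapid
  have h2 := (h1.dominatedOn_snd (μ := volume)).hasFDerivAt ht
  refine h2.hasDerivAt.congr_deriv ?_
  have h3 := ((h1.dominatedOn_snd (μ := volume)).fderiv.clm
    ((ContinuousLinearMap.compL ℝ ℝ (ℝ × E n) ℂ).flip (ContinuousLinearMap.inl ℝ ℝ (E n)))
    ).integrable_slice ht
  refine (ContinuousLinearMap.integral_apply h3 (1 : ℝ)).trans ?_
  simp only [braketL_apply, braket]
  rw [← integral_add (integrable_braket _ _) (integrable_braket _ _)]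
  congr 1; funext x
  have h4 := HasFDerivAt.comp_hasDerivAt (f := fun t => (t, x)) t
    (h1.differentiableAt_prod ht x).hasFDerivAt
    ((hasDerivAt_id t).prodMk (hasDerivAt_const t x))
  have h5 := ((Complex.conjCLE : ℂ →L[ℝ] ℂ).hasFDerivAt.comp_hasDerivAt t
    (hU.hasDerivAt t ht x)).mul (hV.hasDerivAt t ht x)
  exact h4.unique h5

/-! ### Ehrenfest equations -/

/-- `⟨φ|ẑ|φ⟩`. -/
def moment₁ (ħ : ℝ) (φ : 𝓢(E n, ℂ)) (a : Idx n) : ℝ := (braketL φ (NonlocalGPE.zS ħ a φ)).re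

/-- `½⟨φ|ẑ_a ẑ_b + ẑ_b ẑ_a|φ⟩`. -/
def moment₂ (ħ : ℝ) (φ : 𝓢(E n, ℂ)) : Matrix (Idx n) (Idx n) ℝ :=
  Matrix.of fun a b => (braketL φ (NonlocalGPE.zS ħ a (NonlocalGPE.zS ħ b φ))).re

theorem braketL_zS_self (ħ : ℝ) (φ : 𝓢(E n, ℂ)) (a : Idx n) :
    braketL φ (NonlocalGPE.zS ħ a φ) = (moment₁ ħ φ a : ℂ) := by
  refine (Complex.conj_eq_iff_re.1 ?_).symm
  rw [braketL_conj, braketL_zS]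

theorem moment₂_isSymm (ħ : ℝ) (φ : 𝓢(E n, ℂ)) : (moment₂ ħ φ).IsSymm := by
  ext a b
  simp only [moment₂, Matrix.transpose_apply, Matrix.of_apply]
  rw [← Complex.conj_re, braketL_conj, braketL_zS, braketL_zS]

variable {ħ : ℝ} {h : ℝ → Matrix (Idx n) (Idx n) ℝ} {b : ℝ → Idx n → ℝ} {c : ℝ → ℝ}

/-- The symmetric Hamiltonian cancels between the two slots of the scalar product, leaving only `X`,
the failure of `V` to solve the same equation. For `V = U` this is conservation of the norm; for `V
= ẑ U` or `V = ẑ ẑ U` it is the expectation of a commutator. -/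
theorem SchwartzCurve.ehrenfest (hU : SchwartzCurve T U U') (hV : SchwartzCurve T V V')
    (hħ : ħ ≠ 0) (hh : ∀ t, (h t).IsSymm)
    (hSchr : ∀ t ∈ T, (Complex.I * (ħ : ℂ)) • U' t = affineS ħ (h t) (b t) (c t) (U t))
    {X : 𝓢(E n, ℂ)} {t : ℝ} (ht : t ∈ T)
    (hX : (Complex.I * (ħ : ℂ)) • V' t = affineS ħ (h t) (b t) (c t) (V t) +
      (Complex.I * (ħ : ℂ)) • X) :
    HasDerivAt (fun t => braketL (U t) (V t)) (braketL (U t) X) t := by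
  refine (hU.hasDerivAt_braketL hV ht).congr_deriv ?_
  have hne : (Complex.I * (ħ : ℂ)) ≠ 0 := by simp [hħ]
  refine mul_left_cancel₀ hne ?_
  have h1 : (Complex.I * (ħ : ℂ)) * braketL (U' t) (V t) =
      -braketL (affineS ħ (h t) (b t) (c t) (U t)) (V t) := by
    rw [← hSchr t ht, braketL_smul_left]
    simp
  rw [mul_add, h1, ← smul_eq_mul _ (braketL (U t) (V' t)), ← map_smul, hX, map_add, map_smul,
    braketL_affineS (hh t), smul_eq_mul]
  ring

theorem SchwartzCurve.normSq_eq (hU : SchwartzCurve T U U') (hħ : ħ ≠ 0)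
    (hh : ∀ t, (h t).IsSymm) (hT : T.OrdConnected)
    (hSchr : ∀ t ∈ T, (Complex.I * (ħ : ℂ)) • U' t = affineS ħ (h t) (b t) (c t) (U t))
    {s t : ℝ} (hs : s ∈ T) (ht : t ∈ T) : normSq (U t) = normSq (U s) := by
  have hd : ∀ t ∈ T, HasDerivAt (fun t => braketL (U t) (U t)) 0 t := fun t ht => by
    have := hU.ehrenfest hU hħ hh hSchr ht (X := 0) (by simpa using hSchr t ht)
    simpa using this
  have := linear_ode_unique (V := ℂ) (L := fun _ => 0) continuous_const hT hU.rapid.isOpen hs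
    (x := fun t => braketL (U t) (U t)) (y := fun _ => braketL (U s) (U s)) (fun _ => 0)
    (fun t ht => by simpa using hd t ht) (fun t _ => by simpa using hasDerivAt_const t _) rfl t ht
  simp only [braketL_self] at this
  exact_mod_cast this

/-- The commutator of a quadratic Hamiltonian with `ẑ` is affine in `ẑ`, so the equation closes on
the first moments and the norm. -/
theorem SchwartzCurve.hasDerivAt_moment₁ (hU : SchwartzCurve T U U') (hħ : ħ ≠ 0)
    (hh : ∀ t, (h t).IsSymm)
    (hSchr : ∀ t ∈ T, (Complex.I * (ħ : ℂ)) • U' t = affineS ħ (h t) (b t) (c t) (U t))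
    {t : ℝ} (ht : t ∈ T) (e : Idx n) :
    HasDerivAt (fun t => moment₁ ħ (U t) e) ((Matrix.J (Fin n) ℝ *ᵥ
      (h t *ᵥ moment₁ ħ (U t) + normSq (U t) • b t)) e) t := by
  have h1 := hU.ehrenfest (hU.zS ħ e) hħ hh hSchr ht
    (X := ∑ a, (Matrix.J (Fin n) ℝ e a : ℂ) • (∑ a', (h t a a' : ℂ) • NonlocalGPE.zS ħ a' (U t) +
      (b t a : ℂ) • U t)) (by
      rw [← map_smul, hSchr t ht]
      have := affineS_zS_comm (ħ := ħ) (b := b t) (c := c t) (hh t) e (U t)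
      rw [sub_eq_iff_eq_add, neg_smul] at this
      rw [this]
      abel)
  refine (Complex.reCLM.hasFDerivAt.comp_hasDerivAt t h1).congr_deriv ?_
  simp only [map_sum, map_add, map_smul, braketL_zS_self, braketL_self, smul_eq_mul,
    Complex.reCLM_apply, Matrix.mulVec, dotProduct, Pi.add_apply, Pi.smul_apply]
  refine Finset.sum_congr rfl fun a _ => ?_
  norm_cast
  rw [mul_comm (b t a)]

/-- Commuting with `ẑ_e ẑ_f` obeys the product rule. The commutator with `ẑ_e` gives the terms with
`J` on the left, that with `ẑ_f` the terms with `J` on the right. -/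
theorem SchwartzCurve.hasDerivAt_moment₂ (hU : SchwartzCurve T U U') (hħ : ħ ≠ 0)
    (hh : ∀ t, (h t).IsSymm)
    (hSchr : ∀ t ∈ T, (Complex.I * (ħ : ℂ)) • U' t = affineS ħ (h t) (b t) (c t) (U t))
    {t : ℝ} (ht : t ∈ T) (e f : Idx n) :
    HasDerivAt (fun t => moment₂ ħ (U t) e f)
      ((Matrix.J (Fin n) ℝ * (h t * moment₂ ħ (U t) + Matrix.vecMulVec (b t) (moment₁ ħ (U t)))
        - (moment₂ ħ (U t) * h t + Matrix.vecMulVec (moment₁ ħ (U t)) (b t)) *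
          Matrix.J (Fin n) ℝ) e f) t := by
  set K : Idx n → 𝓢(E n, ℂ) → 𝓢(E n, ℂ) := fun e φ => ∑ a, (Matrix.J (Fin n) ℝ e a : ℂ) •
    (∑ a', (h t a a' : ℂ) • NonlocalGPE.zS ħ a' φ + (b t a : ℂ) • φ) with hK
  have hcomm : ∀ e φ, NonlocalGPE.zS ħ e (affineS ħ (h t) (b t) (c t) φ) =
      affineS ħ (h t) (b t) (c t) (NonlocalGPE.zS ħ e φ) + (Complex.I * (ħ : ℂ)) • K e φ := by
    intro e φ
    have := affineS_zS_comm (ħ := ħ) (b := b t) (c := c t) (hh t) e φ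
    rw [sub_eq_iff_eq_add, neg_smul] at this
    rw [this]
    abel
  have h1 := hU.ehrenfest ((hU.zS ħ f).zS ħ e) hħ hh hSchr ht
    (X := K e (NonlocalGPE.zS ħ f (U t)) + NonlocalGPE.zS ħ e (K f (U t))) (by
      rw [← map_smul, ← map_smul, hSchr t ht, hcomm, map_add, hcomm, map_smul]
      rw [smul_add]
      abel)
  refine (Complex.reCLM.hasFDerivAt.comp_hasDerivAt t h1).congr_deriv ?_
  -- Antisymmetry of `J` turns summation over the row `f` into right multiplication by `J`, with a
  -- minus sign.
  have hJ : ∀ a, Matrix.J (Fin n) ℝ a f = -Matrix.J (Fin n) ℝ f a := by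
    intro a
    have := congrFun (congrFun (Matrix.J_transpose (Fin n) ℝ) f) a
    rwa [Matrix.transpose_apply, Matrix.neg_apply] at this
  have h2 : (braketL (U t) (K e (NonlocalGPE.zS ħ f (U t)))).re =
      ∑ a, Matrix.J (Fin n) ℝ e a * (∑ a', h t a a' * moment₂ ħ (U t) a' f +
        b t a * moment₁ ħ (U t) f) := by
    simp only [hK, map_sum, map_add, map_smul, smul_eq_mul, Complex.re_sum, Complex.re_ofReal_mul,
      Complex.add_re, moment₂, moment₁, Matrix.of_apply]
  have h3 : (braketL (U t) (NonlocalGPE.zS ħ e (K f (U t)))).re =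
      ∑ a, Matrix.J (Fin n) ℝ f a * (∑ a', h t a a' * moment₂ ħ (U t) e a' +
        b t a * moment₁ ħ (U t) e) := by
    simp only [hK, map_sum, map_add, map_smul, smul_eq_mul, Complex.re_sum, Complex.re_ofReal_mul,
      Complex.add_re, moment₂, moment₁, Matrix.of_apply]
  rw [Complex.reCLM_apply, map_add, Complex.add_re, h2, h3, Matrix.sub_apply, sub_eq_add_neg]
  congr 1
  · simp only [Matrix.mul_apply, Matrix.add_apply, Matrix.vecMulVec_apply]
    rw [← Finset.sum_neg_distrib]
    refine Finset.sum_congr rfl fun a _ => ?_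
    have : ∑ a', h t a a' * moment₂ ħ (U t) e a' = ∑ a', moment₂ ħ (U t) e a' * h t a' a :=
      Finset.sum_congr rfl fun a' _ => by rw [(hh t).apply, mul_comm]
    rw [this, hJ]
    ring

end SchwartzCurves

/-! ### The Gross–Pitaevskii equation as a family of linear equations -/

section Linearization

variable {n : ℕ}

theorem eq_zero_of_normSq_eq_zero {φ : 𝓢(E n, ℂ)} (h : normSq φ = 0) : φ = 0 := by
  have hi : Integrable fun x => ‖φ x‖ ^ 2 := by
    have := (integrable_braket φ φ).norm
    refine this.congr (Eventually.of_forall fun x => ?_)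
    simp [sq]
  have h1 := (integral_eq_zero_iff_of_nonneg (fun x => by positivity) hi).1 h
  have h2 : (fun x => ‖φ x‖ ^ 2) = fun _ => 0 :=
    Continuous.ae_eq_iff_eq volume (φ.continuous.norm.pow 2) continuous_const |>.1 h1
  ext x
  have := congrFun h2 x
  simpa using this

theorem normSq_pos {φ : 𝓢(E n, ℂ)} (h : φ ≠ 0) : 0 < normSq φ :=
  lt_of_le_of_ne (integral_nonneg fun x => by positivity) fun h0 =>
    h (eq_zero_of_normSq_eq_zero h0.symm)

theorem meanZ_eq (ħ : ℝ) (φ : 𝓢(E n, ℂ)) (a : Idx n) :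
    meanZ ħ φ a = moment₁ ħ φ a / normSq φ := by
  rw [meanZ, moment₁, braketL_apply, coe_zS]

/-- The Hamilton–Ehrenfest system is written in centred moments, whereas `⟨φ|ẑẑ|φ⟩` is what the
evolution of a state controls directly. This is the passage between the two; the symmetrization in
`covZ` matches the symmetry of the real parts in `moment₂`. -/
theorem covZ_eq (ħ : ℝ) {φ : 𝓢(E n, ℂ)} (h : φ ≠ 0) (a b : Idx n) :
    covZ ħ φ a b = moment₂ ħ φ a b / normSq φ - meanZ ħ φ a * meanZ ħ φ b := by
  set c := meanZ ħ φ with hc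
  have hN := (normSq_pos h).ne'
  have h1 : ∀ a (ψ : 𝓢(E n, ℂ)), dzOp ħ c a ψ = ⇑(zS ħ a ψ - (c a : ℂ) • ψ) := by
    intro a ψ
    funext x
    rw [sub_apply, smul_apply, smul_eq_mul, coe_zS, dzOp]
  have h2 : ∀ a, moment₁ ħ φ a = c a * normSq φ := by
    intro a
    rw [hc, meanZ_eq]; field_simp
  have h3 : ∀ a b, (braketL φ ((zS ħ a) ((zS ħ b) φ - (c b : ℂ) • φ) - (c a : ℂ) •
      ((zS ħ b) φ - (c b : ℂ) • φ))).re = moment₂ ħ φ a b - c a * c b * normSq φ := by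
    intro a b
    simp only [map_sub, map_smul, smul_eq_mul, braketL_zS_self, h2, braketL_self, Complex.sub_re,
      Complex.re_ofReal_mul, Complex.ofReal_re]
    simp only [moment₂, Matrix.of_apply]
    ring
  have h4 : (fun x => dzOp ħ c a (dzOp ħ c b φ) x + dzOp ħ c b (dzOp ħ c a φ) x) =
      ⇑(((zS ħ a) ((zS ħ b) φ - (c b : ℂ) • φ) - (c a : ℂ) • ((zS ħ b) φ - (c b : ℂ) • φ)) +
        ((zS ħ b) ((zS ħ a) φ - (c a : ℂ) • φ) - (c b : ℂ) • ((zS ħ a) φ - (c a : ℂ) • φ))) := by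
    funext x
    rw [h1, h1, h1, h1]
    rfl
  simp only [covZ, Matrix.of_apply]
  rw [← hc, h4, ← braketL_apply, map_add, Complex.add_re, h3, h3,
    ← (moment₂_isSymm ħ φ).apply a b]
  field_simp
  ring

variable (Q : QuadraticModel n)

/-- The coefficients of the terms of first order of the effective linear Hamiltonian. -/
def QuadraticModel.effLinear (ϰ ħ t : ℝ) (φ : 𝓢(E n, ℂ)) : Idx n → ℝ :=
  Q.Hz t + ϰ • (Q.Wzw t *ᵥ moment₁ ħ φ)

/-- The scalar term of the effective linear Hamiltonian. -/
def QuadraticModel.effConst (ϰ ħ t : ℝ) (φ : 𝓢(E n, ℂ)) : ℝ :=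
  1 / 2 * ϰ * (Q.Www t * moment₂ ħ φ).trace

theorem zOp_mul_const (ħ : ℝ) (a : Idx n) (φ : 𝓢(E n, ℂ)) (k : ℂ) :
    zOp ħ a (fun x => φ x * k) = fun x => zS ħ a φ x * k := by
  funext x
  rw [coe_zS]
  rcases a with j | j
  · simp only [zOp]
    rw [fderiv_mul_const φ.differentiableAt]
    simp only [smul_apply, smul_eq_mul]
    ring
  · simp only [zOp]
    ring

theorem zOp_const_mul (ħ : ℝ) (a : Idx n) (φ : 𝓢(E n, ℂ)) (k : ℂ) :
    zOp ħ a (fun x => k * φ x) = fun x => k * zS ħ a φ x := by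
  simpa only [mul_comm k] using zOp_mul_const ħ a φ k

/-- The expectation of `ẑ_a ẑ_b` changes into its conjugate when `a` and `b` are exchanged. Against
a symmetric matrix the imaginary parts therefore cancel and only the symmetrized moments remain. -/
theorem sum_smul_braketL_zS_zS (ħ : ℝ) {W : Matrix (Idx n) (Idx n) ℝ} (hW : W.IsSymm)
    (φ : 𝓢(E n, ℂ)) :
    ∑ a, ∑ b, (W a b : ℂ) * braketL φ (zS ħ a (zS ħ b φ)) =
      ((W * moment₂ ħ φ).trace : ℂ) := by
  have h1 : (starRingEnd ℂ) (∑ a, ∑ b, (W a b : ℂ) * braketL φ (zS ħ a (zS ħ b φ))) =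
      ∑ a, ∑ b, (W a b : ℂ) * braketL φ (zS ħ a (zS ħ b φ)) := by
    simp only [map_sum, map_mul, Complex.conj_ofReal, braketL_conj, braketL_zS]
    rw [Finset.sum_comm]
    simp only [hW.apply]
  rw [← Complex.conj_eq_iff_re.1 h1]
  congr 1
  simp only [Complex.re_sum, Complex.re_ofReal_mul, Matrix.trace, Matrix.diag, Matrix.mul_apply]
  refine Finset.sum_congr rfl fun a _ => Finset.sum_congr rfl fun b _ => ?_
  rw [(moment₂_isSymm ħ φ).apply a b]
  rfl

/-- On a product function each operator acts on its own factor, so the integral over `y` replaces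
every `ŵ` by a moment of `φ`, and the absence of `ŵ` by the squared norm. -/
theorem QuadraticModel.meanField_eq (ħ t : ℝ) (φ : 𝓢(E n, ℂ)) (x : E n) :
    Q.meanField ħ t φ φ x =
      (1 / 2 : ℂ) * (∑ a, ∑ b, (Q.Wzz t a b : ℂ) * zS ħ a (zS ħ b φ) x) * (normSq φ : ℂ) +
      ∑ a, ((Q.Wzw t *ᵥ moment₁ ħ φ) a : ℂ) * zS ħ a φ x +
      (1 / 2 : ℂ) * ((Q.Www t * moment₂ ħ φ).trace : ℂ) * φ x := by
  have hF : ∀ (a : Idx n) (ψ χ : 𝓢(E n, ℂ)), zOpFst ħ a (fun x' y' => ψ x' * χ y') =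
      fun x' y' => zS ħ a ψ x' * χ y' := fun a ψ χ => by
    funext x' y'
    exact congrFun (zOp_mul_const ħ a ψ (χ y')) x'
  have hS : ∀ (a : Idx n) (ψ χ : 𝓢(E n, ℂ)), wOpSnd ħ a (fun x' y' => ψ x' * χ y') =
      fun x' y' => ψ x' * zS ħ a χ y' := fun a ψ χ => by
    funext x' y'
    exact congrFun (zOp_const_mul ħ a χ (ψ x')) y'
  -- With `x` frozen, the two-particle function is a Schwartz function of `y`, and the mean field
  -- becomes a single scalar product with it.
  set χ : 𝓢(E n, ℂ) := ((1 / 2 : ℂ) * ∑ a, ∑ b, (Q.Wzz t a b : ℂ) * zS ħ a (zS ħ b φ) x) • φ +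
    ∑ a, ∑ b, ((Q.Wzw t a b : ℂ) * zS ħ a φ x) • zS ħ b φ +
    ((1 / 2 : ℂ) * φ x) • ∑ a, ∑ b, (Q.Www t a b : ℂ) • zS ħ a (zS ħ b φ) with hχ
  have h1 : Q.meanField ħ t φ φ x = braketL φ χ := by
    rw [QuadraticModel.meanField, braketL_apply, braket]
    congr 1; funext y; congr 1
    rw [QuadraticModel.pairOp, hχ]
    simp only [hF, hS, add_apply, smul_apply, sum_apply, smul_eq_mul]
    congr 1
    · congr 1
      · rw [mul_assoc, Finset.sum_mul]
        congr 1
        refine Finset.sum_congr rfl fun a _ => ?_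
        rw [Finset.sum_mul]
        exact Finset.sum_congr rfl fun b _ => by ring
      · exact Finset.sum_congr rfl fun a _ => Finset.sum_congr rfl fun b _ => by ring
    · simp only [Finset.mul_sum]
      exact Finset.sum_congr rfl fun a _ => Finset.sum_congr rfl fun b _ => by ring
  rw [h1, hχ]
  simp only [map_add, map_smul, map_sum, smul_eq_mul, braketL_self, braketL_zS_self]
  rw [sum_smul_braketL_zS_zS ħ (Q.symm_Www t)]
  congr 1
  · congr 1
    refine Finset.sum_congr rfl fun a _ => ?_
    simp only [Matrix.mulVec, dotProduct]
    push_cast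
    rw [Finset.sum_mul]
    exact Finset.sum_congr rfl fun b _ => by ring
  · ring

/-- The nonlinear Hamiltonian acts as a linear one, whose coefficients depend on the moments. -/
theorem QuadraticModel.gpe_operator_eq (ϰ ħ t : ℝ) (φ : 𝓢(E n, ℂ)) (x : E n) :
    Q.hamiltonian ħ t φ x + (ϰ : ℂ) * Q.meanField ħ t φ φ x =
      affineS ħ (Q.hess (ϰ * normSq φ) t) (Q.effLinear ϰ ħ t φ) (Q.effConst ϰ ħ t φ) φ x := by
  rw [Q.meanField_eq, affineS_apply]
  simp only [QuadraticModel.hamiltonian, add_apply, smul_apply, sum_apply, smul_eq_mul, ← coe_zS]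
  simp only [QuadraticModel.hess, QuadraticModel.effLinear, QuadraticModel.effConst,
    Matrix.add_apply, Matrix.smul_apply, Pi.add_apply, Pi.smul_apply, smul_eq_mul]
  push_cast
  simp only [add_mul, Finset.sum_add_distrib, mul_add]
  have h1 : ∑ a, ∑ b, (ϰ : ℂ) * (normSq φ : ℂ) * (Q.Wzz t a b : ℂ) * zS ħ a (zS ħ b φ) x =
      (ϰ : ℂ) * (normSq φ : ℂ) * ∑ a, ∑ b, (Q.Wzz t a b : ℂ) * zS ħ a (zS ħ b φ) x := by
    simp only [Finset.mul_sum, mul_assoc]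
  have h2 : ∑ a, (ϰ : ℂ) * ((Q.Wzw t *ᵥ moment₁ ħ φ) a : ℂ) * zS ħ a φ x =
      (ϰ : ℂ) * ∑ a, ((Q.Wzw t *ᵥ moment₁ ħ φ) a : ℂ) * zS ħ a φ x := by
    simp only [Finset.mul_sum, mul_assoc]
  rw [h1, h2]
  ring

theorem QuadraticModel.SolvesGPE.schwartzCurve {ϰ ħ : ℝ} {T : Set ℝ} {Ψ : ℝ → E n → ℂ}
    (h : Q.SolvesGPE ϰ ħ T Ψ) {U U' : ℝ → 𝓢(E n, ℂ)} (hU : SchwartzCurve T U U')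
    (hUΨ : ∀ t ∈ T, ∀ x, U t x = Ψ t x) {t : ℝ} (ht : t ∈ T) :
    (Complex.I * (ħ : ℂ)) • U' t = affineS ħ (Q.hess (ϰ * normSq (U t)) t)
      (Q.effLinear ϰ ħ t (U t)) (Q.effConst ϰ ħ t (U t)) (U t) := by
  ext x
  have h1 := (h t ht x).2
  have h2 : Ψ t = U t := funext fun x => (hUΨ t ht x).symm
  have h3 : deriv (fun τ => Ψ τ x) t = U' t x := by
    refine HasDerivAt.deriv ((hU.hasDerivAt t ht x).congr_of_eventuallyEq ?_)
    filter_upwards [hU.rapid.isOpen.mem_nhds ht] with r hr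
    exact (hUΨ r hr x).symm
  rw [h2, h3, add_assoc, Q.gpe_operator_eq] at h1
  rw [smul_apply, smul_eq_mul]
  linear_combination -h1

theorem QuadraticModel.solvesGPE_of_schwartzCurve {ϰ ħ : ℝ} {T : Set ℝ} {U U' : ℝ → 𝓢(E n, ℂ)}
    (hU : SchwartzCurve T U U') (h : ∀ t ∈ T, (Complex.I * (ħ : ℂ)) • U' t =
      affineS ħ (Q.hess (ϰ * normSq (U t)) t)
        (Q.effLinear ϰ ħ t (U t)) (Q.effConst ϰ ħ t (U t)) (U t)) :
    Q.SolvesGPE ϰ ħ T (fun t => U t) := by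
  intro t ht x
  have h1 := hU.hasDerivAt t ht x
  refine ⟨h1.differentiableAt, ?_⟩
  rw [h1.deriv, add_assoc, Q.gpe_operator_eq, ← h t ht, smul_apply, smul_eq_mul]
  ring

end Linearization

/-! ### Uniqueness -/

section Uniqueness

/-- Read as a vector indexed by pairs, the unknown solves a linear equation whose generator is the
Kronecker sum `X ⊗ 1 + 1 ⊗ X`. -/
theorem lyapunov_unique {ι : Type} [Fintype ι] [DecidableEq ι] {X : ℝ → Matrix ι ι ℝ}
    (hX : ∀ a b, ContDiff ℝ ∞ fun t => X t a b) {T : Set ℝ} (hT : T.OrdConnected) (hT' : IsOpen T)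
    {s : ℝ} (hs : s ∈ T) {M M' : ℝ → Matrix ι ι ℝ} (f : ℝ → Matrix ι ι ℝ)
    (hM : ∀ t ∈ T, ∀ a b, HasDerivAt (fun t => M t a b) ((X t * M t + M t * (X t)ᵀ + f t) a b) t)
    (hM' : ∀ t ∈ T, ∀ a b,
      HasDerivAt (fun t => M' t a b) ((X t * M' t + M' t * (X t)ᵀ + f t) a b) t)
    (h0 : M s = M' s) : ∀ t ∈ T, M t = M' t := by
  set K : ℝ → Matrix (ι × ι) (ι × ι) ℝ := fun t => Matrix.of fun p q =>
    X t p.1 q.1 * (if p.2 = q.2 then 1 else 0) + (if p.1 = q.1 then 1 else 0) * X t p.2 q.2 with hK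
  have hKs : ∀ p q, ContDiff ℝ ∞ fun t => K t p q := fun p q =>
    ((hX _ _).mul contDiff_const).add (contDiff_const.mul (hX _ _))
  have hKM : ∀ t (N : Matrix ι ι ℝ), K t *ᵥ (fun p => N p.1 p.2) =
      fun p => (X t * N + N * (X t)ᵀ) p.1 p.2 := by
    intro t N
    funext p
    simp only [hK, Matrix.mulVec, dotProduct, Matrix.of_apply, add_mul, Finset.sum_add_distrib,
      Fintype.sum_prod_type, Matrix.add_apply, Matrix.mul_apply, Matrix.transpose_apply]
    congr 1
    · refine Finset.sum_congr rfl fun a _ => ?_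
      simp
    · rw [Finset.sum_comm]
      refine Finset.sum_congr rfl fun a _ => ?_
      simp [mul_comm]
  have key : ∀ {N : ℝ → Matrix ι ι ℝ}, (∀ t ∈ T, ∀ a b, HasDerivAt (fun t => N t a b)
      ((X t * N t + N t * (X t)ᵀ + f t) a b) t) → ∀ t ∈ T,
      HasDerivAt (fun t => fun p : ι × ι => N t p.1 p.2)
        (entriesCLM (K t) (fun p : ι × ι => N t p.1 p.2) + fun p => f t p.1 p.2) t := by
    intro N hN t ht
    refine hasDerivAt_pi.2 fun p => ?_
    rw [entriesCLM_apply, hKM]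
    exact hN t ht p.1 p.2
  intro t ht
  have := linear_ode_unique (contDiff_entriesCLM hKs).continuous hT hT' hs
    (fun t p => f t p.1 p.2) (key hM) (key hM') (by simp only [h0]) t ht
  ext a b
  exact congrFun this (a, b)

variable {n : ℕ} (Q : QuadraticModel n)

theorem SchwartzCurve.sub {T : Set ℝ} {U U' V V' : ℝ → 𝓢(E n, ℂ)} (hU : SchwartzCurve T U U')
    (hV : SchwartzCurve T V V') :
    SchwartzCurve T (fun t => U t - V t) (fun t => U' t - V' t) :=
  ⟨(hU.rapid.add ((SlowOn.const hV.rapid.isOpen (-1 : ℂ)).mul_rapid hV.rapid)).congr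
    fun t _ x => by simp [sub_eq_add_neg], fun t ht x => (hU.hasDerivAt t ht x).sub
      (hV.hasDerivAt t ht x)⟩

variable {T : Set ℝ} {ϰ ħ : ℝ} {U U' V V' : ℝ → 𝓢(E n, ℂ)} {s : ℝ}

/-- The equations for the moments of a solution of the Gross–Pitaevskii equation. -/
theorem QuadraticModel.moment_equations (hU : SchwartzCurve T U U') (hħ : ħ ≠ 0)
    (hT : T.OrdConnected) (hs : s ∈ T) (h : ∀ t ∈ T, (Complex.I * (ħ : ℂ)) • U' t =
      affineS ħ (Q.hess (ϰ * normSq (U t)) t)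
        (Q.effLinear ϰ ħ t (U t)) (Q.effConst ϰ ħ t (U t)) (U t)) :
    (∀ t ∈ T, normSq (U t) = normSq (U s)) ∧
    (∀ t ∈ T, HasDerivAt (fun t => moment₁ ħ (U t)) (entriesCLM (Matrix.J (Fin n) ℝ *
        (Q.hess (ϰ * normSq (U s)) t + (ϰ * normSq (U s)) • Q.Wzw t)) (moment₁ ħ (U t)) +
        Matrix.J (Fin n) ℝ *ᵥ (normSq (U s) • Q.Hz t)) t) ∧
    (∀ t ∈ T, ∀ a b, HasDerivAt (fun t => moment₂ ħ (U t) a b)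
      (((Matrix.J (Fin n) ℝ * Q.hess (ϰ * normSq (U s)) t) * moment₂ ħ (U t) +
        moment₂ ħ (U t) * (Matrix.J (Fin n) ℝ * Q.hess (ϰ * normSq (U s)) t)ᵀ +
        (Matrix.J (Fin n) ℝ * Matrix.vecMulVec (Q.effLinear ϰ ħ t (U t)) (moment₁ ħ (U t)) -
          Matrix.vecMulVec (moment₁ ħ (U t)) (Q.effLinear ϰ ħ t (U t)) * Matrix.J (Fin n) ℝ))
        a b) t) := by
  have hsym : ∀ t, (Q.hess (ϰ * normSq (U t)) t).IsSymm := fun t => Q.hess_isSymm _ t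
  have hN : ∀ t ∈ T, normSq (U t) = normSq (U s) := fun t ht =>
    hU.normSq_eq (b := fun t => Q.effLinear ϰ ħ t (U t)) (c := fun t => Q.effConst ϰ ħ t (U t))
      hħ hsym hT h hs ht
  refine ⟨hN, fun t ht => ?_, fun t ht a b => ?_⟩
  · refine hasDerivAt_pi.2 fun e => ?_
    refine (hU.hasDerivAt_moment₁ (b := fun t => Q.effLinear ϰ ħ t (U t))
      (c := fun t => Q.effConst ϰ ħ t (U t)) hħ hsym h ht e).congr_deriv ?_
    rw [hN t ht, entriesCLM_apply, ← Matrix.mulVec_mulVec, ← Matrix.mulVec_add]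
    refine congrFun (congrArg _ ?_) e
    rw [QuadraticModel.effLinear, Matrix.add_mulVec, smul_add, Matrix.smul_mulVec, smul_smul,
      mul_comm ϰ]
    abel
  · refine (hU.hasDerivAt_moment₂ (b := fun t => Q.effLinear ϰ ħ t (U t))
      (c := fun t => Q.effConst ϰ ħ t (U t)) hħ hsym h ht a b).congr_deriv ?_
    rw [hN t ht, Matrix.transpose_mul, (Q.hess_isSymm _ t).eq, Matrix.J_transpose]
    refine congrFun (congrFun (?_ : (_ : Matrix (Idx n) (Idx n) ℝ) = _) a) b
    simp only [Matrix.mul_add, Matrix.add_mul, Matrix.mul_neg, Matrix.mul_assoc]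
    abel

/-- The norms are constant, hence equal. This makes the linear equation for the first moments the
same for both solutions, and equal first moments make the inhomogeneity of the equation for the
second moments the same. With all moments equal, the difference solves one linear Schrödinger
equation, and its conserved norm vanishes at `s`. -/
theorem QuadraticModel.gpe_unique (hU : SchwartzCurve T U U') (hV : SchwartzCurve T V V')
    (hħ : ħ ≠ 0) (hT : T.OrdConnected) (hs : s ∈ T)
    (h : ∀ t ∈ T, (Complex.I * (ħ : ℂ)) • U' t = affineS ħ (Q.hess (ϰ * normSq (U t)) t)
      (Q.effLinear ϰ ħ t (U t)) (Q.effConst ϰ ħ t (U t)) (U t))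
    (h' : ∀ t ∈ T, (Complex.I * (ħ : ℂ)) • V' t = affineS ħ (Q.hess (ϰ * normSq (V t)) t)
      (Q.effLinear ϰ ħ t (V t)) (Q.effConst ϰ ħ t (V t)) (V t))
    (h0 : U s = V s) : ∀ t ∈ T, U t = V t := by
  have ho := hU.rapid.isOpen
  obtain ⟨a1, a2, a3⟩ := Q.moment_equations hU hħ hT hs h
  obtain ⟨b1, b2, b3⟩ := Q.moment_equations hV hħ hT hs h'
  rw [← h0] at b1 b2
  simp only [← h0] at b3
  set κ := ϰ * normSq (U s) with hκ
  have hcκ : ContDiff ℝ ∞ fun t : ℝ => (κ, t) := by fun_prop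
  have hJh : ∀ a b, ContDiff ℝ ∞ fun t => (Matrix.J (Fin n) ℝ * Q.hess κ t) a b := fun a b =>
    (Q.contDiff_J_hess a b).comp hcκ
  have hm : ∀ t ∈ T, moment₁ ħ (U t) = moment₁ ħ (V t) :=
    linear_ode_unique (contDiff_entriesCLM fun a b => contDiff_matrix_mul
      (M := fun _ : ℝ => Matrix.J (Fin n) ℝ) (N := fun t => Q.hess κ t + κ • Q.Wzw t)
      (fun _ _ => contDiff_const) (fun a b => ((Q.contDiff_hess a b).comp hcκ).add
        (contDiff_const.mul (Q.smooth_Wzw a b))) a b).continuous hT ho hs _ a2 b2 (by rw [h0])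
  have hb : ∀ t ∈ T, Q.effLinear ϰ ħ t (U t) = Q.effLinear ϰ ħ t (V t) := fun t ht => by
    rw [QuadraticModel.effLinear, QuadraticModel.effLinear, hm t ht]
  have hM : ∀ t ∈ T, moment₂ ħ (U t) = moment₂ ħ (V t) :=
    lyapunov_unique hJh hT ho hs _ a3 (fun t ht a b => by
      rw [hb t ht, hm t ht]
      exact b3 t ht a b) (by rw [h0])
  have hW : ∀ t ∈ T, (Complex.I * (ħ : ℂ)) • (U' t - V' t) = affineS ħ (Q.hess κ t)
      (Q.effLinear ϰ ħ t (U t)) (Q.effConst ϰ ħ t (U t)) (U t - V t) := fun t ht => by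
    have hc : Q.effConst ϰ ħ t (U t) = Q.effConst ϰ ħ t (V t) := by
      rw [QuadraticModel.effConst, QuadraticModel.effConst, hM t ht]
    rw [smul_sub, map_sub, h t ht, h' t ht, a1 t ht, b1 t ht, hc, hb t ht]
  intro t ht
  have h2 := (hU.sub hV).normSq_eq (h := Q.hess κ) (b := fun t => Q.effLinear ϰ ħ t (U t))
    (c := fun t => Q.effConst ϰ ħ t (U t)) hħ (fun t => Q.hess_isSymm κ t) hT hW hs ht
  have h3 : normSq (⇑(U s - V s)) = 0 := by
    rw [h0, sub_self]; simp [normSq]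
  exact sub_eq_zero.1 (eq_zero_of_normSq_eq_zero (h2.trans h3))

end Uniqueness

/-! ### Phase-space translations and dilations -/

section Translation

variable {n : ℕ}

theorem slowOn_phase {F : Type} [NormedAddCommGroup F] [NormedSpace ℝ F] {D : Set F}
    (hD : IsOpen D) {S : F → ℝ} {P X : F → E n} (hS : ContDiffOn ℝ ∞ S D)
    (hP : ContDiffOn ℝ ∞ P D) (hX : ContDiffOn ℝ ∞ X D) :
    SlowOn D (fun q : F × E n => S q.1 + inner ℝ (P q.1) (q.2 - X q.1)) := by
  refine (SlowOn.param hD hS).add (SlowOn.bilin (B := innerSL ℝ) (SlowOn.param hD hP) ?_)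
  refine ((SlowOn.clm_snd hD (ContinuousLinearMap.id ℝ (E n))).add
    (SlowOn.param (V := E n) hD hX.neg)).congr fun τ _ ξ => ?_
  simp [sub_eq_add_neg]

theorem RapidOn.tcWave {F : Type} [NormedAddCommGroup F] [NormedSpace ℝ F] {D : Set F} {ħ : ℝ}
    (hħ : 0 < ħ) {S : F → ℝ} {P X : F → E n} {u : F × E n → ℂ} (hu : RapidOn D u)
    (hS : ContDiffOn ℝ ∞ S D) (hP : ContDiffOn ℝ ∞ P D) (hX : ContDiffOn ℝ ∞ X D) :
    RapidOn D (fun q : F × E n =>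
      NonlocalGPE.tcWave ħ (S q.1) (P q.1) (X q.1) (fun ξ => u (q.1, ξ)) q.2) := by
  have hD := hu.isOpen
  have hsq : 0 < Real.sqrt ħ := Real.sqrt_pos.2 hħ
  have hθ : SlowOn D (fun q : F × E n => (Real.sqrt ħ)⁻¹ • (q.2 - X q.1)) := by
    refine (((SlowOn.clm_snd hD (ContinuousLinearMap.id ℝ (E n))).add
      (SlowOn.param (V := E n) hD hX.neg)).clm
      ((Real.sqrt ħ)⁻¹ • ContinuousLinearMap.id ℝ (E n))).congr fun τ _ ξ => ?_
    simp [sub_eq_add_neg]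
  have h1 := hu.comp hD (σ := id) contDiffOn_id (mapsTo_id D) hθ (fun K hK hKc => by
    obtain ⟨B, hB⟩ := hKc.bddAbove_image (hX.continuousOn.mono hK).norm
    refine ⟨1, 1 + |B| + Real.sqrt ħ, fun τ hτ ξ => ?_⟩
    have h2 : ‖X τ‖ ≤ |B| := (hB ⟨τ, hτ, rfl⟩).trans (le_abs_self B)
    have h3 : ‖ξ‖ ≤ Real.sqrt ħ * ‖(Real.sqrt ħ)⁻¹ • (ξ - X τ)‖ + ‖X τ‖ := by
      rw [norm_smul, norm_inv, Real.norm_of_nonneg hsq.le, mul_inv_cancel_left₀ hsq.ne']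
      simpa using norm_add_le (ξ - X τ) (X τ)
    have h4 := norm_nonneg ((Real.sqrt ħ)⁻¹ • (ξ - X τ))
    rw [pow_one]
    nlinarith [abs_nonneg B])
  have h2 : SlowOn D (fun q : F × E n => Complex.exp (Complex.I *
      ((ħ⁻¹ * (S q.1 + inner ℝ (P q.1) (q.2 - X q.1)) : ℝ) : ℂ))) :=
    ((SlowOn.const hD ħ⁻¹).mul (slowOn_phase hD hS hP hX)).cexp_I
  refine (h1.mul_slow h2).congr fun τ _ ξ => ?_
  simp only [NonlocalGPE.tcWave, id]
  congr 2
  push_cast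
  rw [div_eq_mul_inv]
  ring

theorem exists_coe_eq_tcWave {ħ : ℝ} (hħ : 0 < ħ) (S : ℝ) (P X : E n) (φ : 𝓢(E n, ℂ)) :
    ∃ χ : 𝓢(E n, ℂ), ⇑χ = tcWave ħ S P X φ := by
  have h := (rapidOn_schwartzMap φ (F := ℝ) isOpen_univ).tcWave hħ (S := fun _ => S)
    (P := fun _ => P) (X := fun _ => X) contDiffOn_const contDiffOn_const contDiffOn_const
  obtain ⟨χ, hχ⟩ := h.exists_schwartzMap (mem_univ 0)
  exact ⟨χ, funext hχ⟩

open scoped Classical in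
/-- `tcWave` on Schwartz functions, for `0 < ħ`. -/
def tcS (ħ S : ℝ) (P X : E n) (φ : 𝓢(E n, ℂ)) : 𝓢(E n, ℂ) :=
  if h : ∃ χ : 𝓢(E n, ℂ), ⇑χ = tcWave ħ S P X φ then h.choose else 0

variable {ħ : ℝ}

theorem coe_tcS (hħ : 0 < ħ) (S : ℝ) (P X : E n) (φ : 𝓢(E n, ℂ)) :
    ⇑(tcS ħ S P X φ) = tcWave ħ S P X φ := by
  have h := exists_coe_eq_tcWave hħ S P X φ
  rw [tcS, dif_pos h]
  exact h.choose_spec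

theorem tcS_add (hħ : 0 < ħ) (S : ℝ) (P X : E n) (φ ψ : 𝓢(E n, ℂ)) :
    tcS ħ S P X (φ + ψ) = tcS ħ S P X φ + tcS ħ S P X ψ := by
  ext x
  simp only [coe_tcS hħ, add_apply, tcWave, add_mul]

theorem tcS_smul (hħ : 0 < ħ) (S : ℝ) (P X : E n) (c : ℂ) (φ : 𝓢(E n, ℂ)) :
    tcS ħ S P X (c • φ) = c • tcS ħ S P X φ := by
  ext x
  simp only [coe_tcS hħ, smul_apply, tcWave, smul_eq_mul, mul_assoc]

/-- `tcS` as a linear map. -/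
def tcL (hħ : 0 < ħ) (S : ℝ) (P X : E n) : 𝓢(E n, ℂ) →ₗ[ℂ] 𝓢(E n, ℂ) where
  toFun := tcS ħ S P X
  map_add' := tcS_add hħ S P X
  map_smul' := tcS_smul hħ S P X

theorem coe_tcL (hħ : 0 < ħ) (S : ℝ) (P X : E n) (φ : 𝓢(E n, ℂ)) :
    ⇑(tcL hħ S P X φ) = tcWave ħ S P X φ := coe_tcS hħ S P X φ

theorem hasFDerivAt_tcWave_phase (S : ℝ) (P X x : E n) :
    HasFDerivAt (fun x => Complex.exp (Complex.I / (ħ : ℂ) * ((S + inner ℝ P (x - X) : ℝ) : ℂ)))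
      (Complex.exp (Complex.I / (ħ : ℂ) * ((S + inner ℝ P (x - X) : ℝ) : ℂ)) •
        (Complex.I / (ħ : ℂ)) • Complex.ofRealCLM.comp (innerSL ℝ P)) x := by
  have h1 : HasFDerivAt (fun x : E n => S + inner ℝ P (x - X)) (innerSL ℝ P) x := by
    have := ((innerSL ℝ P).hasFDerivAt (x := x - X)).comp x ((hasFDerivAt_id x).sub_const X)
    exact (this.const_add S)
  exact ((Complex.ofRealCLM.hasFDerivAt.comp x h1).const_mul _).cexp

/-- Differentiating the phase produces `P`; differentiating the dilated profile produces `1/√ħ`,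
which turns the factor `ħ` of the momentum operator into `√ħ`. Position scales with `√ħ` as well, so
both kinds of operators transform by one rule. -/
theorem zS_tcL (hħ : 0 < ħ) (S : ℝ) (P X : E n) (a : Idx n) (φ : 𝓢(E n, ℂ)) :
    zS ħ a (tcL hħ S P X φ) = tcL hħ S P X ((Real.sqrt ħ : ℂ) • zS 1 a φ +
      ((Sum.elim P.ofLp X.ofLp a : ℝ) : ℂ) • φ) := by
  have hsq : 0 < Real.sqrt ħ := Real.sqrt_pos.2 hħ
  have hsq' : (Real.sqrt ħ : ℂ) * (Real.sqrt ħ : ℂ) = (ħ : ℂ) := by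
    rw [← Complex.ofReal_mul, Real.mul_self_sqrt hħ.le]
  have hsq0 : (Real.sqrt ħ : ℂ) ≠ 0 := by exact_mod_cast hsq.ne'
  have hħ0 : (ħ : ℂ) ≠ 0 := by exact_mod_cast hħ.ne'
  ext x
  rw [coe_tcL]
  rcases a with j | j
  · rw [zS_inl_apply, coe_tcL]
    have h1 : HasFDerivAt (fun x => φ ((Real.sqrt ħ)⁻¹ • (x - X)))
        ((fderiv ℝ φ ((Real.sqrt ħ)⁻¹ • (x - X))).comp
          ((Real.sqrt ħ)⁻¹ • ContinuousLinearMap.id ℝ (E n))) x :=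
      φ.differentiableAt.hasFDerivAt.comp x
        (((hasFDerivAt_id x).sub_const X).const_smul (Real.sqrt ħ)⁻¹)
    have h2 := h1.mul (hasFDerivAt_tcWave_phase (ħ := ħ) S P X x)
    have h3 : fderiv ℝ (tcWave ħ S P X φ) x = _ := h2.fderiv
    have h4 : innerSL ℝ P (EuclideanSpace.single j (1 : ℝ)) = P j := by
      simp [EuclideanSpace.inner_single_right]
    rw [h3]
    simp only [add_apply, smul_apply, ContinuousLinearMap.comp_apply, h4, smul_eq_mul,
      ContinuousLinearMap.id_apply, map_smul, Complex.ofRealCLM_apply, tcWave, zS_inl_apply,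
      Sum.elim_inl, Complex.real_smul]
    push_cast
    generalize (Real.sqrt ħ)⁻¹ • (x - X) = y
    rw [← hsq']
    field_simp
    linear_combination (-(P j : ℂ) * φ y) * Complex.I_sq
  · rw [zS_inr_apply, coe_tcL]
    simp only [tcWave, add_apply, smul_apply, zS_inr_apply, smul_eq_mul, Sum.elim_inr,
      PiLp.smul_apply, PiLp.sub_apply]
    push_cast
    field_simp
    ring

/-- The Taylor expansion of a quadratic polynomial about `z`, ordered by powers of `r`, which stands
for `√ħ`. Symmetry of `h` merges the two mixed terms. -/
theorem sum_affine_expand {ι : Type} [Fintype ι] (h : ι → ι → ℂ) (hh : ∀ a a', h a a' = h a' a)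
    (z b g : ι → ℂ) (f : ι → ι → ℂ) (r φ c : ℂ) :
    1 / 2 * ∑ a, ∑ a', h a a' * (r * (r * f a a' + z a' * g a) + z a * (r * g a' + z a' * φ)) +
        ∑ a, b a * (r * g a + z a * φ) + c * φ =
      r * r * (1 / 2 * ∑ a, ∑ a', h a a' * f a a') + r * ∑ a, (∑ a', h a a' * z a' + b a) * g a +
        (1 / 2 * ∑ a, z a * ∑ a', h a a' * z a' + ∑ a, b a * z a + c) * φ := by
  have e1 : ∑ a, ∑ a', h a a' * (z a * g a') = ∑ a, ∑ a', h a a' * (z a' * g a) := by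
    rw [Finset.sum_comm]
    exact Finset.sum_congr rfl fun a _ => Finset.sum_congr rfl fun a' _ => by rw [hh]
  have e2 : ∑ a, ∑ a', h a a' *
      (r * (r * f a a' + z a' * g a) + z a * (r * g a' + z a' * φ)) =
      r * r * ∑ a, ∑ a', h a a' * f a a' + r * ∑ a, ∑ a', h a a' * (z a' * g a) +
        r * ∑ a, ∑ a', h a a' * (z a * g a') + (∑ a, ∑ a', h a a' * (z a * z a')) * φ := by
    simp only [Finset.mul_sum, Finset.sum_mul, ← Finset.sum_add_distrib]
    exact Finset.sum_congr rfl fun a _ => Finset.sum_congr rfl fun a' _ => by ring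
  have e3 : ∑ a, (∑ a', h a a' * z a' + b a) * g a =
      ∑ a, ∑ a', h a a' * (z a' * g a) + ∑ a, b a * g a := by
    simp only [add_mul, Finset.sum_add_distrib, Finset.sum_mul, mul_assoc]
  have e4 : ∑ a, z a * ∑ a', h a a' * z a' = ∑ a, ∑ a', h a a' * (z a * z a') := by
    simp only [Finset.mul_sum]
    exact Finset.sum_congr rfl fun a _ => Finset.sum_congr rfl fun a' _ => by ring
  have e5 : ∑ a, b a * (r * g a + z a * φ) = r * ∑ a, b a * g a + (∑ a, b a * z a) * φ := by
    simp only [Finset.mul_sum, Finset.sum_mul, ← Finset.sum_add_distrib]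
    exact Finset.sum_congr rfl fun a _ => by ring
  rw [e2, e3, e4, e5, e1]
  ring

theorem affineS_tcL (hħ : 0 < ħ) (S : ℝ) (P X : E n) {h : Matrix (Idx n) (Idx n) ℝ}
    (hh : h.IsSymm) (b : Idx n → ℝ) (c : ℝ) (φ : 𝓢(E n, ℂ)) :
    affineS ħ h b c (tcL hħ S P X φ) = tcL hħ S P X ((ħ : ℂ) • affineS 1 h 0 0 φ +
      (Real.sqrt ħ : ℂ) • ∑ a, (((h *ᵥ Sum.elim P.ofLp X.ofLp) a + b a : ℝ) : ℂ) • zS 1 a φ +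
      ((1 / 2 * (Sum.elim P.ofLp X.ofLp ⬝ᵥ (h *ᵥ Sum.elim P.ofLp X.ofLp)) +
        b ⬝ᵥ Sum.elim P.ofLp X.ofLp + c : ℝ) : ℂ) • φ) := by
  set z : Idx n → ℝ := Sum.elim P.ofLp X.ofLp with hz
  have hsq' : (Real.sqrt ħ : ℂ) * (Real.sqrt ħ : ℂ) = (ħ : ℂ) := by
    rw [← Complex.ofReal_mul, Real.mul_self_sqrt hħ.le]
  simp only [affineS_apply, zS_tcL hħ, ← map_smul, ← map_sum, ← map_add]
  congr 1
  rw [← hz]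
  ext x
  have key := sum_affine_expand (fun a a' => (h a a' : ℂ)) (fun a a' => by rw [hh.apply])
    (fun a => (z a : ℂ)) (fun a => (b a : ℂ)) (fun a => zS 1 a φ x)
    (fun a a' => zS 1 a (zS 1 a' φ) x) (Real.sqrt ħ) (φ x) c
  simp only [add_apply, smul_apply, sum_apply, map_add, map_smul, map_sum, smul_eq_mul,
    Pi.zero_apply, Complex.ofReal_zero, zero_mul, Finset.sum_const_zero, add_zero] at key ⊢
  rw [key, hsq']
  simp only [Matrix.mulVec, dotProduct]
  push_cast
  rfl

variable {T : Set ℝ} {U U' : ℝ → 𝓢(E n, ℂ)}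

theorem J_mulVec_inl (v : Idx n → ℝ) (j : Fin n) :
    (Matrix.J (Fin n) ℝ *ᵥ v) (Sum.inl j) = -v (Sum.inr j) := by
  simp [Matrix.J, Matrix.mulVec, dotProduct, Matrix.fromBlocks, Matrix.neg_apply, Matrix.one_apply]

theorem J_mulVec_inr (v : Idx n → ℝ) (j : Fin n) :
    (Matrix.J (Fin n) ℝ *ᵥ v) (Sum.inr j) = v (Sum.inl j) := by
  simp [Matrix.J, Matrix.mulVec, dotProduct, Matrix.fromBlocks, Matrix.one_apply]

/-- The moving centre contributes `-Ẋ` against the gradient of the profile, the moving momentum `Ṗ`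
against the position. Together these are the components of `Jż` paired with `ẑ`, which is the shape
in which the linear part of a Hamiltonian appears in the same frame. -/
theorem SchwartzCurve.tcL (hU : SchwartzCurve T U U') (hħ : 0 < ħ) {S : ℝ → ℝ} {P X : ℝ → E n}
    (hS : ContDiff ℝ ∞ S) (hP : ContDiff ℝ ∞ P) (hX : ContDiff ℝ ∞ X) {S' : ℝ → ℝ}
    {z' : ℝ → Idx n → ℝ} (hS' : ∀ t, HasDerivAt S (S' t) t)
    (hP' : ∀ t j, HasDerivAt (fun t => P t j) (z' t (Sum.inl j)) t)
    (hX' : ∀ t j, HasDerivAt (fun t => X t j) (z' t (Sum.inr j)) t) :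
    ∃ W' : ℝ → 𝓢(E n, ℂ), SchwartzCurve T (fun t => NonlocalGPE.tcL hħ (S t) (P t) (X t) (U t)) W' ∧
      ∀ t ∈ T, (Complex.I * (ħ : ℂ)) • W' t = NonlocalGPE.tcL hħ (S t) (P t) (X t)
        ((Complex.I * (ħ : ℂ)) • U' t - (Real.sqrt ħ : ℂ) •
          ∑ a, ((Matrix.J (Fin n) ℝ *ᵥ z' t) a : ℂ) • NonlocalGPE.zS 1 a (U t) -
          ((S' t - ∑ j, P t j * z' t (Sum.inr j) : ℝ) : ℂ) • U t) := by
  have hr := hU.rapid.tcWave hħ hS.contDiffOn hP.contDiffOn hX.contDiffOn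
  obtain ⟨W, W', hW, hWe⟩ := exists_schwartzCurve hr
  have hWe' : ∀ t ∈ T, NonlocalGPE.tcL hħ (S t) (P t) (X t) (U t) = W t := fun t ht => by
    ext x
    rw [hWe t ht, coe_tcL]
  refine ⟨W', ⟨hr.congr fun t _ x => by rw [coe_tcL], fun t ht x => ?_⟩, fun t ht => ?_⟩
  · refine (hW.hasDerivAt t ht x).congr_of_eventuallyEq ?_
    filter_upwards [hr.isOpen.mem_nhds ht] with τ hτ
    rw [hWe' τ hτ]
  have hsq : 0 < Real.sqrt ħ := Real.sqrt_pos.2 hħ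
  have hsq' : (Real.sqrt ħ : ℂ) * (Real.sqrt ħ : ℂ) = (ħ : ℂ) := by
    rw [← Complex.ofReal_mul, Real.mul_self_sqrt hħ.le]
  have hsq0 : (Real.sqrt ħ : ℂ) ≠ 0 := by exact_mod_cast hsq.ne'
  ext x
  set ξ : E n := (Real.sqrt ħ)⁻¹ • (x - X t) with hξ
  have hXd : HasDerivAt X (WithLp.toLp 2 fun j => z' t (Sum.inr j)) t := by
    exact (EuclideanSpace.equiv (Fin n) ℝ).symm.hasFDerivAt.comp_hasDerivAt
      (f := fun τ => (X τ).ofLp) t (hasDerivAt_pi.2 (hX' t))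
  have hξd : HasDerivAt (fun τ => (Real.sqrt ħ)⁻¹ • (x - X τ))
      ((Real.sqrt ħ)⁻¹ • -(WithLp.toLp 2 fun j => z' t (Sum.inr j) : E n)) t :=
    (hXd.const_sub x).fun_const_smul _
  have hu : HasDerivAt (fun τ => U τ ((Real.sqrt ħ)⁻¹ • (x - X τ))) (U' t ξ -
      ((Real.sqrt ħ)⁻¹ : ℝ) * ∑ j, (z' t (Sum.inr j) : ℂ) *
        (Complex.I * NonlocalGPE.zS 1 (Sum.inl j) (U t) ξ)) t := by
    have h1 := (hU.rapid.differentiableAt_prod ht ξ).hasFDerivAt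
    have h2 := HasFDerivAt.comp_hasDerivAt (f := fun τ => (τ, (Real.sqrt ħ)⁻¹ • (x - X τ))) t
      h1 ((hasDerivAt_id t).prodMk hξd)
    refine h2.congr_deriv ?_
    have h3 : ((1 : ℝ), (Real.sqrt ħ)⁻¹ • -(WithLp.toLp 2 fun j => z' t (Sum.inr j) : E n)) =
        (1, 0) + -((Real.sqrt ħ)⁻¹) • ∑ j, z' t (Sum.inr j) •
          ((0 : ℝ), EuclideanSpace.single j (1 : ℝ)) := by
      refine Prod.ext ?_ ?_
      · simp [Prod.fst_sum]
      · have h4 : ∑ j, z' t (Sum.inr j) • ((0 : ℝ), EuclideanSpace.single j (1 : ℝ)) =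
            (0, (WithLp.toLp 2 fun j => z' t (Sum.inr j) : E n)) := by
          refine Prod.ext (by simp [Prod.fst_sum]) ?_
          rw [Prod.snd_sum]
          ext i
          simp [Finset.sum_apply, Pi.single_apply]
        rw [h4]
        simp
    have h4 : ∀ j, fderiv ℝ (fun q : ℝ × E n => U q.1 q.2) (t, ξ)
        ((0 : ℝ), EuclideanSpace.single j (1 : ℝ)) =
        Complex.I * NonlocalGPE.zS 1 (Sum.inl j) (U t) ξ := by
      intro j
      have h5 := HasFDerivAt.comp (f := fun x => (t, x)) ξ h1 (hasFDerivAt_prodMk_right t ξ)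
      have h6 : fderiv ℝ (U t) ξ = _ := h5.fderiv
      rw [zS_inl_apply, h6]
      simp only [ContinuousLinearMap.comp_apply, ContinuousLinearMap.inr_apply, Complex.ofReal_one]
      linear_combination (fderiv ℝ (fun q : ℝ × E n => U q.1 q.2) (t, ξ)
        ((0 : ℝ), EuclideanSpace.single j (1 : ℝ))) * Complex.I_sq
    rw [h3, map_add, map_smul, map_sum, hU.fderiv_eq ht]
    simp only [map_smul, h4, Complex.real_smul]
    push_cast
    ring
  have hph : HasDerivAt (fun τ => Complex.exp (Complex.I / (ħ : ℂ) *
      ((S τ + inner ℝ (P τ) (x - X τ) : ℝ) : ℂ)))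
      (Complex.exp (Complex.I / (ħ : ℂ) * ((S t + inner ℝ (P t) (x - X t) : ℝ) : ℂ)) *
        (Complex.I / (ħ : ℂ) * ((S' t + ∑ j, (z' t (Sum.inl j) * (Real.sqrt ħ * ξ j) -
          P t j * z' t (Sum.inr j)) : ℝ) : ℂ))) t := by
    have hin : HasDerivAt (fun τ => inner ℝ (P τ) (x - X τ)) (∑ j, (z' t (Sum.inl j) *
        (Real.sqrt ħ * ξ j) - P t j * z' t (Sum.inr j))) t := by
      have h1 : (fun τ => inner ℝ (P τ) (x - X τ)) = fun τ => ∑ j, P τ j * (x j - X τ j) := by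
        funext τ
        simp [PiLp.inner_apply, mul_comm]
      rw [h1]
      refine (HasDerivAt.fun_sum fun j _ => (hP' t j).mul ((hX' t j).const_sub (x j))).congr_deriv
        (Finset.sum_congr rfl fun j _ => ?_)
      have : Real.sqrt ħ * ξ j = x j - X t j := by
        rw [hξ]
        simp only [PiLp.smul_apply, PiLp.sub_apply, smul_eq_mul]
        rw [mul_inv_cancel_left₀ hsq.ne']
      rw [this]
      ring
    exact (((hS' t).add hin).ofReal_comp.const_mul _).cexp
  have hev : (fun τ => W τ x) =ᶠ[𝓝 t] ((fun τ => U τ ((Real.sqrt ħ)⁻¹ • (x - X τ))) * fun τ =>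
      Complex.exp (Complex.I / (ħ : ℂ) * ((S τ + inner ℝ (P τ) (x - X τ) : ℝ) : ℂ))) := by
    filter_upwards [hr.isOpen.mem_nhds ht] with τ hτ
    rw [hWe τ hτ x]
    rfl
  have hd := (hu.mul hph).congr_of_eventuallyEq hev
  rw [smul_apply, (hW.hasDerivAt t ht x).unique hd, coe_tcL]
  simp only [tcWave, ← hξ, Fintype.sum_sum_type, sub_apply, smul_apply, sum_apply, add_apply,
    smul_eq_mul, J_mulVec_inl, J_mulVec_inr, zS_inr_apply]
  have e1 : ∑ j, (z' t (Sum.inr j) : ℂ) * (Complex.I * NonlocalGPE.zS 1 (Sum.inl j) (U t) ξ) =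
      Complex.I * ∑ j, (z' t (Sum.inr j) : ℂ) * NonlocalGPE.zS 1 (Sum.inl j) (U t) ξ := by
    rw [Finset.mul_sum]
    exact Finset.sum_congr rfl fun j _ => by ring
  have e2 : ∑ j, ((-z' t (Sum.inr j) : ℝ) : ℂ) * NonlocalGPE.zS 1 (Sum.inl j) (U t) ξ =
      -∑ j, (z' t (Sum.inr j) : ℂ) * NonlocalGPE.zS 1 (Sum.inl j) (U t) ξ := by
    rw [← Finset.sum_neg_distrib]
    exact Finset.sum_congr rfl fun j _ => by push_cast; ring
  have e3 : ∑ j, (z' t (Sum.inl j) : ℂ) * ((ξ j : ℂ) * U t ξ) =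
      (∑ j, (z' t (Sum.inl j) : ℂ) * (ξ j : ℂ)) * U t ξ := by
    rw [Finset.sum_mul]
    exact Finset.sum_congr rfl fun j _ => by ring
  have e4 : ((∑ j, (z' t (Sum.inl j) * (Real.sqrt ħ * ξ j) - P t j * z' t (Sum.inr j)) : ℝ) : ℂ) =
      (Real.sqrt ħ : ℂ) * ∑ j, (z' t (Sum.inl j) : ℂ) * (ξ j : ℂ) -
        ((∑ j, P t j * z' t (Sum.inr j) : ℝ) : ℂ) := by
    rw [Finset.sum_sub_distrib, Finset.mul_sum]
    push_cast
    congr 1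
    exact Finset.sum_congr rfl fun j _ => by ring
  generalize Complex.exp (Complex.I / (ħ : ℂ) * ((S t + inner ℝ (P t) (x - X t) : ℝ) : ℂ)) = e
  rw [e1, e2, e3, Complex.ofReal_add, e4, Complex.ofReal_sub, Complex.ofReal_inv]
  generalize ∑ j, (z' t (Sum.inr j) : ℂ) * NonlocalGPE.zS 1 (Sum.inl j) (U t) ξ = s₁
  generalize ∑ j, (z' t (Sum.inl j) : ℂ) * (ξ j : ℂ) = s₂
  rw [← hsq']
  field_simp
  ring_nf
  simp only [Complex.I_sq]
  ring

/-- The affine Schrödinger equation in the frame moving with the classical trajectory. -/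
theorem SchwartzCurve.tcL_solves (hU : SchwartzCurve T U U') (hħ : 0 < ħ) {S : ℝ → ℝ}
    {P X : ℝ → E n} {S' : ℝ → ℝ} {h : ℝ → Matrix (Idx n) (Idx n) ℝ} {b : ℝ → Idx n → ℝ} {c : ℝ → ℝ}
    (hS : ContDiff ℝ ∞ S) (hP : ContDiff ℝ ∞ P) (hX : ContDiff ℝ ∞ X) (hh : ∀ t, (h t).IsSymm)
    (hS' : ∀ t, HasDerivAt S (S' t) t)
    (hz' : ∀ t a, HasDerivAt (fun t => Sum.elim (P t).ofLp (X t).ofLp a)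
      ((Matrix.J (Fin n) ℝ *ᵥ (b t + h t *ᵥ Sum.elim (P t).ofLp (X t).ofLp)) a) t)
    (hSP : ∀ t, S' t = ∑ j, P t j *
        (Matrix.J (Fin n) ℝ *ᵥ (b t + h t *ᵥ Sum.elim (P t).ofLp (X t).ofLp)) (Sum.inr j) -
      (1 / 2 * (Sum.elim (P t).ofLp (X t).ofLp ⬝ᵥ (h t *ᵥ Sum.elim (P t).ofLp (X t).ofLp)) +
        b t ⬝ᵥ Sum.elim (P t).ofLp (X t).ofLp + c t))
    (hUs : ∀ t ∈ T, Complex.I • U' t = affineS 1 (h t) 0 0 (U t)) :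
    ∃ W' : ℝ → 𝓢(E n, ℂ), SchwartzCurve T (fun t => NonlocalGPE.tcL hħ (S t) (P t) (X t) (U t)) W' ∧
      ∀ t ∈ T, (Complex.I * (ħ : ℂ)) • W' t =
        affineS ħ (h t) (b t) (c t) (NonlocalGPE.tcL hħ (S t) (P t) (X t) (U t)) := by
  obtain ⟨W', hW, hWt⟩ := hU.tcL hħ hS hP hX hS' (fun t j => hz' t (Sum.inl j))
    (fun t j => hz' t (Sum.inr j))
  refine ⟨W', hW, fun t ht => ?_⟩
  -- Hamilton's equations give `Jż = -(b + hz)`. The terms of order `√ħ` caused by the moving frame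
  -- are then those of the expanded Hamiltonian, and `hSP` matches the scalar terms in the same way.
  have hJJ : ∀ v : Idx n → ℝ, Matrix.J (Fin n) ℝ *ᵥ (Matrix.J (Fin n) ℝ *ᵥ v) = -v := fun v => by
    rw [Matrix.mulVec_mulVec, Matrix.J_squared, Matrix.neg_mulVec, Matrix.one_mulVec]
  rw [hWt t ht, affineS_tcL hħ _ _ _ (hh t)]
  congr 1
  rw [← hUs t ht, hJJ, hSP t]
  ext x
  simp only [add_apply, sub_apply, smul_apply, sum_apply, smul_eq_mul, Pi.neg_apply, Pi.add_apply,
    Complex.ofReal_neg, neg_mul, Finset.sum_neg_distrib, add_comm (b t _)]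
  push_cast
  ring

end Translation

/-! ### Superpositions of coherent states -/

section Superposition

variable {n : ℕ} {F W : Type} [NormedAddCommGroup F] [NormedSpace ℝ F] [FiniteDimensional ℝ F]
  [NormedAddCommGroup W] [NormedSpace ℝ W] [FiniteDimensional ℝ W] [MeasurableSpace W]
  [BorelSpace W] {μ : Measure W} [μ.IsAddHaarMeasure] {D : Set F} {f : F × (E n × W) → ℂ}

theorem zOp_inl_slice (hf : RapidOn D f) {τ : F} (hτ : τ ∈ D) (x : E n) (w : W) (j : Fin n) :
    zOp 1 (Sum.inl j) (fun x => f (τ, (x, w))) x =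
      -Complex.I * ((1 : ℝ) : ℂ) * fderiv ℝ f (τ, (x, w)) (0, (EuclideanSpace.single j (1 : ℝ), 0)) := by
  have h1 := (hf.differentiableAt_prod hτ (x, w)).hasFDerivAt
  have h2 : HasFDerivAt (fun x : E n => (τ, (x, w)))
      ((ContinuousLinearMap.inr ℝ F (E n × W)).comp (ContinuousLinearMap.inl ℝ (E n) W)) x :=
    (hasFDerivAt_prodMk_right τ (x, w)).comp x (hasFDerivAt_prodMk_left x w)
  have h3 : fderiv ℝ (fun x => f (τ, (x, w))) x = _ := (h1.comp x h2).fderiv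
  change -Complex.I * ((1 : ℝ) : ℂ) * fderiv ℝ (fun x => f (τ, (x, w))) x _ = _
  rw [h3]
  rfl

theorem RapidOn.zOp_slice (hf : RapidOn D f) (a : Idx n) :
    RapidOn D (fun q : F × (E n × W) => zOp 1 a (fun x => f (q.1, (x, q.2.2))) q.2.1) := by
  rcases a with j | j
  · exact ((SlowOn.const hf.isOpen (-Complex.I * ((1 : ℝ) : ℂ))).mul_rapid (hf.fderiv_apply
      (0, (EuclideanSpace.single j (1 : ℝ), 0)))).congr fun τ hτ v => zOp_inl_slice hf hτ v.1 v.2 j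
  · exact ((SlowOn.clm_snd hf.isOpen ((EuclideanSpace.proj j : E n →L[ℝ] ℝ).comp
      (ContinuousLinearMap.fst ℝ (E n) W))).ofReal).mul_rapid hf

theorem zOp_integral (hf : RapidOn D f) {τ : F} (hτ : τ ∈ D) (a : Idx n) (x : E n) :
    zOp 1 a (fun x => ∫ w, f (τ, (x, w)) ∂μ) x =
      ∫ w, zOp 1 a (fun x => f (τ, (x, w))) x ∂μ := by
  rcases a with j | j
  · have h1 := ((hf.integral (μ := μ)).differentiableAt_prod hτ x).hasFDerivAt
    have h2 : fderiv ℝ (fun x => ∫ w, f (τ, (x, w)) ∂μ) x = _ :=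
      (HasFDerivAt.comp (f := fun x => (τ, x)) x h1 (hasFDerivAt_prodMk_right τ x)).fderiv
    simp only [zOp_inl_slice hf hτ]
    change -Complex.I * ((1 : ℝ) : ℂ) * fderiv ℝ (fun x => ∫ w, f (τ, (x, w)) ∂μ) x _ = _
    rw [h2, integral_const_mul, ← hf.fderiv_integral hτ]
    rfl
  · exact (integral_const_mul _ _).symm

/-- A superposition of solutions of a quadratic Schrödinger equation is a solution. -/
theorem hasDerivAt_integral_schrodinger {D : Set (ℝ × ℝ)} {f : (ℝ × ℝ) × (E n × W) → ℂ}
    (hf : RapidOn D f) {h : Matrix (Idx n) (Idx n) ℝ} {t ε : ℝ} (hq : (t, ε) ∈ D) (x : E n)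
    (hd : ∀ w, HasDerivAt (fun t => f ((t, ε), (x, w))) (-Complex.I * ((1 / 2 : ℂ) *
      ∑ a, ∑ b, (h a b : ℂ) * zOp 1 a (zOp 1 b (fun x => f ((t, ε), (x, w)))) x)) t) :
    HasDerivAt (fun t => ∫ w, f ((t, ε), (x, w)) ∂μ) (-Complex.I * ((1 / 2 : ℂ) *
      ∑ a, ∑ b, (h a b : ℂ) *
        zOp 1 a (zOp 1 b (fun x => ∫ w, f ((t, ε), (x, w)) ∂μ)) x)) t := by
  have h1 := ((hf.integral (μ := μ)).differentiableAt_prod hq x).hasFDerivAt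
  have hc : ∀ v : E n, HasDerivAt (fun t : ℝ => ((t, ε), v)) ((1, 0), 0) t := fun v =>
    ((hasDerivAt_id t).prodMk (hasDerivAt_const t ε)).prodMk (hasDerivAt_const t v)
  have h2 := HasFDerivAt.comp_hasDerivAt (f := fun t : ℝ => ((t, ε), x)) t h1 (hc x)
  refine h2.congr_deriv ?_
  rw [hf.fderiv_integral hq]
  have h3 : ∀ w, fderiv ℝ f ((t, ε), (x, w)) ((1, 0), ((0 : E n), (0 : W))) =
      -Complex.I * ((1 / 2 : ℂ) * ∑ a, ∑ b, (h a b : ℂ) *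
        zOp 1 a (zOp 1 b (fun x => f ((t, ε), (x, w)))) x) := fun w => by
    have h4 := HasFDerivAt.comp_hasDerivAt (f := fun t : ℝ => ((t, ε), (x, w))) t
      (hf.differentiableAt_prod hq (x, w)).hasFDerivAt
      (((hasDerivAt_id t).prodMk (hasDerivAt_const t ε)).prodMk (hasDerivAt_const t (x, w)))
    exact h4.unique (hd w)
  simp only [h3]
  have h5 : ∀ b, (zOp 1 b fun x => ∫ w, f ((t, ε), (x, w)) ∂μ) =
      fun x => ∫ w, zOp 1 b (fun x => f ((t, ε), (x, w))) x ∂μ := fun b =>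
    funext fun x => zOp_integral hf hq b x
  have h6 : ∀ a b, zOp 1 a (zOp 1 b (fun x => ∫ w, f ((t, ε), (x, w)) ∂μ)) x =
      ∫ w, zOp 1 a (zOp 1 b (fun x => f ((t, ε), (x, w)))) x ∂μ := fun a b => by
    rw [h5, zOp_integral (hf.zOp_slice b) hq a x]
  have h7 : ∀ a b, Integrable (fun w => (h a b : ℂ) *
      zOp 1 a (zOp 1 b (fun x => f ((t, ε), (x, w)))) x) μ := fun a b =>
    ((((hf.zOp_slice b).zOp_slice a).dominatedOn (μ := μ)).integrable_slice
      (q := ((t, ε), x)) ⟨hq, mem_univ _⟩).const_mul _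
  rw [integral_const_mul, integral_const_mul,
    integral_finsetSum _ fun a _ => integrable_finsetSum _ fun b _ => h7 a b]
  congr 2
  refine Finset.sum_congr rfl fun a _ => ?_
  rw [integral_finsetSum _ fun b _ => h7 a b]
  refine Finset.sum_congr rfl fun b _ => ?_
  rw [integral_const_mul, h6]

end Superposition

/-! ### Coherent states and the expansion of profiles in them -/

section Coherent

variable {n : ℕ} (Q : QuadraticModel n)

instance isAddHaarMeasure_volume_prod :
    (volume : Measure (E n × E n)).IsAddHaarMeasure :=
  inferInstanceAs ((volume : Measure (E n)).prod volume).IsAddHaarMeasure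

/-- The momentum at time `t` of the linear flow started at `(2πk, q)`, `w = (q, k)`. -/
def QuadraticModel.orbitP (s : ℝ) (κt : ℝ × ℝ) (w : E n × E n) : E n :=
  WithLp.toLp 2 fun j => (Q.matriciant κt.1 s κt.2 *ᵥ
    Sum.elim (fun i => 2 * Real.pi * w.2 i) w.1.ofLp) (Sum.inl j)

/-- The position at time `t` of the linear flow started at `(2πk, q)`, `w = (q, k)`. -/
def QuadraticModel.orbitX (s : ℝ) (κt : ℝ × ℝ) (w : E n × E n) : E n :=
  WithLp.toLp 2 fun j => (Q.matriciant κt.1 s κt.2 *ᵥ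
    Sum.elim (fun i => 2 * Real.pi * w.2 i) w.1.ofLp) (Sum.inr j)

/-- The coherent state propagated by the quadratic Hamiltonian. -/
def QuadraticModel.coherent (s : ℝ) (κt : ℝ × ℝ) (w : E n × E n) : E n → ℂ :=
  tcWave 1 (1 / 2 * inner ℝ (Q.orbitP s κt w) (Q.orbitX s κt w)) (Q.orbitP s κt w)
    (Q.orbitX s κt w) (fun ξ => Q.wavePacket s (κt, ξ))

theorem QuadraticModel.orbit_eq (s : ℝ) (κt : ℝ × ℝ) (w : E n × E n) :
    Sum.elim (Q.orbitP s κt w).ofLp (Q.orbitX s κt w).ofLp =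
      Q.matriciant κt.1 s κt.2 *ᵥ Sum.elim (fun i => 2 * Real.pi * w.2 i) w.1.ofLp := by
  funext a
  rcases a with j | j <;> rfl

theorem QuadraticModel.orbitP_self (κ s : ℝ) (w : E n × E n) :
    Q.orbitP s (κ, s) w = (2 * Real.pi) • w.2 := by
  ext j
  simp [QuadraticModel.orbitP, Q.matriciant_self]

theorem QuadraticModel.orbitX_self (κ s : ℝ) (w : E n × E n) :
    Q.orbitX s (κ, s) w = w.1 := by
  ext j
  simp [QuadraticModel.orbitX, Q.matriciant_self]

variable {F V : Type} [NormedAddCommGroup F] [NormedSpace ℝ F] [NormedAddCommGroup V]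
  [NormedSpace ℝ V] {D : Set F}

theorem QuadraticModel.slowOn_orbit (hD : IsOpen D) (s : ℝ) {σ : F → ℝ × ℝ}
    (hσ : ContDiffOn ℝ ∞ σ D) (L : V →L[ℝ] E n × E n) (a : Idx n) :
    SlowOn D (fun q : F × V => (Q.matriciant (σ q.1).1 s (σ q.1).2 *ᵥ
      Sum.elim (fun i => 2 * Real.pi * (L q.2).2 i) (L q.2).1.ofLp) a) := by
  simp only [Matrix.mulVec, dotProduct, Fintype.sum_sum_type, Sum.elim_inl, Sum.elim_inr]
  have hm : ∀ b, SlowOn D (fun q : F × V => Q.matriciant (σ q.1).1 s (σ q.1).2 a b) := fun b =>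
    SlowOn.param hD ((Q.contDiff_matriciant s a b).comp_contDiffOn hσ)
  refine (SlowOn.sum hD _ fun j _ => (hm _).mul ((SlowOn.const hD _).mul ?_)).add
    (SlowOn.sum hD _ fun j _ => (hm _).mul ?_)
  · exact SlowOn.clm_snd hD ((EuclideanSpace.proj j : E n →L[ℝ] ℝ).comp
      ((ContinuousLinearMap.snd ℝ (E n) (E n)).comp L))
  · exact SlowOn.clm_snd hD ((EuclideanSpace.proj j : E n →L[ℝ] ℝ).comp
      ((ContinuousLinearMap.fst ℝ (E n) (E n)).comp L))

theorem QuadraticModel.slowOn_orbitP (hD : IsOpen D) (s : ℝ) {σ : F → ℝ × ℝ}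
    (hσ : ContDiffOn ℝ ∞ σ D) (L : V →L[ℝ] E n × E n) :
    SlowOn D (fun q : F × V => Q.orbitP s (σ q.1) (L q.2)) :=
  SlowOn.of_coord hD fun j => Q.slowOn_orbit hD s hσ L (Sum.inl j)

theorem QuadraticModel.slowOn_orbitX (hD : IsOpen D) (s : ℝ) {σ : F → ℝ × ℝ}
    (hσ : ContDiffOn ℝ ∞ σ D) (L : V →L[ℝ] E n × E n) :
    SlowOn D (fun q : F × V => Q.orbitX s (σ q.1) (L q.2)) :=
  SlowOn.of_coord hD fun j => Q.slowOn_orbit hD s hσ L (Sum.inr j)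

/-- The coherent state decays in `x - X(w)` and the coefficient in `w`. Since `X(w)` grows at most
polynomially, the pair `(x - X(w), w)` controls `(x, w)`, and the product decays jointly. -/
theorem QuadraticModel.rapidOn_coherent_mul (hD : IsOpen D) (s : ℝ) {σ : F → ℝ × ℝ}
    (hσ : ContDiffOn ℝ ∞ σ D) {H : F × (E n × E n) → ℂ} (hH : RapidOn D H) :
    RapidOn D (fun q : F × (E n × (E n × E n)) =>
      Q.coherent s (σ q.1) q.2.2 q.2.1 * H (q.1, q.2.2)) := by
  have hX := Q.slowOn_orbitX hD s hσ (ContinuousLinearMap.snd ℝ (E n) (E n × E n))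
  have hP := Q.slowOn_orbitP hD s hσ (ContinuousLinearMap.snd ℝ (E n) (E n × E n))
  have hX' := Q.slowOn_orbitX hD s hσ (ContinuousLinearMap.id ℝ (E n × E n))
  have hx := SlowOn.clm_snd hD (ContinuousLinearMap.fst ℝ (E n) (E n × E n))
  have hxX : SlowOn D (fun q : F × (E n × (E n × E n)) =>
      q.2.1 - Q.orbitX s (σ q.1) q.2.2) :=
    (hx.add (hX.clm (-ContinuousLinearMap.id ℝ (E n)))).congr fun τ _ v => by
      simp [sub_eq_add_neg]
  have hg := (Q.rapidOn_wavePacket s).comp_param hD hσ (mapsTo_univ _ _)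
  have h1 := (hg.tensor hH).comp hD (σ := id) contDiffOn_id (mapsTo_id D)
    (hxX.prodMk (SlowOn.clm_snd hD (ContinuousLinearMap.snd ℝ (E n) (E n × E n)))) (by
      intro K hK hKc
      obtain ⟨N, C, hC0, hC⟩ := hX'.bound 0 K hK hKc
      refine ⟨N + 1, 1 + C, fun τ hτ v => ?_⟩
      have h1 := hC τ hτ v.2
      beta_reduce at h1
      rw [norm_iteratedFDeriv_zero, ContinuousLinearMap.id_apply] at h1
      set θ : E n × (E n × E n) := (v.1 - Q.orbitX s (σ τ) v.2, v.2) with hθ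
      change 1 + ‖v‖ ≤ (1 + C) * (1 + ‖θ‖) ^ (N + 1)
      have h2 : ‖v.2‖ ≤ ‖θ‖ := norm_snd_le θ
      have h3 : ‖v.1‖ ≤ ‖θ‖ + ‖Q.orbitX s (σ τ) v.2‖ := by
        have h4 : ‖v.1 - Q.orbitX s (σ τ) v.2‖ ≤ ‖θ‖ := norm_fst_le θ
        have h5 := norm_add_le (v.1 - Q.orbitX s (σ τ) v.2) (Q.orbitX s (σ τ) v.2)
        rw [sub_add_cancel] at h5
        linarith
      have hθ0 := norm_nonneg θ
      have h6 : ‖v‖ ≤ ‖θ‖ + C * (1 + ‖θ‖) ^ N := by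
        have h7 : C * (1 + ‖v.2‖) ^ N ≤ C * (1 + ‖θ‖) ^ N := by gcongr
        refine max_le (by linarith) (h2.trans ?_)
        have : 0 ≤ C * (1 + ‖θ‖) ^ N := by positivity
        linarith
      have h8 : 1 + ‖θ‖ ≤ (1 + ‖θ‖) ^ (N + 1) := le_self_pow₀ (by linarith) (by simp)
      have h9 : (1 + ‖θ‖) ^ N ≤ (1 + ‖θ‖) ^ (N + 1) := pow_le_pow_right₀ (by linarith) (by simp)
      nlinarith [mul_le_mul_of_nonneg_left h9 hC0])
  have h2 : SlowOn D (fun q : F × (E n × (E n × E n)) => Complex.exp (Complex.I *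
      ((1 / 2 * inner ℝ (Q.orbitP s (σ q.1) q.2.2) (Q.orbitX s (σ q.1) q.2.2) +
        inner ℝ (Q.orbitP s (σ q.1) q.2.2) (q.2.1 - Q.orbitX s (σ q.1) q.2.2) : ℝ) : ℂ))) :=
    (((SlowOn.const hD (1 / 2 : ℝ)).mul (hP.bilin hX (innerSL ℝ))).add
      (hP.bilin hxX (innerSL ℝ))).cexp_I
  refine (h1.mul_slow h2).congr fun τ _ v => ?_
  simp only [QuadraticModel.coherent, tcWave, Real.sqrt_one, inv_one, one_smul, Complex.ofReal_one,
    div_one, id, show ContinuousLinearMap.snd ℝ (E n) (E n × E n) v = v.2 from rfl]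
  ring

/-- A coherent state is the wave packet in the frame of a linear orbit. By Euler's identity for the
homogeneous quadratic Hamiltonian the Lagrangian `⟨P, Ẋ⟩ - 𝔥` is the derivative of `½⟨P, X⟩`, which
explains the phase in the definition. -/
theorem QuadraticModel.hasDerivAt_coherent (κ s t : ℝ) (w : E n × E n) (x : E n) :
    HasDerivAt (fun t => Q.coherent s (κ, t) w x) (-Complex.I * ((1 / 2 : ℂ) *
      ∑ a, ∑ b, (Q.hess κ t a b : ℂ) * zOp 1 a (zOp 1 b (Q.coherent s (κ, t) w)) x)) t := by
  have hg : RapidOn univ (fun q : ℝ × E n => Q.wavePacket s ((κ, q.1), q.2)) :=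
    (Q.rapidOn_wavePacket s).comp_param isOpen_univ (σ := fun t => (κ, t))
      (contDiff_const.prodMk contDiff_id).contDiffOn (mapsTo_univ _ _)
  obtain ⟨U, U', hU, hUe⟩ := exists_schwartzCurve hg
  have hUe' : ∀ t, ⇑(U t) = fun x => Q.wavePacket s ((κ, t), x) := fun t =>
    funext fun x => hUe t (mem_univ t) x
  have hUs : ∀ t ∈ univ, Complex.I • U' t = affineS 1 (Q.hess κ t) 0 0 (U t) := fun t _ => by
    ext x
    have h1 := hU.hasDerivAt t (mem_univ t) x
    simp only [hUe'] at h1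
    rw [smul_apply, h1.unique (Q.hasDerivAt_wavePacket κ s t x), affineS_apply]
    simp only [add_apply, smul_apply, sum_apply, coe_zS, smul_eq_mul, Pi.zero_apply,
      Complex.ofReal_zero, zero_mul, Finset.sum_const_zero, add_zero, hUe']
    linear_combination -((1 / 2 : ℂ) * ∑ a, ∑ b, (Q.hess κ t a b : ℂ) *
        zOp 1 a (zOp 1 b (fun y => Q.wavePacket s ((κ, t), y))) x) * Complex.I_mul_I
  have hm : ∀ a, ContDiff ℝ ∞ (fun t => (Q.matriciant κ s t *ᵥ
      Sum.elim (fun i => 2 * Real.pi * w.2 i) w.1.ofLp) a) := fun a =>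
    contDiff_matrix_mulVec (M := fun t => Q.matriciant κ s t)
      (v := fun _ => Sum.elim (fun i => 2 * Real.pi * w.2 i) w.1.ofLp)
      (fun a b => (Q.contDiff_matriciant s a b).comp (contDiff_const.prodMk contDiff_id))
      (fun b => contDiff_const) a
  have hP : ContDiff ℝ ∞ (fun t => Q.orbitP s (κ, t) w) :=
    (EuclideanSpace.equiv (Fin n) ℝ).symm.contDiff.comp (contDiff_pi.2 fun j => hm (Sum.inl j))
  have hX : ContDiff ℝ ∞ (fun t => Q.orbitX s (κ, t) w) :=
    (EuclideanSpace.equiv (Fin n) ℝ).symm.contDiff.comp (contDiff_pi.2 fun j => hm (Sum.inr j))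
  have hz : ∀ t a, HasDerivAt (fun t => Sum.elim (Q.orbitP s (κ, t) w).ofLp
      (Q.orbitX s (κ, t) w).ofLp a) ((Matrix.J (Fin n) ℝ *ᵥ (0 + Q.hess κ t *ᵥ
        Sum.elim (Q.orbitP s (κ, t) w).ofLp (Q.orbitX s (κ, t) w).ofLp)) a) t := by
    intro t a
    simp only [Q.orbit_eq, zero_add, Matrix.mulVec_mulVec, ← Matrix.mul_assoc]
    refine (hasDerivAt_matrix_mulVec (v := fun _ => Sum.elim (fun i => 2 * Real.pi * w.2 i) w.1.ofLp)
      (v' := 0) (fun a b => Q.hasDerivAt_matriciant κ s t a b)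
      (fun b => hasDerivAt_const t _) a).congr_deriv (by simp)
  obtain ⟨W', hW, hWs⟩ := hU.tcL_solves one_pos (b := fun _ => 0) (c := fun _ => 0)
    (S := fun t => 1 / 2 * inner ℝ (Q.orbitP s (κ, t) w) (Q.orbitX s (κ, t) w))
    (contDiff_const.mul (hP.inner ℝ hX)) hP hX (Q.hess_isSymm κ) (S' := fun t =>
      1 / 2 * ∑ j, ((Matrix.J (Fin n) ℝ *ᵥ (0 + Q.hess κ t *ᵥ
        Sum.elim (Q.orbitP s (κ, t) w).ofLp (Q.orbitX s (κ, t) w).ofLp)) (Sum.inl j) *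
        Q.orbitX s (κ, t) w j + Q.orbitP s (κ, t) w j *
        (Matrix.J (Fin n) ℝ *ᵥ (0 + Q.hess κ t *ᵥ
        Sum.elim (Q.orbitP s (κ, t) w).ofLp (Q.orbitX s (κ, t) w).ofLp)) (Sum.inr j))) (by
      intro t
      refine HasDerivAt.const_mul _ ?_
      have h1 : (fun t => inner ℝ (Q.orbitP s (κ, t) w) (Q.orbitX s (κ, t) w)) = fun t =>
          ∑ j, Q.orbitP s (κ, t) w j * Q.orbitX s (κ, t) w j := by
        funext τ
        simp [PiLp.inner_apply, mul_comm]
      rw [h1]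
      exact HasDerivAt.fun_sum fun j _ => (hz t (Sum.inl j)).mul (hz t (Sum.inr j))) hz (by
      intro t
      simp only [zero_add, J_mulVec_inl, J_mulVec_inr, dotProduct, Fintype.sum_sum_type,
        Sum.elim_inl, Sum.elim_inr, Pi.zero_apply, zero_mul, Finset.sum_const_zero, add_zero,
        Finset.sum_add_distrib, neg_mul, Finset.sum_neg_distrib]
      have h2 : ∀ v : Fin n → ℝ, ∑ j, v j * Q.orbitX s (κ, t) w j =
          ∑ j, Q.orbitX s (κ, t) w j * v j := fun v => Finset.sum_congr rfl fun j _ => mul_comm _ _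
      rw [h2]
      ring) hUs
  have h3 : ∀ t, ⇑(tcL one_pos (1 / 2 * inner ℝ (Q.orbitP s (κ, t) w) (Q.orbitX s (κ, t) w))
      (Q.orbitP s (κ, t) w) (Q.orbitX s (κ, t) w) (U t)) = Q.coherent s (κ, t) w := fun t => by
    rw [coe_tcL, hUe']
    rfl
  have h4 := hW.hasDerivAt t (mem_univ t) x
  simp only [h3] at h4
  refine h4.congr_deriv ?_
  have h5 := congrArg (fun φ : 𝓢(E n, ℂ) => -Complex.I * φ x) (hWs t (mem_univ t))
  simp only [affineS_apply, add_apply, smul_apply, sum_apply, coe_zS, smul_eq_mul, Pi.zero_apply,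
      Complex.ofReal_zero, zero_mul, Finset.sum_const_zero, add_zero, h3, Complex.ofReal_one] at h5
  rw [← h5]
  linear_combination W' t x * Complex.I_mul_I

/-- The squared norm of the Gaussian window. -/
def gaussNorm (n : ℕ) : ℂ :=
  ∫ ξ : E n, Complex.exp (-(1 / 2) * ((‖ξ‖ ^ 2 : ℝ) : ℂ)) * Complex.exp (-(1 / 2) * ((‖ξ‖ ^ 2 : ℝ) : ℂ))

theorem gaussNorm_ne_zero (n : ℕ) : gaussNorm n ≠ 0 := by
  have h1 : gaussNorm n = ((∫ ξ : E n, Real.exp (-1 * ‖ξ‖ ^ 2) : ℝ) : ℂ) := by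
    rw [gaussNorm, ← integral_complex_ofReal]
    congr 1
    funext ξ
    rw [← Complex.exp_add, Complex.ofReal_exp]
    congr 1
    push_cast
    ring
  rw [h1, GaussianFourier.integral_rexp_neg_mul_sq_norm one_pos]
  have : (0 : ℝ) < (Real.pi / 1) ^ (Module.finrank ℝ (E n) / 2 : ℝ) := by positivity
  exact_mod_cast this.ne'

/-- The coefficients of `φ` with respect to coherent states. -/
def windowTransform (φ : F × E n → ℂ) (q : F × (E n × E n)) : ℂ :=
  Complex.exp (Complex.I * ((Real.pi * inner ℝ q.2.2 q.2.1 : ℝ) : ℂ)) *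
    partialFourier (fun r : F × (E n × E n) =>
      Complex.exp (-(1 / 2) * ((‖r.2.2 - r.2.1‖ ^ 2 : ℝ) : ℂ)) * φ (r.1, r.2.2)) q

theorem rapidOn_gaussian (hD : IsOpen D) :
    RapidOn D (fun q : F × E n => Complex.exp (-(1 / 2) * ((‖q.2‖ ^ 2 : ℝ) : ℂ))) := by
  -- The standard Gaussian is the wave packet of the zero Hamiltonian at its initial time, so its
  -- decay is already known.
  let Q : QuadraticModel n := ⟨0, 0, 0, 0, 0, fun _ _ => contDiff_const, fun _ => contDiff_const,
    fun _ _ => contDiff_const, fun _ _ => contDiff_const, fun _ _ => contDiff_const,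
    fun _ => Matrix.isSymm_zero, fun _ => Matrix.isSymm_zero, fun _ => Matrix.isSymm_zero⟩
  refine ((Q.rapidOn_wavePacket 0).comp_param hD (σ := fun _ => ((0 : ℝ), (0 : ℝ)))
    contDiffOn_const (mapsTo_univ _ _)).congr fun τ _ ξ => ?_
  exact (Q.wavePacket_self 0 0 ξ).symm

theorem one_add_norm_le_shear (v : E n × E n) : 1 + ‖v‖ ≤ 2 * (1 + ‖(v.2 - v.1, v.2)‖) ^ 1 := by
  have h1 : ‖v.2 - v.1‖ ≤ ‖(v.2 - v.1, v.2)‖ := norm_fst_le (v.2 - v.1, v.2)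
  have h2 : ‖v.2‖ ≤ ‖(v.2 - v.1, v.2)‖ := norm_snd_le (v.2 - v.1, v.2)
  have h3 : ‖v.1‖ ≤ ‖v.2‖ + ‖v.2 - v.1‖ := by
    have := norm_sub_le v.2 (v.2 - v.1)
    rwa [sub_sub_cancel] at this
  have h4 : ‖v‖ ≤ 2 * ‖(v.2 - v.1, v.2)‖ :=
    max_le (by linarith) (by linarith [norm_nonneg v.2])
  linarith

theorem RapidOn.window {φ : F × E n → ℂ} (hφ : RapidOn D φ) :
    RapidOn D (fun r : F × (E n × E n) =>
      Complex.exp (-(1 / 2) * ((‖r.2.2 - r.2.1‖ ^ 2 : ℝ) : ℂ)) * φ (r.1, r.2.2)) := by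
  have hD := hφ.isOpen
  have hθ : SlowOn D (fun q : F × (E n × E n) => (q.2.2 - q.2.1, q.2.2)) :=
    SlowOn.clm_snd hD ((ContinuousLinearMap.snd ℝ (E n) (E n) -
      ContinuousLinearMap.fst ℝ (E n) (E n)).prod (ContinuousLinearMap.snd ℝ (E n) (E n)))
  have h1 := (rapidOn_gaussian (n := n) hD).tensor hφ
  have h2 := h1.comp hD (σ := id) contDiffOn_id (mapsTo_id D) hθ
    fun K _ _ => ⟨1, 2, fun τ _ v => one_add_norm_le_shear v⟩
  exact h2.congr fun τ _ v => rfl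

variable [FiniteDimensional ℝ F]

theorem RapidOn.windowTransform {φ : F × E n → ℂ} (hφ : RapidOn D φ) :
    RapidOn D (windowTransform φ) :=
  (((SlowOn.const hφ.isOpen Real.pi).mul
    ((SlowOn.clm_snd hφ.isOpen (ContinuousLinearMap.snd ℝ (E n) (E n))).bilin
      (SlowOn.clm_snd hφ.isOpen (ContinuousLinearMap.fst ℝ (E n) (E n)))
      (innerSL ℝ))).cexp_I).mul_rapid hφ.window.partialFourier

/-- The solution of the quadratic Schrödinger equation with the initial datum that has the
coefficients `H`. -/
def QuadraticModel.profile (s : ℝ) (κt : ℝ × ℝ) (H : E n × E n → ℂ) (x : E n) : ℂ :=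
  (gaussNorm n)⁻¹ * ∫ w, Q.coherent s κt w x * H w

/-- For `w = (q, k)` the phase of the coherent state is `π⟨k, q⟩ + 2π⟨k, x - q⟩`. The factor
`exp(iπ⟨k, q⟩)` in the coefficients completes it to `2π⟨k, x⟩`, the kernel of the inverse Fourier
transform. -/
theorem QuadraticModel.coherent_self_mul (κ s : ℝ) (φ : F × E n → ℂ) (ε : F) (w : E n × E n)
    (x : E n) : Q.coherent s (κ, s) w x * NonlocalGPE.windowTransform φ (ε, w) =
      Complex.exp (-(1 / 2) * ((‖x - w.1‖ ^ 2 : ℝ) : ℂ)) *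
        (Complex.exp (((2 * Real.pi * inner ℝ w.2 x : ℝ) : ℂ) * Complex.I) •
        partialFourier (fun r : F × (E n × E n) =>
          Complex.exp (-(1 / 2) * ((‖r.2.2 - r.2.1‖ ^ 2 : ℝ) : ℂ)) * φ (r.1, r.2.2)) (ε, w)) := by
  rw [QuadraticModel.coherent, tcWave, NonlocalGPE.windowTransform, Q.orbitP_self, Q.orbitX_self]
  simp only [Real.sqrt_one, inv_one, one_smul, Complex.ofReal_one, div_one, Q.wavePacket_self,
    smul_eq_mul]
  generalize partialFourier (fun r : F × (E n × E n) =>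
    Complex.exp (-(1 / 2) * ((‖r.2.2 - r.2.1‖ ^ 2 : ℝ) : ℂ)) * φ (r.1, r.2.2)) (ε, w) = y
  have h1 : Complex.exp (((2 * Real.pi * inner ℝ w.2 x : ℝ) : ℂ) * Complex.I) =
      Complex.exp (Complex.I * ((1 / 2 * inner ℝ ((2 * Real.pi) • w.2) w.1 +
        inner ℝ ((2 * Real.pi) • w.2) (x - w.1) : ℝ) : ℂ)) *
      Complex.exp (Complex.I * ((Real.pi * inner ℝ w.2 w.1 : ℝ) : ℂ)) := by
    rw [← Complex.exp_add]
    congr 1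
    rw [inner_sub_right, real_inner_smul_left, real_inner_smul_left]
    push_cast
    ring
  rw [h1]
  ring

/-- The resolution of the identity by coherent states. Fourier inversion in `k` restores the
windowed function at `x`, leaving the square of the window at `x - q` times the value of `φ`;
integration over `q` gives the constant `gaussNorm`. -/
theorem QuadraticModel.profile_self (κ s : ℝ) {φ : F × E n → ℂ} (hφ : RapidOn D φ) {ε : F}
    (hε : ε ∈ D) (x : E n) :
    Q.profile s (κ, s) (fun w => NonlocalGPE.windowTransform φ (ε, w)) x = φ (ε, x) := by
  have h1 := Q.rapidOn_coherent_mul hφ.isOpen s (σ := fun _ => (κ, s)) contDiffOn_const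
    hφ.windowTransform
  have h2 : Integrable (fun w : E n × E n => Q.coherent s (κ, s) w x *
      NonlocalGPE.windowTransform φ (ε, w)) :=
    (h1.dominatedOn (μ := volume)).integrable_slice (q := (ε, x)) ⟨hε, mem_univ _⟩
  rw [QuadraticModel.profile]
  simp only [Q.coherent_self_mul] at h2 ⊢
  rw [Measure.volume_eq_prod] at h2 ⊢
  rw [integral_prod _ h2]
  have h3 : ∀ q : E n, ∫ k : E n, Complex.exp (((2 * Real.pi * inner ℝ k x : ℝ) : ℂ) * Complex.I) •
      partialFourier (fun r : F × (E n × E n) =>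
          Complex.exp (-(1 / 2) * ((‖r.2.2 - r.2.1‖ ^ 2 : ℝ) : ℂ)) * φ (r.1, r.2.2)) (ε, (q, k)) =
      Complex.exp (-(1 / 2) * ((‖x - q‖ ^ 2 : ℝ) : ℂ)) * φ (ε, x) := by
    intro q
    have h4 := hφ.window.slice_integrable hε q
    have h5 := hφ.window.partialFourier.slice_integrable hε q
    have h6 := (hφ.window.differentiableAt_prod hε (q, x)).continuousAt
    have h7 : ContinuousAt (fun y => Complex.exp (-(1 / 2) * ((‖y - q‖ ^ 2 : ℝ) : ℂ)) * φ (ε, y)) x :=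
      ContinuousAt.comp (f := fun y => (ε, (q, y))) h6 (by fun_prop)
    have h8 := MeasureTheory.Integrable.fourierInv_fourier_eq h4 h5 h7
    rw [Real.fourierInv_eq'] at h8
    exact h8
  simp only [integral_const_mul, h3]
  have h9 : ∀ q : E n, Complex.exp (-(1 / 2) * ((‖x - q‖ ^ 2 : ℝ) : ℂ)) *
      (Complex.exp (-(1 / 2) * ((‖x - q‖ ^ 2 : ℝ) : ℂ)) * φ (ε, x)) =
      (fun ξ : E n => Complex.exp (-(1 / 2) * ((‖ξ‖ ^ 2 : ℝ) : ℂ)) *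
        Complex.exp (-(1 / 2) * ((‖ξ‖ ^ 2 : ℝ) : ℂ)) * φ (ε, x)) (x - q) := fun q => by
    rw [← mul_assoc]
  rw [integral_congr_ae (Eventually.of_forall h9)]
  rw [integral_sub_left_eq_self (fun ξ : E n => Complex.exp (-(1 / 2) * ((‖ξ‖ ^ 2 : ℝ) : ℂ)) *
        Complex.exp (-(1 / 2) * ((‖ξ‖ ^ 2 : ℝ) : ℂ)) * φ (ε, x)) volume x, integral_mul_const, ← gaussNorm,
    inv_mul_cancel_left₀ (gaussNorm_ne_zero n)]

variable {D' : Set ℝ} {κ : ℝ → ℝ} {φ : ℝ × E n → ℂ}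

theorem QuadraticModel.rapidOn_coherent_windowTransform (s : ℝ) (hκ : ContDiffOn ℝ ∞ κ D')
    (hφ : RapidOn D' φ) : RapidOn (univ ×ˢ D') (fun q : (ℝ × ℝ) × (E n × (E n × E n)) =>
      Q.coherent s (κ q.1.2, q.1.1) q.2.2 q.2.1 *
        NonlocalGPE.windowTransform φ (q.1.2, q.2.2)) := by
  have hD : IsOpen ((univ : Set ℝ) ×ˢ D') := isOpen_univ.prod hφ.isOpen
  exact Q.rapidOn_coherent_mul hD s (σ := fun q => (κ q.2, q.1))
    ((hκ.comp contDiffOn_snd fun q hq => hq.2).prodMk contDiffOn_fst)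
    (hφ.windowTransform.comp_param hD contDiffOn_snd fun q hq => hq.2)

/-- The representation by coherent states has no singular times: the profile stays a smooth family
of Schwartz functions also where `λ₃` is not invertible and the kernel is meaningless. -/
theorem QuadraticModel.rapidOn_profile (s : ℝ) (hκ : ContDiffOn ℝ ∞ κ D') (hφ : RapidOn D' φ) :
    RapidOn (univ ×ˢ D') (fun q : (ℝ × ℝ) × E n => Q.profile s (κ q.1.2, q.1.1)
      (fun w => NonlocalGPE.windowTransform φ (q.1.2, w)) q.2) :=
  (SlowOn.const (isOpen_univ.prod hφ.isOpen) (gaussNorm n)⁻¹).mul_rapid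
    (Q.rapidOn_coherent_windowTransform s hκ hφ).integral

theorem zOp_const_mul_fun (ħ : ℝ) (a : Idx n) (c : ℂ) (f : E n → ℂ) :
    zOp ħ a (fun x => c * f x) = fun x => c * zOp ħ a f x := by
  funext x
  rcases a with j | j
  · change -Complex.I * (ħ : ℂ) * fderiv ℝ (fun x => c * f x) x _ =
      c * (-Complex.I * (ħ : ℂ) * fderiv ℝ f x _)
    rw [show (fun x => c * f x) = c • f from rfl, fderiv_const_smul_field]
    simp only [smul_apply, smul_eq_mul, Pi.smul_apply]
    ring
  · simp only [zOp]
    ring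

theorem QuadraticModel.hasDerivAt_profile (s : ℝ) (hκ : ContDiffOn ℝ ∞ κ D') (hφ : RapidOn D' φ)
    {ε : ℝ} (hε : ε ∈ D') (t : ℝ) (x : E n) :
    HasDerivAt (fun t => Q.profile s (κ ε, t) (fun w => NonlocalGPE.windowTransform φ (ε, w)) x)
      (-Complex.I * ((1 / 2 : ℂ) * ∑ a, ∑ b, (Q.hess (κ ε) t a b : ℂ) * zOp 1 a (zOp 1 b
        (Q.profile s (κ ε, t) (fun w => NonlocalGPE.windowTransform φ (ε, w)))) x)) t := by
  have h1 := hasDerivAt_integral_schrodinger (μ := volume)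
    (Q.rapidOn_coherent_windowTransform s hκ hφ) (h := Q.hess (κ ε) t) (t := t) (ε := ε)
    ⟨mem_univ t, hε⟩ x fun w => by
      have h2 := (Q.hasDerivAt_coherent (κ ε) s t w x).mul_const
        (NonlocalGPE.windowTransform φ (ε, w))
      refine h2.congr_deriv ?_
      simp only [mul_comm _ (NonlocalGPE.windowTransform φ (ε, w)), zOp_const_mul_fun]
      simp only [Finset.mul_sum]
      refine Finset.sum_congr rfl fun a _ => Finset.sum_congr rfl fun b _ => ?_
      ring
  refine (h1.const_mul (gaussNorm n)⁻¹).congr_deriv ?_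
  have h3 : Q.profile s (κ ε, t) (fun w => NonlocalGPE.windowTransform φ (ε, w)) = fun x =>
      (gaussNorm n)⁻¹ * ∫ w, Q.coherent s (κ ε, t) w x * NonlocalGPE.windowTransform φ (ε, w) := rfl
  rw [h3]
  simp only [zOp_const_mul_fun, Finset.mul_sum]
  refine Finset.sum_congr rfl fun a _ => Finset.sum_congr rfl fun b _ => ?_
  ring

end Coherent

/-! ### Gaussian integrals -/

section Gaussian

variable {n : ℕ}

theorem exists_orthogonal_diagonalization {B : Matrix (Fin n) (Fin n) ℝ} (hB : B.IsSymm) :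
    ∃ (e : OrthonormalBasis (Fin n) ℝ (E n)) (O : Matrix (Fin n) (Fin n) ℝ) (β : Fin n → ℝ),
      (∀ i j, O i j = e j i) ∧ Oᵀ * O = 1 ∧ B = O * Matrix.diagonal β * Oᵀ := by
  have hH : B.IsHermitian := by
    rw [Matrix.IsHermitian, Matrix.conjTranspose_eq_transpose_of_trivial]
    exact hB
  refine ⟨hH.eigenvectorBasis, hH.eigenvectorUnitary, hH.eigenvalues,
    fun i j => hH.eigenvectorUnitary_apply i j, ?_, ?_⟩
  · rw [← Matrix.conjTranspose_eq_transpose_of_trivial, ← Matrix.star_eq_conjTranspose]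
    exact Unitary.coe_star_mul_self _
  · have h := hH.spectral_theorem
    rw [Unitary.conjStarAlgAut_apply] at h
    rw [← Matrix.conjTranspose_eq_transpose_of_trivial, ← Matrix.star_eq_conjTranspose]
    exact h

/-- The complexification of a real vector. -/
def cx (v : Fin n → ℝ) : Fin n → ℂ := fun j => (v j : ℂ)

theorem cx_mulVec (M : Matrix (Fin n) (Fin n) ℝ) (v : Fin n → ℝ) :
    cx (M *ᵥ v) = M.map Complex.ofReal *ᵥ cx v := by
  funext j
  simp [cx, Matrix.mulVec, dotProduct]

theorem cx_dotProduct (v w : Fin n → ℝ) : cx v ⬝ᵥ cx w = ((v ⬝ᵥ w : ℝ) : ℂ) := by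
  simp [cx, dotProduct]

theorem map_ofReal_mul {ι₁ ι₂ ι₃ : Type} [Fintype ι₂] (M : Matrix ι₁ ι₂ ℝ) (N : Matrix ι₂ ι₃ ℝ) :
    (M * N).map Complex.ofReal = M.map Complex.ofReal * N.map Complex.ofReal :=
  Matrix.map_mul (f := Complex.ofRealHom)

theorem map_ofReal_one {ι : Type} [DecidableEq ι] :
    (1 : Matrix ι ι ℝ).map Complex.ofReal = 1 :=
  Matrix.map_one Complex.ofReal Complex.ofReal_zero Complex.ofReal_one

/-- `∫ exp(-½⟨η, (1 - iB)η⟩) dη`. -/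
def gaussI (B : Matrix (Fin n) (Fin n) ℝ) : ℂ :=
  ∫ η : E n, Complex.exp (-(1 / 2) *
    (cx η.ofLp ⬝ᵥ ((1 - Complex.I • B.map Complex.ofReal) *ᵥ cx η.ofLp)))

/-- A real symmetric `B` is diagonalized by an orthogonal matrix, which also diagonalizes `1 - iB`
because it fixes the identity. The integral becomes a product of one-dimensional Gaussians with
coefficients of real part one. -/
theorem gaussian_diagonal {B : Matrix (Fin n) (Fin n) ℝ} (hB : B.IsSymm) :
    ∃ (b : Fin n → ℂ) (O : Matrix (Fin n) (Fin n) ℝ), (∀ j, (b j).re = 1) ∧ Oᵀ * O = 1 ∧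
      1 - Complex.I • B.map Complex.ofReal =
        O.map Complex.ofReal * Matrix.diagonal b * (O.map Complex.ofReal)ᵀ ∧
      ∀ v : Fin n → ℝ, ∫ η : E n, Complex.exp (-(1 / 2) *
        (cx η.ofLp ⬝ᵥ ((1 - Complex.I • B.map Complex.ofReal) *ᵥ cx η.ofLp)) -
          Complex.I * (cx v ⬝ᵥ cx η.ofLp)) =
        ∏ j, ((Real.pi : ℂ) / (1 / 2 * b j)) ^ (1 / 2 : ℂ) *
          Complex.exp ((-Complex.I * cx (Oᵀ *ᵥ v) j) ^ 2 / (4 * (1 / 2 * b j))) := by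
  obtain ⟨e, O, β, hOe, hO, hBO⟩ := exists_orthogonal_diagonalization hB
  have hO' : O * Oᵀ = 1 := mul_eq_one_comm.1 hO
  set b : Fin n → ℂ := fun j => 1 - Complex.I * (β j : ℂ) with hb
  have hOc : (O.map Complex.ofReal)ᵀ * O.map Complex.ofReal = 1 := by
    rw [← Matrix.transpose_map, ← map_ofReal_mul, hO, map_ofReal_one]
  have hOc' : O.map Complex.ofReal * (O.map Complex.ofReal)ᵀ = 1 := by
    rw [← Matrix.transpose_map, ← map_ofReal_mul, hO', map_ofReal_one]
  have hM : 1 - Complex.I • B.map Complex.ofReal =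
      O.map Complex.ofReal * Matrix.diagonal b * (O.map Complex.ofReal)ᵀ := by
    have h1 : Matrix.diagonal b = 1 - Complex.I • (Matrix.diagonal β).map Complex.ofReal := by
      rw [Matrix.diagonal_map Complex.ofReal_zero, ← Matrix.diagonal_one, ← Matrix.diagonal_smul,
        Matrix.diagonal_sub]
      rfl
    rw [h1, Matrix.mul_sub, Matrix.sub_mul, Matrix.mul_one, hOc', Matrix.mul_smul, Matrix.smul_mul,
      ← Matrix.transpose_map, ← map_ofReal_mul, ← map_ofReal_mul, ← hBO]
  refine ⟨b, O, fun j => by simp [hb], hO, hM, fun v => ?_⟩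
  have hT : ∀ y : Fin n → ℝ, (e.repr.symm (WithLp.toLp 2 y)).ofLp = O *ᵥ y := fun y => by
    funext i
    rw [← e.sum_repr_symm]
    simp [Matrix.mulVec, dotProduct, hOe, mul_comm]
  -- The substitution `η = O y` preserves Lebesgue measure because the columns of `O` form an
  -- orthonormal basis.
  rw [← (e.measurePreserving_repr_symm).integral_comp
      e.repr.symm.toHomeomorph.measurableEmbedding,
    ← (PiLp.volume_preserving_toLp (Fin n)).integral_comp
      (MeasurableEquiv.toLp 2 _).measurableEmbedding]
  simp only [hT, hM]
  rw [← GaussianFourier.integral_cexp_neg_sum_mul_add (b := fun j => 1 / 2 * b j)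
    (fun j => by simp [hb]) (fun j => -Complex.I * cx (Oᵀ *ᵥ v) j)]
  congr 1
  funext y
  congr 1
  have e1 : cx (O *ᵥ y) ⬝ᵥ ((O.map Complex.ofReal * Matrix.diagonal b * (O.map Complex.ofReal)ᵀ) *ᵥ
      cx (O *ᵥ y)) = ∑ j, b j * (y j : ℂ) ^ 2 := by
    rw [cx_mulVec, Matrix.mulVec_mulVec, Matrix.mul_assoc, hOc, Matrix.mul_one,
      ← Matrix.mulVec_mulVec, Matrix.dotProduct_mulVec, Matrix.vecMul_mulVec, hOc,
      Matrix.vecMul_one]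
    simp only [dotProduct, Matrix.mulVec_diagonal, cx]
    exact Finset.sum_congr rfl fun j _ => by ring
  have e2 : cx v ⬝ᵥ cx (O *ᵥ y) = ∑ j, cx (Oᵀ *ᵥ v) j * (y j : ℂ) := by
    rw [cx_dotProduct, Matrix.dotProduct_mulVec, ← Matrix.mulVec_transpose, ← cx_dotProduct]
    rfl
  rw [e1, e2, sub_eq_add_neg, Finset.mul_sum, ← Finset.sum_neg_distrib, Finset.mul_sum,
    ← Finset.sum_neg_distrib]
  exact congrArg₂ _ (Finset.sum_congr rfl fun j _ => by ring)
    (Finset.sum_congr rfl fun j _ => by ring)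

/-- Squaring removes the complex square roots of the one-dimensional factors and leaves `2π / b j`,
whose denominators multiply to the determinant. -/
theorem gaussI_sq_mul_det {B : Matrix (Fin n) (Fin n) ℝ} (hB : B.IsSymm) :
    gaussI B ^ 2 * (1 - Complex.I • B.map Complex.ofReal).det = (2 * (Real.pi : ℂ)) ^ n := by
  obtain ⟨b, O, hb, hO, hM, hG⟩ := gaussian_diagonal hB
  have hb0 : ∀ j, b j ≠ 0 := fun j h => by simpa [h] using hb j
  have h1 := hG 0
  have h0 : cx (0 : Fin n → ℝ) = 0 := by funext j; simp [cx]
  simp only [h0, zero_dotProduct, mul_zero, sub_zero, Matrix.mulVec_zero, Pi.zero_apply, ne_eq,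
    OfNat.ofNat_ne_zero, not_false_eq_true, zero_pow, zero_div, Complex.exp_zero, mul_one] at h1
  have hdet : (O.map Complex.ofReal).det * (O.map Complex.ofReal)ᵀ.det = 1 := by
    rw [mul_comm, ← Matrix.det_mul, ← Matrix.transpose_map, ← map_ofReal_mul, hO, map_ofReal_one,
      Matrix.det_one]
  rw [gaussI, h1, hM, Matrix.det_mul, Matrix.det_mul, Matrix.det_diagonal, mul_right_comm _ _
    (Matrix.det _), hdet, one_mul, ← Finset.prod_pow, ← Finset.prod_mul_distrib]
  rw [Finset.prod_congr rfl (g := fun _ => 2 * (Real.pi : ℂ)) fun j _ => ?_, Finset.prod_const,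
    Finset.card_univ, Fintype.card_fin]
  rw [← Complex.cpow_nat_mul]
  have := hb0 j
  norm_num
  field_simp

theorem gaussI_ne_zero {B : Matrix (Fin n) (Fin n) ℝ} (hB : B.IsSymm) : gaussI B ≠ 0 := by
  intro h
  have h1 := gaussI_sq_mul_det hB
  rw [h, zero_pow two_ne_zero, zero_mul] at h1
  exact pow_ne_zero n (mul_ne_zero two_ne_zero (by exact_mod_cast Real.pi_ne_zero)) h1.symm

theorem integral_gaussian {B : Matrix (Fin n) (Fin n) ℝ} (hB : B.IsSymm) (v : Fin n → ℝ) :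
    ∫ η : E n, Complex.exp (-(1 / 2) *
        (cx η.ofLp ⬝ᵥ ((1 - Complex.I • B.map Complex.ofReal) *ᵥ cx η.ofLp)) -
          Complex.I * (cx v ⬝ᵥ cx η.ofLp)) =
      gaussI B * Complex.exp (-(1 / 2) *
        (cx v ⬝ᵥ ((1 - Complex.I • B.map Complex.ofReal)⁻¹ *ᵥ cx v))) := by
  obtain ⟨b, O, hb, hO, hM, hG⟩ := gaussian_diagonal hB
  have hb0 : ∀ j, b j ≠ 0 := fun j h => by simpa [h] using hb j
  have h1 := hG 0
  have h0 : cx (0 : Fin n → ℝ) = 0 := by funext j; simp [cx]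
  simp only [h0, zero_dotProduct, mul_zero, sub_zero, Matrix.mulVec_zero, Pi.zero_apply, ne_eq,
    OfNat.ofNat_ne_zero, not_false_eq_true, zero_pow, zero_div, Complex.exp_zero, mul_one] at h1
  have hOc : (O.map Complex.ofReal)ᵀ * O.map Complex.ofReal = 1 := by
    rw [← Matrix.transpose_map, ← map_ofReal_mul, hO, map_ofReal_one]
  have hOc' := mul_eq_one_comm.1 hOc
  have hinv : (1 - Complex.I • B.map Complex.ofReal)⁻¹ =
      O.map Complex.ofReal * Matrix.diagonal (fun j => (b j)⁻¹) * (O.map Complex.ofReal)ᵀ := by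
    refine Matrix.inv_eq_right_inv ?_
    have h2 : Matrix.diagonal b * Matrix.diagonal (fun j => (b j)⁻¹) = 1 := by
      rw [Matrix.diagonal_mul_diagonal, ← Matrix.diagonal_one]
      congr 1
      funext j
      exact mul_inv_cancel₀ (hb0 j)
    rw [hM]
    calc _ = O.map Complex.ofReal * (Matrix.diagonal b * ((O.map Complex.ofReal)ᵀ *
          O.map Complex.ofReal) * Matrix.diagonal (fun j => (b j)⁻¹)) *
          (O.map Complex.ofReal)ᵀ := by simp only [Matrix.mul_assoc]
      _ = 1 := by rw [hOc, Matrix.mul_one, h2, Matrix.mul_one, hOc']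
  rw [hG, gaussI, h1, Finset.prod_mul_distrib, ← Complex.exp_sum, hinv]
  congr 2
  rw [← Matrix.mulVec_mulVec, ← Matrix.mulVec_mulVec, Matrix.dotProduct_mulVec,
    ← Matrix.mulVec_transpose, ← Matrix.transpose_map, ← cx_mulVec]
  simp only [dotProduct, Matrix.mulVec_diagonal, Finset.mul_sum]
  refine Finset.sum_congr rfl fun j _ => ?_
  have := hb0 j
  rw [mul_pow, neg_sq, Complex.I_sq]
  field_simp
  norm_num

end Gaussian

/-! ### The Green function of the quadratic Schrödinger equation -/

section Green

variable {n : ℕ} {A : Matrix (Idx n) (Idx n) ℝ}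

/-- The transpose of a symplectic matrix is symplectic: the first two relations are blocks of `A J
Aᵀ = J`, the third is a block of `Aᵀ J A = J`. -/
theorem symplectic_blocks (hA : Aᵀ * Matrix.J (Fin n) ℝ * A = Matrix.J (Fin n) ℝ) :
    A.toBlocks₂₁ * A.toBlocks₂₂ᵀ = A.toBlocks₂₂ * A.toBlocks₂₁ᵀ ∧
    A.toBlocks₁₁ * A.toBlocks₂₂ᵀ - A.toBlocks₁₂ * A.toBlocks₂₁ᵀ = 1 ∧
    A.toBlocks₁₁ᵀ * A.toBlocks₂₁ = A.toBlocks₂₁ᵀ * A.toBlocks₁₁ := by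
  have h1 : A * Matrix.J (Fin n) ℝ * Aᵀ = Matrix.J (Fin n) ℝ :=
    SymplecticGroup.mem_iff.1 (SymplecticGroup.mem_iff'.2 hA)
  rw [← Matrix.fromBlocks_toBlocks A] at h1 hA
  simp only [Matrix.J, Matrix.fromBlocks_transpose, Matrix.fromBlocks_multiply, mul_zero, mul_one,
    mul_neg, zero_add, add_zero, Matrix.fromBlocks_inj, neg_mul, ← sub_eq_add_neg] at h1 hA
  obtain ⟨-, h2, -, h4⟩ := h1
  obtain ⟨h5, -, -, -⟩ := hA
  refine ⟨(sub_eq_zero.1 h4).symm, ?_, (sub_eq_zero.1 h5).symm⟩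
  rw [← neg_inj, neg_sub]
  exact h2

/-- The quadratic form of the Green function in centered coordinates. -/
def greenPhase (A : Matrix (Idx n) (Idx n) ℝ) (ξ η : Fin n → ℝ) : ℝ :=
  -(1 / 2 * (η ⬝ᵥ ((lam1 A * (lam3 A)⁻¹) *ᵥ η))) + ξ ⬝ᵥ ((lam3 A)⁻¹ *ᵥ η)
    - 1 / 2 * (ξ ⬝ᵥ (((lam3 A)⁻¹ * lam4 A) *ᵥ ξ))

/-- The matrix of the quadratic form of the Green function in the initial position. -/
def greenB (A : Matrix (Idx n) (Idx n) ℝ) : Matrix (Fin n) (Fin n) ℝ := -(lam1 A * (lam3 A)⁻¹)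

theorem det_lam3 : (lam3 A).det = (-1) ^ n * A.toBlocks₂₁.det := by
  rw [lam3, Matrix.det_neg, Matrix.det_transpose, Fintype.card_fin]

theorem lam3_inv (h3 : (lam3 A).det ≠ 0) : (lam3 A)⁻¹ = -(A.toBlocks₂₁⁻¹)ᵀ := by
  have hc : IsUnit A.toBlocks₂₁.det := by
    rw [det_lam3] at h3
    exact (right_ne_zero_of_mul h3).isUnit
  refine Matrix.inv_eq_right_inv ?_
  rw [lam3, neg_mul_neg, ← Matrix.transpose_mul, Matrix.nonsing_inv_mul _ hc, Matrix.transpose_one]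

section Blocks

variable (hA : Aᵀ * Matrix.J (Fin n) ℝ * A = Matrix.J (Fin n) ℝ) (h3 : (lam3 A).det ≠ 0)
include hA h3

theorem isUnit_det_toBlocks₂₁ : IsUnit A.toBlocks₂₁.det := by
  rw [det_lam3] at h3
  exact (right_ne_zero_of_mul h3).isUnit

theorem inv_mul_toBlocks_isSymm : (A.toBlocks₂₁⁻¹ * A.toBlocks₂₂).IsSymm := by
  have hc := isUnit_det_toBlocks₂₁ hA h3
  have h1 := (symplectic_blocks hA).1
  rw [Matrix.IsSymm, Matrix.transpose_mul]
  calc A.toBlocks₂₂ᵀ * (A.toBlocks₂₁⁻¹)ᵀ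
      = A.toBlocks₂₁⁻¹ * (A.toBlocks₂₁ * A.toBlocks₂₂ᵀ) * (A.toBlocks₂₁⁻¹)ᵀ := by
        rw [Matrix.nonsing_inv_mul_cancel_left _ _ hc]
    _ = A.toBlocks₂₁⁻¹ * A.toBlocks₂₂ * (A.toBlocks₂₁⁻¹ * A.toBlocks₂₁)ᵀ := by
        rw [h1, Matrix.transpose_mul]
        simp only [Matrix.mul_assoc]
    _ = _ := by rw [Matrix.nonsing_inv_mul _ hc, Matrix.transpose_one, Matrix.mul_one]

theorem greenB_eq : greenB A = A.toBlocks₂₁⁻¹ * A.toBlocks₂₂ := by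
  rw [greenB, lam3_inv h3, lam1, mul_neg, neg_neg, ← Matrix.transpose_mul]
  exact inv_mul_toBlocks_isSymm hA h3

theorem greenB_isSymm : (greenB A).IsSymm := by
  rw [greenB_eq hA h3]
  exact inv_mul_toBlocks_isSymm hA h3

theorem mul_inv_toBlocks_isSymm : (A.toBlocks₁₁ * A.toBlocks₂₁⁻¹).IsSymm := by
  have hc := isUnit_det_toBlocks₂₁ hA h3
  have h1 := (symplectic_blocks hA).2.2
  rw [Matrix.IsSymm, Matrix.transpose_mul]
  calc (A.toBlocks₂₁⁻¹)ᵀ * A.toBlocks₁₁ᵀ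
      = (A.toBlocks₂₁⁻¹)ᵀ * (A.toBlocks₁₁ᵀ * A.toBlocks₂₁) * A.toBlocks₂₁⁻¹ := by
        rw [Matrix.mul_assoc, Matrix.mul_nonsing_inv_cancel_right _ _ hc]
    _ = (A.toBlocks₂₁ * A.toBlocks₂₁⁻¹)ᵀ * A.toBlocks₁₁ * A.toBlocks₂₁⁻¹ := by
        rw [h1, Matrix.transpose_mul]
        simp only [Matrix.mul_assoc]
    _ = _ := by rw [Matrix.mul_nonsing_inv _ hc, Matrix.transpose_one, Matrix.one_mul]

/-- For `A = (a, b; c, d)` the phase is built from `c⁻¹d`, `c⁻¹` and `ac⁻¹`, the first and the last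
being symmetric by the symplectic relations. This is the usual generating function of a linear
canonical map with invertible `c`. -/
theorem greenPhase_eq (ξ η : Fin n → ℝ) : greenPhase A ξ η =
    1 / 2 * (η ⬝ᵥ (greenB A *ᵥ η)) - (A.toBlocks₂₁⁻¹ *ᵥ ξ) ⬝ᵥ η +
      1 / 2 * (ξ ⬝ᵥ ((A.toBlocks₁₁ * A.toBlocks₂₁⁻¹) *ᵥ ξ)) := by
  have h1 : (lam3 A)⁻¹ * lam4 A = -(A.toBlocks₁₁ * A.toBlocks₂₁⁻¹) := by
    rw [lam3_inv h3, lam4, neg_mul, ← Matrix.transpose_mul, mul_inv_toBlocks_isSymm hA h3]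
  have h2 : ξ ⬝ᵥ ((lam3 A)⁻¹ *ᵥ η) = -((A.toBlocks₂₁⁻¹ *ᵥ ξ) ⬝ᵥ η) := by
    rw [lam3_inv h3, Matrix.neg_mulVec, dotProduct_neg, Matrix.dotProduct_mulVec,
      Matrix.vecMul_transpose]
  have h4 : lam1 A * (lam3 A)⁻¹ = -greenB A := by rw [greenB, neg_neg]
  rw [greenPhase, h1, h2, h4, Matrix.neg_mulVec, Matrix.neg_mulVec, dotProduct_neg, dotProduct_neg]
  ring

theorem mul_inv_mul_sub : A.toBlocks₁₁ * (A.toBlocks₂₁⁻¹ * A.toBlocks₂₂) - A.toBlocks₁₂ =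
    (A.toBlocks₂₁⁻¹)ᵀ := by
  have hc := isUnit_det_toBlocks₂₁ hA h3
  have h1 := (symplectic_blocks hA).2.1
  have h2 := inv_mul_toBlocks_isSymm hA h3
  rw [← h2, Matrix.transpose_mul]
  have h5 : A.toBlocks₁₂ = A.toBlocks₁₂ * A.toBlocks₂₁ᵀ * (A.toBlocks₂₁⁻¹)ᵀ := by
    rw [Matrix.mul_assoc, ← Matrix.transpose_mul, Matrix.nonsing_inv_mul _ hc,
      Matrix.transpose_one, Matrix.mul_one]
  rw [h5, ← Matrix.mul_assoc, ← Matrix.sub_mul, h1, Matrix.one_mul]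

/-- The phase of the Green function is a generating function of the linear flow. -/
theorem greenPhase_add (z : Idx n → ℝ) (ξ η : Fin n → ℝ) :
    greenPhase A (fun j => (A *ᵥ z) (Sum.inr j) + ξ j) (fun j => z (Sum.inr j) + η j) =
      1 / 2 * ((fun j => (A *ᵥ z) (Sum.inl j)) ⬝ᵥ (fun j => (A *ᵥ z) (Sum.inr j)) -
        (fun j => z (Sum.inl j)) ⬝ᵥ (fun j => z (Sum.inr j))) +
      (fun j => (A *ᵥ z) (Sum.inl j)) ⬝ᵥ ξ - (fun j => z (Sum.inl j)) ⬝ᵥ η +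
      greenPhase A ξ η := by
  have hc := isUnit_det_toBlocks₂₁ hA h3
  set p₀ : Fin n → ℝ := fun j => z (Sum.inl j) with hp₀
  set q₀ : Fin n → ℝ := fun j => z (Sum.inr j) with hq₀
  set p : Fin n → ℝ := fun j => (A *ᵥ z) (Sum.inl j) with hp
  set q : Fin n → ℝ := fun j => (A *ᵥ z) (Sum.inr j) with hq
  have hz : z = Sum.elim p₀ q₀ := by funext a; rcases a with j | j <;> rfl
  have hpe : p = A.toBlocks₁₁ *ᵥ p₀ + A.toBlocks₁₂ *ᵥ q₀ := by
    funext j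
    simp [hp, Matrix.mulVec, dotProduct, Fintype.sum_sum_type, Matrix.toBlocks₁₁, Matrix.toBlocks₁₂,
      hp₀, hq₀]
  have hqe : q = A.toBlocks₂₁ *ᵥ p₀ + A.toBlocks₂₂ *ᵥ q₀ := by
    funext j
    simp [hq, Matrix.mulVec, dotProduct, Fintype.sum_sum_type, Matrix.toBlocks₂₁, Matrix.toBlocks₂₂,
      hp₀, hq₀]
  -- `e1` and `e2` express that at `(q, q₀)` the gradient of the phase is `p` in the final and `-p₀`
  -- in the initial position. Expanding a quadratic form about this point then leaves the same form
  -- in the increments.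
  have e1 : A.toBlocks₂₁⁻¹ *ᵥ q = p₀ + greenB A *ᵥ q₀ := by
    rw [hqe, Matrix.mulVec_add, Matrix.mulVec_mulVec, Matrix.nonsing_inv_mul _ hc,
      Matrix.one_mulVec, Matrix.mulVec_mulVec, greenB_eq hA h3]
  have e2 : (A.toBlocks₁₁ * A.toBlocks₂₁⁻¹) *ᵥ q = p + (A.toBlocks₂₁⁻¹)ᵀ *ᵥ q₀ := by
    rw [← Matrix.mulVec_mulVec, e1, greenB_eq hA h3, ← mul_inv_mul_sub hA h3, hpe,
      Matrix.mulVec_add, Matrix.mulVec_mulVec, Matrix.sub_mulVec]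
    abel
  have hBs : ∀ x y : Fin n → ℝ, x ⬝ᵥ (greenB A *ᵥ y) = y ⬝ᵥ (greenB A *ᵥ x) := fun x y => by
    rw [Matrix.dotProduct_mulVec, ← Matrix.mulVec_transpose, greenB_isSymm hA h3, dotProduct_comm]
  have hKs : ∀ x y : Fin n → ℝ, x ⬝ᵥ ((A.toBlocks₁₁ * A.toBlocks₂₁⁻¹) *ᵥ y) =
      y ⬝ᵥ ((A.toBlocks₁₁ * A.toBlocks₂₁⁻¹) *ᵥ x) := fun x y => by
    rw [Matrix.dotProduct_mulVec, ← Matrix.mulVec_transpose, mul_inv_toBlocks_isSymm hA h3,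
      dotProduct_comm]
  have e3 : ∀ x : Fin n → ℝ, x ⬝ᵥ ((A.toBlocks₂₁⁻¹)ᵀ *ᵥ q₀) = (A.toBlocks₂₁⁻¹ *ᵥ x) ⬝ᵥ q₀ :=
    fun x => by rw [Matrix.dotProduct_mulVec, Matrix.vecMul_transpose]
  change greenPhase A (q + ξ) (q₀ + η) = _
  simp only [greenPhase_eq hA h3, Matrix.mulVec_add, dotProduct_add, add_dotProduct, e1, e2]
  rw [hKs q ξ, e2, hBs q₀ η]
  simp only [dotProduct_add, e3, e1, add_dotProduct]
  rw [dotProduct_comm (greenB A *ᵥ q₀) η, dotProduct_comm (greenB A *ᵥ q₀) q₀,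
    dotProduct_comm q p, dotProduct_comm ξ p]
  ring

theorem waveFrame_toRows : (waveFrame A).toRows₁ =
      Complex.I • A.toBlocks₁₁.map Complex.ofReal + A.toBlocks₁₂.map Complex.ofReal ∧
    waveD A = Complex.I • A.toBlocks₂₁.map Complex.ofReal + A.toBlocks₂₂.map Complex.ofReal := by
  constructor <;> ext i j <;>
  simp [waveD, waveFrame, standardFrame, Matrix.mul_apply, Fintype.sum_sum_type, Matrix.toRows₁,
    Matrix.toRows₂, Matrix.one_apply, Matrix.toBlocks₁₁, Matrix.toBlocks₁₂, Matrix.toBlocks₂₁,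
    Matrix.toBlocks₂₂, mul_comm]

theorem waveD_eq_mul : waveD A = Complex.I • (A.toBlocks₂₁.map Complex.ofReal *
    (1 - Complex.I • (greenB A).map Complex.ofReal)) := by
  have hc := isUnit_det_toBlocks₂₁ hA h3
  have h1 : A.toBlocks₂₁.map Complex.ofReal * (greenB A).map Complex.ofReal =
      A.toBlocks₂₂.map Complex.ofReal := by
    rw [← map_ofReal_mul, greenB_eq hA h3, Matrix.mul_nonsing_inv_cancel_left _ _ hc]
  rw [(waveFrame_toRows hA h3).2, Matrix.mul_sub, Matrix.mul_one, Matrix.mul_smul, h1, smul_sub,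
    smul_smul, Complex.I_mul_I, neg_one_smul, sub_neg_eq_add]

/-- The right side is the matrix that Gaussian integration of the kernel produces. That it equals `C
D⁻¹` is checked by multiplying with `D = i c (1 - iB)`. -/
theorem waveΓ_eq : waveΓ A = (A.toBlocks₁₁ * A.toBlocks₂₁⁻¹).map Complex.ofReal +
    Complex.I • (((A.toBlocks₂₁⁻¹).map Complex.ofReal)ᵀ *
      (1 - Complex.I • (greenB A).map Complex.ofReal)⁻¹ *
        (A.toBlocks₂₁⁻¹).map Complex.ofReal) := by
  have hc := isUnit_det_toBlocks₂₁ hA h3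
  set M := 1 - Complex.I • (greenB A).map Complex.ofReal with hM
  have hdM : IsUnit M.det := by
    have h1 := gaussI_sq_mul_det (greenB_isSymm hA h3)
    refine (right_ne_zero_of_mul (h1.trans_ne ?_)).isUnit
    exact pow_ne_zero n (mul_ne_zero two_ne_zero (by exact_mod_cast Real.pi_ne_zero))
  have hcc : (A.toBlocks₂₁⁻¹).map Complex.ofReal * A.toBlocks₂₁.map Complex.ofReal = 1 := by
    rw [← map_ofReal_mul, Matrix.nonsing_inv_mul _ hc, map_ofReal_one]
  have key : ((A.toBlocks₁₁ * A.toBlocks₂₁⁻¹).map Complex.ofReal +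
    Complex.I • (((A.toBlocks₂₁⁻¹).map Complex.ofReal)ᵀ * M⁻¹ *
        (A.toBlocks₂₁⁻¹).map Complex.ofReal)) * waveD A = (waveFrame A).toRows₁ := by
    have h2 : ((A.toBlocks₂₁⁻¹).map Complex.ofReal)ᵀ * M⁻¹ *
        (A.toBlocks₂₁⁻¹).map Complex.ofReal * waveD A =
        Complex.I • ((A.toBlocks₂₁⁻¹).map Complex.ofReal)ᵀ := by
      rw [waveD_eq_mul hA h3, ← hM, Matrix.mul_smul]
      congr 1
      calc _ = ((A.toBlocks₂₁⁻¹).map Complex.ofReal)ᵀ * (M⁻¹ *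
          ((A.toBlocks₂₁⁻¹).map Complex.ofReal * A.toBlocks₂₁.map Complex.ofReal) * M) := by
            simp only [Matrix.mul_assoc]
        _ = _ := by rw [hcc, Matrix.mul_one, Matrix.nonsing_inv_mul _ hdM, Matrix.mul_one]
    have h4 : (A.toBlocks₁₁ * A.toBlocks₂₁⁻¹).map Complex.ofReal * waveD A =
        Complex.I • A.toBlocks₁₁.map Complex.ofReal + A.toBlocks₁₂.map Complex.ofReal +
          ((A.toBlocks₂₁⁻¹).map Complex.ofReal)ᵀ := by
      rw [(waveFrame_toRows hA h3).2, Matrix.mul_add, Matrix.mul_smul, ← map_ofReal_mul,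
        ← map_ofReal_mul, Matrix.nonsing_inv_mul_cancel_right _ _ hc, Matrix.mul_assoc,
        sub_eq_iff_eq_add'.1 (mul_inv_mul_sub hA h3), ← Matrix.transpose_map, add_assoc]
      congr 1
      ext i j
      simp
    rw [Matrix.add_mul, Matrix.smul_mul, h2, h4, (waveFrame_toRows hA h3).1, smul_smul,
      Complex.I_mul_I, neg_one_smul, add_neg_cancel_right]
  rw [waveΓ, ← key, Matrix.mul_nonsing_inv_cancel_right _ _ (waveD_det_ne_zero hA).isUnit]

/-- In `det D = i^n det c det (1 - iB)` the last factor is the one that `gaussI ^ 2` turns into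
`(2π)^n`. The sign `(-1)^n` comes from `λ₃ = -cᵀ`. -/
theorem gaussI_sq_eq : gaussI (greenB A) ^ 2 * (waveD A).det =
    ((-Complex.I * 2 * (Real.pi : ℂ)) • (lam3 A).map Complex.ofReal).det := by
  have h1 := gaussI_sq_mul_det (greenB_isSymm hA h3)
  have h2 : ((lam3 A).map Complex.ofReal).det = (-1) ^ n * (A.toBlocks₂₁.map Complex.ofReal).det := by
    have e1 := (Complex.ofRealHom.map_det (lam3 A)).symm
    have e2 := (Complex.ofRealHom.map_det A.toBlocks₂₁).symm
    rw [det_lam3, map_mul, ← e2] at e1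
    exact e1.trans (by simp; rfl)
  rw [waveD_eq_mul hA h3, Matrix.det_smul, Matrix.det_smul, Matrix.det_mul, h2, Fintype.card_fin]
  calc _ = Complex.I ^ n * (A.toBlocks₂₁.map Complex.ofReal).det *
        (gaussI (greenB A) ^ 2 * (1 - Complex.I • (greenB A).map Complex.ofReal).det) := by ring
    _ = _ := by
      rw [h1, ← mul_assoc, ← mul_pow, mul_right_comm, ← mul_pow]
      congr 2
      ring

/-- The case of a coherent state at the origin. The mixed term of the phase is the linear term of a
Gaussian integral in `η`, whose value combines with the part quadratic in `ξ` to the matrix `Γ`. -/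
theorem integral_greenPhase_gaussian (ξ : Fin n → ℝ) :
    ∫ η : E n, Complex.exp (Complex.I * (greenPhase A ξ η.ofLp : ℂ)) *
      Complex.exp (-(1 / 2) * ((‖η‖ ^ 2 : ℝ) : ℂ)) =
    gaussI (greenB A) * Complex.exp (Complex.I / 2 * (cx ξ ⬝ᵥ (waveΓ A *ᵥ cx ξ))) := by
  have hB := greenB_isSymm hA h3
  have h1 : ∀ η : E n, Complex.exp (Complex.I * (greenPhase A ξ η.ofLp : ℂ)) *
      Complex.exp (-(1 / 2) * ((‖η‖ ^ 2 : ℝ) : ℂ)) =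
      Complex.exp (-(1 / 2) *
        (cx η.ofLp ⬝ᵥ ((1 - Complex.I • (greenB A).map Complex.ofReal) *ᵥ cx η.ofLp)) -
          Complex.I * (cx (A.toBlocks₂₁⁻¹ *ᵥ ξ) ⬝ᵥ cx η.ofLp)) *
      Complex.exp (Complex.I / 2 *
        (cx ξ ⬝ᵥ ((A.toBlocks₁₁ * A.toBlocks₂₁⁻¹).map Complex.ofReal *ᵥ cx ξ))) := by
    intro η
    rw [← Complex.exp_add, ← Complex.exp_add]
    congr 1
    have e1 : ‖η‖ ^ 2 = η.ofLp ⬝ᵥ η.ofLp := by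
      rw [EuclideanSpace.norm_sq_eq]
      simp [dotProduct, sq]
    rw [greenPhase_eq hA h3, e1, Matrix.sub_mulVec, Matrix.one_mulVec, Matrix.smul_mulVec,
      ← cx_mulVec, ← cx_mulVec, dotProduct_sub, dotProduct_smul, cx_dotProduct, cx_dotProduct,
      cx_dotProduct, cx_dotProduct, smul_eq_mul]
    push_cast
    ring
  simp only [h1]
  rw [integral_mul_const, integral_gaussian hB, mul_assoc, ← Complex.exp_add]
  congr 2
  rw [waveΓ_eq hA h3, Matrix.add_mulVec, dotProduct_add, Matrix.smul_mulVec, dotProduct_smul,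
    smul_eq_mul, cx_mulVec, ← Matrix.mulVec_mulVec, ← Matrix.mulVec_mulVec,
    Matrix.dotProduct_mulVec (cx ξ) ((A.toBlocks₂₁⁻¹).map Complex.ofReal)ᵀ, Matrix.vecMul_transpose]
  linear_combination (-(1 / 2) * ((A.toBlocks₂₁⁻¹).map Complex.ofReal *ᵥ cx ξ ⬝ᵥ
    ((1 - Complex.I • (greenB A).map Complex.ofReal)⁻¹ *ᵥ
      ((A.toBlocks₂₁⁻¹).map Complex.ofReal *ᵥ cx ξ)))) * Complex.I_mul_I

end Blocks

theorem cx_quadratic (B : Matrix (Fin n) (Fin n) ℝ) (v : Fin n → ℝ) :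
    cx v ⬝ᵥ ((1 - Complex.I • B.map Complex.ofReal) *ᵥ cx v) =
      ((v ⬝ᵥ v : ℝ) : ℂ) - Complex.I * ((v ⬝ᵥ (B *ᵥ v) : ℝ) : ℂ) := by
  rw [Matrix.sub_mulVec, Matrix.one_mulVec, Matrix.smul_mulVec, ← cx_mulVec, dotProduct_sub,
    dotProduct_smul, cx_dotProduct, cx_dotProduct, smul_eq_mul]

/-- The real matrix `B` enters only through an oscillating factor, so `exp(-‖η‖²/2)` dominates the
integrand for all times. -/
theorem continuousOn_gaussI {T : Set ℝ} {B : ℝ → Matrix (Fin n) (Fin n) ℝ}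
    (hB : ∀ i j, ContinuousOn (fun t => B t i j) T) : ContinuousOn (fun t => gaussI (B t)) T := by
  simp only [gaussI, cx_quadratic]
  refine continuousOn_of_dominated (bound := fun η : E n => Real.exp (-(1 / 2) * ‖η‖ ^ 2))
    (fun t _ => ?_) (fun t _ => Eventually.of_forall fun η => ?_) ?_
    (Eventually.of_forall fun η => ?_)
  · refine Continuous.aestronglyMeasurable ?_
    simp only [dotProduct, Matrix.mulVec]
    fun_prop
  · rw [Complex.norm_exp]
    have e1 : ‖η‖ ^ 2 = η.ofLp ⬝ᵥ η.ofLp := by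
      rw [EuclideanSpace.norm_sq_eq]
      simp [dotProduct, sq]
    rw [e1]
    simp
  · refine (GaussianFourier.integrable_cexp_neg_mul_sq_norm_add (V := E n)
      (b := 1 / 2) (by norm_num) 0 0).norm.congr (Eventually.of_forall fun η => ?_)
    simp [Complex.norm_exp, ← Complex.ofReal_pow]
  · simp only [dotProduct, Matrix.mulVec]
    refine Complex.continuous_exp.comp_continuousOn (continuousOn_const.mul
      (continuousOn_const.sub (continuousOn_const.mul (Complex.continuous_ofReal.comp_continuousOn
      (continuousOn_finsetSum _ fun i _ => continuousOn_const.mul (continuousOn_finsetSum _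
      fun j _ => (hB i j).mul continuousOn_const))))))

variable (Q : QuadraticModel n)

/-- The branch of `√det(-2πiħ λ₃)` given by the propagation of the standard Gaussian. -/
def QuadraticModel.greenRoot (ħ κ s t : ℝ) : ℂ :=
  open scoped Classical in
  -- When the determinant vanishes, zero is its only square root, so the identity for the square can
  -- hold at every time.
  if (lam3 (Q.matriciant κ s t)).det = 0 then 0
  else (Real.sqrt ħ : ℂ) ^ n *
    (gaussI (greenB (Q.matriciant κ s t)) * Complex.exp (-Q.waveLog s (κ, t)))

/-- By Liouville's formula `exp (-2 waveLog) = det D`, which is the factor missing from `gaussI ^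
2`; the power of `√ħ` squares to `ħ^n`. -/
theorem QuadraticModel.greenRoot_sq {ħ : ℝ} (hħ : 0 < ħ) (κ s t : ℝ) :
    Q.greenRoot ħ κ s t ^ 2 = ((-Complex.I * 2 * (Real.pi : ℂ) * (ħ : ℂ)) •
      (lam3 (Q.matriciant κ s t)).map (Complex.ofReal)).det := by
  rw [QuadraticModel.greenRoot]
  split_ifs with h
  · have h1 : ((lam3 (Q.matriciant κ s t)).map Complex.ofReal).det = 0 := by
      have := (Complex.ofRealHom.map_det (lam3 (Q.matriciant κ s t))).symm
      rw [h, map_zero] at this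
      exact this
    rw [Matrix.det_smul, h1, mul_zero, zero_pow two_ne_zero]
  · have h1 := gaussI_sq_eq (Q.matriciant_symplectic κ s t) h
    have h2 := Q.exp_waveLog_mul_det κ s t
    have h4 : Complex.exp (-Q.waveLog s (κ, t)) ^ 2 * Complex.exp (2 * Q.waveLog s (κ, t)) = 1 := by
      rw [← Complex.exp_nat_mul, ← Complex.exp_add]
      simp
    have h5 : (Real.sqrt ħ : ℂ) ^ 2 = (ħ : ℂ) := by
      rw [← Complex.ofReal_pow, Real.sq_sqrt hħ.le]
    have h6 : Complex.exp (-Q.waveLog s (κ, t)) ^ 2 = (waveD (Q.matriciant κ s t)).det := by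
      calc _ = Complex.exp (-Q.waveLog s (κ, t)) ^ 2 * (Complex.exp (2 * Q.waveLog s (κ, t)) *
          (waveD (Q.matriciant κ s t)).det) := by rw [h2, mul_one]
        _ = _ := by rw [← mul_assoc, h4, one_mul]
    rw [mul_pow, mul_pow, h6, h1, ← pow_mul, mul_comm n 2, pow_mul, h5, Matrix.det_smul,
      Matrix.det_smul, Fintype.card_fin, mul_pow _ (ħ : ℂ)]
    ring

theorem QuadraticModel.continuous_matriciant (κ s : ℝ) (a b : Idx n) :
    Continuous fun t => Q.matriciant κ s t a b :=
  (Q.contDiff_matriciant s a b).continuous.comp (continuous_const.prodMk continuous_id)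

theorem QuadraticModel.continuousOn_greenRoot (ħ κ s : ℝ) :
    ContinuousOn (Q.greenRoot ħ κ s) {t | (lam3 (Q.matriciant κ s t)).det ≠ 0} := by
  have h3 : Continuous fun t => lam3 (Q.matriciant κ s t) :=
    continuous_matrix fun i j => (Q.continuous_matriciant κ s _ _).neg
  have h1 : Continuous fun t => lam1 (Q.matriciant κ s t) :=
    continuous_matrix fun i j => Q.continuous_matriciant κ s _ _
  have hinv : ContinuousOn (fun t => (lam3 (Q.matriciant κ s t))⁻¹)
      {t | (lam3 (Q.matriciant κ s t)).det ≠ 0} := by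
    simp only [Matrix.inv_def, Ring.inverse_eq_inv']
    exact (h3.matrix_det.continuousOn.inv₀ fun t ht => ht).smul h3.matrix_adjugate.continuousOn
  have hB : ContinuousOn (fun t => greenB (Q.matriciant κ s t))
      {t | (lam3 (Q.matriciant κ s t)).det ≠ 0} := (h1.continuousOn.mul hinv).neg
  have hw : Continuous fun t => Q.waveLog s (κ, t) :=
    (continuous_iff_continuousAt.2 fun t => (Q.hasDerivAt_waveLog κ s t).continuousAt)
  have h5 : ContinuousOn (fun t => (Real.sqrt ħ : ℂ) ^ n *
      (gaussI (greenB (Q.matriciant κ s t)) * Complex.exp (-Q.waveLog s (κ, t))))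
      {t | (lam3 (Q.matriciant κ s t)).det ≠ 0} :=
    continuousOn_const.mul ((continuousOn_gaussI fun i j =>
      (continuous_apply_apply i j).comp_continuousOn hB).mul
      (Complex.continuous_exp.comp hw.neg).continuousOn)
  exact h5.congr fun t ht => if_neg ht

/-- The lower left block of `J𝔥` is `𝔥_pp`, so the corresponding block of the matriciant divided by
`t - s` tends to `𝔥_pp(s)`, and the determinant is continuous. -/
theorem QuadraticModel.eventually_det_lam3_ne_zero {κ s : ℝ} (h : (Q.hpp κ s).det ≠ 0) :
    ∀ᶠ t in 𝓝[≠] s, (lam3 (Q.matriciant κ s t)).det ≠ 0 := by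
  have h1 : Tendsto (fun t => (t - s)⁻¹ • (Q.matriciant κ s t).toBlocks₂₁) (𝓝[≠] s)
      (𝓝 (Q.hpp κ s)) := by
    refine tendsto_pi_nhds.2 fun i => tendsto_pi_nhds.2 fun j => ?_
    have h2 := (hasDerivAt_iff_tendsto_slope.1
      (Q.hasDerivAt_matriciant κ s s (Sum.inr i) (Sum.inl j)))
    have h4 : (Matrix.J (Fin n) ℝ * Q.hess κ s * Q.matriciant κ s s) (Sum.inr i) (Sum.inl j) =
        Q.hpp κ s i j := by
      rw [Q.matriciant_self, Matrix.mul_one]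
      simp [Matrix.J, Matrix.mul_apply, Fintype.sum_sum_type, Matrix.one_apply, QuadraticModel.hpp,
        Matrix.toBlocks₁₁]
    rw [h4] at h2
    refine h2.congr fun t => ?_
    rw [slope_def_field, Q.matriciant_self]
    simp [Matrix.toBlocks₂₁, div_eq_inv_mul]
  have h2 := ((Continuous.matrix_det continuous_id).tendsto (Q.hpp κ s)).comp h1
  filter_upwards [h2.eventually_ne h] with t ht h0
  rw [det_lam3] at h0
  have h5 := (mul_eq_zero.1 h0).resolve_left (pow_ne_zero n (by norm_num))
  exact ht (by simp [h5])

end Green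

/-! ### The Green function acting on coherent states and on arbitrary profiles -/

section GreenPropagation

variable {n : ℕ} (Q : QuadraticModel n)

theorem inner_eq_dotProduct (a b : E n) : inner ℝ a b = a.ofLp ⬝ᵥ b.ofLp := by
  simp [PiLp.inner_apply, dotProduct, mul_comm]

/-- Centre the integration at the initial point and `x` at the final point of the orbit. By the
generating property of the phase the terms linear in the initial increment cancel against the
momentum phase of the state, and what remains is the centred integral times the phase of the
propagated state. The scalar on the right does not depend on the orbit. -/
theorem QuadraticModel.integral_greenPhase_coherent {κ s t : ℝ}
    (h3 : (lam3 (Q.matriciant κ s t)).det ≠ 0) (w : E n × E n) (x : E n) :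
    ∫ y : E n, Complex.exp (Complex.I *
      (greenPhase (Q.matriciant κ s t) x.ofLp y.ofLp : ℂ)) * Q.coherent s (κ, s) w y =
      gaussI (greenB (Q.matriciant κ s t)) * Complex.exp (-Q.waveLog s (κ, t)) *
        Q.coherent s (κ, t) w x := by
  have hA := Q.matriciant_symplectic κ s t
  set P := Q.orbitP s (κ, t) w with hP
  set X := Q.orbitX s (κ, t) w with hX
  set ξ : E n := x - X with hξ
  have h1 : ∀ η : E n, Complex.exp (Complex.I *
      (greenPhase (Q.matriciant κ s t) x.ofLp (w.1 + η).ofLp : ℂ)) *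
        Q.coherent s (κ, s) w (w.1 + η) =
      Complex.exp (Complex.I * ((1 / 2 * inner ℝ P X + inner ℝ P ξ : ℝ) : ℂ)) *
      (Complex.exp (Complex.I * (greenPhase (Q.matriciant κ s t) ξ.ofLp η.ofLp : ℂ)) *
        Complex.exp (-(1 / 2) * ((‖η‖ ^ 2 : ℝ) : ℂ))) := by
    intro η
    have h2 := greenPhase_add hA h3 (Sum.elim (fun i => 2 * Real.pi * w.2 i) w.1.ofLp) ξ.ofLp η.ofLp
    have h4 : (fun j => (Q.matriciant κ s t *ᵥ
        Sum.elim (fun i => 2 * Real.pi * w.2 i) w.1.ofLp) (Sum.inr j) + ξ j) = x.ofLp := by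
      funext j
      change X j + (x j - X j) = x j
      ring
    have h5 : (fun j => Sum.elim (fun i => 2 * Real.pi * w.2 i) w.1.ofLp (Sum.inr j) + η j) =
        (w.1 + η).ofLp := rfl
    rw [h4, h5] at h2
    change _ = 1 / 2 * (P.ofLp ⬝ᵥ X.ofLp - ((2 * Real.pi) • w.2).ofLp ⬝ᵥ w.1.ofLp) +
      P.ofLp ⬝ᵥ ξ.ofLp - ((2 * Real.pi) • w.2).ofLp ⬝ᵥ η.ofLp + _ at h2
    simp only [← inner_eq_dotProduct] at h2
    rw [QuadraticModel.coherent, tcWave, Q.orbitP_self, Q.orbitX_self, h2]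
    simp only [Real.sqrt_one, inv_one, one_smul, Complex.ofReal_one, div_one, add_sub_cancel_left,
      Q.wavePacket_self]
    rw [← Complex.exp_add, ← Complex.exp_add, ← Complex.exp_add, ← Complex.exp_add]
    congr 1
    push_cast
    ring
  rw [← integral_add_left_eq_self _ w.1]
  simp only [h1]
  rw [integral_const_mul, integral_greenPhase_gaussian hA h3, QuadraticModel.coherent, tcWave,
    ← hP, ← hX, ← hξ, QuadraticModel.wavePacket]
  simp only [Real.sqrt_one, inv_one, one_smul, Complex.ofReal_one, div_one]
  have h6 : Complex.exp (Complex.I / 2 * (cx ξ.ofLp ⬝ᵥ (waveΓ (Q.matriciant κ s t) *ᵥ cx ξ.ofLp))) =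
      Complex.exp (-Q.waveLog s (κ, t)) * Complex.exp (Q.waveLog s (κ, t) + Complex.I / 2 *
        ∑ j, ∑ k, (ξ j : ℂ) * waveΓ (Q.matriciant κ s t) j k * (ξ k : ℂ)) := by
    rw [← Complex.exp_add, neg_add_cancel_left]
    congr 2
    simp only [dotProduct, Matrix.mulVec, Finset.mul_sum, cx, mul_assoc]
  rw [h6]
  ring

variable {F : Type} [NormedAddCommGroup F] [NormedSpace ℝ F] [FiniteDimensional ℝ F] {D : Set F}

theorem continuous_greenPhase (A : Matrix (Idx n) (Idx n) ℝ) (ξ : Fin n → ℝ) :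
    Continuous fun y : E n => greenPhase A ξ y.ofLp := by
  simp only [greenPhase, dotProduct, Matrix.mulVec]
  fun_prop

/-- Kernel and propagator differ by the same scalar on all coherent states, hence on their
superpositions. Fubini applies since the kernel is unimodular and the expansion of `φ` is jointly
integrable in `y` and `w`. -/
theorem QuadraticModel.integral_greenPhase_mul {κ s t : ℝ}
    (h3 : (lam3 (Q.matriciant κ s t)).det ≠ 0) {φ : F × E n → ℂ} (hφ : RapidOn D φ) {ε : F}
    (hε : ε ∈ D) (x : E n) :
    ∫ y : E n, Complex.exp (Complex.I *
      (greenPhase (Q.matriciant κ s t) x.ofLp y.ofLp : ℂ)) * φ (ε, y) =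
      gaussI (greenB (Q.matriciant κ s t)) * Complex.exp (-Q.waveLog s (κ, t)) *
        Q.profile s (κ, t) (fun w => windowTransform φ (ε, w)) x := by
  have h1 := Q.rapidOn_coherent_mul hφ.isOpen s (σ := fun _ => (κ, s)) contDiffOn_const
    hφ.windowTransform
  have : ((volume : Measure (E n)).prod (volume : Measure (E n × E n))).IsAddHaarMeasure :=
    Measure.prod.instIsAddHaarMeasure _ _
  have h2 : Integrable (fun v : E n × (E n × E n) => Q.coherent s (κ, s) v.2 v.1 *
      windowTransform φ (ε, v.2)) ((volume : Measure (E n)).prod volume) :=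
    h1.integrable hε
  have h4 : Integrable (fun v : E n × (E n × E n) => Complex.exp (Complex.I *
      (greenPhase (Q.matriciant κ s t) x.ofLp v.1.ofLp : ℂ)) * (Q.coherent s (κ, s) v.2 v.1 *
      windowTransform φ (ε, v.2))) ((volume : Measure (E n)).prod volume) := by
    refine h2.bdd_mul (c := 1) ?_ (Eventually.of_forall fun v => ?_)
    · exact (Complex.continuous_exp.comp (continuous_const.mul (Complex.continuous_ofReal.comp
        ((continuous_greenPhase _ _).comp continuous_fst)))).aestronglyMeasurable
    · rw [mul_comm, Complex.norm_exp_ofReal_mul_I]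
  calc ∫ y : E n, Complex.exp (Complex.I *
      (greenPhase (Q.matriciant κ s t) x.ofLp y.ofLp : ℂ)) * φ (ε, y)
      = (gaussNorm n)⁻¹ * ∫ y : E n, ∫ w : E n × E n, Complex.exp (Complex.I *
      (greenPhase (Q.matriciant κ s t) x.ofLp y.ofLp : ℂ)) * (Q.coherent s (κ, s) w y *
      windowTransform φ (ε, w)) := by
        rw [← integral_const_mul]
        refine integral_congr_ae (Eventually.of_forall fun y => ?_)
        beta_reduce
        rw [← Q.profile_self κ s hφ hε y, QuadraticModel.profile, integral_const_mul]
        ring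
    _ = (gaussNorm n)⁻¹ * ∫ w : E n × E n, ∫ y : E n, Complex.exp (Complex.I *
      (greenPhase (Q.matriciant κ s t) x.ofLp y.ofLp : ℂ)) * (Q.coherent s (κ, s) w y *
      windowTransform φ (ε, w)) := by
        rw [integral_integral_swap h4]
    _ = _ := by
        simp only [← mul_assoc, integral_mul_const, Q.integral_greenPhase_coherent h3]
        rw [QuadraticModel.profile]
        simp only [mul_assoc, integral_const_mul]
        ring

theorem integral_comp_scale (f : E n → ℂ) {R : ℝ} (hR : 0 < R) (X₀ : E n) :
    ∫ y : E n, f (R⁻¹ • (y - X₀)) = (R : ℂ) ^ n * ∫ η : E n, f η := by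
  rw [integral_sub_right_eq_self (fun y : E n => f (R⁻¹ • y)) X₀]
  have h := Measure.integral_comp_inv_smul_of_nonneg (volume : Measure (E n)) f hR.le
  rw [finrank_euclideanSpace_fin, Complex.real_smul, Complex.ofReal_pow] at h
  exact h

/-- Measuring positions from the trajectory in units of `√ħ` removes `ħ` from the quadratic phase.
The momentum term at the initial time cancels against the phase of the datum, the action increment
adds to `S₀`, and the Jacobian `(√ħ)^n` cancels against the same power in `greenRoot`. -/
theorem QuadraticModel.integral_green_tcWave {κ s t ħ : ℝ} (hħ : 0 < ħ)
    (h3 : (lam3 (Q.matriciant κ s t)).det ≠ 0) {φ : F × E n → ℂ} (hφ : RapidOn D φ) {ε : F}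
    (hε : ε ∈ D) (S₀ dS : ℝ) {P₀ X₀ P X : E n} {z₀ z : Idx n → ℝ}
    (hz₀ : z₀ = Sum.elim P₀.ofLp X₀.ofLp) (hz : z = Sum.elim P.ofLp X.ofLp) (x : E n) :
    ∫ y : E n, green ħ (Q.matriciant κ s t) (Q.greenRoot ħ κ s t) dS z z₀ x y *
      tcWave ħ S₀ P₀ X₀ (fun η => φ (ε, η)) y =
    tcWave ħ (S₀ + dS) P X (Q.profile s (κ, t) (fun w => windowTransform φ (ε, w))) x := by
  have hsq : 0 < Real.sqrt ħ := Real.sqrt_pos.2 hħ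
  have hsq' : Real.sqrt ħ * Real.sqrt ħ = ħ := Real.mul_self_sqrt hħ.le
  have hħ0 : (ħ : ℂ) ≠ 0 := by exact_mod_cast hħ.ne'
  set A := Q.matriciant κ s t with hA
  set ρ := Q.greenRoot ħ κ s t with hρ
  set ξ : E n := (Real.sqrt ħ)⁻¹ • (x - X) with hξ
  have h1 : ∀ y, green ħ A ρ dS z z₀ x y * tcWave ħ S₀ P₀ X₀ (fun η => φ (ε, η)) y =
      (fun η : E n => (1 / ρ * Complex.exp (Complex.I / (ħ : ℂ) *
        ((S₀ + dS + inner ℝ P (x - X) : ℝ) : ℂ))) * (Complex.exp (Complex.I *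
        (greenPhase A ξ.ofLp η.ofLp : ℂ)) * φ (ε, η))) ((Real.sqrt ħ)⁻¹ • (y - X₀)) := by
    intro y
    set η : E n := (Real.sqrt ħ)⁻¹ • (y - X₀) with hη
    have e1 : (fun j => x j - z (Sum.inr j)) = Real.sqrt ħ • ξ.ofLp := by
      funext j
      simp [hξ, hz, hsq.ne']
    have e2 : (fun j => y j - z₀ (Sum.inr j)) = Real.sqrt ħ • η.ofLp := by
      funext j
      simp [hη, hz₀, hsq.ne']
    have e3 : (fun j => z (Sum.inl j)) = P.ofLp := by rw [hz]; rfl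
    have e4 : (fun j => z₀ (Sum.inl j)) = P₀.ofLp := by rw [hz₀]; rfl
    have e5 : x - X = Real.sqrt ħ • ξ := by
      rw [hξ, smul_inv_smul₀ hsq.ne']
    have e6 : y - X₀ = Real.sqrt ħ • η := by
      rw [hη, smul_inv_smul₀ hsq.ne']
    simp only [green, tcWave, e1, e2, e3, e4]
    rw [← hη, e5, e6]
    simp only [inner_eq_dotProduct, WithLp.ofLp_smul, Matrix.mulVec_smul, dotProduct_smul,
      smul_dotProduct, smul_eq_mul]
    have e7 : Complex.exp (Complex.I / (ħ : ℂ) * ((dS + Real.sqrt ħ * P.ofLp ⬝ᵥ ξ.ofLp -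
          Real.sqrt ħ * P₀.ofLp ⬝ᵥ η.ofLp -
          1 / 2 * (Real.sqrt ħ * (Real.sqrt ħ * η.ofLp ⬝ᵥ (lam1 A * (lam3 A)⁻¹) *ᵥ η.ofLp)) +
          Real.sqrt ħ * (Real.sqrt ħ * ξ.ofLp ⬝ᵥ (lam3 A)⁻¹ *ᵥ η.ofLp) -
          1 / 2 * (Real.sqrt ħ * (Real.sqrt ħ * ξ.ofLp ⬝ᵥ ((lam3 A)⁻¹ * lam4 A) *ᵥ ξ.ofLp)) :
            ℝ) : ℂ)) *
        Complex.exp (Complex.I / (ħ : ℂ) * ((S₀ + Real.sqrt ħ * P₀.ofLp ⬝ᵥ η.ofLp : ℝ) : ℂ)) =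
        Complex.exp (Complex.I / (ħ : ℂ) * ((S₀ + dS + Real.sqrt ħ * P.ofLp ⬝ᵥ ξ.ofLp : ℝ) : ℂ)) *
        Complex.exp (Complex.I * (greenPhase A ξ.ofLp η.ofLp : ℂ)) := by
      rw [← Complex.exp_add, ← Complex.exp_add]
      congr 1
      have e8 : Complex.I * (greenPhase A ξ.ofLp η.ofLp : ℂ) = Complex.I / (ħ : ℂ) *
          ((Real.sqrt ħ * Real.sqrt ħ * greenPhase A ξ.ofLp η.ofLp : ℝ) : ℂ) := by
        rw [hsq']
        push_cast
        field_simp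
      rw [e8, ← mul_add, ← mul_add, ← Complex.ofReal_add, ← Complex.ofReal_add, greenPhase]
      congr 2
      ring
    linear_combination (1 / ρ * φ (ε, η)) * e7
  refine (integral_congr_ae (Eventually.of_forall h1)).trans
    ((integral_comp_scale (fun η : E n => (1 / ρ * Complex.exp (Complex.I / (ħ : ℂ) *
        ((S₀ + dS + inner ℝ P (x - X) : ℝ) : ℂ))) * (Complex.exp (Complex.I *
        (greenPhase A ξ.ofLp η.ofLp : ℂ)) * φ (ε, η))) hsq X₀).trans ?_)
  rw [integral_const_mul, Q.integral_greenPhase_mul h3 hφ hε]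
  have hρ' : ρ = (Real.sqrt ħ : ℂ) ^ n *
      (gaussI (greenB A) * Complex.exp (-Q.waveLog s (κ, t))) := by
    rw [hρ, QuadraticModel.greenRoot, if_neg h3]
  have hρ0 : ρ ≠ 0 := by
    rw [hρ']
    exact mul_ne_zero (pow_ne_zero n (by exact_mod_cast hsq.ne')) (mul_ne_zero
      (gaussI_ne_zero (greenB_isSymm (Q.matriciant_symplectic κ s t) h3)) (Complex.exp_ne_zero _))
  rw [tcWave, ← hξ]
  have h4 : (Real.sqrt ħ : ℂ) ^ n *
      (gaussI (greenB A) * Complex.exp (-Q.waveLog s (κ, t))) * (1 / ρ) = 1 := by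
    rw [← hρ', mul_one_div_cancel hρ0]
  linear_combination (Q.profile s (κ, t) (fun w => windowTransform φ (ε, w)) ξ *
    Complex.exp (Complex.I / (ħ : ℂ) * ((S₀ + dS + inner ℝ P (x - X) : ℝ) : ℂ))) * h4

end GreenPropagation

/-! ### Solutions of the effective linear equation solve the Gross–Pitaevskii equation -/

section EffectiveEquation

variable {n : ℕ} (Q : QuadraticModel n)

/-- The coefficients of the terms of first order of the Hamiltonian linearized at `g`. -/
def QuadraticModel.linearAlong (κ t : ℝ) (g : PhasePoint n) : Idx n → ℝ :=
  Q.Hz t + κ • (Q.Wzw t *ᵥ g.z)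

/-- The scalar term of the Hamiltonian linearized at `g`. -/
def QuadraticModel.constAlong (κ t : ℝ) (g : PhasePoint n) : ℝ :=
  1 / 2 * κ * (Q.Www t * (g.cov + Matrix.vecMulVec g.z g.z)).trace

theorem QuadraticModel.generator_eq (κ t : ℝ) (g : PhasePoint n) :
    Q.Hz t + (Q.Hzz t + κ • (Q.Wzz t + Q.Wzw t)) *ᵥ g.z =
      Q.linearAlong κ t g + Q.hess κ t *ᵥ g.z := by
  simp only [QuadraticModel.linearAlong, QuadraticModel.hess, Matrix.add_mulVec,
    Matrix.smul_mulVec, smul_add]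
  abel

/-- The scalar `𝔥` is the symbol of the linearized Hamiltonian at the mean point: the term with
`Wzw` belongs to the linear part, and `Www` pairs with the uncentred second moments `Δ + z zᵀ`.
Hence the integrand of the action is the one that the moving frame requires. -/
theorem QuadraticModel.energy_eq (κ t : ℝ) (g : PhasePoint n) :
    Q.energy κ t g = 1 / 2 * (g.z ⬝ᵥ (Q.hess κ t *ᵥ g.z)) + Q.linearAlong κ t g ⬝ᵥ g.z +
      Q.constAlong κ t g := by
  have h1 : (Q.Www t * Matrix.vecMulVec g.z g.z).trace = g.z ⬝ᵥ (Q.Www t *ᵥ g.z) := by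
    rw [Matrix.mul_vecMulVec, Matrix.trace_vecMulVec, dotProduct_comm]
  have h2 : (Q.Wzw t *ᵥ g.z) ⬝ᵥ g.z = g.z ⬝ᵥ (Q.Wzw t *ᵥ g.z) := dotProduct_comm _ _
  simp only [QuadraticModel.energy, QuadraticModel.constAlong, QuadraticModel.linearAlong,
    QuadraticModel.hess, Matrix.add_mulVec, Matrix.smul_mulVec, dotProduct_add, add_dotProduct,
    smul_dotProduct, dotProduct_smul, Matrix.mul_add, Matrix.trace_add, smul_eq_mul, smul_add, h1,
    h2]
  ring

theorem QuadraticModel.hasDerivAt_heFlow_z (κ s : ℝ) (c : PhasePoint n) (t : ℝ) (a : Idx n) :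
    HasDerivAt (fun t => (Q.heFlow κ s c t).z a) ((Matrix.J (Fin n) ℝ *ᵥ
      (Q.linearAlong κ t (Q.heFlow κ s c t) + Q.hess κ t *ᵥ (Q.heFlow κ s c t).z)) a) t := by
  rw [← Q.generator_eq]
  exact Q.hasDerivAt_meanFlow κ s c.z t a

/-- The uncentred second moments of a Hamilton–Ehrenfest solution obey the same Lyapunov equation
with source as `moment₂` along a linear Schrödinger equation, which allows comparison by uniqueness.
-/
theorem QuadraticModel.hasDerivAt_heFlow_raw (κ s : ℝ) (c : PhasePoint n) (t : ℝ) (a b : Idx n) :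
    HasDerivAt (fun t => ((Q.heFlow κ s c t).cov +
        Matrix.vecMulVec (Q.heFlow κ s c t).z (Q.heFlow κ s c t).z) a b)
      (((Matrix.J (Fin n) ℝ * Q.hess κ t) * ((Q.heFlow κ s c t).cov +
          Matrix.vecMulVec (Q.heFlow κ s c t).z (Q.heFlow κ s c t).z) +
        ((Q.heFlow κ s c t).cov + Matrix.vecMulVec (Q.heFlow κ s c t).z (Q.heFlow κ s c t).z) *
          (Matrix.J (Fin n) ℝ * Q.hess κ t)ᵀ +
        (Matrix.J (Fin n) ℝ * Matrix.vecMulVec (Q.linearAlong κ t (Q.heFlow κ s c t))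
            (Q.heFlow κ s c t).z -
          Matrix.vecMulVec (Q.heFlow κ s c t).z (Q.linearAlong κ t (Q.heFlow κ s c t)) *
            Matrix.J (Fin n) ℝ)) a b) t := by
  refine ((Q.hasDerivAt_heFlow_cov κ s c t a b).add ((Q.hasDerivAt_heFlow_z κ s c t a).mul
    (Q.hasDerivAt_heFlow_z κ s c t b))).congr_deriv ?_
  set z := (Q.heFlow κ s c t).z
  set Δ := (Q.heFlow κ s c t).cov
  set l := Q.linearAlong κ t (Q.heFlow κ s c t)
  set h := Q.hess κ t with hh
  set J := Matrix.J (Fin n) ℝ with hJ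
  have e1 : (J *ᵥ (l + h *ᵥ z)) a * z b + z a * (J *ᵥ (l + h *ᵥ z)) b =
      (Matrix.vecMulVec (J *ᵥ (l + h *ᵥ z)) z + Matrix.vecMulVec z (J *ᵥ (l + h *ᵥ z))) a b := rfl
  have e2 : Matrix.vecMulVec z (J *ᵥ (l + h *ᵥ z)) =
      -(Matrix.vecMulVec z l * J) - Matrix.vecMulVec z z * h * J := by
    rw [← Matrix.vecMul_transpose, ← Matrix.vecMulVec_mul, hJ, Matrix.J_transpose,
      Matrix.vecMulVec_add, ← Matrix.vecMul_transpose, ← Matrix.vecMulVec_mul,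
      (Q.hess_isSymm κ t).eq]
    simp only [Matrix.add_mul, Matrix.mul_neg]
    abel
  have e3 : Matrix.vecMulVec (J *ᵥ (l + h *ᵥ z)) z =
      J * Matrix.vecMulVec l z + J * h * Matrix.vecMulVec z z := by
    rw [← Matrix.mul_vecMulVec, Matrix.add_vecMulVec, ← Matrix.mul_vecMulVec, Matrix.mul_add,
      Matrix.mul_assoc]
  rw [e1, e2, e3, ← Matrix.add_apply, Matrix.transpose_mul, (Q.hess_isSymm κ t).eq, hJ,
    Matrix.J_transpose]
  refine congrFun (congrFun (?_ : (_ : Matrix (Idx n) (Idx n) ℝ) = _) a) b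
  simp only [Matrix.mul_add, Matrix.add_mul, Matrix.mul_neg, ← Matrix.mul_assoc]
  abel

variable {ϰ ħ s : ℝ} {U U' : ℝ → 𝓢(E n, ℂ)}

/-- The moments of a solution of the linear equation obtained from the Gross–Pitaevskii equation
by inserting the solution of the Hamilton–Ehrenfest system with the same initial moments. -/
theorem QuadraticModel.moments_of_effective (hU : SchwartzCurve univ U U') (hħ : ħ ≠ 0)
    (h0 : U s ≠ 0) {κ : ℝ} {g : ℝ → PhasePoint n}
    (hg : g = Q.heFlow κ s (moments ħ (U s)))
    (h : ∀ t ∈ univ, (Complex.I * (ħ : ℂ)) • U' t = affineS ħ (Q.hess κ t)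
      (Q.linearAlong κ t (g t)) (Q.constAlong κ t (g t)) (U t)) (t : ℝ) :
    normSq (U t) = normSq (U s) ∧ moment₁ ħ (U t) = normSq (U s) • (g t).z ∧
      moment₂ ħ (U t) = normSq (U s) • ((g t).cov + Matrix.vecMulVec (g t).z (g t).z) := by
  have hsym : ∀ t, (Q.hess κ t).IsSymm := fun t => Q.hess_isSymm _ t
  have hN : ∀ t, normSq (U t) = normSq (U s) := fun t =>
    hU.normSq_eq (b := fun t => Q.linearAlong κ t (g t)) (c := fun t => Q.constAlong κ t (g t))
      hħ hsym ordConnected_univ h (mem_univ s) (mem_univ t)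
  have hN0 : normSq (U s) ≠ 0 := (normSq_pos h0).ne'
  have hcκ : ContDiff ℝ ∞ fun t : ℝ => (κ, t) := by fun_prop
  have hJh : ∀ a b, ContDiff ℝ ∞ fun t => (Matrix.J (Fin n) ℝ * Q.hess κ t) a b := fun a b =>
    (Q.contDiff_J_hess a b).comp hcκ
  have hgs : g s = moments ħ (U s) := by rw [hg, Q.heFlow_self]
  set N := normSq (U s) with hNd
  have hz0 : moment₁ ħ (U s) = N • (g s).z := by
    funext a
    rw [hgs, Pi.smul_apply, smul_eq_mul]
    change _ = N * meanZ ħ (U s) a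
    rw [meanZ_eq, ← hNd, mul_div_cancel₀ _ hN0]
  have h1 : ∀ t, moment₁ ħ (U t) = N • (g t).z := fun t =>
    linear_ode_unique (x := fun t => moment₁ ħ (U t)) (y := fun t => N • (g t).z)
      (contDiff_entriesCLM hJh).continuous ordConnected_univ isOpen_univ (mem_univ s)
      (fun t => Matrix.J (Fin n) ℝ *ᵥ (N • Q.linearAlong κ t (g t)))
      (fun t ht => hasDerivAt_pi.2 fun e => by
        refine (hU.hasDerivAt_moment₁ (b := fun t => Q.linearAlong κ t (g t))
          (c := fun t => Q.constAlong κ t (g t)) hħ hsym h ht e).congr_deriv ?_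
        rw [hN t, entriesCLM_apply, ← Matrix.mulVec_mulVec, ← Matrix.mulVec_add])
      (fun t _ => hasDerivAt_pi.2 fun e => by
        rw [hg]
        refine ((Q.hasDerivAt_heFlow_z κ s (moments ħ (U s)) t e).const_mul N).congr_deriv ?_
        rw [entriesCLM_apply, ← Matrix.mulVec_mulVec, ← Matrix.mulVec_add, Matrix.mulVec_smul,
          ← smul_add, Matrix.mulVec_smul, Pi.smul_apply, smul_eq_mul, add_comm])
      hz0 t (mem_univ t)
  refine ⟨hN t, h1 t, ?_⟩
  refine lyapunov_unique (M := fun t => moment₂ ħ (U t)) (M' := fun t => N • ((g t).cov +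
    Matrix.vecMulVec (g t).z (g t).z)) hJh ordConnected_univ isOpen_univ (mem_univ s)
    (fun t => N • (Matrix.J (Fin n) ℝ * Matrix.vecMulVec (Q.linearAlong κ t (g t)) (g t).z -
      Matrix.vecMulVec (g t).z (Q.linearAlong κ t (g t)) * Matrix.J (Fin n) ℝ))
    (fun t ht a b => ?_) (fun t _ a b => ?_) ?_ t (mem_univ t)
  · refine (hU.hasDerivAt_moment₂ (b := fun t => Q.linearAlong κ t (g t))
      (c := fun t => Q.constAlong κ t (g t)) hħ hsym h ht a b).congr_deriv ?_
    rw [h1 t, Matrix.transpose_mul, (Q.hess_isSymm _ t).eq, Matrix.J_transpose]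
    refine congrFun (congrFun (?_ : (_ : Matrix (Idx n) (Idx n) ℝ) = _) a) b
    simp only [Matrix.vecMulVec_smul, Matrix.smul_vecMulVec, smul_sub, Matrix.mul_add,
      Matrix.add_mul, Matrix.mul_neg, Matrix.mul_assoc, Matrix.mul_smul, Matrix.smul_mul]
    abel
  · rw [hg]
    refine ((Q.hasDerivAt_heFlow_raw κ s (moments ħ (U s)) t a b).const_mul N).congr_deriv ?_
    rw [Matrix.mul_smul, Matrix.smul_mul, ← smul_add, ← smul_add]
    rfl
  · ext a b
    rw [hgs, Matrix.smul_apply, Matrix.add_apply, Matrix.vecMulVec_apply]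
    change _ = N * (covZ ħ (U s) a b + meanZ ħ (U s) a * meanZ ħ (U s) b)
    rw [covZ_eq ħ h0, ← hNd, sub_add_cancel, mul_div_cancel₀ _ hN0]

/-- Self-consistency: the moments of `U` are the inserted ones multiplied by the constant squared
norm, so the coefficients computed from `U` itself are those the linear equation was given. The
factor `normSq (U s)` combines with `ϰ` to `κ`. -/
theorem QuadraticModel.solvesGPE_of_effective (hU : SchwartzCurve univ U U') (hħ : ħ ≠ 0)
    (h0 : U s ≠ 0) {κ : ℝ} (hκ : κ = ϰ * normSq (U s)) {g : ℝ → PhasePoint n}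
    (hg : g = Q.heFlow κ s (moments ħ (U s)))
    (h : ∀ t ∈ univ, (Complex.I * (ħ : ℂ)) • U' t = affineS ħ (Q.hess κ t)
      (Q.linearAlong κ t (g t)) (Q.constAlong κ t (g t)) (U t)) :
    Q.SolvesGPE ϰ ħ univ (fun t => U t) ∧ ∀ t, meanZ ħ (U t) = (g t).z := by
  have hm := Q.moments_of_effective hU hħ h0 hg h
  have hN0 : normSq (U s) ≠ 0 := (normSq_pos h0).ne'
  refine ⟨Q.solvesGPE_of_schwartzCurve hU fun t ht => ?_, fun t => ?_⟩
  · obtain ⟨e1, e2, e3⟩ := hm t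
    rw [h t ht, e1, ← hκ]
    congr 1
    rw [QuadraticModel.effLinear, QuadraticModel.effConst, e2, e3, QuadraticModel.linearAlong,
      QuadraticModel.constAlong, Matrix.mulVec_smul, smul_smul, ← hκ, Matrix.mul_smul,
      Matrix.trace_smul, smul_eq_mul, hκ]
    congr 1
    ring
  · obtain ⟨e1, e2, -⟩ := hm t
    funext a
    rw [meanZ_eq, e1, e2, Pi.smul_apply, smul_eq_mul, mul_div_cancel_left₀ _ hN0]

end EffectiveEquation

/-! ### The action and the propagated wave -/

section Propagation

variable {n : ℕ} (Q : QuadraticModel n)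

/-- The integrand of the action. -/
def QuadraticModel.lagrangian (κ t : ℝ) (g : PhasePoint n) : ℝ :=
  ∑ j, g.z (Sum.inl j) * (Matrix.J (Fin n) ℝ *ᵥ
    (Q.Hz t + (Q.Hzz t + κ • (Q.Wzz t + Q.Wzw t)) *ᵥ g.z)) (Sum.inr j) - Q.energy κ t g

/-- The action accumulated after the time `s`. -/
def QuadraticModel.actionFrom (κ s : ℝ) (c : PhasePoint n) (t : ℝ) : ℝ :=
  ∫ τ in s..t, Q.lagrangian κ τ (Q.heFlow κ s c τ)

/-- The covariance enters the action only multiplied by `κ`, so smoothness is asked of the product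
alone. For concentrated data the covariance itself contains a division by a norm, which may vanish
for `ε ≤ 0`. -/
theorem QuadraticModel.contDiffOn_lagrangian {F : Type} [NormedAddCommGroup F] [NormedSpace ℝ F]
    {D : Set F} {κ : F → ℝ} {c : F → PhasePoint n} (hκ : ContDiffOn ℝ ∞ κ D)
    (hz : ∀ a, ContDiffOn ℝ ∞ (fun q => (c q).z a) D)
    (hc : ∀ a b, ContDiffOn ℝ ∞ (fun q => κ q * (c q).cov a b) D) (s : ℝ) :
    ContDiffOn ℝ ∞ (fun q : F × ℝ => Q.lagrangian (κ q.1) q.2 (Q.heFlow (κ q.1) s (c q.1) q.2))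
      (D ×ˢ univ) := by
  have hm : MapsTo (Prod.fst : F × ℝ → F) (D ×ˢ univ) D := fun q hq => hq.1
  have hκ' : ContDiffOn ℝ ∞ (fun q : F × ℝ => κ q.1) (D ×ˢ univ) := hκ.comp contDiffOn_fst hm
  have hz' : ∀ a, ContDiffOn ℝ ∞ (fun q : F × ℝ => (Q.heFlow (κ q.1) s (c q.1) q.2).z a)
      (D ×ˢ univ) := fun a =>
    Q.contDiffOn_meanFlow hκ' contDiffOn_snd (fun a => (hz a).comp contDiffOn_fst hm) s a
  have ht : ∀ {f : ℝ → ℝ}, ContDiff ℝ ∞ f → ContDiffOn ℝ ∞ (fun q : F × ℝ => f q.2) (D ×ˢ univ) :=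
    fun hf => (hf.comp contDiff_snd).contDiffOn
  have hA : ∀ a b, ContDiffOn ℝ ∞ (fun q : F × ℝ => Q.matriciant (κ q.1) s q.2 a b)
      (D ×ˢ univ) := fun a b =>
    (Q.contDiff_matriciant s a b).comp_contDiffOn (hκ'.prodMk contDiffOn_snd)
  have hc' : ∀ a b, ContDiffOn ℝ ∞ (fun q : F × ℝ => κ q.1 * (Q.heFlow (κ q.1) s (c q.1) q.2).cov a b)
      (D ×ˢ univ) := by
    intro a b
    have h1 : ContDiffOn ℝ ∞ (fun q : F × ℝ => ∑ d, (∑ e, Q.matriciant (κ q.1) s q.2 a e *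
        (κ q.1 * (c q.1).cov e d)) * Q.matriciant (κ q.1) s q.2 b d) (D ×ˢ univ) :=
      ContDiffOn.sum fun d _ => (ContDiffOn.sum fun e _ => (hA a e).mul
        ((hc e d).comp contDiffOn_fst hm)).mul (hA b d)
    refine h1.congr fun q _ => ?_
    simp only [QuadraticModel.heFlow, Matrix.mul_apply, Matrix.transpose_apply, Finset.mul_sum,
      Finset.sum_mul]
    refine Finset.sum_congr rfl fun d _ => Finset.sum_congr rfl fun e _ => ?_
    ring
  have hWww : ContDiffOn ℝ ∞ (fun q : F × ℝ =>
      κ q.1 * (Q.Www q.2 * (Q.heFlow (κ q.1) s (c q.1) q.2).cov).trace) (D ×ˢ univ) := by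
    have h1 : ContDiffOn ℝ ∞ (fun q : F × ℝ => ∑ a, ∑ b, Q.Www q.2 a b *
        (κ q.1 * (Q.heFlow (κ q.1) s (c q.1) q.2).cov b a)) (D ×ˢ univ) :=
      ContDiffOn.sum fun a _ => ContDiffOn.sum fun b _ => (ht (Q.smooth_Www a b)).mul (hc' b a)
    refine h1.congr fun q _ => ?_
    simp only [Matrix.trace, Matrix.diag, Matrix.mul_apply, Finset.mul_sum]
    refine Finset.sum_congr rfl fun a _ => Finset.sum_congr rfl fun b _ => ?_
    ring
  simp only [QuadraticModel.lagrangian, J_mulVec_inr, QuadraticModel.energy, mul_assoc (1 / 2 : ℝ)]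
  simp only [Pi.add_apply, Matrix.mulVec, dotProduct, Matrix.add_apply, Matrix.smul_apply,
    smul_eq_mul]
  refine (ContDiffOn.sum fun j _ => (hz' _).mul ((ht (Q.smooth_Hz _)).add
    (ContDiffOn.sum fun a _ => ((ht (Q.smooth_Hzz _ _)).add (hκ'.mul ((ht (Q.smooth_Wzz _ _)).add
      (ht (Q.smooth_Wzw _ _))))).mul (hz' a)))).sub ?_
  refine ((contDiffOn_const.mul (ContDiffOn.sum fun a _ => (hz' a).mul (ContDiffOn.sum fun b _ =>
    ((ht (Q.smooth_Hzz _ _)).add (hκ'.mul (((ht (Q.smooth_Wzz _ _)).add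
      (contDiffOn_const.mul (ht (Q.smooth_Wzw _ _)))).add (ht (Q.smooth_Www _ _))))).mul
        (hz' b)))).add (ContDiffOn.sum fun a _ => (ht (Q.smooth_Hz a)).mul (hz' a))).add
    (contDiffOn_const.mul hWww)

theorem contDiff_slice_zero {f : ℝ × ℝ → ℝ} (h : ContDiff ℝ ∞ f) :
    ContDiff ℝ ∞ fun t : ℝ => f (0, t) :=
  h.comp (contDiff_const.prodMk contDiff_id)

theorem QuadraticModel.contDiff_lagrangian (κ s : ℝ) (c : PhasePoint n) :
    ContDiff ℝ ∞ fun t => Q.lagrangian κ t (Q.heFlow κ s c t) := by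
  have h : ContDiffOn ℝ ∞ (fun q : ℝ × ℝ => Q.lagrangian κ q.2 (Q.heFlow κ s c q.2))
      (univ ×ˢ univ) :=
    Q.contDiffOn_lagrangian (F := ℝ) (D := univ) (κ := fun _ => κ) (c := fun _ => c)
      contDiffOn_const (fun _ => contDiffOn_const) (fun _ _ => contDiffOn_const) s
  rw [univ_prod_univ, contDiffOn_univ] at h
  exact contDiff_slice_zero h

theorem QuadraticModel.contDiff_actionFrom (κ s : ℝ) (c : PhasePoint n) :
    ContDiff ℝ ∞ (Q.actionFrom κ s c) :=
  (contDiff_intervalIntegral s ((Q.contDiff_lagrangian κ s c).comp contDiff_snd)).comp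
    ((contDiff_const (c := (0 : ℝ))).prodMk contDiff_id)

theorem QuadraticModel.hasDerivAt_actionFrom (κ s : ℝ) (c : PhasePoint n) (t : ℝ) :
    HasDerivAt (Q.actionFrom κ s c) (Q.lagrangian κ t (Q.heFlow κ s c t)) t :=
  intervalIntegral.integral_hasDerivAt_right
    ((Q.contDiff_lagrangian κ s c).continuous.intervalIntegrable _ _)
    ((Q.contDiff_lagrangian κ s c).continuous.stronglyMeasurableAtFilter _ _)
    (Q.contDiff_lagrangian κ s c).continuous.continuousAt

theorem QuadraticModel.action_sub_action (κ s : ℝ) (c : PhasePoint n) (t : ℝ) :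
    Q.action κ (Q.heFlow κ s c) t - Q.action κ (Q.heFlow κ s c) s = Q.actionFrom κ s c t := by
  have h1 : ∀ t, Q.action κ (Q.heFlow κ s c) t =
      ∫ τ in (0 : ℝ)..t, Q.lagrangian κ τ (Q.heFlow κ s c τ) := by
    intro t
    refine intervalIntegral.integral_congr fun τ _ => ?_
    simp only [((Q.isHESSolution_heFlow κ s c τ).1 _).deriv]
    rfl
  have h2 := (Q.contDiff_lagrangian κ s c).continuous
  rw [h1, h1, QuadraticModel.actionFrom]
  exact intervalIntegral.integral_interval_sub_left (h2.intervalIntegrable _ _)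
    (h2.intervalIntegrable _ _)

/-- The momentum `P` of `z = (P, X)`. -/
def momentumPart (z : Idx n → ℝ) : E n := WithLp.toLp 2 fun j => z (Sum.inl j)

/-- The position `X` of `z = (P, X)`. -/
def positionPart (z : Idx n → ℝ) : E n := WithLp.toLp 2 fun j => z (Sum.inr j)

theorem sumElim_parts (z : Idx n → ℝ) :
    Sum.elim (momentumPart z).ofLp (positionPart z).ofLp = z := by
  funext a
  rcases a with j | j <;> rfl

theorem contDiffOn_momentumPart {F : Type} [NormedAddCommGroup F] [NormedSpace ℝ F] {D : Set F}
    {z : F → Idx n → ℝ} (hz : ∀ a, ContDiffOn ℝ ∞ (fun q => z q a) D) :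
    ContDiffOn ℝ ∞ (fun q => momentumPart (z q)) D :=
  (EuclideanSpace.equiv (Fin n) ℝ).symm.contDiff.comp_contDiffOn
    (contDiffOn_pi.2 fun j => hz (Sum.inl j))

theorem contDiffOn_positionPart {F : Type} [NormedAddCommGroup F] [NormedSpace ℝ F] {D : Set F}
    {z : F → Idx n → ℝ} (hz : ∀ a, ContDiffOn ℝ ∞ (fun q => z q a) D) :
    ContDiffOn ℝ ∞ (fun q => positionPart (z q)) D :=
  (EuclideanSpace.equiv (Fin n) ℝ).symm.contDiff.comp_contDiffOn
    (contDiffOn_pi.2 fun j => hz (Sum.inr j))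

/-- The wave at time `t` in the frame that moves along the flow of the Hamilton–Ehrenfest system,
with the profile propagated by the homogeneous quadratic Schrödinger equation. -/
def QuadraticModel.wave (ħ s κ S₀ : ℝ) (c : PhasePoint n) (H : E n × E n → ℂ) (t : ℝ) : E n → ℂ :=
  tcWave ħ (S₀ + Q.actionFrom κ s c t) (momentumPart (Q.heFlow κ s c t).z)
    (positionPart (Q.heFlow κ s c t).z) (Q.profile s (κ, t) H)

variable {D : Set ℝ} {κ : ℝ → ℝ} {φ : ℝ × E n → ℂ}

/-- The propagated profile is a curve in Schwartz space. -/
theorem QuadraticModel.exists_profile_schwartzCurve (s : ℝ) (hκ : ContDiffOn ℝ ∞ κ D)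
    (hφ : RapidOn D φ) {ε : ℝ} (hε : ε ∈ D) :
    ∃ U U' : ℝ → 𝓢(E n, ℂ), SchwartzCurve univ U U' ∧
      (∀ t, ⇑(U t) = Q.profile s (κ ε, t) (fun w => windowTransform φ (ε, w))) ∧
      ∀ t ∈ univ, Complex.I • U' t = affineS 1 (Q.hess (κ ε) t) 0 0 (U t) := by
  have h1 := (Q.rapidOn_profile s hκ hφ).comp_param (σ := fun t : ℝ => (t, ε)) isOpen_univ
    (contDiffOn_id.prodMk contDiffOn_const) (fun t _ => ⟨mem_univ t, hε⟩)
  obtain ⟨U, U', hU, hUe⟩ := exists_schwartzCurve h1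
  have hUe' : ∀ t, ⇑(U t) = Q.profile s (κ ε, t) (fun w => windowTransform φ (ε, w)) :=
    fun t => funext fun x => hUe t (mem_univ t) x
  refine ⟨U, U', hU, hUe', fun t ht => ?_⟩
  ext x
  have h2 := Q.hasDerivAt_profile s hκ hφ hε t x
  have h3 := hU.hasDerivAt t ht x
  simp only [hUe'] at h3
  rw [smul_apply, h3.unique h2, affineS_apply]
  simp only [← hUe', ← coe_zS, smul_apply, sum_apply, Pi.zero_apply, zero_smul,
    Complex.ofReal_zero, Finset.sum_const_zero, add_zero, smul_eq_mul]
  linear_combination (-((1 / 2 : ℂ) * ∑ a, ∑ b, (Q.hess (κ ε) t a b : ℂ) *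
    zS 1 a (zS 1 b (U t)) x)) * Complex.I_sq

/-- The propagated wave solves the Gross–Pitaevskii equation and is given by the evolution
operator away from focal times. -/
theorem QuadraticModel.wave_spec {ϰ ħ : ℝ} (hħ : 0 < ħ) (s : ℝ) (hκ : ContDiffOn ℝ ∞ κ D)
    (hφ : RapidOn D φ) {ε : ℝ} (hε : ε ∈ D) {ψ : 𝓢(E n, ℂ)} (hψ : ψ ≠ 0) {S₀ : ℝ} {P₀ X₀ : E n}
    (hψφ : ⇑ψ = tcWave ħ S₀ P₀ X₀ (fun ξ => φ (ε, ξ))) (hκε : κ ε = ϰ * normSq ψ)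
    (hz₀ : meanZ ħ ψ = Sum.elim P₀.ofLp X₀.ofLp) {Ψ : ℝ → E n → ℂ}
    (hΨ : Ψ = Q.wave ħ s (κ ε) S₀ (moments ħ ψ) (fun w => windowTransform φ (ε, w))) :
    SchwartzSmoothOn univ Ψ ∧ Ψ s = ψ ∧ Q.SolvesGPE ϰ ħ univ Ψ ∧
      (∀ t, meanZ ħ (Ψ t) = (Q.heFlow (κ ε) s (moments ħ ψ) t).z) ∧
      ∀ t, t = s ∨ (lam3 (Q.matriciant (ϰ * normSq ψ) s t)).det ≠ 0 →
        Ψ t = Q.evolution Q.matriciant Q.heFlow Q.greenRoot ϰ ħ t s ψ := by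
  obtain ⟨U, U', hU, hUe, hUs⟩ := Q.exists_profile_schwartzCurve s hκ hφ hε
  set c := moments ħ ψ with hc
  set k := κ ε with hk
  set g := Q.heFlow k s c with hg
  have hgs : g s = c := Q.heFlow_self k s c
  have hz : ∀ a, ContDiff ℝ ∞ fun t => (g t).z a := fun a => contDiffOn_univ.1
    (Q.contDiffOn_meanFlow (κ := fun _ => k) (τ := fun t => t) (z₀ := fun _ => c.z)
      contDiffOn_const contDiffOn_id (fun _ => contDiffOn_const) s a)
  have hP : ContDiff ℝ ∞ fun t => momentumPart (g t).z :=
    contDiffOn_univ.1 (contDiffOn_momentumPart fun a => (hz a).contDiffOn)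
  have hX : ContDiff ℝ ∞ fun t => positionPart (g t).z :=
    contDiffOn_univ.1 (contDiffOn_positionPart fun a => (hz a).contDiffOn)
  obtain ⟨W', hW, hWs⟩ := hU.tcL_solves hħ (S := fun t => S₀ + Q.actionFrom k s c t)
    (P := fun t => momentumPart (g t).z) (X := fun t => positionPart (g t).z)
    (S' := fun t => Q.lagrangian k t (g t))
    (b := fun t => Q.linearAlong k t (g t)) (c := fun t => Q.constAlong k t (g t))
    (contDiff_const.add (Q.contDiff_actionFrom k s c)) hP hX (Q.hess_isSymm k)
    (fun t => (Q.hasDerivAt_actionFrom k s c t).const_add S₀)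
    (fun t a => by
      simp only [sumElim_parts]
      exact Q.hasDerivAt_heFlow_z k s c t a)
    (fun t => by
      simp only [sumElim_parts]
      rw [QuadraticModel.lagrangian, Q.generator_eq, Q.energy_eq]
      rfl)
    hUs
  have hWΨ : ∀ t, ⇑(tcL hħ (S₀ + Q.actionFrom k s c t) (momentumPart (g t).z)
      (positionPart (g t).z) (U t)) = Ψ t := fun t => by
    rw [coe_tcL, hUe, hΨ]
    rfl
  have hP₀ : momentumPart (g s).z = P₀ := by
    rw [hgs]
    ext j
    exact congrFun hz₀ (Sum.inl j)
  have hX₀ : positionPart (g s).z = X₀ := by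
    rw [hgs]
    ext j
    exact congrFun hz₀ (Sum.inr j)
  have hΨs : Ψ s = ψ := by
    rw [← hWΨ, coe_tcL, hP₀, hX₀, hUe, hψφ, QuadraticModel.actionFrom,
      intervalIntegral.integral_same, add_zero]
    congr 1
    funext x
    exact Q.profile_self k s hφ hε x
  have hWψ : tcL hħ (S₀ + Q.actionFrom k s c s) (momentumPart (g s).z)
      (positionPart (g s).z) (U s) = ψ := DFunLike.coe_injective ((hWΨ s).trans hΨs)
  -- The moving frame has produced a solution of the linear equation along `g`, and `g` starts from
  -- the moments of that solution at time `s`, as self-consistency demands.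
  obtain ⟨hG, hM⟩ := Q.solvesGPE_of_effective hW hħ.ne' (s := s) (ϰ := ϰ) (κ := k) (g := g)
    (by rw [hWψ]; exact hψ) (by rw [hWψ, hκε]) (by rw [hWψ]) hWs
  simp only [hWΨ] at hG hM
  refine ⟨schwartzSmoothOn_iff.2 (hW.rapid.congr fun t _ x => by rw [hWΨ]), hΨs, hG, hM,
    fun t ht => ?_⟩
  funext x
  rw [QuadraticModel.evolution]
  split_ifs with hts
  · rw [hts, hΨs]
  · have h3 := ht.resolve_left hts
    rw [← hκε] at h3 ⊢
    rw [← hc, Q.action_sub_action, hΨ, QuadraticModel.wave, hψφ]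
    symm
    refine Q.integral_green_tcWave hħ h3 hφ hε S₀ _ ?_ ?_ x
    · rw [← hg, hgs, hc]
      exact hz₀
    · rw [sumElim_parts]

end Propagation

/-! ### Moments of trajectory concentrated functions -/

section ConcentratedMoments

variable {n : ℕ} {ħ : ℝ}

theorem braketL_tcL (hħ : 0 < ħ) (S : ℝ) (P X : E n) (φ χ : 𝓢(E n, ℂ)) :
    braketL (tcL hħ S P X φ) (tcL hħ S P X χ) = (Real.sqrt ħ : ℂ) ^ n * braketL φ χ := by
  rw [braketL_apply, braketL_apply, braket, braket,
    ← integral_comp_scale (fun η => (starRingEnd ℂ) (φ η) * χ η) (Real.sqrt_pos.2 hħ) X]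
  congr 1
  funext x
  simp only [coe_tcL, tcWave, map_mul]
  have h1 : (starRingEnd ℂ) (Complex.exp (Complex.I / (ħ : ℂ) *
      ((S + inner ℝ P (x - X) : ℝ) : ℂ))) * Complex.exp (Complex.I / (ħ : ℂ) *
      ((S + inner ℝ P (x - X) : ℝ) : ℂ)) = 1 := by
    rw [← Complex.exp_conj, ← Complex.exp_add, map_mul, map_div₀, Complex.conj_I,
      Complex.conj_ofReal, Complex.conj_ofReal, ← Complex.exp_zero]
    congr 1
    ring
  linear_combination ((starRingEnd ℂ) (φ ((Real.sqrt ħ)⁻¹ • (x - X))) *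
    χ ((Real.sqrt ħ)⁻¹ • (x - X))) * h1

theorem normSq_tcL (hħ : 0 < ħ) (S : ℝ) (P X : E n) (φ : 𝓢(E n, ℂ)) :
    normSq (tcL hħ S P X φ) = Real.sqrt ħ ^ n * normSq φ := by
  have h := braketL_tcL hħ S P X φ φ
  rw [braketL_self, braketL_self] at h
  exact_mod_cast h

theorem moment₁_tcL (hħ : 0 < ħ) (S : ℝ) (P X : E n) (φ : 𝓢(E n, ℂ)) (a : Idx n) :
    moment₁ ħ (tcL hħ S P X φ) a = Real.sqrt ħ ^ n * (Real.sqrt ħ * moment₁ 1 φ a +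
      Sum.elim P.ofLp X.ofLp a * normSq φ) := by
  rw [moment₁, zS_tcL, braketL_tcL, map_add, map_smul, map_smul, braketL_self, braketL_zS_self,
    smul_eq_mul, smul_eq_mul]
  norm_cast

theorem moment₂_tcL (hħ : 0 < ħ) (S : ℝ) (P X : E n) (φ : 𝓢(E n, ℂ)) (a b : Idx n) :
    moment₂ ħ (tcL hħ S P X φ) a b = Real.sqrt ħ ^ n * (ħ * moment₂ 1 φ a b +
      Real.sqrt ħ * (Sum.elim P.ofLp X.ofLp a * moment₁ 1 φ b +
        Sum.elim P.ofLp X.ofLp b * moment₁ 1 φ a) +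
      Sum.elim P.ofLp X.ofLp a * Sum.elim P.ofLp X.ofLp b * normSq φ) := by
  simp only [moment₂, Matrix.of_apply, zS_tcL, braketL_tcL, map_add, map_smul, braketL_self,
    braketL_zS_self, smul_eq_mul]
  norm_cast
  simp only [normSq_tcL, Complex.add_re, Complex.re_ofReal_mul, Complex.ofReal_re]
  linear_combination (Real.sqrt ħ ^ n * (braketL φ (zS 1 a (zS 1 b φ))).re) *
    Real.mul_self_sqrt hħ.le

/-- When `(P, X)` is the mean of the wave, the first moments of the profile vanish and no mixed
terms survive. -/
theorem covZ_tcL (hħ : 0 < ħ) {S : ℝ} {P X : E n} {φ : 𝓢(E n, ℂ)} (hφ : φ ≠ 0)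
    (hz : meanZ ħ (tcL hħ S P X φ) = Sum.elim P.ofLp X.ofLp) (a b : Idx n) :
    covZ ħ (tcL hħ S P X φ) a b = ħ * moment₂ 1 φ a b / normSq φ := by
  have hr : Real.sqrt ħ ≠ 0 := (Real.sqrt_pos.2 hħ).ne'
  have hN := (normSq_pos hφ).ne'
  have h0 : tcL hħ S P X φ ≠ 0 := by
    intro h
    have := normSq_tcL hħ S P X φ
    rw [h] at this
    exact (mul_ne_zero (pow_ne_zero n hr) hN) (this.symm.trans (by simp [normSq]))
  have h1 : ∀ a, moment₁ 1 φ a = 0 := by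
    intro a
    have h2 := congrFun hz a
    rw [meanZ_eq, moment₁_tcL, normSq_tcL, mul_div_mul_left _ _ (pow_ne_zero n hr),
      div_eq_iff hN, add_eq_right] at h2
    exact (mul_eq_zero.1 h2).resolve_left hr
  rw [covZ_eq ħ h0, hz, moment₂_tcL, normSq_tcL, mul_div_mul_left _ _ (pow_ne_zero n hr), h1, h1]
  field_simp
  ring

theorem tcL_surjective (hħ : 0 < ħ) (P X : E n) (ψ : 𝓢(E n, ℂ)) :
    ∃ φ, tcL hħ 0 P X φ = ψ := by
  have hr : 0 < Real.sqrt ħ := Real.sqrt_pos.2 hħ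
  have hr' : Real.sqrt ħ * Real.sqrt ħ = ħ := Real.mul_self_sqrt hħ.le
  have hħ0 : (ħ : ℂ) ≠ 0 := by exact_mod_cast hħ.ne'
  -- The inverse is a transformation of the same kind with `ħ⁻¹` in place of `ħ`. The vector `X'`
  -- undoes the translation after rescaling, `P'` undoes the phase, and the scalar phase `⟨P', X'⟩`
  -- makes the exponent homogeneous in the rescaled position.
  set P' : E n := -((ħ * Real.sqrt ħ)⁻¹ • P) with hP'
  set X' : E n := -((Real.sqrt ħ)⁻¹ • X) with hX'
  refine ⟨tcL (inv_pos.2 hħ) (inner ℝ P' X') P' X' ψ, ?_⟩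
  ext x
  simp only [coe_tcL, tcWave]
  have e1 : (Real.sqrt ħ⁻¹)⁻¹ • ((Real.sqrt ħ)⁻¹ • (x - X) - X') = x := by
    rw [Real.sqrt_inv, inv_inv, hX', sub_neg_eq_add, ← smul_add, sub_add_cancel,
      smul_inv_smul₀ hr.ne']
  have e0 : inner ℝ P' X' + inner ℝ P' ((Real.sqrt ħ)⁻¹ • (x - X) - X') =
      -((ħ * Real.sqrt ħ)⁻¹ * (Real.sqrt ħ)⁻¹ * inner ℝ P (x - X)) := by
    rw [inner_sub_right, add_sub_cancel, hP', inner_neg_left, real_inner_smul_left,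
      real_inner_smul_right, mul_assoc]
  rw [e1, mul_assoc, ← Complex.exp_add, e0]
  have e2 : Complex.I / ((ħ⁻¹ : ℝ) : ℂ) * ((-((ħ * Real.sqrt ħ)⁻¹ * (Real.sqrt ħ)⁻¹ *
      inner ℝ P (x - X)) : ℝ) : ℂ) +
      Complex.I / (ħ : ℂ) * ((0 + inner ℝ P (x - X) : ℝ) : ℂ) = 0 := by
    have e3 : ħ * ((ħ * Real.sqrt ħ)⁻¹ * (Real.sqrt ħ)⁻¹) = ħ⁻¹ := by
      rw [mul_inv, mul_assoc, ← mul_inv, hr']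
      field_simp
    rw [zero_add]
    have e4 : Complex.I / ((ħ⁻¹ : ℝ) : ℂ) = Complex.I * (ħ : ℂ) := by
      push_cast
      field_simp
    rw [e4, mul_assoc, ← Complex.ofReal_mul, mul_neg, ← mul_assoc, e3]
    push_cast
    field_simp
    ring
  rw [e2, Complex.exp_zero, mul_one]

/-! ### Smooth dependence of brackets on parameters -/

variable {F : Type} [NormedAddCommGroup F] [NormedSpace ℝ F] {D : Set F}

theorem RapidOn.zOp_param {f : F × E n → ℂ} (hf : RapidOn D f) (a : Idx n) :
    RapidOn D (fun q : F × E n => zOp 1 a (fun x => f (q.1, x)) q.2) := by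
  rcases a with j | j
  · refine ((SlowOn.const hf.isOpen (-Complex.I * ((1 : ℝ) : ℂ))).mul_rapid
      (hf.fderiv_apply (0, EuclideanSpace.single j (1 : ℝ)))).congr fun τ hτ x => ?_
    have h := (HasFDerivAt.comp (f := fun x => (τ, x)) x
      (hf.differentiableAt_prod hτ x).hasFDerivAt (hasFDerivAt_prodMk_right τ x)).fderiv
    change -Complex.I * ((1 : ℝ) : ℂ) *
      _root_.fderiv ℝ (fun x => f (τ, x)) x (EuclideanSpace.single j (1 : ℝ)) = _
    rw [show _root_.fderiv ℝ (fun x => f (τ, x)) x = _ from h]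
    rfl
  · exact (SlowOn.clm_snd hf.isOpen (EuclideanSpace.proj j : E n →L[ℝ] ℝ)).ofReal.mul_rapid hf

theorem RapidOn.contDiffOn_braket [FiniteDimensional ℝ F] {f g : F × E n → ℂ} (hf : RapidOn D f)
    (hg : RapidOn D g) :
    ContDiffOn ℝ ∞ (fun ε => (braket (fun x => f (ε, x)) (fun x => g (ε, x))).re) D :=
  Complex.reCLM.contDiff.comp_contDiffOn
    ((hf.clm (Complex.conjCLE : ℂ →L[ℝ] ℂ)).slow.mul_rapid hg).contDiffOn_integral

theorem RapidOn.contDiffOn_normSq [FiniteDimensional ℝ F] {f : F × E n → ℂ} (hf : RapidOn D f) :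
    ContDiffOn ℝ ∞ (fun ε => normSq (fun x => f (ε, x))) D := by
  refine (hf.contDiffOn_braket hf).congr fun ε hε => ?_
  obtain ⟨φ, hφ⟩ := hf.exists_schwartzMap hε
  simp only [← hφ]
  rw [← braketL_apply φ φ, braketL_self, Complex.ofReal_re]

theorem RapidOn.contDiffOn_moment₂ [FiniteDimensional ℝ F] {f : F × E n → ℂ} (hf : RapidOn D f)
    {φ : F → 𝓢(E n, ℂ)} (hφ : ∀ ε ∈ D, ∀ x, φ ε x = f (ε, x)) (a b : Idx n) :
    ContDiffOn ℝ ∞ (fun ε => moment₂ 1 (φ ε) a b) D := by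
  refine (hf.contDiffOn_braket ((hf.zOp_param b).zOp_param a)).congr fun ε hε => ?_
  simp only [← hφ ε hε]
  rw [moment₂, Matrix.of_apply, braketL_apply, coe_zS, coe_zS]

end ConcentratedMoments

/-! ### The Cauchy problem -/

section CauchyProblem

variable {n : ℕ} (Q : QuadraticModel n)

/-- For fixed `ħ` no concentration is needed: every Schwartz datum is a translated and dilated
profile centred at its own means, and this profile is taken as a family constant in the parameter.
-/
theorem QuadraticModel.exists_solution {ϰ ħ : ℝ} (hħ : 0 < ħ) (s : ℝ) {ψ : 𝓢(E n, ℂ)}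
    (hψ : ψ ≠ 0) :
    ∃ Ψ : ℝ → E n → ℂ, SchwartzSmoothOn univ Ψ ∧ Ψ s = ψ ∧ Q.SolvesGPE ϰ ħ univ Ψ ∧
      ∀ t, t = s ∨ (lam3 (Q.matriciant (ϰ * normSq ψ) s t)).det ≠ 0 →
        Ψ t = Q.evolution Q.matriciant Q.heFlow Q.greenRoot ϰ ħ t s ψ := by
  obtain ⟨φ, hφ⟩ := tcL_surjective hħ (momentumPart (meanZ ħ ψ)) (positionPart (meanZ ħ ψ)) ψ
  obtain ⟨h1, h2, h3, -, h4⟩ := Q.wave_spec (κ := fun _ => ϰ * normSq ψ) hħ s contDiffOn_const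
    (rapidOn_schwartzMap φ (F := ℝ) isOpen_univ) (mem_univ 0) hψ
    (by rw [← coe_tcL hħ, hφ]) rfl (sumElim_parts _).symm rfl
  exact ⟨_, h1, h2, h3, h4⟩

theorem QuadraticModel.SolvesGPE.unique {ϰ ħ : ℝ} (hħ : ħ ≠ 0) {s : ℝ} {T : Set ℝ}
    (hT : T.OrdConnected) (hs : s ∈ T) {Ψ Ψ' : ℝ → E n → ℂ} (h : Q.SolvesGPE ϰ ħ T Ψ)
    (h' : Q.SolvesGPE ϰ ħ T Ψ') (hΨ : SchwartzSmoothOn T Ψ) (hΨ' : SchwartzSmoothOn T Ψ')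
    (h0 : Ψ s = Ψ' s) : ∀ t ∈ T, Ψ t = Ψ' t := by
  obtain ⟨U, U', hU, hUe⟩ := exists_schwartzCurve (schwartzSmoothOn_iff.1 hΨ)
  obtain ⟨V, V', hV, hVe⟩ := exists_schwartzCurve (schwartzSmoothOn_iff.1 hΨ')
  have key := Q.gpe_unique hU hV hħ hT hs (fun t ht => h.schwartzCurve Q hU hUe ht)
    (fun t ht => h'.schwartzCurve Q hV hVe ht) (by
      ext x
      rw [hUe s hs x, hVe s hs x, h0])
  intro t ht
  funext x
  rw [← hUe t ht x, ← hVe t ht x, key t ht]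

/-- The moments of a trajectory concentrated function with the profile `φ` and the mean `z`. -/
def concentratedMoments (ε : ℝ) (z : Idx n → ℝ) (φ : 𝓢(E n, ℂ)) : PhasePoint n :=
  ⟨z, Matrix.of fun a b => ε ^ 2 * moment₂ 1 φ a b / normSq φ⟩

theorem moments_tcL {ħ : ℝ} (hħ : 0 < ħ) {S : ℝ} {P X : E n} {φ : 𝓢(E n, ℂ)} (hφ : φ ≠ 0)
    (hz : meanZ ħ (tcL hħ S P X φ) = Sum.elim P.ofLp X.ofLp) :
    moments ħ (tcL hħ S P X φ) =
      concentratedMoments (Real.sqrt ħ) (Sum.elim P.ofLp X.ofLp) φ := by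
  refine PhasePoint.ext hz ?_
  ext a b
  change covZ ħ _ a b = Real.sqrt ħ ^ 2 * moment₂ 1 φ a b / normSq φ
  rw [covZ_tcL hħ hφ hz, Real.sq_sqrt hħ.le]

/-- The coupling constant `ϰ‖ψ‖²` of a trajectory concentrated function. -/
def concentratedCoupling (ϰ ε : ℝ) (φ : 𝓢(E n, ℂ)) : ℝ := ϰ * (ε ^ n * normSq φ)

/-- The squared norm in the coupling cancels the one in the denominator of the covariance. The
product is therefore smooth in `ε` even where the profile vanishes. -/
theorem concentratedCoupling_mul_cov (ϰ ε : ℝ) (z : Idx n → ℝ) (φ : 𝓢(E n, ℂ)) (a b : Idx n) :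
    concentratedCoupling ϰ ε φ * (concentratedMoments ε z φ).cov a b =
      ϰ * ε ^ n * ε ^ 2 * moment₂ 1 φ a b := by
  simp only [concentratedCoupling, concentratedMoments, Matrix.of_apply]
  rcases eq_or_ne φ 0 with rfl | h
  · have : moment₂ 1 (0 : 𝓢(E n, ℂ)) a b = 0 := by simp [moment₂]
    rw [this]
    simp
  · have := (normSq_pos h).ne'
    field_simp

theorem contDiffOn_swap {f : ℝ × ℝ → ℝ} {D : Set ℝ} (hf : ContDiffOn ℝ ∞ f (D ×ˢ univ)) :
    ContDiffOn ℝ ∞ (fun q : ℝ × ℝ => f (q.2, q.1)) (univ ×ˢ D) :=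
  hf.comp (contDiff_snd.prodMk contDiff_fst).contDiffOn fun _ hq => ⟨hq.2, mem_univ _⟩

theorem QuadraticModel.contDiffOn_actionFrom {D : Set ℝ} (hD : IsOpen D) {κ : ℝ → ℝ}
    {c : ℝ → PhasePoint n} (hκ : ContDiffOn ℝ ∞ κ D)
    (hz : ∀ a, ContDiffOn ℝ ∞ (fun ε => (c ε).z a) D)
    (hc : ∀ a b, ContDiffOn ℝ ∞ (fun ε => κ ε * (c ε).cov a b) D) (s : ℝ) :
    ContDiffOn ℝ ∞ (fun q : ℝ × ℝ => Q.actionFrom (κ q.2) s (c q.2) q.1) (univ ×ˢ D) := by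
  have h1 := contDiffOn_intervalIntegral hD s (Q.contDiffOn_lagrangian hκ hz hc s)
  exact contDiffOn_swap (f := fun q => Q.actionFrom (κ q.1) s (c q.1) q.2) h1

theorem QuadraticModel.contDiffOn_heFlow_z {D : Set ℝ} {κ : ℝ → ℝ} {c : ℝ → PhasePoint n}
    (hκ : ContDiffOn ℝ ∞ κ D) (hz : ∀ a, ContDiffOn ℝ ∞ (fun ε => (c ε).z a) D) (s : ℝ)
    (a : Idx n) :
    ContDiffOn ℝ ∞ (fun q : ℝ × ℝ => (Q.heFlow (κ q.2) s (c q.2) q.1).z a) (univ ×ˢ D) := by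
  have hsnd : MapsTo (Prod.snd : ℝ × ℝ → ℝ) (univ ×ˢ D) D := fun q hq => hq.2
  exact Q.contDiffOn_meanFlow (κ := fun q : ℝ × ℝ => κ q.2) (z₀ := fun q : ℝ × ℝ => (c q.2).z)
    (τ := fun q : ℝ × ℝ => q.1) (hκ.comp contDiffOn_snd hsnd) contDiffOn_fst
    (fun a => (hz a).comp contDiffOn_snd hsnd) s a

/-- All ingredients of the propagated wave are functions of `ε = √ħ`, defined on an interval
symmetric about zero: the coupling, the initial moments, the coefficients of the profile. Smooth
dependence of flow, action and superposition on these gives a profile, a phase and a trajectory that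
are smooth in `(t, ε)` across `ε = 0`, and for each `ħ` the wave is the solution built before. -/
theorem QuadraticModel.exists_concentrated_solution {ϰ ħ₀ : ℝ} (s : ℝ)
    {ψ : ℝ → E n → ℂ} (hψ : IsTCData ħ₀ ψ) (h0 : ∀ ħ ∈ Ioo 0 ħ₀, ψ ħ ≠ 0) :
    ∃ Ψ : ℝ → ℝ → E n → ℂ, IsTCFamily ħ₀ Ψ ∧
      ∀ ħ ∈ Ioo 0 ħ₀, Ψ ħ s = ψ ħ ∧ Q.SolvesGPE ϰ ħ univ (Ψ ħ) ∧
        ∀ t, t = s ∨ (lam3 (Q.matriciant (ϰ * normSq (ψ ħ)) s t)).det ≠ 0 →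
          Ψ ħ t = Q.evolution Q.matriciant Q.heFlow Q.greenRoot ϰ ħ t s (ψ ħ) := by
  obtain ⟨φ₀, S₀, P₀, X₀, hφ, hS, hP, hX, hψ⟩ := hψ
  set D : Set ℝ := Ioo (-Real.sqrt ħ₀) (Real.sqrt ħ₀) with hD
  have hφ' := schwartzSmoothOn_iff.1 hφ
  choose! φ hφe using fun ε (hε : ε ∈ D) => hφ'.exists_schwartzMap hε
  set z : ℝ → Idx n → ℝ := fun ε => Sum.elim (P₀ ε).ofLp (X₀ ε).ofLp with hz
  have hzs : ∀ a, ContDiffOn ℝ ∞ (fun ε => z ε a) D := by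
    rintro (j | j)
    · exact (EuclideanSpace.proj (𝕜 := ℝ) j).contDiff.comp_contDiffOn hP
    · exact (EuclideanSpace.proj (𝕜 := ℝ) j).contDiff.comp_contDiffOn hX
  -- Dilation multiplies the squared norm by `(√ħ)^n`, so at `ε = √ħ` this is `ϰ‖ψ‖²`. Written with
  -- `ε ^ n`, the coupling and likewise the moments make sense for `ε ≤ 0` too.
  set κ : ℝ → ℝ := fun ε => concentratedCoupling ϰ ε (φ ε) with hκ
  set c : ℝ → PhasePoint n := fun ε => concentratedMoments ε (z ε) (φ ε) with hc
  have hpow : ∀ k : ℕ, ContDiffOn ℝ ∞ (fun ε : ℝ => ε ^ k) D := fun k =>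
    (contDiff_id.pow k).contDiffOn
  have hN : ContDiffOn ℝ ∞ (fun ε => normSq (φ ε)) D :=
    hφ'.contDiffOn_normSq.congr fun ε hε => by
      congr 1
      funext x
      exact hφe ε hε x
  have hκs : ContDiffOn ℝ ∞ κ D := contDiffOn_const.mul ((hpow n).mul hN)
  have hcs : ∀ a b, ContDiffOn ℝ ∞ (fun ε => κ ε * (c ε).cov a b) D := by
    intro a b
    simp only [hκ, hc, concentratedCoupling_mul_cov]
    exact ((contDiffOn_const.mul (hpow n)).mul (hpow 2)).mul (hφ'.contDiffOn_moment₂ hφe a b)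
  have hsnd : MapsTo (Prod.snd : ℝ × ℝ → ℝ) (univ ×ˢ D) D := fun q hq => hq.2
  have hflow := Q.contDiffOn_heFlow_z (c := c) hκs hzs s
  have hact := Q.contDiffOn_actionFrom (c := c) isOpen_Ioo hκs hzs hcs s
  set H : ℝ → E n × E n → ℂ := fun ε w => windowTransform (fun q : ℝ × E n => φ₀ q.1 q.2) (ε, w)
    with hH
  set Ψ : ℝ → ℝ → E n → ℂ := fun ħ => Q.wave ħ s (κ (Real.sqrt ħ)) (S₀ (Real.sqrt ħ))
    (c (Real.sqrt ħ)) (H (Real.sqrt ħ)) with hΨ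
  have hspec : ∀ ħ ∈ Ioo 0 ħ₀, Ψ ħ s = ψ ħ ∧ Q.SolvesGPE ϰ ħ univ (Ψ ħ) ∧
      (∀ t, meanZ ħ (Ψ ħ t) = (Q.heFlow (κ (Real.sqrt ħ)) s (c (Real.sqrt ħ)) t).z) ∧
      ∀ t, t = s ∨ (lam3 (Q.matriciant (ϰ * normSq (ψ ħ)) s t)).det ≠ 0 →
        Ψ ħ t = Q.evolution Q.matriciant Q.heFlow Q.greenRoot ϰ ħ t s (ψ ħ) := by
    intro ħ hħ
    have hr : Real.sqrt ħ ∈ D := ⟨(neg_nonpos.2 (Real.sqrt_nonneg _)).trans_lt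
      (Real.sqrt_pos.2 hħ.1), Real.sqrt_lt_sqrt hħ.1.le hħ.2⟩
    obtain ⟨e1, e2⟩ := hψ ħ hħ
    have hφr : ⇑(φ (Real.sqrt ħ)) = φ₀ (Real.sqrt ħ) := funext (hφe _ hr)
    set χ : 𝓢(E n, ℂ) := tcL hħ.1 (S₀ (Real.sqrt ħ)) (P₀ (Real.sqrt ħ)) (X₀ (Real.sqrt ħ))
      (φ (Real.sqrt ħ)) with hχ
    have hχψ : ⇑χ = ψ ħ := by rw [hχ, coe_tcL, hφr, e1]
    have hχ0 : χ ≠ 0 := fun h => h0 ħ hħ (by rw [← hχψ, h]; rfl)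
    have hφ0 : φ (Real.sqrt ħ) ≠ 0 := fun h => hχ0 (by rw [hχ, h, map_zero])
    have hzχ : meanZ ħ χ = z (Real.sqrt ħ) := by
      rw [hχψ]
      funext a
      rcases a with j | j
      · exact (e2 j).1
      · exact (e2 j).2
    have hκχ : κ (Real.sqrt ħ) = ϰ * normSq χ := by
      rw [hχ, normSq_tcL]
      rfl
    obtain ⟨-, f1, f2, f3, f4⟩ := Q.wave_spec (Ψ := Ψ ħ) hħ.1 s hκs hφ' hr hχ0
      (by rw [hχψ, e1]) hκχ hzχ (by rw [hχ, moments_tcL hħ.1 hφ0 hzχ])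
    rw [hχ, moments_tcL hħ.1 hφ0 hzχ] at f3
    rw [hχψ] at f1 f4
    exact ⟨f1, f2, f3, f4⟩
  refine ⟨Ψ, ⟨fun q => Q.profile s (κ q.2, q.1) (H q.2), fun q => S₀ q.2 +
    Q.actionFrom (κ q.2) s (c q.2) q.1,
    fun q => momentumPart (Q.heFlow (κ q.2) s (c q.2) q.1).z,
    fun q => positionPart (Q.heFlow (κ q.2) s (c q.2) q.1).z, ?_, ?_, ?_, ?_, ?_⟩,
    fun ħ hħ => ⟨(hspec ħ hħ).1, (hspec ħ hħ).2.1, (hspec ħ hħ).2.2.2⟩⟩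
  · exact schwartzSmoothOn_iff.2 (Q.rapidOn_profile s hκs hφ')
  · exact (hS.comp contDiffOn_snd hsnd).add hact
  · exact contDiffOn_momentumPart hflow
  · exact contDiffOn_positionPart hflow
  · intro ħ hħ t
    refine ⟨rfl, fun j => ?_⟩
    rw [(hspec ħ hħ).2.2.1 t]
    exact ⟨rfl, rfl⟩

end CauchyProblem

end NonlocalGPE

end

theorem mainTheorem2 (n : ℕ) (ϰ : ℝ) (Q : QuadraticModel n) :
    ∃ (A : ℝ → ℝ → ℝ → Matrix (Idx n) (Idx n) ℝ)
      (flow : ℝ → ℝ → PhasePoint n → ℝ → PhasePoint n)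
      (root : ℝ → ℝ → ℝ → ℝ → ℂ),
      -- matriciant, general solution of the Hamilton–Ehrenfest system, branch of the square root
      (∀ κ s, Q.IsMatriciant κ s (A κ s)) ∧
      (∀ κ s c, Q.IsHESSolution κ (flow κ s c) ∧ flow κ s c s = c) ∧
      (∀ ħ κ s, 0 < ħ → (Q.hpp κ s).det ≠ 0 →
        IsRootBranch ħ (A κ s) (root ħ κ s) ∧ ∀ᶠ t in 𝓝[≠] s, (lam3 (A κ s t)).det ≠ 0) ∧
      -- exact solution of the Cauchy problem, and uniqueness
      (∀ (ħ s : ℝ) (ψ : 𝓢(E n, ℂ)), 0 < ħ → ψ ≠ 0 → (Q.hpp (ϰ * normSq ψ) s).det ≠ 0 →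
        ∃ Ψ : ℝ → E n → ℂ,
          SchwartzSmoothOn Set.univ Ψ ∧ Ψ s = ψ ∧ Q.SolvesGPE ϰ ħ Set.univ Ψ ∧
          (∀ t, t = s ∨ (lam3 (A (ϰ * normSq ψ) s t)).det ≠ 0 →
            Ψ t = Q.evolution A flow root ϰ ħ t s ψ) ∧
          (∀ (T : Set ℝ) (Ψ' : ℝ → E n → ℂ), IsOpen T → T.OrdConnected → s ∈ T →
            SchwartzSmoothOn T Ψ' → Ψ' s = ψ → Q.SolvesGPE ϰ ħ T Ψ' → ∀ t ∈ T, Ψ' t = Ψ t)) ∧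
      -- action on the class of trajectory concentrated functions
      (∀ (ħ₀ s : ℝ) (ψ : ℝ → E n → ℂ), 0 < ħ₀ → IsTCData ħ₀ ψ →
        (∀ ħ ∈ Set.Ioo 0 ħ₀, ψ ħ ≠ 0 ∧ (Q.hpp (ϰ * normSq (ψ ħ)) s).det ≠ 0) →
        ∃ Ψ : ℝ → ℝ → E n → ℂ, IsTCFamily ħ₀ Ψ ∧
          ∀ ħ ∈ Set.Ioo 0 ħ₀, Ψ ħ s = ψ ħ ∧ Q.SolvesGPE ϰ ħ Set.univ (Ψ ħ) ∧
            ∀ t, t = s ∨ (lam3 (A (ϰ * normSq (ψ ħ)) s t)).det ≠ 0 →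
              Ψ ħ t = Q.evolution A flow root ϰ ħ t s (ψ ħ)) := by
  refine ⟨Q.matriciant, Q.heFlow, Q.greenRoot, Q.isMatriciant,
    fun κ s c => ⟨Q.isHESSolution_heFlow κ s c, Q.heFlow_self κ s c⟩,
    fun ħ κ s hħ h => ⟨⟨Q.greenRoot_sq hħ κ s, Q.continuousOn_greenRoot ħ κ s⟩,
      Q.eventually_det_lam3_ne_zero h⟩, fun ħ s ψ hħ hψ _ => ?_,
    fun ħ₀ s ψ _ hψ h => Q.exists_concentrated_solution s hψ fun ħ hħ => (h ħ hħ).1⟩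
  obtain ⟨Ψ, h1, h2, h3, h4⟩ := Q.exists_solution (ϰ := ϰ) hħ s hψ
  refine ⟨Ψ, h1, h2, h3, h4, fun T Ψ' hTo hT hs hΨ' h0 h' => ?_⟩
  exact h'.unique Q hħ.ne' hT hs (fun t _ x => h3 t (Set.mem_univ t) x) hΨ'
    (schwartzSmoothOn_iff.2 ((schwartzSmoothOn_iff.1 h1).mono hTo (Set.subset_univ T)))
    (h0.trans h2.symm)
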